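/- All plane graphs are finite and connected, may have multiple edges, and are considered up to homeomorphism; the degree of a face is the length of its boundary walk. A \emph{minimal loop} is a connected plane graph $G$ together with a face $F$ whose boundary is a cycle $C$ (the boundary of $G$), such that exactly one vertex of $C$ (the base vertex) has degree $2$ in $G$, every other vertex of $C$ has degree $3$, and every vertex not on $C$ (an interior vertex) has degree $4$. It is \emph{nontrivial} if it has more than one vertex. A \emph{2-group} of $G$ is a face other than $F$ bounded by a cycle of two edges (joining two distinct vertices). A \emph{triangle} of $G$ is a face other than $F$ bounded by a cycle of three edges. A triangle is a \emph{rots-triangle} if it has an edge in common with a 2-group, and an \emph{ots-triangle} otherwise. An \emph{ots operation} on an ots-triangle with vertices $a,b,c$ and edges $B_1=ca$, $B_2=ab$, $B_3=bc$ is the following modification of $G$, giving a new minimal loop. (1) No $B_i$ is an edge of $C$. Let the edges around $a$, $b$, $c$ in clockwise order be $B_1,e,f,B_2$, resp. $B_2,g,h,B_3$, resp. $B_3,i,j,B_1$. The strand $j,B_3,g$ is moved across $a$: the vertices $b,c$ are replaced by a vertex $x$ on $e$ and a vertex $y$ on $f$; $e$ is divided into the new edge $ax$ and a remainder $e'$ ending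 at $x$, $f$ is divided into the new edge $ay$ and a remainder $f'$ ending at $y$; there is a new edge $xy$; $j$ and $g$ now end at $x$ and $y$ respectively, and $i$ and $h$ are prolonged along $B_1$ and $B_2$ to end at $a$. The clockwise orders become $e',xy,xa,j$ at $x$; $f',g,ya,yx$ at $y$; $ax,ay,h,i$ at $a$. (Any of the three vertices of the triangle may play the role of $a$.) (2) Exactly one $B_i$, say $B_3$, is an edge of $C$. With the same notation (now $h,i$ do not exist, and $j,g$ are the edges of $C$ following $B_3$ at $c$ and $b$) the boundary path $j,B_3,g$ is moved across $a$: the vertices $a,b,c$ and the edges $B_1,B_2,B_3$ are removed, and the boundary now runs along $j$ to a new vertex $x$, which is the new end of $e$, along a new edge $xy$ to a new vertex $y$, which is the new end of $f$, and on along $g$. (3) Exactly two, say $B_1$ and $B_2$, are edges of $C$, so that $a$ is the base vertex. Then $B_3$ and the vertices $b,c$ are removed, and the other boundary edges at $b$ and $c$ are prolonged along $B_2$ and $B_1$ to end at $a$. A \emph{t operation} turns a 2-group whose two vertices $x,y$ are both interior vertices. If the edges around $x$ and $y$ in clockwise order are $e,f,e_1,e_2$ and $f,e,f_1,f_2$,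 where $e,f$ are the edges of the 2-group, then the end of $e_2$ at $x$ is moved to $y$ and the end of $f_2$ at $y$ is moved to $x$, so that the clockwise orders become $e,f,f_2,e_1$ at $x$ and $f,e,e_2,f_1$ at $y$; the result is a minimal loop. \textbf{Theorem.} Let $G$ be a nontrivial minimal loop without loop edges (no edge of $G$ joins a vertex to itself). Then there is a finite (possibly empty) sequence of ots and/or t operations that transforms $G$ into a minimal loop which has at least one of the following features: a 2-group one of whose edges is an edge of the boundary cycle; two different 2-groups having a vertex in common; a rots-triangle. -/

import Mathlib

/-- A connected plane graph (loops and multiple edges allowed, at least one edge), given up to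
orientation-preserving homeomorphism of the sphere by its rotation system.

`Dart` is the set of half-edges (edges with a direction); a dart sits at its initial vertex.
`rot d` is the next dart after `d` in clockwise order around the initial vertex of `d`, and
`rev d` is the same edge with the opposite direction.  Vertices are the cycles of `rot`, edges
are the cycles of `rev`, and faces are the cycles of `rot ∘ rev`.  The field `euler` (Euler's
formula `V + F = E + 2`) says that the surface carrying the graph is the sphere. -/
structure PlaneMap where
  Dart : Type
  finite : Finite Dart
  rot : Equiv.Perm Dart
  rev : Equiv.Perm Dart
  rev_rev : ∀ d, rev (rev d) = d
  rev_ne : ∀ d, rev d ≠ d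
  connected : ∀ d e, ∃ g ∈ Subgroup.closure ({rot, rev} : Set (Equiv.Perm Dart)), g d = e
  euler :
    Nat.card (Quotient (Equiv.Perm.SameCycle.setoid rot))
        + Nat.card (Quotient (Equiv.Perm.SameCycle.setoid (rot * rev)))
      = Nat.card (Quotient (Equiv.Perm.SameCycle.setoid rev)) + 2

namespace PlaneMap

variable (G : PlaneMap)

/-- The successor of a dart along the boundary walk of the face on its left. -/
def next : Equiv.Perm G.Dart := G.rot * G.rev

/-- The two darts have the same initial vertex. -/
def SameVertex (d e : G.Dart) : Prop := G.rot.SameCycle d e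

/-- The two darts have the same face on their left. -/
def SameFace (d e : G.Dart) : Prop := G.next.SameCycle d e

/-- The degree of the initial vertex of `d` (a loop counts twice). -/
noncomputable def vertexDegree (d : G.Dart) : ℕ := {e | G.SameVertex d e}.ncard

/-- The degree (length of the boundary walk) of the face on the left of `d`. -/
noncomputable def faceDegree (d : G.Dart) : ℕ := {e | G.SameFace d e}.ncard

/-- No edge of the graph joins a vertex to itself. -/
def Loopless : Prop := ∀ d, ¬ G.SameVertex d (G.rev d)

end PlaneMap

/-- A minimal loop: a connected plane graph with a face `F` whose boundary is a cycle `C`, such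
that exactly one vertex on `C` (the base vertex) has degree 2, all other vertices on `C` have
degree 3, and all vertices not on `C` have degree 4.  The face `F` and the base vertex are
recorded by the dart `base`, which starts at the base vertex and has `F` on its left.  The
vertices of `C` are the initial vertices of the darts that have `F` on their left. -/
structure MinimalLoop extends PlaneMap where
  base : Dart
  boundary_vertex_injective : ∀ d e, toPlaneMap.SameFace base d → toPlaneMap.SameFace base e →
    toPlaneMap.SameVertex d e → d = e
  boundary_edge_injective : ∀ d, toPlaneMap.SameFace base d → ¬ toPlaneMap.SameFace base (rev d)
  degree_base : toPlaneMap.vertexDegree base = 2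
  degree_boundary : ∀ d, toPlaneMap.SameFace base d → d ≠ base → toPlaneMap.vertexDegree d = 3
  degree_interior : ∀ d, (∀ e, toPlaneMap.SameVertex d e → ¬ toPlaneMap.SameFace base e) →
    toPlaneMap.vertexDegree d = 4

namespace MinimalLoop

variable (G : MinimalLoop)

/-- The minimal loop has more than one vertex. -/
def Nontrivial : Prop := ∃ d, ¬ G.SameVertex G.base d

/-- The face on the left of `d` is the distinguished face `F`. -/
def IsOuter (d : G.Dart) : Prop := G.SameFace G.base d

/-- The edge carrying `d` is an edge of the boundary cycle. -/
def IsBoundaryEdge (d : G.Dart) : Prop := G.IsOuter d ∨ G.IsOuter (G.rev d)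

/-- The initial vertex of `d` does not lie on the boundary cycle. -/
def IsInteriorVertex (d : G.Dart) : Prop := ∀ e, G.SameVertex d e → ¬ G.IsOuter e

/-- The face on the left of `d` is (the interior of) a 2-group: a face other than `F` that is
bounded by a cycle consisting of two edges joining two distinct vertices. -/
def IsTwoGroup (d : G.Dart) : Prop :=
  ¬ G.IsOuter d ∧ G.faceDegree d = 2 ∧ ¬ G.SameVertex d (G.next d)

/-- The face on the left of `d` is a triangle: a face other than `F` that is bounded by a cycle
consisting of three edges. -/
def IsTriangle (d : G.Dart) : Prop :=
  ¬ G.IsOuter d ∧ G.faceDegree d = 3 ∧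
    ¬ G.SameVertex d (G.next d) ∧ ¬ G.SameVertex (G.next d) (G.next (G.next d)) ∧
    ¬ G.SameVertex d (G.next (G.next d))

/-- A triangle none of whose edges belongs to the boundary of a 2-group. -/
def IsOtsTriangle (d : G.Dart) : Prop :=
  G.IsTriangle d ∧ ∀ e, G.SameFace d e → ¬ G.IsTwoGroup (G.rev e)

/-- A triangle that has an edge in common with a 2-group. -/
def IsRotsTriangle (d : G.Dart) : Prop :=
  G.IsTriangle d ∧ ∃ e, G.SameFace d e ∧ G.IsTwoGroup (G.rev e)

open Classical in
/-- The function `f` with its values changed according to the list: for each pair `(a, b)` in the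
list, the new value at `a` is `b`. -/
noncomputable def redirect {D : Type} (f : D → D) : List (D × D) → D → D
  | [] => f
  | (a, b) :: l => Function.update (redirect f l) a b

/-- `G'` is obtained from `G` (up to homeomorphism) by deleting the darts in `S`, keeping the
pairing of the remaining darts into edges, replacing the clockwise successor function by the
function `f`, and taking `b` as the new base dart; `ι` identifies the darts of `G'` with the
remaining darts of `G`. -/
def IsSurgery (G G' : MinimalLoop) (S : Set G.Dart) (f : G.Dart → G.Dart) (b : G.Dart) : Prop :=
  ∃ ι : G'.Dart → G.Dart, Function.Injective ι ∧ Set.range ι = Sᶜ ∧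
    (∀ d, ι (G'.rev d) = G.rev (ι d)) ∧ (∀ d, ι (G'.rot d) = f (ι d)) ∧ ι G'.base = b

/-- `ots` operation on a triangle with no boundary edge.  The triangle has vertices `a` (top),
`b` (right), `c` (left) and lies on the left of the darts `p : c → b`, `q : b → a`, `r : a → c`.
The other edges, in clockwise order, leave `a` along `e`, `f`, leave `b` along `g`, `h`, and leave
`c` along `i`, `j`.  The side `j, p, g` opposite to `a` is moved across `a`: now it crosses `e` at
a new vertex `x` and `f` at a new vertex `y` (replacing `c` and `b`), and the edges `h`, `i` end
at `a`.  After the operation the sides of the triangle are `p : x → y`, `r : a → x`,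
`q : y → a`, and the clockwise orders are
`e, p, rev r, j` at `x`, `f, g, q, rev p` at `y`, and `r, rev q, h, i` at `a`. -/
def OtsInterior (G G' : MinimalLoop) (p : G.Dart) : Prop :=
  let q := G.next p
  let r := G.next q
  let e := G.rot r
  let f := G.rot e
  let g := G.rot q
  let h := G.rot g
  let i := G.rot p
  let j := G.rot i
  ¬ G.IsBoundaryEdge p ∧ ¬ G.IsBoundaryEdge q ∧ ¬ G.IsBoundaryEdge r ∧
  IsSurgery G G' ∅
    (redirect G.rot
      [(e, p), (p, G.rev r), (G.rev r, j), (j, e),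
       (f, g), (g, q), (q, G.rev p), (G.rev p, f),
       (r, G.rev q), (G.rev q, h), (h, i), (i, r)])
    G.base

/-- `ots` operation on a triangle with exactly one boundary edge.  The notation is as in
`OtsInterior`; the boundary edge is `p : c → b`, so that `b` and `c` have degree 3 and there are no
edges `h` and `i`.  The boundary path `j, p, g` is moved across `a`: the vertices `a`, `b`, `c` and
the edges of `q` and `r` disappear, and the boundary now meets `e` at a new vertex `x` and `f` at a
new vertex `y`.  The clockwise orders are `e, p, j` at `x` and `f, g, rev p` at `y`. -/
def OtsOneBoundary (G G' : MinimalLoop) (p : G.Dart) : Prop :=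
  let q := G.next p
  let r := G.next q
  let e := G.rot r
  let f := G.rot e
  let g := G.rot q
  let j := G.rot p
  G.IsBoundaryEdge p ∧ ¬ G.IsBoundaryEdge q ∧ ¬ G.IsBoundaryEdge r ∧
  IsSurgery G G' {q, G.rev q, r, G.rev r}
    (redirect G.rot [(e, p), (p, j), (j, e), (f, g), (g, G.rev p), (G.rev p, f)])
    G.base

/-- `ots` operation on a triangle with exactly two boundary edges `q : b → a` and `r : a → c`, so
that `a` is the base vertex.  Let `h` and `i` be the other boundary edges at `b` and at `c`.
The chord `p : c → b` and its endpoints are deleted; the edges `h` and `i` are prolonged along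
the edges of `q` and `r` and now end at `a`. -/
def OtsTwoBoundary (G G' : MinimalLoop) (p : G.Dart) : Prop :=
  let q := G.next p
  let r := G.next q
  let h := G.rot q
  let i := G.rot p
  ¬ G.IsBoundaryEdge p ∧ G.IsBoundaryEdge q ∧ G.IsBoundaryEdge r ∧
  IsSurgery G G' {p, G.rev p, q, G.rev q, r, G.rev r}
    (redirect G.rot [(h, i), (i, h)])
    h

/-- `G'` is obtained from `G` by an `ots` operation. -/
def Ots (G G' : MinimalLoop) : Prop :=
  ∃ p, G.IsOtsTriangle p ∧ (OtsInterior G G' p ∨ OtsOneBoundary G G' p ∨ OtsTwoBoundary G G' p)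

/-- `G'` is obtained from `G` by a `t` operation, that is, by turning a 2-group both of whose
vertices `x` and `y` are interior vertices.  The 2-group lies on the left of the darts
`k : x → y` and `l : y → x`.  The clockwise orders before the operation are
`rev l, k, e₁, e₂` at `x` and `rev k, l, f₁, f₂` at `y`; the end of `e₂` at `x` is moved to `y`
and the end of `f₂` at `y` is moved to `x`, so that the orders become
`rev l, k, f₂, e₁` at `x` and `rev k, l, e₂, f₁` at `y`. -/
def Turn (G G' : MinimalLoop) : Prop :=
  ∃ k, G.IsTwoGroup k ∧
    let l := G.next k
    let e₁ := G.rot k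
    let e₂ := G.rot e₁
    let f₁ := G.rot l
    let f₂ := G.rot f₁
    G.IsInteriorVertex k ∧ G.IsInteriorVertex l ∧
    IsSurgery G G' ∅
      (redirect G.rot
        [(k, f₂), (f₂, e₁), (e₁, G.rev l), (l, e₂), (e₂, f₁), (f₁, G.rev k)])
      G.base

/-- Some 2-group has an edge on the boundary cycle. -/
def HasBoundaryTwoGroup : Prop := ∃ d, G.IsTwoGroup d ∧ G.IsBoundaryEdge d

/-- Two different 2-groups have a vertex in common. -/
def HasAdjacentTwoGroups : Prop :=
  ∃ d e, G.IsTwoGroup d ∧ G.IsTwoGroup e ∧ ¬ G.SameFace d e ∧ G.SameVertex d e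

/-- There is a `rots`-triangle. -/
def HasRotsTriangle : Prop := ∃ d, G.IsRotsTriangle d

end MinimalLoop

/-! The proof is an induction on the number of darts. If a loopless minimal loop has none of the
three features but has a triangle with an edge on the boundary cycle, then this triangle is an
ots-triangle, and the operation on it deletes edges without creating a loop edge
(`exists_ots_of_boundary`). It therefore suffices that ots operations on interior triangles and t
operations, which keep the set of darts, always lead to a feature or to a triangle at the boundary.
This is the predicate `Reducible`; `Reducible.reaches` turns it into the theorem, and
`reducible_of_loopless` proves it by another induction on the number of darts.

Suppose first that there is a 2-group and no feature. Its vertices are interior, and collapsing it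
to a single vertex of degree 4 gives a smaller minimal loop. This is loopless again: two legs of the
2-group on a common edge would give a loop edge or an adjacent 2-group, or they are opposite legs,
which a parity count excludes (`BigonChart.rev_ne_opposite`). By induction the collapsed loop is
reducible, and its reduction is lifted while the 2-group is carried along (`Doubling`,
`Reducible.of_doubling`). Operations away from the doubled vertex lift directly. An ots operation at
the doubled vertex lifts to two ots operations, possibly preceded by a turn of the 2-group so that
it does not split the angle of the triangle. A 2-group meeting the doubled vertex lifts to an
adjacent 2-group or to a rots-triangle.

Suppose next that there is no 2-group. A `Region` is a union of inner faces without reflex angles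
and with connected complement. The union of all inner faces is a region whose only possible corner
is at the base vertex. Choose a region that is minimal among the nonempty ones with at most two
corners. A strand entering it from its boundary cannot cross itself inside, since the loop would
enclose a smaller region with at most one corner (`Region.arc_or_loop`); so it cuts the region in
two. Each part needs three corners, at most two of which come from the cut, so each part contains an
old corner (`Cut.exists_corner`). Repeated cutting near a corner (`Wedge`) ends in a triangle with
an edge on the boundary of the region (`Region.exists_triangle`). Either this triangle has an edge
on the boundary cycle, or an ots operation pushes the boundary strand of the region across it. The
region then loses darts and gains no corners (`TriChart.AtBoundary`), and induction on its size
applies; a 2-group created on the way leads back to the first case.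

Planarity enters only through homology: Euler's formula is equivalent to the statement that every
cycle of edges mod 2 is the boundary of a set of faces (`euler_iff`). In one direction this replaces
the Jordan curve theorem; in the other it shows that modified rotation systems still describe the
sphere, because their cycles can be carried back to the original loop. -/

/-! ### Cycles of permutations and sums over them mod 2 -/

open Equiv.Perm in
/-- Induction along a cycle of a permutation of a finite type. -/
theorem Equiv.Perm.SameCycle.induct {D : Type*} [Finite D] {σ : Equiv.Perm D} {x y : D}
    (h : σ.SameCycle x y) {P : D → Prop} (hx : P x) (hs : ∀ z, P z → P (σ z)) : P y := by
  obtain ⟨n, rfl⟩ := h.exists_nat_pow_eq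
  induction n with
  | zero => simpa using hx
  | succ n ih => rw [pow_succ', Equiv.Perm.mul_apply]; exact hs _ (ih ⟨n, by simp⟩)

/-- In a finite type going forward along the cycle from `σ d` eventually returns to `d`. -/
theorem Equiv.Perm.mem_of_closed {D : Type*} [Finite D] (σ : Equiv.Perm D) {X : Set D}
    (hX : ∀ d ∈ X, σ d ∈ X) {d : D} (h : σ d ∈ X) : d ∈ X := by
  have : σ.SameCycle (σ d) d := by simp [Equiv.Perm.SameCycle.refl]
  exact this.induct (P := fun x => x ∈ X) h hX

/-- The sum (mod 2) of a function over the vertex of `d`. -/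
noncomputable def vertexSum {D : Type*} (rot : Equiv.Perm D) (z : D → ZMod 2) (d : D) : ZMod 2 :=
  ∑ᶠ e ∈ {e | rot.SameCycle d e}, z e

theorem vertexSum_add {D : Type*} [Finite D] (rot : Equiv.Perm D) (z z' : D → ZMod 2) (d : D) :
    vertexSum rot (fun x => z x + z' x) d = vertexSum rot z d + vertexSum rot z' d :=
  finsum_mem_add_distrib (Set.toFinite _)

theorem vertexSum_congr {D : Type*} (rot : Equiv.Perm D) {z z' : D → ZMod 2} {d : D}
    (h : ∀ e, rot.SameCycle d e → z e = z' e) : vertexSum rot z d = vertexSum rot z' d :=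
  finsum_mem_congr rfl h

theorem vertexSum_zero {D : Type*} (rot : Equiv.Perm D) (d : D) :
    vertexSum rot (fun _ => 0) d = 0 := by simp [vertexSum]

open Classical in
theorem vertexSum_single {D : Type*} (rot : Equiv.Perm D) (a d : D) :
    vertexSum rot (fun x => if x = a then 1 else 0) d = if rot.SameCycle d a then 1 else 0 := by
  unfold vertexSum
  by_cases h : rot.SameCycle d a
  · rw [if_pos h, finsum_eq_single _ a]
    · simp [h]
    · intro x hx; simp [hx]
  · rw [if_neg h, finsum_eq_zero_of_forall_eq_zero]
    intro x
    by_cases hx : x = a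
    · subst hx; simp [h]
    · simp [hx]

/-! ### Euler's formula as vanishing of the first homology mod 2 -/

section euler

variable {D : Type} [Fintype D] [DecidableEq D] (rot rev : Equiv.Perm D)

open Classical in
/-- The mod 2 incidence matrix between the cycles of two permutations. -/
noncomputable def incidence (σ τ : Equiv.Perm D) :
    Matrix (Quotient (Equiv.Perm.SameCycle.setoid σ)) (Quotient (Equiv.Perm.SameCycle.setoid τ))
      (ZMod 2) :=
  fun a b => ∑ d : D, if (Quotient.mk _ d = a ∧ Quotient.mk _ d = b) then 1 else 0

open Classical in
-- Each dart lies in exactly one `τ`-cycle, so the row of `c` collects one term for every dart in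
-- the `σ`-cycle of `c`. This translates between matrices and sums around vertices, edges or faces.
theorem incidence_mulVec (σ τ : Equiv.Perm D)
    (z : Quotient (Equiv.Perm.SameCycle.setoid τ) → ZMod 2) (c : D) :
    (incidence σ τ).mulVec z (Quotient.mk _ c) = vertexSum σ (fun d => z (Quotient.mk _ d)) c := by
  unfold vertexSum
  rw [finsum_mem_eq_sum_of_inter_support_eq (t := Finset.univ.filter (fun e => σ.SameCycle c e))]
  · simp only [Matrix.mulVec, dotProduct, incidence, Finset.sum_mul]
    rw [Finset.sum_comm, Finset.sum_filter]
    refine Finset.sum_congr rfl fun d _ => ?_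
    have : (Quotient.mk (Equiv.Perm.SameCycle.setoid σ) d = Quotient.mk _ c) ↔ σ.SameCycle c d := by
      rw [Quotient.eq]; exact Equiv.Perm.sameCycle_comm
    simp only [this]
    by_cases h : σ.SameCycle c d
    · simp [h]
    · simp [h]
  · ext; simp

open Classical in
theorem incidence_transpose (σ τ : Equiv.Perm D) : (incidence σ τ).transpose = incidence τ σ := by
  ext a b
  simp only [Matrix.transpose_apply, incidence]
  exact Finset.sum_congr rfl fun d _ => if_congr and_comm rfl rfl

theorem vertexSum_edge (hrr : ∀ d, rev (rev d) = d) (hne : ∀ d, rev d ≠ d) (z : D → ZMod 2) (d : D) : vertexSum rev z d = z d + z (rev d) := by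
  unfold vertexSum
  have : {e | rev.SameCycle d e} = (({d, rev d} : Finset D) : Set D) := by
    ext e
    simp only [Set.mem_ofPred_eq, Finset.coe_insert, Finset.coe_singleton, Set.mem_insert_iff,
      Set.mem_singleton_iff]
    constructor
    · intro h
      refine h.induct (P := fun e => e = d ∨ e = rev d) (Or.inl rfl) ?_
      rintro z (rfl | rfl)
      · right; rfl
      · left; exact hrr _
    · rintro (rfl | rfl)
      · exact Equiv.Perm.SameCycle.rfl
      · simp [Equiv.Perm.SameCycle.refl]
  rw [this, finsum_mem_coe_finset, Finset.sum_pair (hne d).symm]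

open Classical in
-- An edge contributes the equation `u d + u (rev d) = 0`, so a kernel vector takes equal values at
-- both darts of every edge and is constant by connectedness. It is applied to vertices (`σ = rot`)
-- and to faces (`σ = rot * rev`).
theorem finrank_ker_incidence (hrr : ∀ d, rev (rev d) = d) (hne : ∀ d, rev d ≠ d) (σ : Equiv.Perm D) [Nonempty D]
    (hconn : ∀ X : Set D, X.Nonempty → (∀ d ∈ X, σ d ∈ X) → (∀ d ∈ X, rev d ∈ X) →
      X = Set.univ) :
    Module.finrank (ZMod 2) (LinearMap.ker (incidence rev σ).mulVecLin) = 1 := by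
  have : LinearMap.ker (incidence rev σ).mulVecLin = Submodule.span (ZMod 2) {fun _ => 1} := by
    apply le_antisymm
    · intro u hu
      rw [LinearMap.mem_ker] at hu
      obtain ⟨d₀⟩ := ‹Nonempty D›
      rw [Submodule.mem_span_singleton]
      refine ⟨u (Quotient.mk _ d₀), ?_⟩
      have key : {d : D | u (Quotient.mk _ d) = u (Quotient.mk _ d₀)} = Set.univ := by
        apply hconn
        · exact ⟨d₀, rfl⟩
        · intro d hd
          have : (Quotient.mk (Equiv.Perm.SameCycle.setoid σ) (σ d)) = Quotient.mk _ d := by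
            rw [Quotient.eq]
            show σ.SameCycle (σ d) d
            simp [Equiv.Perm.SameCycle.refl]
          simpa [this] using hd
        · intro d hd
          have h := congrFun hu (Quotient.mk _ d)
          rw [Matrix.mulVecLin_apply, incidence_mulVec, vertexSum_edge rev hrr hne] at h
          simp only [Pi.zero_apply] at h
          have : u (Quotient.mk _ (rev d)) = u (Quotient.mk _ d) := by
            rw [add_comm] at h
            rw [eq_neg_of_add_eq_zero_left h, ZMod.neg_eq_self_mod_two]
          simpa [this] using hd
      ext q
      induction q using Quotient.inductionOn with
      | h d =>
        have : d ∈ {d : D | u (Quotient.mk _ d) = u (Quotient.mk _ d₀)} := key ▸ Set.mem_univ d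
        simpa using this.symm
    · rw [Submodule.span_singleton_le_iff_mem, LinearMap.mem_ker]
      ext q
      induction q using Quotient.inductionOn with
      | h d =>
        rw [Matrix.mulVecLin_apply, incidence_mulVec, vertexSum_edge rev hrr hne]
        exact CharTwo.add_self_eq_zero _
  rw [this, finrank_span_singleton]
  intro h
  obtain ⟨d₀⟩ := ‹Nonempty D›
  have := congrFun h (Quotient.mk _ d₀)
  simp at this

/-- Euler's formula is equivalent to the vanishing of the first homology group mod 2. -/
theorem euler_iff (hrr : ∀ d, rev (rev d) = d) (hne : ∀ d, rev d ≠ d) [Nonempty D]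
    (hconn : ∀ X : Set D, X.Nonempty → (∀ d ∈ X, rot d ∈ X) → (∀ d ∈ X, rev d ∈ X) →
      X = Set.univ) :
    (Nat.card (Quotient (Equiv.Perm.SameCycle.setoid rot))
        + Nat.card (Quotient (Equiv.Perm.SameCycle.setoid (rot * rev)))
      = Nat.card (Quotient (Equiv.Perm.SameCycle.setoid rev)) + 2) ↔
    ∀ z : D → ZMod 2, (∀ d, z (rev d) = z d) → (∀ d, vertexSum rot z d = 0) →
      ∃ w : D → ZMod 2, (∀ d, w (rot (rev d)) = w d) ∧ ∀ d, w d + w (rev d) = z d := by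
  classical
  have hconn' : ∀ X : Set D, X.Nonempty → (∀ d ∈ X, (rot * rev) d ∈ X) → (∀ d ∈ X, rev d ∈ X) →
      X = Set.univ := by
    intro X h0 h1 h2
    refine hconn X h0 (fun d hd => ?_) h2
    have := h1 _ (h2 d hd)
    simpa [hrr] using this
  have hV := finrank_ker_incidence rev hrr hne rot hconn
  have hF := finrank_ker_incidence rev hrr hne (rot * rev) hconn'
  have rV := LinearMap.finrank_range_add_finrank_ker (incidence rev rot).mulVecLin
  have rF := LinearMap.finrank_range_add_finrank_ker (incidence rev (rot * rev)).mulVecLin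
  have rE := LinearMap.finrank_range_add_finrank_ker (incidence rot rev).mulVecLin
  have rT : Module.finrank (ZMod 2) (LinearMap.range (incidence rot rev).mulVecLin)
      = Module.finrank (ZMod 2) (LinearMap.range (incidence rev rot).mulVecLin) := by
    have := Matrix.rank_transpose (incidence rot rev)
    rw [incidence_transpose] at this
    exact this.symm
  rw [Module.finrank_fintype_fun_eq_card, ← Nat.card_eq_fintype_card] at rV rF rE
  -- The boundary of a boundary vanishes: `rev x` and `rot x` have the same face on their left, so
  -- around a vertex the faces of the `rev x` are those of the `x`, and the two sums cancel.
  have hle : LinearMap.range (incidence rev (rot * rev)).mulVecLin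
      ≤ LinearMap.ker (incidence rot rev).mulVecLin := by
    rintro _ ⟨w, rfl⟩
    rw [LinearMap.mem_ker]
    ext q
    induction q using Quotient.inductionOn with
    | h d =>
      rw [Matrix.mulVecLin_apply, incidence_mulVec]
      simp only [Matrix.mulVecLin_apply, incidence_mulVec, vertexSum_edge rev hrr hne]
      rw [vertexSum_add]
      have : vertexSum rot (fun x => w (Quotient.mk _ (rev x))) d
          = vertexSum rot (fun x => w (Quotient.mk _ x)) d := by
        unfold vertexSum
        refine finsum_mem_eq_of_bijOn rot ?_ ?_
        · refine ⟨?_, rot.injective.injOn, ?_⟩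
          · intro x hx; simpa using hx
          · intro x hx
            refine ⟨rot.symm x, by simpa using hx, by simp⟩
        · intro x _
          congr 1
          rw [Quotient.eq]
          have : (rot * rev) (rev x) = rot x := by simp [hrr]
          rw [← this]
          show (rot * rev).SameCycle _ _
          rw [Equiv.Perm.sameCycle_apply_right]
      rw [this]
      exact CharTwo.add_self_eq_zero _
  have hVpos : 0 < Nat.card (Quotient (Equiv.Perm.SameCycle.setoid rot)) := by
    obtain ⟨d₀⟩ := ‹Nonempty D›
    exact Nat.card_pos_iff.2 ⟨⟨Quotient.mk _ d₀⟩, inferInstance⟩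
  -- The face boundaries have dimension `F - 1` and the cycles have dimension `E - (V - 1)`, so
  -- Euler's formula says that the two spaces in `hle` have the same dimension.
  have key : (Nat.card (Quotient (Equiv.Perm.SameCycle.setoid rot))
        + Nat.card (Quotient (Equiv.Perm.SameCycle.setoid (rot * rev)))
      = Nat.card (Quotient (Equiv.Perm.SameCycle.setoid rev)) + 2) ↔
      LinearMap.ker (incidence rot rev).mulVecLin
        ≤ LinearMap.range (incidence rev (rot * rev)).mulVecLin := by
    constructor
    · intro h
      refine (Submodule.eq_of_le_of_finrank_le hle ?_).ge
      omega
    · intro h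
      have := le_antisymm hle h
      rw [this] at rF
      omega
  rw [key]
  constructor
  · intro h z hz hs
    let zb : Quotient (Equiv.Perm.SameCycle.setoid rev) → ZMod 2 :=
      Quotient.lift z (fun a b (hab : rev.SameCycle a b) =>
        hab.induct (P := fun b => z a = z b) rfl (fun c hc => by rw [hz, hc]))
    have hzb : zb ∈ LinearMap.ker (incidence rot rev).mulVecLin := by
      rw [LinearMap.mem_ker]
      ext q
      induction q using Quotient.inductionOn with
      | h d => rw [Matrix.mulVecLin_apply, incidence_mulVec]; exact hs d
    obtain ⟨w, hw⟩ := h hzb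
    refine ⟨fun d => w (Quotient.mk _ d), fun d => ?_, fun d => ?_⟩
    · refine congrArg w (Quotient.sound ?_)
      show (rot * rev).SameCycle ((rot * rev) d) d
      simp only [Equiv.Perm.sameCycle_apply_left, Equiv.Perm.SameCycle.refl]
    · have := congrFun hw (Quotient.mk _ d)
      rw [Matrix.mulVecLin_apply, incidence_mulVec, vertexSum_edge rev hrr hne] at this
      exact this
  · intro h zb hzb
    rw [LinearMap.mem_ker] at hzb
    obtain ⟨w, hw, hw'⟩ := h (fun d => zb (Quotient.mk _ d)) (fun d => by
        congr 1
        rw [Quotient.eq]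
        show rev.SameCycle (rev d) d
        simp [Equiv.Perm.SameCycle.refl]) (fun d => by
        have := congrFun hzb (Quotient.mk _ d)
        rw [Matrix.mulVecLin_apply, incidence_mulVec] at this
        exact this)
    refine ⟨Quotient.lift w (fun a b (hab : (rot * rev).SameCycle a b) =>
        hab.induct (P := fun b => w a = w b) rfl (fun c hc => by
          rw [Equiv.Perm.mul_apply, hw, hc])), ?_⟩
    ext q
    induction q using Quotient.inductionOn with
    | h d =>
      rw [Matrix.mulVecLin_apply, incidence_mulVec, vertexSum_edge rev hrr hne]
      exact hw' d

end euler

/-! ### Short cycles, periods and transport of cycles -/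

namespace Equiv.Perm

variable {D : Type*} [Finite D] {rot : Equiv.Perm D} {d e : D}

theorem sameCycle_iff_three (h : rot (rot (rot d)) = d) :
    rot.SameCycle d e ↔ e = d ∨ e = rot d ∨ e = rot (rot d) := by
  constructor
  · intro h'
    refine h'.induct (P := fun e => e = d ∨ e = rot d ∨ e = rot (rot d)) (Or.inl rfl) ?_
    grind
  · rintro (rfl | rfl | rfl) <;> simp [Equiv.Perm.SameCycle.refl]

theorem sameCycle_iff_two (h : rot (rot d) = d) :
    rot.SameCycle d e ↔ e = d ∨ e = rot d := by
  constructor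
  · intro h'
    refine h'.induct (P := fun e => e = d ∨ e = rot d) (Or.inl rfl) ?_
    grind
  · rintro (rfl | rfl) <;> simp [Equiv.Perm.SameCycle.refl]

theorem sameCycle_iff_four (h : rot (rot (rot (rot d))) = d) :
    rot.SameCycle d e ↔ e = d ∨ e = rot d ∨ e = rot (rot d) ∨ e = rot (rot (rot d)) := by
  constructor
  · intro h'
    refine h'.induct (P := fun e => e = d ∨ e = rot d ∨ e = rot (rot d) ∨ e = rot (rot (rot d))) (Or.inl rfl) ?_
    grind
  · rintro (rfl | rfl | rfl | rfl) <;> simp [Equiv.Perm.SameCycle.refl]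

end Equiv.Perm

theorem vertexSum_two {D : Type*} [Finite D] {rot : Equiv.Perm D} {d : D} (z : D → ZMod 2)
    (h : rot (rot d) = d) (h1 : rot d ≠ d) : vertexSum rot z d = z d + z (rot d) := by
  classical
  unfold vertexSum
  have : {e | rot.SameCycle d e} = (({d, rot d} : Finset D) : Set D) := by
    ext e
    simp [Equiv.Perm.sameCycle_iff_two h]
  rw [this, finsum_mem_coe_finset, Finset.sum_pair h1.symm]

theorem vertexSum_three {D : Type*} [Finite D] {rot : Equiv.Perm D} {d : D} (z : D → ZMod 2)
    (h : rot (rot (rot d)) = d) (h1 : rot d ≠ d) :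
    vertexSum rot z d = z d + z (rot d) + z (rot (rot d)) := by
  classical
  have h2 : rot (rot d) ≠ d := fun h2 => h1 (by rw [h2] at h; exact h)
  unfold vertexSum
  have : {e | rot.SameCycle d e} = (({d, rot d, rot (rot d)} : Finset D) : Set D) := by
    ext e
    simp [Equiv.Perm.sameCycle_iff_three h]
  rw [this, finsum_mem_coe_finset, Finset.sum_insert, Finset.sum_pair, add_assoc]
  · simpa using h1.symm
  · simp [h1.symm, h2.symm]

theorem vertexSum_four {D : Type*} [Finite D] {rot : Equiv.Perm D} {d : D} (z : D → ZMod 2)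
    (h : rot (rot (rot (rot d))) = d) (h2 : rot (rot d) ≠ d) :
    vertexSum rot z d = z d + z (rot d) + z (rot (rot d)) + z (rot (rot (rot d))) := by
  classical
  have h1 : rot d ≠ d := fun h1 => h2 (by rw [h1, h1])
  have h3 : rot (rot (rot d)) ≠ d := fun h3 => h1 (by rw [h3] at h; exact h)
  unfold vertexSum
  have : {e | rot.SameCycle d e}
      = (({d, rot d, rot (rot d), rot (rot (rot d))} : Finset D) : Set D) := by
    ext e
    simp [Equiv.Perm.sameCycle_iff_four h]
  rw [this, finsum_mem_coe_finset, Finset.sum_insert, Finset.sum_insert, Finset.sum_pair, ← add_assoc,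
    ← add_assoc]
  · simpa using h1.symm
  · simp [h1.symm, h2.symm]
  · simp [h1.symm, h2.symm, h3.symm]

theorem Equiv.Perm.ncard_sameCycle {D : Type*} [Finite D] (σ : Equiv.Perm D) (d : D) :
    {e | σ.SameCycle d e}.ncard = Function.minimalPeriod σ d := by
  classical
  have : {e | σ.SameCycle d e}
      = ((Finset.range (Function.minimalPeriod σ d)).image (fun n => σ^[n] d) : Finset D) := by
    ext e
    simp only [Set.mem_ofPred_eq, Finset.coe_image, Finset.coe_range, Set.mem_image, Set.mem_Iio]
    have hp : 0 < Function.minimalPeriod σ d :=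
      Function.minimalPeriod_pos_of_mem_periodicPts
        (Function.Injective.mem_periodicPts σ.injective d)
    constructor
    · intro h
      obtain ⟨n, rfl⟩ := h.exists_nat_pow_eq
      refine ⟨n % Function.minimalPeriod σ d, Nat.mod_lt _ hp, ?_⟩
      rw [Function.iterate_mod_minimalPeriod_eq, Equiv.Perm.iterate_eq_pow]
    · rintro ⟨n, -, rfl⟩
      rw [Equiv.Perm.iterate_eq_pow]
      exact ⟨n, by simp⟩
  rw [this, Set.ncard_coe_finset, Finset.card_image_of_injOn, Finset.card_range]
  intro a ha b hb hab
  exact Function.iterate_injOn_Iio_minimalPeriod (by simpa using ha) (by simpa using hb) hab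

theorem Function.minimalPeriod_eq_prime_sq {D : Type*} {f : D → D} {d : D} 
    (h : f (f (f (f d))) = d) (h2 : f (f d) ≠ d) : Function.minimalPeriod f d = 4 := by
  have h4 : Function.minimalPeriod f d ∣ 2 ^ 2 := Function.IsPeriodicPt.minimalPeriod_dvd h
  have hn : ¬ Function.minimalPeriod f d ∣ 2 := fun hd =>
    h2 ((Function.isPeriodicPt_minimalPeriod f d).trans_dvd hd)
  obtain ⟨k, hk, hk'⟩ := (Nat.dvd_prime_pow Nat.prime_two).1 h4
  have : k = 2 := by
    by_contra hne
    apply hn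
    rw [hk']
    have : k ≤ 1 := by omega
    exact pow_dvd_pow 2 this |>.trans (by norm_num)
  rw [hk', this]; norm_num

theorem Function.iterate_minimalPeriod_eq {D : Type*} {f : D → D} {d : D} {n : ℕ}
    (h : Function.minimalPeriod f d = n) : f^[n] d = d := by
  subst h; exact Function.iterate_minimalPeriod

theorem Function.iterate_ne_of_minimalPeriod {D : Type*} {f : D → D} {d : D} {n : ℕ} (k : ℕ)
    (h : Function.minimalPeriod f d = n) (hk : k < n) (hk0 : 0 < k) : f^[k] d ≠ d := by
  intro h'
  have := Function.IsPeriodicPt.minimalPeriod_le hk0 h'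
  omega

/-- The commutation of `ι` with the permutations is asked only along the cycle of `x`, so that this
applies to every vertex that an operation leaves unchanged. -/
theorem Equiv.Perm.sameCycle_map {D D' : Type*} [Finite D'] {σ : Equiv.Perm D}
    {σ' : Equiv.Perm D'} {ι : D' → D} {x y : D'} (h : σ'.SameCycle x y)
    (hι : ∀ z, σ'.SameCycle x z → ι (σ' z) = σ (ι z)) : σ.SameCycle (ι x) (ι y) := by
  have : σ'.SameCycle x y ∧ σ.SameCycle (ι x) (ι y) := by
    refine h.induct (P := fun y => σ'.SameCycle x y ∧ σ.SameCycle (ι x) (ι y)) ?_ ?_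
    · exact ⟨Equiv.Perm.SameCycle.rfl, Equiv.Perm.SameCycle.rfl⟩
    · rintro z ⟨h1, h2⟩
      refine ⟨by simpa using h1, ?_⟩
      rw [hι z h1]; simpa using h2
  exact this.2

theorem Equiv.Perm.sameCycle_lift {D D' : Type*} [Finite D] {σ : Equiv.Perm D}
    {σ' : Equiv.Perm D'} {ι : D' → D} {x : D'} {y : D} (h : σ.SameCycle (ι x) y)
    (hι : ∀ z, σ'.SameCycle x z → ι (σ' z) = σ (ι z)) : ∃ z, σ'.SameCycle x z ∧ ι z = y := by
  refine h.induct (P := fun y => ∃ z, σ'.SameCycle x z ∧ ι z = y) ?_ ?_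
  · exact ⟨x, Equiv.Perm.SameCycle.rfl, rfl⟩
  · rintro z ⟨u, h1, rfl⟩
    exact ⟨σ' u, by simpa using h1, hι u h1⟩

theorem vertexSum_comp {D D' : Type*} [Finite D] [Finite D'] {rot : Equiv.Perm D}
    {rot' : Equiv.Perm D'} {ι : D' → D} (hinj : Function.Injective ι) (z : D → ZMod 2) (d : D')
    (h : ∀ e, rot'.SameCycle d e → ι (rot' e) = rot (ι e)) :
    vertexSum rot' (fun x => z (ι x)) d = vertexSum rot z (ι d) := by
  unfold vertexSum
  refine finsum_mem_eq_of_bijOn ι ⟨?_, hinj.injOn, ?_⟩ (fun _ _ => rfl)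
  · intro e he
    exact Equiv.Perm.sameCycle_map he h
  · intro y hy
    obtain ⟨z, hz, rfl⟩ := Equiv.Perm.sameCycle_lift hy h
    exact ⟨z, hz, rfl⟩

/-! ### Minimal loops from rotation systems -/

/-- Conditions on permutations `rot` and `rev` that make them the rotation system of a minimal
loop whose distinguished face consists of the darts in `Out`. -/
structure LoopData {D : Type} (rot rev : Equiv.Perm D) (base : D) (Out : Set D) : Prop where
  rev_rev : ∀ d, rev (rev d) = d
  rev_ne : ∀ d, rev d ≠ d
  conn : ∀ X : Set D, base ∈ X → (∀ d ∈ X, rot d ∈ X) → (∀ d ∈ X, rev d ∈ X) → ∀ d, d ∈ X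
  homology : ∀ z : D → ZMod 2, (∀ d, z (rev d) = z d) → (∀ d, vertexSum rot z d = 0) →
      ∃ w : D → ZMod 2, (∀ d, w (rot (rev d)) = w d) ∧ ∀ d, w d + w (rev d) = z d
  out_iff : ∀ d, d ∈ Out ↔ (rot * rev).SameCycle base d
  out_rot : ∀ d ∈ Out, rot d ∉ Out
  out_rev : ∀ d ∈ Out, rev d ∉ Out
  deg_base : rot (rot base) = base
  deg_out : ∀ d ∈ Out, d ≠ base → rot (rot (rot d)) = d ∧ rot (rot d) ∉ Out
  -- Four consecutive darts are a sufficient test: a vertex with a dart in `Out` has at most three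
  -- darts, by `deg_base` and `deg_out`.
  deg_in : ∀ d, d ∉ Out → rot d ∉ Out → rot (rot d) ∉ Out → rot (rot (rot d)) ∉ Out →
    rot (rot (rot (rot d))) = d ∧ rot (rot d) ≠ d

/-- `conn` tests only sets containing the base; for any other closed set it is applied to the
complement, which is closed too because the type is finite. -/
theorem LoopData.eq_univ {D : Type} [Finite D] {rot rev : Equiv.Perm D} {base : D} {Out : Set D}
    (h : LoopData rot rev base Out) (X : Set D) (h0 : X.Nonempty) (h1 : ∀ d ∈ X, rot d ∈ X)
    (h2 : ∀ d ∈ X, rev d ∈ X) : X = Set.univ := by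
  rw [Set.eq_univ_iff_forall]
  by_cases hb : base ∈ X
  · exact h.conn X hb h1 h2
  · obtain ⟨x, hx⟩ := h0
    refine absurd hx (h.conn Xᶜ hb (fun d hd hd' => hd (rot.mem_of_closed h1 hd'))
      (fun d hd hd' => hd (rev.mem_of_closed h2 hd')) x)

theorem LoopData.vertexDegree_base {D : Type} [Finite D] {rot rev : Equiv.Perm D} {base : D}
    {Out : Set D} (h : LoopData rot rev base Out) : {e | rot.SameCycle base e}.ncard = 2 := by
  have hb : base ∈ Out := (h.out_iff _).2 Equiv.Perm.SameCycle.rfl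
  rw [Equiv.Perm.ncard_sameCycle]
  refine Function.minimalPeriod_eq_prime (p := 2) h.deg_base ?_
  intro h'
  apply h.out_rot _ hb
  rw [Function.IsFixedPt.eq h']; exact hb

theorem LoopData.eq_of_sameCycle {D : Type} [Finite D] {rot rev : Equiv.Perm D} {base : D}
    {Out : Set D} (h : LoopData rot rev base Out) {d e : D} (hd : d ∈ Out) (he : e ∈ Out)
    (hde : rot.SameCycle d e) : d = e := by
  by_cases hb : d = base
  · subst hb
    rw [Equiv.Perm.sameCycle_iff_two h.deg_base] at hde
    rcases hde with h1 | h1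
    · exact h1.symm
    · exact absurd (h1 ▸ he) (h.out_rot _ hd)
  · obtain ⟨h3, h2⟩ := h.deg_out d hd hb
    rw [Equiv.Perm.sameCycle_iff_three h3] at hde
    rcases hde with h1 | h1 | h1
    · exact h1.symm
    · exact absurd (h1 ▸ he) (h.out_rot _ hd)
    · exact absurd (h1 ▸ he) h2

/-- The minimal loop given by its rotation system. -/
def LoopData.toMinimalLoop {D : Type} (fin : Finite D) {rot rev : Equiv.Perm D} {base : D}
    {Out : Set D} (h : LoopData rot rev base Out) : MinimalLoop where
  Dart := D
  finite := fin
  rot := rot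
  rev := rev
  rev_rev := h.rev_rev
  rev_ne := h.rev_ne
  connected := by
    intro d e
    have := h.eq_univ {e | ∃ g ∈ Subgroup.closure ({rot, rev} : Set (Equiv.Perm D)), g d = e}
      ⟨d, 1, one_mem _, rfl⟩ ?_ ?_
    · exact Set.eq_univ_iff_forall.1 this e
    · rintro _ ⟨g, hg, rfl⟩
      exact ⟨rot * g, mul_mem (Subgroup.subset_closure (by simp)) hg, rfl⟩
    · rintro _ ⟨g, hg, rfl⟩
      exact ⟨rev * g, mul_mem (Subgroup.subset_closure (by simp)) hg, rfl⟩
  euler := by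
    classical
    have := Fintype.ofFinite D
    have : Nonempty D := ⟨base⟩
    exact (euler_iff rot rev h.rev_rev h.rev_ne h.eq_univ).2 h.homology
  base := base
  boundary_vertex_injective := fun d e hd he hde =>
    h.eq_of_sameCycle ((h.out_iff d).2 hd) ((h.out_iff e).2 he) hde
  boundary_edge_injective := by
    intro d hd hd'
    exact h.out_rev d ((h.out_iff d).2 hd) ((h.out_iff _).2 hd')
  degree_base := h.vertexDegree_base
  degree_boundary := by
    intro d hd hb
    have hd' := (h.out_iff d).2 hd
    show {e | rot.SameCycle d e}.ncard = 3
    rw [Equiv.Perm.ncard_sameCycle]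
    refine Function.minimalPeriod_eq_prime (p := 3) (h.deg_out d hd' hb).1 ?_
    intro h'
    apply h.out_rot _ hd'
    rw [Function.IsFixedPt.eq h']; exact hd'
  degree_interior := by
    intro d hd
    have hd' : ∀ e, rot.SameCycle d e → e ∉ Out := fun e he he' => hd e he ((h.out_iff e).1 he')
    show {e | rot.SameCycle d e}.ncard = 4
    rw [Equiv.Perm.ncard_sameCycle]
    obtain ⟨h4, h2⟩ := h.deg_in d (hd' _ (by simp [Equiv.Perm.SameCycle.refl]))
      (hd' _ (by simp [Equiv.Perm.SameCycle.refl])) (hd' _ (by simp [Equiv.Perm.SameCycle.refl]))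
      (hd' _ (by simp [Equiv.Perm.SameCycle.refl]))
    exact Function.minimalPeriod_eq_prime_sq h4 h2

/-! ### Outer darts, interior vertices and potentials in a minimal loop -/

namespace MinimalLoop

variable (G : MinimalLoop)

instance : Finite G.Dart := G.finite

variable {G} {d e : G.Dart}

theorem next_apply (d : G.Dart) : G.next d = G.rot (G.rev d) := rfl

theorem next_rev (d : G.Dart) : G.next (G.rev d) = G.rot d := by rw [next_apply, G.rev_rev]

theorem rev_eq_iff : G.rev d = e ↔ d = G.rev e := by
  constructor
  · rintro rfl; rw [G.rev_rev]
  · rintro rfl; rw [G.rev_rev]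

theorem isOuter_base : G.IsOuter G.base := Equiv.Perm.SameCycle.rfl

theorem isOuter_next : G.IsOuter (G.next d) ↔ G.IsOuter d :=
  Equiv.Perm.sameCycle_apply_right

theorem isOuter_rot : G.IsOuter (G.rot d) ↔ G.IsOuter (G.rev d) := by
  rw [← next_rev, isOuter_next]

theorem IsOuter.rev (h : G.IsOuter d) : ¬ G.IsOuter (G.rev d) := G.boundary_edge_injective d h

theorem IsOuter.rot (h : G.IsOuter d) : ¬ G.IsOuter (G.rot d) := by
  rw [isOuter_rot]; exact h.rev

theorem IsOuter.eq_of_sameVertex (h : G.IsOuter d) (h' : G.IsOuter e) (hde : G.SameVertex d e) :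
    d = e := G.boundary_vertex_injective d e h h' hde

theorem sameVertex_rot (d : G.Dart) : G.SameVertex d (G.rot d) := by
  simp [PlaneMap.SameVertex, Equiv.Perm.SameCycle.refl]

theorem IsOuter.rot_ne (h : G.IsOuter d) : G.rot d ≠ d := fun h' => h.rot (by rwa [h'])

theorem rot_base : G.rot (G.rot G.base) = G.base := by
  have := G.degree_base
  unfold PlaneMap.vertexDegree PlaneMap.SameVertex at this
  rw [Equiv.Perm.ncard_sameCycle] at this
  exact Function.iterate_minimalPeriod_eq this

theorem IsOuter.rot_three (h : G.IsOuter d) (hb : d ≠ G.base) : G.rot (G.rot (G.rot d)) = d := by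
  have := G.degree_boundary d h hb
  unfold PlaneMap.vertexDegree PlaneMap.SameVertex at this
  rw [Equiv.Perm.ncard_sameCycle] at this
  exact Function.iterate_minimalPeriod_eq this

theorem IsOuter.rot_two_ne (h : G.IsOuter d) (hb : d ≠ G.base) : G.rot (G.rot d) ≠ d := by
  intro h'
  have h3 := h.rot_three hb
  rw [h'] at h3
  exact h.rot_ne h3

theorem IsOuter.rot_rot (h : G.IsOuter d) (hb : d ≠ G.base) : ¬ G.IsOuter (G.rot (G.rot d)) := by
  intro h'
  exact h.rot_two_ne hb (h'.eq_of_sameVertex h (by simp [PlaneMap.SameVertex, Equiv.Perm.SameCycle.refl]))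

theorem IsInteriorVertex.rot_four (h : G.IsInteriorVertex d) :
    G.rot (G.rot (G.rot (G.rot d))) = d := by
  have := G.degree_interior d h
  unfold PlaneMap.vertexDegree PlaneMap.SameVertex at this
  rw [Equiv.Perm.ncard_sameCycle] at this
  exact Function.iterate_minimalPeriod_eq this

theorem IsInteriorVertex.rot_two_ne (h : G.IsInteriorVertex d) : G.rot (G.rot d) ≠ d := by
  have := G.degree_interior d h
  unfold PlaneMap.vertexDegree PlaneMap.SameVertex at this
  rw [Equiv.Perm.ncard_sameCycle] at this
  exact Function.iterate_ne_of_minimalPeriod 2 this (by norm_num) (by norm_num)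

theorem IsInteriorVertex.rot_ne (h : G.IsInteriorVertex d) : G.rot d ≠ d := by
  intro h'; apply h.rot_two_ne; rw [h', h']

theorem isInteriorVertex_congr (h : G.SameVertex d e) :
    G.IsInteriorVertex d ↔ G.IsInteriorVertex e :=
  ⟨fun hd x hx => hd x (h.trans hx), fun hd x hx => hd x (h.symm.trans hx)⟩

theorem isInteriorVertex_rot : G.IsInteriorVertex (G.rot d) ↔ G.IsInteriorVertex d :=
  (isInteriorVertex_congr (sameVertex_rot d)).symm

/-- A vertex is interior as soon as four consecutive darts are not outer. -/
theorem isInteriorVertex_of (h0 : ¬ G.IsOuter d) (h1 : ¬ G.IsOuter (G.rot d))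
    (h2 : ¬ G.IsOuter (G.rot (G.rot d))) : G.IsInteriorVertex d := by
  intro e he heo
  have he' := Equiv.Perm.SameCycle.symm he
  by_cases hb : e = G.base
  · subst hb
    rw [Equiv.Perm.sameCycle_iff_two rot_base] at he'
    rcases he' with rfl | rfl
    · exact h0 heo
    · rw [rot_base] at h1; exact h1 heo
  · rw [Equiv.Perm.sameCycle_iff_three (heo.rot_three hb)] at he'
    have := heo.rot_three hb
    rcases he' with rfl | rfl | rfl
    · exact h0 heo
    · rw [this] at h2; exact h2 heo
    · rw [this] at h1; exact h1 heo

theorem not_isOuter_of_interior (h : G.IsInteriorVertex d) : ¬ G.IsOuter d :=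
  h d Equiv.Perm.SameCycle.rfl

variable (G) in
theorem eq_univ (X : Set G.Dart) (h0 : X.Nonempty) (h1 : ∀ d ∈ X, G.rot d ∈ X)
    (h2 : ∀ d ∈ X, G.rev d ∈ X) : X = Set.univ := by
  obtain ⟨x, hx⟩ := h0
  rw [Set.eq_univ_iff_forall]
  intro y
  obtain ⟨g, hg, rfl⟩ := G.connected x y
  have : ∀ z ∈ X, g z ∈ X := by
    refine Subgroup.closure_induction (p := fun g _ => ∀ z ∈ X, g z ∈ X) ?_ ?_ ?_ ?_ hg
    · rintro σ (rfl | rfl)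
      · exact h1
      · exact h2
    · intro z hz; exact hz
    · intro a b _ _ ha hb z hz; exact ha _ (hb _ hz)
    · intro a _ ha z hz
      exact a.mem_of_closed ha (by simpa using hz)
  exact this x hx

variable (G) in
-- This is how planarity of `G` is used: the cycle `z` bounds a set of faces with indicator function
-- `w`. Since `rot d = next (rev d)`, the first property of `w` says that it is constant on faces;
-- the second says that it changes exactly across the edges of `z`.
theorem exists_potential (z : G.Dart → ZMod 2) (hz : ∀ d, z (G.rev d) = z d)
    (hs : ∀ d, vertexSum G.rot z d = 0) :
    ∃ w : G.Dart → ZMod 2, (∀ d, w (G.rot d) = w (G.rev d)) ∧ ∀ d, w d + w (G.rev d) = z d := by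
  classical
  have := Fintype.ofFinite G.Dart
  have : Nonempty G.Dart := ⟨G.base⟩
  obtain ⟨w, hw, hw'⟩ := (euler_iff G.rot G.rev G.rev_rev G.rev_ne
    (fun X h0 h1 h2 => G.eq_univ X h0 h1 h2)).1 G.euler z hz hs
  exact ⟨w, fun d => by rw [← hw (G.rev d), G.rev_rev], hw'⟩

end MinimalLoop

theorem vertexSum_rot {D : Type*} (rot : Equiv.Perm D) (z : D → ZMod 2) (d : D) :
    vertexSum rot z (rot d) = vertexSum rot z d := by
  simp [vertexSum]

/-! ### Rotations changed at finitely many darts -/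

namespace MinimalLoop

open Classical in
theorem redirect_of_notMem {D : Type} {f : D → D} {L : List (D × D)} {a : D}
    (h : a ∉ L.map Prod.fst) : redirect f L a = f a := by
  induction L with
  | nil => rfl
  | cons x L ih =>
    obtain ⟨u, v⟩ := x
    simp only [List.map_cons, List.mem_cons, not_or] at h
    rw [redirect, Function.update_of_ne h.1]
    exact ih h.2

open Classical in
theorem redirect_of_mem {D : Type} {f : D → D} {L : List (D × D)} {a b : D}
    (hL : (L.map Prod.fst).Nodup) (h : (a, b) ∈ L) : redirect f L a = b := by
  induction L with
  | nil => simp at h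
  | cons x L ih =>
    obtain ⟨u, v⟩ := x
    simp only [List.map_cons, List.nodup_cons] at hL
    rw [List.mem_cons] at h
    rcases h with h | h
    · cases h
      rw [redirect, Function.update_self]
    · have : a ≠ u := by
        rintro rfl
        exact hL.1 (List.mem_map_of_mem (f := Prod.fst) h)
      rw [redirect, Function.update_of_ne this]
      exact ih hL.2 h

/-- A value not listed as new keeps its old preimage, because by `hf` the redirected darts had only
listed values before. On a finite type this already gives a permutation. -/
theorem redirect_surjective {D : Type} {f : Equiv.Perm D} {L : List (D × D)}
    (hL : (L.map Prod.fst).Nodup) (hf : ∀ a ∈ L.map Prod.fst, f a ∈ L.map Prod.snd) :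
    Function.Surjective (redirect f L) := by
  intro y
  by_cases hy : y ∈ L.map Prod.snd
  · obtain ⟨⟨u, v⟩, hu, rfl⟩ := List.mem_map.1 hy
    exact ⟨u, redirect_of_mem hL hu⟩
  · refine ⟨f.symm y, ?_⟩
    rw [redirect_of_notMem, Equiv.apply_symm_apply]
    intro h'
    have := hf _ h'
    rw [Equiv.apply_symm_apply] at this
    exact hy this

/-- The permutation whose values are given by `redirect`. -/
noncomputable def redirectPerm {D : Type} [Finite D] (f : Equiv.Perm D) (L : List (D × D))
    (h : Function.Surjective (redirect f L)) : Equiv.Perm D :=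
  Equiv.ofBijective (redirect f L) (Finite.surjective_iff_bijective.1 h)

/-! ### The ots operation on an interior triangle -/

/-- A triangle without boundary edges, all of whose vertices have degree 4, with the names of
the darts around it as in `OtsInterior`. -/
structure TriChart (G : MinimalLoop) (p q r e f g h i j : G.Dart) : Prop where
  p_q : G.rot (G.rev p) = q
  q_r : G.rot (G.rev q) = r
  r_p : G.rot (G.rev r) = p
  r_e : G.rot r = e
  e_f : G.rot e = f
  f_q : G.rot f = G.rev q
  q_g : G.rot q = g
  g_h : G.rot g = h
  h_p : G.rot h = G.rev p
  p_i : G.rot p = i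
  i_j : G.rot i = j
  j_r : G.rot j = G.rev r
  nodup : [e, p, G.rev r, j, f, g, q, G.rev p, r, G.rev q, h, i].Nodup
  not_outer : ∀ d ∈ [e, p, G.rev r, j, f, g, q, G.rev p, r, G.rev q, h, i], ¬ G.IsOuter d

namespace TriChart

variable {G : MinimalLoop} {p q r e f g h i j : G.Dart}

/-- The darts at the three vertices of the triangle. -/
def local_ (_ : TriChart G p q r e f g h i j) : List G.Dart :=
  [e, p, G.rev r, j, f, g, q, G.rev p, r, G.rev q, h, i]

variable (T : TriChart G p q r e f g h i j)

theorem rot_local {d : G.Dart} (hd : d ∈ T.local_) : G.rot d ∈ T.local_ := by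
  have := T.p_q; have := T.q_r; have := T.r_p; have := T.r_e; have := T.e_f; have := T.f_q
  have := T.q_g; have := T.g_h; have := T.h_p; have := T.p_i; have := T.i_j; have := T.j_r
  simp only [local_, List.mem_cons, List.not_mem_nil, or_false] at hd ⊢
  rcases hd with rfl | rfl | rfl | rfl | rfl | rfl | rfl | rfl | rfl | rfl | rfl | rfl <;> simp [*]

theorem local_of_rot {d : G.Dart} (hd : G.rot d ∈ T.local_) : d ∈ T.local_ :=
  G.rot.mem_of_closed (X := {d | d ∈ T.local_}) (fun _ h => T.rot_local h) hd

end TriChart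

/-- The new clockwise successors in an `ots` operation on an interior triangle. -/
def flipList (G : MinimalLoop) (p q r e f g h i j : G.Dart) : List (G.Dart × G.Dart) :=
  [(e, p), (p, G.rev r), (G.rev r, j), (j, e), (f, g), (g, q), (q, G.rev p), (G.rev p, f),
    (r, G.rev q), (G.rev q, h), (h, i), (i, r)]

namespace TriChart

variable {G : MinimalLoop} {p q r e f g h i j : G.Dart} (T : TriChart G p q r e f g h i j)

theorem flip_surjective (T : TriChart G p q r e f g h i j) :
    Function.Surjective (redirect G.rot (G.flipList p q r e f g h i j)) := by
  refine redirect_surjective T.nodup ?_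
  intro d hd
  replace hd := T.rot_local hd
  simp only [local_] at hd
  simp only [flipList, List.map_cons, List.map_nil, List.mem_cons, List.not_mem_nil] at hd ⊢
  tauto

/-- The rotation after the `ots` operation. -/
noncomputable def flipRot : Equiv.Perm G.Dart :=
  redirectPerm G.rot (G.flipList p q r e f g h i j) T.flip_surjective

theorem flip_mem {a b : G.Dart} (hab : (a, b) ∈ G.flipList p q r e f g h i j) :
    T.flipRot a = b := redirect_of_mem (L := G.flipList p q r e f g h i j) T.nodup hab

theorem flip_notMem {d : G.Dart} (hd : d ∉ T.local_) : T.flipRot d = G.rot d :=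
  redirect_of_notMem (L := G.flipList p q r e f g h i j) hd

theorem flip_e : T.flipRot e = p := T.flip_mem (by simp [flipList])
theorem flip_p : T.flipRot p = G.rev r := T.flip_mem (by simp [flipList])
theorem flip_rev_r : T.flipRot (G.rev r) = j := T.flip_mem (by simp [flipList])
theorem flip_j : T.flipRot j = e := T.flip_mem (by simp [flipList])
theorem flip_f : T.flipRot f = g := T.flip_mem (by simp [flipList])
theorem flip_g : T.flipRot g = q := T.flip_mem (by simp [flipList])
theorem flip_q : T.flipRot q = G.rev p := T.flip_mem (by simp [flipList])
theorem flip_rev_p : T.flipRot (G.rev p) = f := T.flip_mem (by simp [flipList])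
theorem flip_r : T.flipRot r = G.rev q := T.flip_mem (by simp [flipList])
theorem flip_rev_q : T.flipRot (G.rev q) = h := T.flip_mem (by simp [flipList])
theorem flip_h : T.flipRot h = i := T.flip_mem (by simp [flipList])
theorem flip_i : T.flipRot i = r := T.flip_mem (by simp [flipList])

theorem flip_local {d : G.Dart} (hd : d ∈ T.local_) : T.flipRot d ∈ T.local_ := by
  have := T.flip_e; have := T.flip_p; have := T.flip_rev_r; have := T.flip_j; have := T.flip_f
  have := T.flip_g; have := T.flip_q; have := T.flip_rev_p; have := T.flip_r
  have := T.flip_rev_q; have := T.flip_h; have := T.flip_i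
  simp only [local_, List.mem_cons, List.not_mem_nil, or_false] at hd ⊢
  rcases hd with rfl | rfl | rfl | rfl | rfl | rfl | rfl | rfl | rfl | rfl | rfl | rfl <;> simp [*]

theorem local_of_flip {d : G.Dart} (hd : T.flipRot d ∈ T.local_) : d ∈ T.local_ :=
  T.flipRot.mem_of_closed (X := {d | d ∈ T.local_}) (fun _ h => T.flip_local h) hd

/-- The local darts of a set closed under the new rotation and reversal. -/
theorem local_subset_of_closed {X : Set G.Dart} (h1 : ∀ d ∈ X, T.flipRot d ∈ X)
    (hp : p ∈ X → G.rev p ∈ X) (hp' : G.rev p ∈ X → p ∈ X)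
    (hq : q ∈ X → G.rev q ∈ X) (hq' : G.rev q ∈ X → q ∈ X) {d : G.Dart}
    (hd : d ∈ T.local_) (hX : d ∈ X) : ∀ d' ∈ T.local_, d' ∈ X := by
  have c1 := h1 e; have c2 := h1 p; have c3 := h1 (G.rev r); have c4 := h1 j
  have c5 := h1 f; have c6 := h1 g; have c7 := h1 q; have c8 := h1 (G.rev p)
  have c9 := h1 r; have c10 := h1 (G.rev q); have c11 := h1 h; have c12 := h1 i
  rw [T.flip_e] at c1; rw [T.flip_p] at c2; rw [T.flip_rev_r] at c3; rw [T.flip_j] at c4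
  rw [T.flip_f] at c5; rw [T.flip_g] at c6; rw [T.flip_q] at c7; rw [T.flip_rev_p] at c8
  rw [T.flip_r] at c9; rw [T.flip_rev_q] at c10; rw [T.flip_h] at c11; rw [T.flip_i] at c12
  have hpX : p ∈ X := by
    simp only [local_, List.mem_cons, List.not_mem_nil, or_false] at hd
    rcases hd with rfl | rfl | rfl | rfl | rfl | rfl | rfl | rfl | rfl | rfl | rfl | rfl
    exacts [c1 hX, hX, c1 (c4 (c3 hX)), c1 (c4 hX), hp' (c7 (c6 (c5 hX))), hp' (c7 (c6 hX)),
      hp' (c7 hX), hp' hX, hp' (c7 (hq' (c9 hX))), hp' (c7 (hq' hX)),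
      hp' (c7 (hq' (c9 (c12 (c11 hX))))), hp' (c7 (hq' (c9 (c12 hX))))]
  intro d' hd'
  simp only [local_, List.mem_cons, List.not_mem_nil, or_false] at hd'
  have e1 := c2 hpX; have e2 := c3 e1; have e3 := c4 e2
  have e4 := hp hpX; have e5 := c8 e4; have e6 := c5 e5; have e7 := c6 e6
  have e8 := hq e7; have e9 := c10 e8; have e10 := c11 e9; have e11 := c12 e10
  rcases hd' with rfl | rfl | rfl | rfl | rfl | rfl | rfl | rfl | rfl | rfl | rfl | rfl <;> assumption

/-- The darts of the sides of the triangle. -/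
def inner (_ : TriChart G p q r e f g h i j) : List G.Dart :=
  [p, G.rev p, q, G.rev q, r, G.rev r]

theorem inner_rev {d : G.Dart} : G.rev d ∈ T.inner ↔ d ∈ T.inner := by
  simp only [inner, List.mem_cons, List.not_mem_nil, or_false, rev_eq_iff, G.rev_rev]
  tauto

theorem local_of_inner {d : G.Dart} (hd : d ∈ T.inner) : d ∈ T.local_ := by
  simp only [inner, local_, List.mem_cons, List.not_mem_nil, or_false] at hd ⊢
  tauto

theorem legs_notMem : e ∉ T.inner ∧ f ∉ T.inner ∧ g ∉ T.inner ∧ h ∉ T.inner ∧ i ∉ T.inner ∧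
    j ∉ T.inner := by
  have N := T.nodup
  simp only [List.nodup_cons, List.mem_cons, List.not_mem_nil, not_or, or_false] at N
  simp only [inner, List.mem_cons, List.not_mem_nil, not_or, or_false]
  grind

theorem sides_ne (T : TriChart G p q r e f g h i j) : p ≠ q ∧ p ≠ r ∧ q ≠ r ∧ p ≠ G.rev p ∧ p ≠ G.rev q ∧ p ≠ G.rev r ∧ q ≠ G.rev p ∧
    q ≠ G.rev q ∧ q ≠ G.rev r ∧ r ≠ G.rev p ∧ r ≠ G.rev q ∧ r ≠ G.rev r := by
  have N := T.nodup
  simp only [List.nodup_cons, List.mem_cons, List.not_mem_nil, not_or, or_false] at N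
  grind

theorem rot_two_ne (T : TriChart G p q r e f g h i j) : G.rot (G.rot r) ≠ r ∧ G.rot (G.rot q) ≠ q ∧ G.rot (G.rot p) ≠ p := by
  rw [T.r_e, T.e_f, T.q_g, T.g_h, T.p_i, T.i_j]
  have N := T.nodup
  simp only [List.nodup_cons, List.mem_cons, List.not_mem_nil, not_or, or_false] at N
  grind

theorem flip_two_ne : T.flipRot (T.flipRot e) ≠ e ∧ T.flipRot (T.flipRot f) ≠ f ∧
    T.flipRot (T.flipRot r) ≠ r := by
  rw [T.flip_e, T.flip_p, T.flip_f, T.flip_g, T.flip_r, T.flip_rev_q]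
  have N := T.nodup
  simp only [List.nodup_cons, List.mem_cons, List.not_mem_nil, not_or, or_false] at N
  grind

/-- A cycle `z` of the new map becomes a cycle `z₀` of `G` that agrees with it off the sides of the
triangle. Such a `z₀` is determined up to adding the triangle; the choice `z₀ p = 0` then forces the
values on `q` and `r` at the vertices `b` and `c`. A potential of `z₀` has to be corrected on the
six darts of the sides only. -/
theorem flip_homology (T : TriChart G p q r e f g h i j) (z : G.Dart → ZMod 2)
    (hz : ∀ d, z (G.rev d) = z d) (hs : ∀ d, vertexSum T.flipRot z d = 0) :
    ∃ w : G.Dart → ZMod 2, (∀ d, w (T.flipRot (G.rev d)) = w d) ∧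
      ∀ d, w d + w (G.rev d) = z d := by
  classical
  obtain ⟨le, lf, lg, lh, li, lj⟩ := T.legs_notMem
  obtain ⟨n1, n2, n3, n4, n5, n6, n7, n8, n9, n10, n11, n12⟩ := T.sides_ne
  have sx : z e + z p + z r + z j = 0 := by
    have := hs e
    rw [vertexSum_four _ _ T.flip_two_ne.1] at this
    · simpa [T.flip_e, T.flip_p, T.flip_rev_r, hz] using this
    · simp [T.flip_e, T.flip_p, T.flip_rev_r, T.flip_j]
  have sy : z f + z g + z q + z p = 0 := by
    have := hs f
    rw [vertexSum_four _ _ T.flip_two_ne.2.1] at this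
    · simpa [T.flip_f, T.flip_g, T.flip_q, hz] using this
    · simp [T.flip_f, T.flip_g, T.flip_q, T.flip_rev_p]
  have sa : z r + z q + z h + z i = 0 := by
    have := hs r
    rw [vertexSum_four _ _ T.flip_two_ne.2.2] at this
    · simpa [T.flip_r, T.flip_rev_q, T.flip_h, hz] using this
    · simp [T.flip_r, T.flip_rev_q, T.flip_h, T.flip_i]
  let z₀ : G.Dart → ZMod 2 := fun d =>
    if d = p ∨ d = G.rev p then 0 else if d = q ∨ d = G.rev q then z g + z h else
    if d = r ∨ d = G.rev r then z i + z j else z d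
  have hz0 : ∀ d, z₀ (G.rev d) = z₀ d := by
    intro d
    simp only [z₀, rev_eq_iff, G.rev_rev, hz, or_comm]
  have zleg : ∀ d, d ∉ T.inner → z₀ d = z d := by
    intro d hd
    simp only [inner, List.mem_cons, List.not_mem_nil, not_or, or_false] at hd
    simp [z₀, hd]
  have zp : z₀ p = 0 := by simp [z₀]
  have zq : z₀ q = z g + z h := by simp [z₀, n1.symm, n7]
  have zr : z₀ r = z i + z j := by simp [z₀, n2.symm, n3.symm, n10, n11]
  have hs0 : ∀ d, vertexSum G.rot z₀ d = 0 := by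
    have s1 : vertexSum G.rot z₀ r = 0 := by
      rw [vertexSum_four _ _ T.rot_two_ne.1, T.r_e, T.e_f, T.f_q, hz0, zr, zq, zleg _ le,
        zleg _ lf]
      · clear * - sx sy sa; grind
      · rw [T.r_e, T.e_f, T.f_q, T.q_r]
    have s2 : vertexSum G.rot z₀ q = 0 := by
      rw [vertexSum_four _ _ T.rot_two_ne.2.1, T.q_g, T.g_h, T.h_p, hz0, zp, zq, zleg _ lg,
        zleg _ lh]
      · clear * -; grind
      · rw [T.q_g, T.g_h, T.h_p, T.p_q]
    have s3 : vertexSum G.rot z₀ p = 0 := by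
      rw [vertexSum_four _ _ T.rot_two_ne.2.2, T.p_i, T.i_j, T.j_r, hz0, zp, zr, zleg _ li,
        zleg _ lj]
      · clear * -; grind
      · rw [T.p_i, T.i_j, T.j_r, T.r_p]
    intro d
    by_cases hd : d ∈ T.local_
    · simp only [local_, List.mem_cons, List.not_mem_nil, or_false] at hd
      rcases hd with rfl | rfl | rfl | rfl | rfl | rfl | rfl | rfl | rfl | rfl | rfl | rfl
      · rwa [← T.r_e, vertexSum_rot]
      · exact s3
      · rwa [← vertexSum_rot, T.r_p]
      · rwa [← vertexSum_rot, T.j_r, ← vertexSum_rot, T.r_p]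
      · rwa [← T.e_f, vertexSum_rot, ← T.r_e, vertexSum_rot]
      · rwa [← T.q_g, vertexSum_rot]
      · exact s2
      · rwa [← vertexSum_rot, T.p_q]
      · exact s1
      · rwa [← vertexSum_rot, T.q_r]
      · rwa [← T.g_h, vertexSum_rot, ← T.q_g, vertexSum_rot]
      · rwa [← T.p_i, vertexSum_rot]
    · rw [← hs d]
      have h1 : ∀ x, T.flipRot.SameCycle d x → x ∉ T.local_ := fun x hx =>
        hx.induct (P := fun x => x ∉ T.local_) hd (fun y hy hy' => hy (T.local_of_flip hy'))
      have h2 := vertexSum_comp (rot := G.rot) (rot' := T.flipRot) Function.injective_id z₀ d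
        (fun x hx => T.flip_notMem (h1 x hx))
      simp only [id] at h2
      rw [← h2]
      exact vertexSum_congr _ fun x hx => zleg x (fun h => h1 x hx (T.local_of_inner h))
  obtain ⟨w, hw, hw'⟩ := G.exists_potential z₀ hz0 hs0
  have wp := hw (G.rev p); have wq := hw (G.rev q); have wr := hw (G.rev r)
  have wrr := hw r; have we := hw e; have wf := hw f; have wqq := hw q; have wg := hw g
  have wh := hw h; have wpp := hw p; have wi := hw i; have wj := hw j
  rw [G.rev_rev] at wp wq wr
  rw [T.p_q] at wp; rw [T.q_r] at wq; rw [T.r_p] at wr; rw [T.r_e] at wrr; rw [T.e_f] at we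
  rw [T.f_q] at wf; rw [T.q_g] at wqq; rw [T.g_h] at wg; rw [T.h_p] at wh; rw [T.p_i] at wpp
  rw [T.i_j] at wi; rw [T.j_r] at wj
  have ve := hw' e; have vf := hw' f; have vg := hw' g; have vj := hw' j
  rw [zleg _ le] at ve; rw [zleg _ lf] at vf; rw [zleg _ lg] at vg; rw [zleg _ lj] at vj
  -- In the new map `p`, `q`, `r` lie on the faces of `f`, `h`, `j`. The reversed darts bound the
  -- new triangle, which lies across `p` from the face of `f` and hence gets the value `w f + z p`.
  let w₀ : G.Dart → ZMod 2 := fun d =>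
    if d = p then w f else if d = q then w h else if d = r then w j else
    if d = G.rev p ∨ d = G.rev q ∨ d = G.rev r then w f + z p else w d
  have w0p : w₀ p = w f := by simp [w₀]
  have w0q : w₀ q = w h := by simp [w₀, n1.symm]
  have w0r : w₀ r = w j := by simp [w₀, n2.symm, n3.symm]
  have w0p' : w₀ (G.rev p) = w f + z p := by simp [w₀, n4.symm, n7.symm, n10.symm]
  have w0q' : w₀ (G.rev q) = w f + z p := by simp [w₀, n5.symm, n8.symm, n11.symm]
  have w0r' : w₀ (G.rev r) = w f + z p := by simp [w₀, n6.symm, n9.symm, n12.symm]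
  have w0 : ∀ d, d ∉ T.inner → w₀ d = w d := by
    intro d hd
    simp only [inner, List.mem_cons, List.not_mem_nil, not_or, or_false] at hd
    simp [w₀, hd]
  have w0' : ∀ d, d ∉ T.inner → w₀ (G.rev d) = w (G.rev d) :=
    fun d hd => w0 _ (fun h => hd (T.inner_rev.1 h))
  refine ⟨w₀, fun d => ?_, fun d => ?_⟩
  · suffices H : ∀ u, w₀ (T.flipRot u) = w₀ (G.rev u) by simpa [G.rev_rev] using H (G.rev d)
    intro u
    by_cases hu : u ∈ T.local_
    · simp only [local_, List.mem_cons, List.not_mem_nil, or_false] at hu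
      rcases hu with rfl | rfl | rfl | rfl | rfl | rfl | rfl | rfl | rfl | rfl | rfl | rfl
      · rw [T.flip_e, w0' _ le, w0p, we]
      · rw [T.flip_p, w0r', w0p']
      · rw [T.flip_rev_r, G.rev_rev, w0r, w0 _ lj]
      · rw [T.flip_j, w0' _ lj, w0 _ le, ← wj, wrr]
      · rw [T.flip_f, w0' _ lf, w0 _ lg, ← wf, wqq]
      · rw [T.flip_g, w0' _ lg, w0q, wg]
      · rw [T.flip_q, w0p', w0q']
      · rw [T.flip_rev_p, G.rev_rev, w0p, w0 _ lf]
      · rw [T.flip_r, w0q', w0r']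
      · rw [T.flip_rev_q, G.rev_rev, w0q, w0 _ lh]
      · rw [T.flip_h, w0' _ lh, w0 _ li, ← wh, wpp]
      · rw [T.flip_i, w0' _ li, w0r, wi]
    · rw [T.flip_notMem hu, w0' u (fun h => hu (T.local_of_inner h)),
        w0 _ (fun h => hu (T.local_of_rot (T.local_of_inner h))), hw]
  · have k1 : w₀ p + w₀ (G.rev p) = z p := by
      rw [w0p, w0p']; clear * -; grind
    have k2 : w₀ q + w₀ (G.rev q) = z q := by
      rw [w0q, w0q']; rw [← wf, ← wqq] at vf; rw [← wg] at vg
      clear * - vf vg sy; grind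
    have k3 : w₀ r + w₀ (G.rev r) = z r := by
      rw [w0r, w0r']; rw [← we] at ve; rw [← wj, ← wrr] at vj
      clear * - ve vj sx; grind
    by_cases hd : d ∈ T.inner
    · simp only [inner, List.mem_cons, List.not_mem_nil, or_false] at hd
      rcases hd with rfl | rfl | rfl | rfl | rfl | rfl
      · exact k1
      · rw [G.rev_rev, hz, add_comm]; exact k1
      · exact k2
      · rw [G.rev_rev, hz, add_comm]; exact k2
      · exact k3
      · rw [G.rev_rev, hz, add_comm]; exact k3
    · rw [w0 d hd, w0' d hd, hw', zleg d hd]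

end TriChart
end MinimalLoop

namespace MinimalLoop

theorem sameCycle_of_agree {D : Type*} [Finite D] {σ τ : Equiv.Perm D} {x : D} {S : Set D}
    (hS : ∀ d, σ.SameCycle x d → d ∈ S) (h : ∀ d ∈ S, τ d = σ d) (d : D) :
    τ.SameCycle x d ↔ σ.SameCycle x d := by
  constructor
  · intro hd
    refine hd.induct (P := fun d => σ.SameCycle x d) Equiv.Perm.SameCycle.rfl ?_
    intro z hz
    rw [h z (hS z hz)]; simpa using hz
  · intro hd
    refine (hd.induct (P := fun d => σ.SameCycle x d ∧ τ.SameCycle x d)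
      ⟨Equiv.Perm.SameCycle.rfl, Equiv.Perm.SameCycle.rfl⟩ ?_).2
    rintro z ⟨hz, hz'⟩
    refine ⟨by simpa using hz, ?_⟩
    rw [← h z (hS z hz)]; simpa using hz'

variable {G : MinimalLoop}

namespace TriChart

variable {p q r e f g h i j : G.Dart} (T : TriChart G p q r e f g h i j)

theorem flip_loopData : LoopData T.flipRot G.rev G.base {d | G.IsOuter d} where
  rev_rev := G.rev_rev
  rev_ne := G.rev_ne
  conn := by
    intro X hb h1 h2 d
    have : X = Set.univ := by
      refine G.eq_univ X ⟨_, hb⟩ (fun d hd => ?_) h2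
      by_cases hl : d ∈ T.local_
      · have hr := fun d => h2 (G.rev d)
        simp only [G.rev_rev] at hr
        exact T.local_subset_of_closed h1 (h2 _) (hr _) (h2 _) (hr _) hl hd _ (T.rot_local hl)
      · rw [← T.flip_notMem hl]; exact h1 d hd
    rw [this]; trivial
  homology := T.flip_homology
  out_iff := by
    intro d
    refine (sameCycle_of_agree (σ := G.next) (S := {d | G.IsOuter d}) (fun d h => h) ?_ d).symm
    intro d hd
    show T.flipRot (G.rev d) = G.rot (G.rev d)
    refine T.flip_notMem fun hl => ?_
    refine T.not_outer _ (T.rot_local hl) ?_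
    rw [isOuter_rot, G.rev_rev]; exact hd
  out_rot := by
    intro d hd
    rw [T.flip_notMem fun hl => T.not_outer _ hl hd]
    exact hd.rot
  out_rev := fun d hd => IsOuter.rev hd
  deg_base := by
    rw [T.flip_notMem fun hl => T.not_outer _ hl isOuter_base, T.flip_notMem fun hl =>
      T.not_outer _ (T.local_of_rot hl) isOuter_base, rot_base]
  deg_out := by
    intro d hd hb
    have h0 : d ∉ T.local_ := fun hl => T.not_outer _ hl hd
    have h1 : G.rot d ∉ T.local_ := fun hl => h0 (T.local_of_rot hl)
    have h2 : G.rot (G.rot d) ∉ T.local_ := fun hl => h1 (T.local_of_rot hl)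
    rw [T.flip_notMem h0, T.flip_notMem h1, T.flip_notMem h2]
    exact ⟨IsOuter.rot_three hd hb, IsOuter.rot_rot hd hb⟩
  deg_in := by
    intro d d0 d1 d2 d3
    by_cases hl : d ∈ T.local_
    · have e1 := T.flip_e; have e2 := T.flip_p; have e3 := T.flip_rev_r; have e4 := T.flip_j
      have e5 := T.flip_f; have e6 := T.flip_g; have e7 := T.flip_q; have e8 := T.flip_rev_p
      have e9 := T.flip_r; have e10 := T.flip_rev_q; have e11 := T.flip_h; have e12 := T.flip_i
      obtain ⟨t1, t2, t3⟩ := T.flip_two_ne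
      simp only [local_, List.mem_cons, List.not_mem_nil, or_false] at hl
      have t : T.flipRot (T.flipRot (T.flipRot (T.flipRot d))) = d := by
        rcases hl with rfl | rfl | rfl | rfl | rfl | rfl | rfl | rfl | rfl | rfl | rfl | rfl <;>
          simp only [*]
      refine ⟨t, fun h' => ?_⟩
      have t' : T.flipRot.SameCycle d (T.flipRot (T.flipRot d)) := by
        simp [Equiv.Perm.SameCycle.refl]
      -- A double step fixing one dart of the vertex fixes all of them, among them one of `e`, `f`,
      -- `r`, contrary to `flip_two_ne`.
      have hfix : ∀ x, T.flipRot.SameCycle d x → T.flipRot (T.flipRot x) = x := fun x hx =>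
        hx.induct (P := fun x => T.flipRot (T.flipRot x) = x) h' (fun z hz => by rw [hz])
      have k1 : T.flipRot.SameCycle d (T.flipRot d) := by simp [Equiv.Perm.SameCycle.refl]
      have k3 : T.flipRot.SameCycle d (T.flipRot (T.flipRot (T.flipRot d))) := by
        simp [Equiv.Perm.SameCycle.refl]
      have m0 := hfix _ Equiv.Perm.SameCycle.rfl
      have m1 := hfix _ k1
      have m2 := hfix _ t'
      have m3 := hfix _ k3
      rcases hl with rfl | rfl | rfl | rfl | rfl | rfl | rfl | rfl | rfl | rfl | rfl | rfl <;>
        simp only [e1, e2, e3, e4, e5, e6, e7, e8, e9, e10, e11, e12] at m0 m1 m2 m3 t1 t2 t3 <;>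
        grind
    · have hl1 : G.rot d ∉ T.local_ := fun h => hl (T.local_of_rot h)
      have hl2 : G.rot (G.rot d) ∉ T.local_ := fun h => hl1 (T.local_of_rot h)
      have hl3 : G.rot (G.rot (G.rot d)) ∉ T.local_ := fun h => hl2 (T.local_of_rot h)
      simp only [T.flip_notMem hl, T.flip_notMem hl1, T.flip_notMem hl2, T.flip_notMem hl3]
        at d0 d1 d2 d3 ⊢
      have := isInteriorVertex_of d0 d1 d2
      exact ⟨this.rot_four, this.rot_two_ne⟩

/-- The result of the `ots` operation. -/
noncomputable def flip : MinimalLoop := T.flip_loopData.toMinimalLoop G.finite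

theorem ots_flip (hp : ¬ G.IsBoundaryEdge p) (hq : ¬ G.IsBoundaryEdge q)
    (hr : ¬ G.IsBoundaryEdge r) : G.OtsInterior T.flip p := by
  have h1 : G.next p = q := T.p_q
  have h2 : G.next q = r := T.q_r
  unfold OtsInterior
  simp only [h1, h2, T.r_e, T.e_f, T.q_g, T.g_h, T.p_i, T.i_j]
  exact ⟨hp, hq, hr, id, Function.injective_id, by rw [Set.compl_empty]; exact Set.range_id,
    fun d => rfl, fun d => rfl, rfl⟩

theorem not_isBoundaryEdge (T : TriChart G p q r e f g h i j) : ¬ G.IsBoundaryEdge p ∧ ¬ G.IsBoundaryEdge q ∧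
    ¬ G.IsBoundaryEdge r := by
  refine ⟨?_, ?_, ?_⟩ <;> rintro (h | h) <;>
    exact T.not_outer _ (by simp) h

theorem flip_isOuter {d : G.Dart} : T.flip.IsOuter d ↔ G.IsOuter d :=
  (T.flip_loopData.out_iff d).symm

end TriChart

theorem nodup_four {D : Type*} {σ : Equiv.Perm D} {a b c d : D} (h1 : σ a = b) (h2 : σ b = c)
    (h3 : σ c = d) (h4 : σ d = a) (h : c ≠ a) : [a, b, c, d].Nodup := by
  subst h1 h2 h3
  have : σ a ≠ a := fun h' => h (by rw [h', h'])
  simp only [List.nodup_cons, List.mem_cons, List.not_mem_nil, not_or, or_false,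
    not_false_eq_true, and_true, List.nodup_nil, EmbeddingLike.apply_eq_iff_eq]
  grind

/-- The rearrangement is decided for lists of indices and then mapped to arbitrary entries. -/
theorem perm_twelve {D : Type*} (p i j r' q g h p' r e f q' : D) :
    List.Perm ([p, i, j, r'] ++ ([q, g, h, p'] ++ [r, e, f, q']))
      [e, p, r', j, f, g, q, p', r, q', h, i] := by
  have := List.Perm.map (![p, i, j, r', q, g, h, p', r, e, f, q'] : Fin 12 → D)
    (show List.Perm [0, 1, 2, 3, 4, 5, 6, 7, 8, 9, 10, 11] [9, 0, 3, 2, 10, 5, 4, 7, 8, 11, 6, 1]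
      by decide)
  exact this

/-- A triangle with interior vertices has a chart. -/
theorem triChart_of {p q r : G.Dart} (hp : G.rot (G.rev p) = q) (hq : G.rot (G.rev q) = r)
    (hr : G.rot (G.rev r) = p) (ip : G.IsInteriorVertex p) (iq : G.IsInteriorVertex q)
    (ir : G.IsInteriorVertex r) (hpq : ¬ G.SameVertex p q) (hqr : ¬ G.SameVertex q r)
    (hpr : ¬ G.SameVertex p r) :
    TriChart G p q r (G.rot r) (G.rot (G.rot r)) (G.rot q) (G.rot (G.rot q)) (G.rot p)
      (G.rot (G.rot p)) := by
  have hrp : G.rot (G.rot (G.rot q)) = G.rev p := by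
    apply G.rot.injective; rw [iq.rot_four, hp]
  have hrq : G.rot (G.rot (G.rot r)) = G.rev q := by
    apply G.rot.injective; rw [ir.rot_four, hq]
  have hrr : G.rot (G.rot (G.rot p)) = G.rev r := by
    apply G.rot.injective; rw [ip.rot_four, hr]
  have sv : ∀ a b : G.Dart, ∀ x y, ¬ G.SameVertex a b → G.SameVertex a x → G.SameVertex b y →
      x ≠ y := by
    rintro a b x y hab hx hy rfl
    exact hab (hx.trans hy.symm)
  have na := nodup_four rfl rfl hrq hq ir.rot_two_ne
  have nb := nodup_four rfl rfl hrp hp iq.rot_two_ne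
  have nc := nodup_four rfl rfl hrr hr ip.rot_two_ne
  have mem : ∀ a b c x : G.Dart, G.rot (G.rot (G.rot a)) = b → 
      (x = a ∨ x = G.rot a ∨ x = G.rot (G.rot a) ∨ x = b) → G.SameVertex a x := by
    rintro a b - x rfl (rfl | rfl | rfl | rfl) <;>
      simp [PlaneMap.SameVertex, Equiv.Perm.SameCycle.refl]
  have key : ([p, G.rot p, G.rot (G.rot p), G.rev r] ++ ([q, G.rot q, G.rot (G.rot q), G.rev p] ++
      [r, G.rot r, G.rot (G.rot r), G.rev q])).Nodup := by
    rw [List.nodup_append, List.nodup_append]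
    refine ⟨nc, ⟨nb, na, ?_⟩, ?_⟩
    · intro x hx y hy
      simp only [List.mem_cons, List.not_mem_nil, or_false] at hx hy
      exact sv q r x y hqr (mem _ _ q _ hrp hx) (mem _ _ q _ hrq hy)
    · intro x hx y hy
      simp only [List.mem_cons, List.not_mem_nil, or_false, List.mem_append] at hx hy
      rcases hy with hy | hy
      · exact sv p q x y hpq (mem _ _ q _ hrr hx) (mem _ _ q _ hrp hy)
      · exact sv p r x y hpr (mem _ _ q _ hrr hx) (mem _ _ q _ hrq hy)
  refine ⟨hp, hq, hr, rfl, rfl, hrq, rfl, rfl, hrp, rfl, rfl, hrr, ?_, ?_⟩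
  · exact (perm_twelve ..).nodup_iff.1 key
  · intro d hd
    have m1 := fun d => mem _ _ q d hrr
    have m2 := fun d => mem _ _ q d hrp
    have m3 := fun d => mem _ _ q d hrq
    have : G.SameVertex p d ∨ G.SameVertex q d ∨ G.SameVertex r d := by
      simp only [List.mem_cons, List.not_mem_nil, or_false] at hd
      rcases hd with h | h | h | h | h | h | h | h | h | h | h | h
      exacts [.inr (.inr (m3 _ (.inr (.inl h)))), .inl (m1 _ (.inl h)),
        .inl (m1 _ (.inr (.inr (.inr h)))), .inl (m1 _ (.inr (.inr (.inl h)))),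
        .inr (.inr (m3 _ (.inr (.inr (.inl h))))), .inr (.inl (m2 _ (.inr (.inl h)))),
        .inr (.inl (m2 _ (.inl h))), .inr (.inl (m2 _ (.inr (.inr (.inr h))))),
        .inr (.inr (m3 _ (.inl h))), .inr (.inr (m3 _ (.inr (.inr (.inr h))))),
        .inr (.inl (m2 _ (.inr (.inr (.inl h))))), .inl (m1 _ (.inr (.inl h)))]
    rcases this with h | h | h
    · exact ip d h
    · exact iq d h
    · exact ir d h

end MinimalLoop

/-! ### The t operation -/

namespace MinimalLoop

/-- A 2-group between two vertices of degree 4, with the names of the darts around it: the vertex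
`x` carries `rev l, k, a, b` and the vertex `y` carries `rev k, l, c, d`. -/
structure BigonChart (G : MinimalLoop) (k l a b c d : G.Dart) : Prop where
  k_l : G.rot (G.rev k) = l
  l_k : G.rot (G.rev l) = k
  k_a : G.rot k = a
  a_b : G.rot a = b
  b_l : G.rot b = G.rev l
  l_c : G.rot l = c
  c_d : G.rot c = d
  d_k : G.rot d = G.rev k
  nodup : [k, d, a, l, b, c, G.rev k, G.rev l].Nodup
  not_outer : ∀ x ∈ [k, d, a, l, b, c, G.rev k, G.rev l], ¬ G.IsOuter x

namespace BigonChart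

variable {G : MinimalLoop} {k l a b c d : G.Dart} (T : BigonChart G k l a b c d)

/-- The darts at the two vertices of the 2-group. -/
def local_ (_ : BigonChart G k l a b c d) : List G.Dart := [k, d, a, l, b, c, G.rev k, G.rev l]

theorem rot_local {x : G.Dart} (hx : x ∈ T.local_) : G.rot x ∈ T.local_ := by
  have := T.k_l; have := T.l_k; have := T.k_a; have := T.a_b; have := T.b_l; have := T.l_c
  have := T.c_d; have := T.d_k
  simp only [local_, List.mem_cons, List.not_mem_nil, or_false] at hx ⊢
  rcases hx with rfl | rfl | rfl | rfl | rfl | rfl | rfl | rfl <;> simp [*]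

theorem local_of_rot {x : G.Dart} (hx : G.rot x ∈ T.local_) : x ∈ T.local_ :=
  G.rot.mem_of_closed (X := {x | x ∈ T.local_}) (fun _ h => T.rot_local h) hx

theorem rot_two_ne (T : BigonChart G k l a b c d) :
    G.rot (G.rot k) ≠ k ∧ G.rot (G.rot l) ≠ l := by
  rw [T.k_a, T.a_b, T.l_c, T.c_d]
  have N := T.nodup
  simp only [List.nodup_cons, List.mem_cons, List.not_mem_nil, not_or, or_false] at N
  grind

theorem legs_ne (T : BigonChart G k l a b c d) : ∀ x ∈ [a, b, c, d], x ≠ k ∧ x ≠ l ∧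
    x ≠ G.rev k ∧ x ≠ G.rev l := by
  have N := T.nodup
  simp only [List.nodup_cons, List.mem_cons, List.not_mem_nil, not_or, or_false] at N ⊢
  grind

theorem sides_ne (T : BigonChart G k l a b c d) : k ≠ l ∧ k ≠ G.rev k ∧ k ≠ G.rev l ∧
    l ≠ G.rev k ∧ l ≠ G.rev l := by
  have N := T.nodup
  simp only [List.nodup_cons, List.mem_cons, List.not_mem_nil, not_or, or_false] at N ⊢
  grind

theorem isInteriorVertex (T : BigonChart G k l a b c d) :
    G.IsInteriorVertex k ∧ G.IsInteriorVertex l := by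
  constructor
  · refine isInteriorVertex_of ?_ ?_ ?_
    · exact T.not_outer _ (by simp)
    · rw [T.k_a]; exact T.not_outer _ (by simp)
    · rw [T.k_a, T.a_b]; exact T.not_outer _ (by simp)
  · refine isInteriorVertex_of ?_ ?_ ?_
    · exact T.not_outer _ (by simp)
    · rw [T.l_c]; exact T.not_outer _ (by simp)
    · rw [T.l_c, T.c_d]; exact T.not_outer _ (by simp)

theorem isTwoGroup (T : BigonChart G k l a b c d) :
    G.IsTwoGroup k := by
  have h1 : G.next k = l := T.k_l
  have h2 : G.next l = k := T.l_k
  have hn := T.sides_ne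
  refine ⟨T.not_outer _ (by simp), ?_, ?_⟩
  · unfold PlaneMap.faceDegree PlaneMap.SameFace
    rw [Equiv.Perm.ncard_sameCycle]
    refine Function.minimalPeriod_eq_prime (p := 2) ?_ ?_
    · show G.next (G.next k) = k
      rw [h1, h2]
    · intro h'
      exact hn.1 (h1 ▸ (Function.IsFixedPt.eq h').symm)
  · rw [h1]
    intro h
    have h' : G.rot.SameCycle k l := h
    rw [Equiv.Perm.sameCycle_iff_four T.isInteriorVertex.1.rot_four, T.k_a, T.a_b, T.b_l] at h'
    have h3 := T.legs_ne a (by simp)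
    have h4 := T.legs_ne b (by simp)
    rcases h' with h' | h' | h' | h'
    · exact hn.1 h'.symm
    · exact h3.2.1 h'.symm
    · exact h4.2.1 h'.symm
    · exact hn.2.2.2.2 h'

theorem not_sameVertex (T : BigonChart G k l a b c d) :
    ¬ G.SameVertex k l := by
  have := T.isTwoGroup.2.2
  rwa [show G.next k = l from T.k_l] at this

end BigonChart

theorem perm_eight {D : Type*} (k d a l b c k' l' : D) :
    List.Perm ([k, a, b, l'] ++ [l, c, d, k']) [k, d, a, l, b, c, k', l'] := by
  have := List.Perm.map (![k, a, b, l', l, c, d, k'] : Fin 8 → D)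
    (show List.Perm [0, 1, 2, 3, 4, 5, 6, 7] [0, 6, 1, 4, 2, 5, 7, 3] by decide)
  exact this

variable {G : MinimalLoop}

theorem IsTwoGroup.next_next {k : G.Dart} (h : G.IsTwoGroup k) : G.next (G.next k) = k := by
  have := h.2.1
  unfold PlaneMap.faceDegree PlaneMap.SameFace at this
  rw [Equiv.Perm.ncard_sameCycle] at this
  exact Function.iterate_minimalPeriod_eq this

/-- A 2-group with interior vertices has a chart. -/
theorem bigonChart_of {k l : G.Dart} (h : G.IsTwoGroup k) (hl : G.next k = l)
    (ik : G.IsInteriorVertex k) (il : G.IsInteriorVertex l) :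
    BigonChart G k l (G.rot k) (G.rot (G.rot k)) (G.rot l) (G.rot (G.rot l)) := by
  have hlk : G.next l = k := by rw [← hl]; exact h.next_next
  have hl' : G.rot (G.rev k) = l := hl
  have hlk' : G.rot (G.rev l) = k := hlk
  have hk : G.rot (G.rot (G.rot l)) = G.rev k := by
    apply G.rot.injective; rw [il.rot_four, hl']
  have hl'' : G.rot (G.rot (G.rot k)) = G.rev l := by
    apply G.rot.injective; rw [ik.rot_four, hlk']
  have hne : ¬ G.SameVertex k l := by rw [← hl]; exact h.2.2
  have nx := nodup_four rfl rfl hl'' hlk' ik.rot_two_ne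
  have ny := nodup_four rfl rfl hk hl' il.rot_two_ne
  have mem : ∀ a b x : G.Dart, G.rot (G.rot (G.rot a)) = b → 
      x ∈ [a, G.rot a, G.rot (G.rot a), b] → G.SameVertex a x := by
    rintro a b x rfl hx
    simp only [List.mem_cons, List.not_mem_nil, or_false] at hx
    rcases hx with rfl | rfl | rfl | rfl <;>
      simp [PlaneMap.SameVertex, Equiv.Perm.SameCycle.refl]
  refine ⟨hl', hlk', rfl, rfl, hl'', rfl, rfl, hk, (perm_eight ..).nodup_iff.1 ?_, ?_⟩
  · rw [List.nodup_append]
    refine ⟨nx, ny, ?_⟩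
    rintro x hx y hy rfl
    exact hne ((mem _ _ _ hl'' hx).trans (mem _ _ _ hk hy).symm)
  · intro x hx
    rw [(perm_eight ..).symm.mem_iff, List.mem_append] at hx
    rcases hx with hx | hx
    · exact ik x (mem _ _ _ hl'' hx)
    · exact il x (mem _ _ _ hk hx)

/-- The new clockwise successors in a `t` operation. -/
def turnList (G : MinimalLoop) (k l a b c d : G.Dart) : List (G.Dart × G.Dart) :=
  [(k, d), (d, a), (a, G.rev l), (l, b), (b, c), (c, G.rev k)]

namespace BigonChart

variable {k l a b c d : G.Dart} (T : BigonChart G k l a b c d)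

theorem turn_nodup (T : BigonChart G k l a b c d) :
    ((G.turnList k l a b c d).map Prod.fst).Nodup :=
  (List.nodup_append.1 (show ([k, d, a, l, b, c] ++ [G.rev k, G.rev l]).Nodup from T.nodup)).1

theorem turn_surjective (T : BigonChart G k l a b c d) :
    Function.Surjective (redirect G.rot (G.turnList k l a b c d)) := by
  refine redirect_surjective T.turn_nodup ?_
  have := T.k_a; have := T.a_b; have := T.b_l; have := T.l_c; have := T.c_d; have := T.d_k
  intro x hx
  simp only [turnList, List.map_cons, List.map_nil, List.mem_cons, List.not_mem_nil,
    or_false] at hx ⊢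
  rcases hx with rfl | rfl | rfl | rfl | rfl | rfl <;> simp [*]

/-- The rotation after the `t` operation. -/
noncomputable def turnRot : Equiv.Perm G.Dart :=
  redirectPerm G.rot (G.turnList k l a b c d) T.turn_surjective

theorem turn_mem {x y : G.Dart} (hxy : (x, y) ∈ G.turnList k l a b c d) : T.turnRot x = y :=
  redirect_of_mem T.turn_nodup hxy

theorem turn_notMem' {x : G.Dart} (hx : x ∉ [k, d, a, l, b, c]) : T.turnRot x = G.rot x :=
  redirect_of_notMem (L := G.turnList k l a b c d) hx

theorem turn_notMem {x : G.Dart} (hx : x ∉ T.local_) : T.turnRot x = G.rot x :=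
  T.turn_notMem' (fun h => hx (by simp only [local_, List.mem_cons] at h ⊢; tauto))

theorem turn_k : T.turnRot k = d := T.turn_mem (by simp [turnList])
theorem turn_d : T.turnRot d = a := T.turn_mem (by simp [turnList])
theorem turn_a : T.turnRot a = G.rev l := T.turn_mem (by simp [turnList])
theorem turn_l : T.turnRot l = b := T.turn_mem (by simp [turnList])
theorem turn_b : T.turnRot b = c := T.turn_mem (by simp [turnList])
theorem turn_c : T.turnRot c = G.rev k := T.turn_mem (by simp [turnList])

theorem rev_notMem (T : BigonChart G k l a b c d) :
    G.rev k ∉ [k, d, a, l, b, c] ∧ G.rev l ∉ [k, d, a, l, b, c] := by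
  have := (List.nodup_append.1
    (show ([k, d, a, l, b, c] ++ [G.rev k, G.rev l]).Nodup from T.nodup)).2.2
  exact ⟨fun h => this _ h _ (by simp) rfl, fun h => this _ h _ (by simp) rfl⟩

theorem turn_rev_k : T.turnRot (G.rev k) = l := by rw [T.turn_notMem' T.rev_notMem.1, T.k_l]
theorem turn_rev_l : T.turnRot (G.rev l) = k := by rw [T.turn_notMem' T.rev_notMem.2, T.l_k]

theorem turn_local {x : G.Dart} (hx : x ∈ T.local_) : T.turnRot x ∈ T.local_ := by
  have := T.turn_k; have := T.turn_d; have := T.turn_a; have := T.turn_l; have := T.turn_b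
  have := T.turn_c; have := T.turn_rev_k; have := T.turn_rev_l
  simp only [local_, List.mem_cons, List.not_mem_nil, or_false] at hx ⊢
  rcases hx with rfl | rfl | rfl | rfl | rfl | rfl | rfl | rfl <;> simp [*]

theorem local_of_turn {x : G.Dart} (hx : T.turnRot x ∈ T.local_) : x ∈ T.local_ :=
  T.turnRot.mem_of_closed (X := {x | x ∈ T.local_}) (fun _ h => T.turn_local h) hx

theorem turn_two_ne : T.turnRot (T.turnRot k) ≠ k ∧ T.turnRot (T.turnRot l) ≠ l := by
  rw [T.turn_k, T.turn_d, T.turn_l, T.turn_b]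
  exact ⟨(T.legs_ne a (by simp)).1, (T.legs_ne c (by simp)).2.1⟩

theorem vertexSum_local (z : G.Dart → ZMod 2) (hk : vertexSum G.rot z k = 0)
    (hl : vertexSum G.rot z l = 0) {x : G.Dart} (hx : x ∈ T.local_) :
    vertexSum G.rot z x = 0 := by
  simp only [local_, List.mem_cons, List.not_mem_nil, or_false] at hx
  rcases hx with rfl | rfl | rfl | rfl | rfl | rfl | rfl | rfl
  · exact hk
  · rwa [← T.c_d, vertexSum_rot, ← T.l_c, vertexSum_rot]
  · rwa [← T.k_a, vertexSum_rot]
  · exact hl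
  · rwa [← T.a_b, vertexSum_rot, ← T.k_a, vertexSum_rot]
  · rwa [← T.l_c, vertexSum_rot]
  · rwa [← vertexSum_rot, T.k_l]
  · rwa [← vertexSum_rot, T.l_k]

/-- The pattern is that of `flip_homology`. A cycle of the turned map is changed on the two sides of
the 2-group only; adding both sides does not affect the cycle condition, so the value on `l` may be
taken to be 0, and the value on `k` is then forced. -/
theorem turn_homology (z : G.Dart → ZMod 2) (hz : ∀ x, z (G.rev x) = z x)
    (hs : ∀ x, vertexSum T.turnRot z x = 0) :
    ∃ w : G.Dart → ZMod 2, (∀ x, w (T.turnRot (G.rev x)) = w x) ∧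
      ∀ x, w x + w (G.rev x) = z x := by
  classical
  obtain ⟨n1, n2, n3, n4, n5⟩ := T.sides_ne
  have hL := T.legs_ne
  have sx : z l + z k + z d + z a = 0 := by
    have := hs k
    rw [vertexSum_four _ _ T.turn_two_ne.1, T.turn_k, T.turn_d, T.turn_a, hz] at this
    · rw [← this]; ring
    · rw [T.turn_k, T.turn_d, T.turn_a, T.turn_rev_l]
  have sy : z k + z l + z b + z c = 0 := by
    have := hs l
    rw [vertexSum_four _ _ T.turn_two_ne.2, T.turn_l, T.turn_b, T.turn_c, hz] at this
    · rw [← this]; ring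
    · rw [T.turn_l, T.turn_b, T.turn_c, T.turn_rev_k]
  let z₀ : G.Dart → ZMod 2 := fun x =>
    if x = k ∨ x = G.rev k then z a + z b else if x = l ∨ x = G.rev l then 0 else z x
  have hz0 : ∀ x, z₀ (G.rev x) = z₀ x := by
    intro x
    simp only [z₀, rev_eq_iff, G.rev_rev, hz, or_comm]
  have zleg : ∀ x, x ≠ k ∧ x ≠ l ∧ x ≠ G.rev k ∧ x ≠ G.rev l → z₀ x = z x := by
    intro x hx
    simp [z₀, hx]
  have zk : z₀ k = z a + z b := by simp [z₀]
  have zl : z₀ l = 0 := by simp [z₀, n1.symm, n4]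
  have hs0 : ∀ x, vertexSum G.rot z₀ x = 0 := by
    intro x
    by_cases hx : x ∈ T.local_
    · refine T.vertexSum_local _ ?_ ?_ hx
      · rw [vertexSum_four _ T.isInteriorVertex.1.rot_four T.rot_two_ne.1, T.k_a, T.a_b, T.b_l,
          hz0, zk, zl, zleg _ (hL a (by simp)), zleg _ (hL b (by simp))]
        clear * -; grind
      · rw [vertexSum_four _ T.isInteriorVertex.2.rot_four T.rot_two_ne.2, T.l_c, T.c_d, T.d_k,
          hz0, zk, zl, zleg _ (hL c (by simp)), zleg _ (hL d (by simp))]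
        clear * - sx sy; grind
    · rw [← hs x]
      have h1 : ∀ y, T.turnRot.SameCycle x y → y ∉ T.local_ := fun y hy =>
        hy.induct (P := fun y => y ∉ T.local_) hx (fun u hu hu' => hu (T.local_of_turn hu'))
      have h2 := vertexSum_comp (rot := G.rot) (rot' := T.turnRot) Function.injective_id z₀ x
        (fun y hy => T.turn_notMem (h1 y hy))
      simp only [id] at h2
      rw [← h2]
      refine vertexSum_congr _ fun y hy => zleg y ?_
      have := h1 y hy
      simp only [local_, List.mem_cons, not_or] at this
      tauto
  obtain ⟨w, hw, hw'⟩ := G.exists_potential z₀ hz0 hs0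
  have wk := hw (G.rev k); have wl := hw (G.rev l)
  have wka := hw k; have wa := hw a; have wb := hw b; have wlc := hw l; have wc := hw c
  have wd := hw d
  rw [G.rev_rev] at wk wl
  rw [T.k_l] at wk; rw [T.l_k] at wl; rw [T.k_a] at wka; rw [T.a_b] at wa; rw [T.b_l] at wb
  rw [T.l_c] at wlc; rw [T.c_d] at wc; rw [T.d_k] at wd
  have va := hw' a; have vb := hw' b; have vc := hw' c; have vd := hw' d
  rw [zleg _ (hL a (by simp))] at va; rw [zleg _ (hL b (by simp))] at vb
  rw [zleg _ (hL c (by simp))] at vc; rw [zleg _ (hL d (by simp))] at vd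
  -- After the turn `rev k` lies on the face of `d` and `rev l` on the face of `b`. The 2-group, on
  -- the left of `k` and `l`, lies across `k` from the face of `d`.
  let w₀ : G.Dart → ZMod 2 := fun x =>
    if x = k ∨ x = l then w d + z k else if x = G.rev k then w d else
    if x = G.rev l then w b else w x
  have w0k : w₀ k = w d + z k := by simp [w₀]
  have w0l : w₀ l = w d + z k := by simp [w₀]
  have w0k' : w₀ (G.rev k) = w d := by simp [w₀, n2.symm, n4.symm]
  have w0l' : w₀ (G.rev l) = w b := by simp [w₀, n3.symm, n5.symm, n1.symm]
  have w0 : ∀ x, x ≠ k ∧ x ≠ l ∧ x ≠ G.rev k ∧ x ≠ G.rev l → w₀ x = w x := by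
    intro x hx
    simp [w₀, hx]
  have w0' : ∀ x, x ≠ k ∧ x ≠ l ∧ x ≠ G.rev k ∧ x ≠ G.rev l → w₀ (G.rev x) = w (G.rev x) := by
    intro x hx
    refine w0 _ ?_
    simp only [Ne, rev_eq_iff, G.rev_rev] at hx ⊢
    tauto
  refine ⟨w₀, fun x => ?_, fun x => ?_⟩
  · suffices H : ∀ u, w₀ (T.turnRot u) = w₀ (G.rev u) by simpa [G.rev_rev] using H (G.rev x)
    intro u
    by_cases hu : u ∈ T.local_
    · simp only [local_, List.mem_cons, List.not_mem_nil, or_false] at hu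
      have wla := w0 _ (hL a (by simp)); have wlb := w0 _ (hL b (by simp))
      have wlc' := w0 _ (hL c (by simp)); have wld := w0 _ (hL d (by simp))
      have wla' := w0' _ (hL a (by simp)); have wlb' := w0' _ (hL b (by simp))
      have wlc'' := w0' _ (hL c (by simp)); have wld' := w0' _ (hL d (by simp))
      rcases hu with rfl | rfl | rfl | rfl | rfl | rfl | rfl | rfl
      · rw [T.turn_k, w0k', wld]
      · rw [T.turn_d, wla, wld', wka, wd]
      · rw [T.turn_a, w0l', wla', wa]
      · rw [T.turn_l, w0l', wlb]
      · rw [T.turn_b, wlc', wlb', wlc, wb]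
      · rw [T.turn_c, w0k', wlc'', wc]
      · rw [T.turn_rev_k, G.rev_rev, w0k, w0l]
      · rw [T.turn_rev_l, G.rev_rev, w0k, w0l]
    · have hu' := fun h => hu (T.local_of_rot h)
      rw [T.turn_notMem hu]
      simp only [local_, List.mem_cons, not_or] at hu hu'
      rw [w0' u (by tauto), w0 _ (by tauto), hw]
  · have k1 : w₀ k + w₀ (G.rev k) = z k := by
      rw [w0k, w0k']; clear * -; grind
    have k2 : w₀ l + w₀ (G.rev l) = z l := by
      rw [w0l, w0l']; rw [← wa] at va; rw [← wd, ← wka] at vd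
      clear * - va vd sx; grind
    by_cases h1 : x = k
    · subst h1; exact k1
    by_cases h2 : x = l
    · subst h2; exact k2
    by_cases h3 : x = G.rev k
    · subst h3; rw [G.rev_rev, hz, add_comm]; exact k1
    by_cases h4 : x = G.rev l
    · subst h4; rw [G.rev_rev, hz, add_comm]; exact k2
    rw [w0 x ⟨h1, h2, h3, h4⟩, w0' x ⟨h1, h2, h3, h4⟩, hw', zleg x ⟨h1, h2, h3, h4⟩]

theorem turn_closed {X : Set G.Dart} (h1 : ∀ x ∈ X, T.turnRot x ∈ X)
    (h2 : ∀ x ∈ X, G.rev x ∈ X) {x : G.Dart} (hx : x ∈ T.local_) (hX : x ∈ X) :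
    ∀ y ∈ T.local_, y ∈ X := by
  have c1 := h1 k; have c2 := h1 d; have c3 := h1 a; have c4 := h1 (G.rev l)
  have c5 := h1 l; have c6 := h1 b; have c7 := h1 c; have c8 := h1 (G.rev k)
  rw [T.turn_k] at c1; rw [T.turn_d] at c2; rw [T.turn_a] at c3; rw [T.turn_rev_l] at c4
  rw [T.turn_l] at c5; rw [T.turn_b] at c6; rw [T.turn_c] at c7; rw [T.turn_rev_k] at c8
  have c9 : G.rev l ∈ X → l ∈ X := fun h => by simpa [G.rev_rev] using h2 _ h
  have c10 : G.rev k ∈ X → k ∈ X := fun h => by simpa [G.rev_rev] using h2 _ h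
  have hk : k ∈ X := by
    simp only [local_, List.mem_cons, List.not_mem_nil, or_false] at hx
    rcases hx with rfl | rfl | rfl | rfl | rfl | rfl | rfl | rfl
    exacts [hX, c4 (c3 (c2 hX)), c4 (c3 hX), c4 (h2 _ hX), c10 (c7 (c6 hX)), c10 (c7 hX), c10 hX,
      c4 hX]
  have hl : l ∈ X := c8 (h2 _ hk)
  intro y hy
  simp only [local_, List.mem_cons, List.not_mem_nil, or_false] at hy
  rcases hy with rfl | rfl | rfl | rfl | rfl | rfl | rfl | rfl
  exacts [hk, c1 hk, c2 (c1 hk), hl, c5 hl, c6 (c5 hl), h2 _ hk, h2 _ hl]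

theorem turn_loopData : LoopData T.turnRot G.rev G.base {x | G.IsOuter x} where
  rev_rev := G.rev_rev
  rev_ne := G.rev_ne
  conn := by
    intro X hb h1 h2 x
    have : X = Set.univ := by
      refine G.eq_univ X ⟨_, hb⟩ (fun x hx => ?_) h2
      by_cases hl : x ∈ T.local_
      · exact T.turn_closed h1 h2 hl hx _ (T.rot_local hl)
      · rw [← T.turn_notMem hl]; exact h1 x hx
    rw [this]; trivial
  homology := T.turn_homology
  out_iff := by
    intro x
    refine (sameCycle_of_agree (σ := G.next) (S := {x | G.IsOuter x}) (fun x h => h) ?_ x).symm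
    intro x hx
    show T.turnRot (G.rev x) = G.rot (G.rev x)
    refine T.turn_notMem fun hl => ?_
    refine T.not_outer _ (T.rot_local hl) ?_
    rw [isOuter_rot, G.rev_rev]; exact hx
  out_rot := by
    intro x hx
    rw [T.turn_notMem fun hl => T.not_outer _ hl hx]
    exact hx.rot
  out_rev := fun x hx => IsOuter.rev hx
  deg_base := by
    rw [T.turn_notMem fun hl => T.not_outer _ hl isOuter_base, T.turn_notMem fun hl =>
      T.not_outer _ (T.local_of_rot hl) isOuter_base, rot_base]
  deg_out := by
    intro x hx hb
    have h0 : x ∉ T.local_ := fun hl => T.not_outer _ hl hx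
    have h1 : G.rot x ∉ T.local_ := fun hl => h0 (T.local_of_rot hl)
    have h2 : G.rot (G.rot x) ∉ T.local_ := fun hl => h1 (T.local_of_rot hl)
    rw [T.turn_notMem h0, T.turn_notMem h1, T.turn_notMem h2]
    exact ⟨IsOuter.rot_three hx hb, IsOuter.rot_rot hx hb⟩
  deg_in := by
    intro x d0 d1 d2 d3
    by_cases hl : x ∈ T.local_
    · have e1 := T.turn_k; have e2 := T.turn_d; have e3 := T.turn_a; have e4 := T.turn_rev_l
      have e5 := T.turn_l; have e6 := T.turn_b; have e7 := T.turn_c; have e8 := T.turn_rev_k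
      obtain ⟨t1, t2⟩ := T.turn_two_ne
      simp only [local_, List.mem_cons, List.not_mem_nil, or_false] at hl
      have t : T.turnRot (T.turnRot (T.turnRot (T.turnRot x))) = x := by
        rcases hl with rfl | rfl | rfl | rfl | rfl | rfl | rfl | rfl <;> simp only [*]
      refine ⟨t, fun m0 => ?_⟩
      have m1 := congrArg T.turnRot m0
      have m2 := congrArg T.turnRot m1
      rcases hl with rfl | rfl | rfl | rfl | rfl | rfl | rfl | rfl <;>
        simp only [e1, e2, e3, e4, e5, e6, e7, e8] at m0 m1 m2 t1 t2 <;>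
        grind
    · have hl1 : G.rot x ∉ T.local_ := fun h => hl (T.local_of_rot h)
      have hl2 : G.rot (G.rot x) ∉ T.local_ := fun h => hl1 (T.local_of_rot h)
      have hl3 : G.rot (G.rot (G.rot x)) ∉ T.local_ := fun h => hl2 (T.local_of_rot h)
      simp only [T.turn_notMem hl, T.turn_notMem hl1, T.turn_notMem hl2, T.turn_notMem hl3]
        at d0 d1 d2 d3 ⊢
      have := isInteriorVertex_of d0 d1 d2
      exact ⟨this.rot_four, this.rot_two_ne⟩

/-- The result of the `t` operation. -/
noncomputable def turn : MinimalLoop := T.turn_loopData.toMinimalLoop G.finite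

theorem turn_turn : G.Turn T.turn := by
  refine ⟨k, T.isTwoGroup, ?_⟩
  have h1 : G.next k = l := T.k_l
  simp only [h1, T.k_a, T.a_b, T.l_c, T.c_d]
  exact ⟨T.isInteriorVertex.1, T.isInteriorVertex.2, id, Function.injective_id,
    by rw [Set.compl_empty]; exact Set.range_id, fun d => rfl, fun d => rfl, rfl⟩

theorem turn_isOuter {x : G.Dart} : T.turn.IsOuter x ↔ G.IsOuter x :=
  (T.turn_loopData.out_iff x).symm

/-- After the `t` operation the legs of the 2-group are shifted by one step. -/
theorem turn_chart : BigonChart T.turn k l d a b c where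
  k_l := T.turn_rev_k
  l_k := T.turn_rev_l
  k_a := T.turn_k
  a_b := T.turn_d
  b_l := T.turn_a
  l_c := T.turn_l
  c_d := T.turn_b
  d_k := T.turn_c
  nodup := by
    have := T.nodup
    show [k, c, d, l, a, b, G.rev k, G.rev l].Nodup
    refine (List.Perm.nodup_iff ?_).1 this
    have := List.Perm.map (![k, d, a, l, b, c, G.rev k, G.rev l] : Fin 8 → G.Dart)
      (show List.Perm [0, 1, 2, 3, 4, 5, 6, 7] [0, 5, 1, 3, 2, 4, 6, 7] by decide)
    exact this
  not_outer := by
    have key : ∀ x : G.Dart, x ∈ [k, c, d, l, a, b, G.rev k, G.rev l] →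
        x ∈ [k, d, a, l, b, c, G.rev k, G.rev l] := by
      intro x hx
      simp only [List.mem_cons] at hx ⊢
      tauto
    intro x hx hx'
    exact T.not_outer x (key x hx) (T.turn_isOuter.1 hx')

end BigonChart
end MinimalLoop

/-! ### Deleting darts from a minimal loop -/

/-- A permutation of the complement of a set given by a function. -/
noncomputable def restrictPerm {D : Type} [Finite D] (F : D → D) (S : Set D)
    (h1 : ∀ x, x ∉ S → F x ∉ S) (h2 : ∀ y, y ∉ S → ∃ x, x ∉ S ∧ F x = y) :
    Equiv.Perm {x // x ∉ S} :=
  Equiv.ofBijective (fun x => ⟨F x, h1 x x.2⟩) (Finite.surjective_iff_bijective.1 fun y => by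
    obtain ⟨x, hx, hxy⟩ := h2 y y.2
    exact ⟨⟨x, hx⟩, Subtype.ext hxy⟩)

namespace MinimalLoop

/-- The sums of `z` over the cycles of `F` of lengths 2, 3 and 4 vanish. -/
structure SmallSums {D : Type} (F : D → D) (z : D → ZMod 2) (d : D) : Prop where
  two : F (F d) = d → F d ≠ d → z d + z (F d) = 0
  three : F (F (F d)) = d → F d ≠ d → z d + z (F d) + z (F (F d)) = 0
  four : F (F (F (F d))) = d → F (F d) ≠ d → z d + z (F d) + z (F (F d)) + z (F (F (F d))) = 0

/-- All vertices of a minimal loop have degree 2, 3 or 4, so the three cases of `SmallSums` suffice.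
Unlike `vertexSum` they make sense for a function that is a permutation of the kept darts only. -/
theorem vertexSum_of_smallSums {G : MinimalLoop} {z : G.Dart → ZMod 2} {d : G.Dart}
    (h : ∀ e, G.SameVertex d e → SmallSums G.rot z e) : vertexSum G.rot z d = 0 := by
  by_cases hd : G.IsInteriorVertex d
  · rw [vertexSum_four _ hd.rot_four hd.rot_two_ne]
    exact (h d Equiv.Perm.SameCycle.rfl).four hd.rot_four hd.rot_two_ne
  · unfold IsInteriorVertex at hd
    push Not at hd
    obtain ⟨e, he, heo⟩ := hd
    have hde : vertexSum G.rot z e = vertexSum G.rot z d := by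
      refine Equiv.Perm.SameCycle.induct he
        (P := fun e => vertexSum G.rot z e = vertexSum G.rot z d) rfl ?_
      intro x hx; rw [vertexSum_rot, hx]
    rw [← hde]
    by_cases hb : e = G.base
    · subst hb
      rw [vertexSum_two _ rot_base heo.rot_ne]
      exact (h _ he).two rot_base heo.rot_ne
    · rw [vertexSum_three _ (heo.rot_three hb) heo.rot_ne]
      exact (h _ he).three (heo.rot_three hb) heo.rot_ne

/-- Conditions under which deleting the darts in `S` and replacing the rotation by `F` yields a
minimal loop with base dart `b`. -/
structure CutData (G : MinimalLoop) (S : Set G.Dart) (F : G.Dart → G.Dart) (b : G.Dart) :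
    Prop where
  rev_mem : ∀ d ∈ S, G.rev d ∈ S
  map : ∀ d, d ∉ S → F d ∉ S
  surj : ∀ y, y ∉ S → ∃ x, x ∉ S ∧ F x = y
  base : b ∉ S
  conn : ∀ X : Set G.Dart, b ∈ X → (∀ d ∈ X, d ∉ S → F d ∈ X) →
    (∀ d ∈ X, d ∉ S → G.rev d ∈ X) → ∀ d, d ∉ S → d ∈ X
  homology : ∀ z : G.Dart → ZMod 2, (∀ d, z (G.rev d) = z d) → (∀ d, d ∉ S → SmallSums F z d) →
    ∃ w : G.Dart → ZMod 2, (∀ d, d ∉ S → w (F d) = w (G.rev d)) ∧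
      ∀ d, d ∉ S → w d + w (G.rev d) = z d
  outer_base : G.IsOuter b
  outer_next : ∀ d, d ∉ S → G.IsOuter d → G.IsOuter (F (G.rev d))
  -- Together with `outer_next` this makes the kept outer darts a single face of the new map.
  outer_conn : ∀ X : Set G.Dart, b ∈ X → (∀ d ∈ X, d ∉ S → F (G.rev d) ∈ X) →
    ∀ d, d ∉ S → G.IsOuter d → d ∈ X
  outer_rot : ∀ d, d ∉ S → G.IsOuter d → ¬ G.IsOuter (F d)
  deg_base : F (F b) = b
  deg_out : ∀ d, d ∉ S → G.IsOuter d → d ≠ b → F (F (F d)) = d ∧ ¬ G.IsOuter (F (F d))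
  deg_in : ∀ d, d ∉ S → ¬ G.IsOuter d → ¬ G.IsOuter (F d) → ¬ G.IsOuter (F (F d)) →
    ¬ G.IsOuter (F (F (F d))) → F (F (F (F d))) = d ∧ F (F d) ≠ d

namespace CutData

variable {G : MinimalLoop} {S : Set G.Dart} {F : G.Dart → G.Dart} {b : G.Dart}
  (C : CutData G S F b)

theorem rev_notMem {d : G.Dart} (C : CutData G S F b) (hd : d ∉ S) : G.rev d ∉ S :=
  fun h => hd (by simpa [G.rev_rev] using C.rev_mem _ h)

/-- The rotation of the new minimal loop. -/
noncomputable def rot : Equiv.Perm {x // x ∉ S} := restrictPerm F S C.map C.surj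

/-- The reversal of the new minimal loop. -/
noncomputable def rev : Equiv.Perm {x // x ∉ S} :=
  restrictPerm G.rev S (fun _ h => C.rev_notMem h)
    (fun y h => ⟨G.rev y, C.rev_notMem h, G.rev_rev y⟩)

theorem coe_rot (d : {x // x ∉ S}) : (C.rot d : G.Dart) = F d := rfl

theorem loopData : LoopData C.rot C.rev ⟨b, C.base⟩ {x | G.IsOuter x.1} where
  rev_rev := fun d => Subtype.ext (G.rev_rev d)
  rev_ne := fun d h => G.rev_ne d (congrArg Subtype.val h)
  conn := by
    intro X hb h1 h2 d
    have := C.conn {x | ∃ h : x ∉ S, (⟨x, h⟩ : {x // x ∉ S}) ∈ X} ⟨C.base, hb⟩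
      (fun d hd hS => ⟨C.map d hS, h1 _ hd.2⟩) (fun d hd hS => ⟨C.rev_notMem hS, h2 _ hd.2⟩) d d.2
    exact this.2
  homology := by
    classical
    intro z hz hs
    let z' : G.Dart → ZMod 2 := fun d => if h : d ∉ S then z ⟨d, h⟩ else 0
    have hz' : ∀ d : {x // x ∉ S}, z' d = z d := by
      intro d; simp only [z', d.2, not_false_eq_true, dif_pos, Subtype.coe_eta]
    have h1 : ∀ d, z' (G.rev d) = z' d := by
      intro d
      by_cases h : d ∈ S
      · have := C.rev_mem d h
        simp [z', h, this]
      · have h' := C.rev_notMem h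
        rw [hz' ⟨d, h⟩, hz' ⟨_, h'⟩, ← hz ⟨d, h⟩]
        rfl
    have h2 : ∀ d, d ∉ S → SmallSums F z' d := by
      intro d hd
      have h0 := hs ⟨d, hd⟩
      refine ⟨fun h h1 => ?_, fun h h1 => ?_, fun h h1 => ?_⟩
      · rw [vertexSum_two _ (Subtype.ext h) (fun h' => h1 (congrArg Subtype.val h'))] at h0
        simpa only [← hz', coe_rot] using h0
      · rw [vertexSum_three _ (Subtype.ext h) (fun h' => h1 (congrArg Subtype.val h'))] at h0
        simpa only [← hz', coe_rot] using h0
      · rw [vertexSum_four _ (Subtype.ext h) (fun h' => h1 (congrArg Subtype.val h'))] at h0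
        simpa only [← hz', coe_rot] using h0
    obtain ⟨w, hw, hw'⟩ := C.homology z' h1 h2
    refine ⟨fun d => w d, fun d => ?_, fun d => ?_⟩
    · show w (F (G.rev d)) = w d
      rw [hw _ (C.rev_notMem d.2), G.rev_rev]
    · show w d + w (G.rev d) = z d
      rw [hw' _ d.2, hz']
  out_iff := by
    intro d
    constructor
    · intro hd
      have := C.outer_conn {x | ∃ h : x ∉ S, (C.rot * C.rev).SameCycle ⟨b, C.base⟩ ⟨x, h⟩}
        ⟨C.base, Equiv.Perm.SameCycle.rfl⟩ ?_ d d.2 hd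
      · exact this.2
      · rintro x ⟨h, hx⟩ -
        refine ⟨C.map _ (C.rev_notMem h), ?_⟩
        have : (⟨F (G.rev x), C.map _ (C.rev_notMem h)⟩ : {x // x ∉ S})
          = (C.rot * C.rev) ⟨x, h⟩ := rfl
        rw [this]; exact Equiv.Perm.sameCycle_apply_right.2 hx
    · intro hd
      refine hd.induct (P := fun d => G.IsOuter d.1) C.outer_base ?_
      intro x hx
      exact C.outer_next x x.2 hx
  out_rot := fun d hd => C.outer_rot d d.2 hd
  out_rev := fun d hd => IsOuter.rev hd
  deg_base := Subtype.ext C.deg_base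
  deg_out := by
    intro d hd hb
    have := C.deg_out d d.2 hd (fun h => hb (Subtype.ext h))
    exact ⟨Subtype.ext this.1, this.2⟩
  deg_in := by
    intro d d0 d1 d2 d3
    have := C.deg_in d d.2 d0 d1 d2 d3
    exact ⟨Subtype.ext this.1, fun h => this.2 (congrArg Subtype.val h)⟩

/-- The minimal loop obtained by the deletion. -/
noncomputable def loop : MinimalLoop := C.loopData.toMinimalLoop inferInstance

theorem isSurgery : IsSurgery G C.loop S F b :=
  ⟨Subtype.val, Subtype.val_injective, Subtype.range_val, fun _ => rfl, fun _ => rfl, rfl⟩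

end CutData

variable {G : MinimalLoop}

/-- Local verification of the degree conditions away from a set of modified vertices. -/
theorem deg_of_notMem {F : G.Dart → G.Dart} {L : Set G.Dart}
    (hL : ∀ d ∈ L, G.rot d ∈ L) (hF : ∀ d, d ∉ L → F d = G.rot d) {d : G.Dart} (hd : d ∉ L) :
    F d = G.rot d ∧ F (F d) = G.rot (G.rot d) ∧ F (F (F d)) = G.rot (G.rot (G.rot d)) ∧
      F (F (F (F d))) = G.rot (G.rot (G.rot (G.rot d))) := by
  have h1 : G.rot d ∉ L := fun h => hd (G.rot.mem_of_closed hL h)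
  have h2 : G.rot (G.rot d) ∉ L := fun h => h1 (G.rot.mem_of_closed hL h)
  have h3 : G.rot (G.rot (G.rot d)) ∉ L := fun h => h2 (G.rot.mem_of_closed hL h)
  rw [hF d hd, hF _ h1, hF _ h2, hF _ h3]
  exact ⟨rfl, rfl, rfl, rfl⟩

theorem notMem_of_sameVertex {L : Set G.Dart} (hL : ∀ d ∈ L, G.rot d ∈ L) {d e : G.Dart}
    (hd : d ∉ L) (hde : G.SameVertex d e) : e ∉ L :=
  Equiv.Perm.SameCycle.induct hde (P := fun e => e ∉ L) hd
    (fun _ hz hz' => hz (G.rot.mem_of_closed hL hz'))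

/-! ### Collapsing a 2-group to a vertex -/

namespace BigonChart

variable {k l a b c d : G.Dart} (T : BigonChart G k l a b c d)

/-- The darts deleted when the 2-group is collapsed to a vertex. -/
def sides (_ : BigonChart G k l a b c d) : Set G.Dart := {k, G.rev k, l, G.rev l}

/-- The clockwise successors after the 2-group has been collapsed to a vertex. -/
noncomputable def collapseFun (_ : BigonChart G k l a b c d) : G.Dart → G.Dart :=
  redirect G.rot [(b, c), (d, a)]

theorem legs_distinct (T : BigonChart G k l a b c d) :
    a ≠ b ∧ a ≠ c ∧ a ≠ d ∧ b ≠ c ∧ b ≠ d ∧ c ≠ d := by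
  have N := T.nodup
  simp only [List.nodup_cons, List.mem_cons, List.not_mem_nil, not_or, or_false] at N
  grind

theorem collapse_b : T.collapseFun b = c :=
  redirect_of_mem (by simp [T.legs_distinct.2.2.2.2.1]) (by simp)

theorem collapse_d : T.collapseFun d = a :=
  redirect_of_mem (by simp [T.legs_distinct.2.2.2.2.1]) (by simp)

theorem collapse_ne {x : G.Dart} (hb : x ≠ b) (hd : x ≠ d) : T.collapseFun x = G.rot x :=
  redirect_of_notMem (by simp [hb, hd])

theorem collapse_a : T.collapseFun a = b := by
  rw [T.collapse_ne T.legs_distinct.1 T.legs_distinct.2.2.1, T.a_b]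

theorem collapse_c : T.collapseFun c = d := by
  rw [T.collapse_ne T.legs_distinct.2.2.2.1.symm T.legs_distinct.2.2.2.2.2, T.c_d]

theorem collapse_notMem {x : G.Dart} (hx : x ∉ T.local_) : T.collapseFun x = G.rot x := by
  simp only [local_, List.mem_cons, not_or] at hx
  exact T.collapse_ne (by tauto) (by tauto)

theorem leg_notMem (T : BigonChart G k l a b c d) : a ∉ T.sides ∧ b ∉ T.sides ∧ c ∉ T.sides ∧
    d ∉ T.sides := by
  have := T.legs_ne
  simp only [sides, Set.mem_insert_iff, Set.mem_singleton_iff]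
  grind

theorem local_cases {x : G.Dart} (hx : x ∈ T.local_) (hS : x ∉ T.sides) :
    x = a ∨ x = b ∨ x = c ∨ x = d := by
  simp only [local_, sides, List.mem_cons, List.not_mem_nil, or_false, Set.mem_insert_iff,
    Set.mem_singleton_iff] at hx hS
  tauto

theorem sides_subset {x : G.Dart} (hx : x ∈ T.sides) : x ∈ T.local_ := by
  simp only [local_, sides, List.mem_cons, List.not_mem_nil, or_false, Set.mem_insert_iff,
    Set.mem_singleton_iff] at hx ⊢
  tauto

theorem rev_sides {x : G.Dart} : G.rev x ∈ T.sides ↔ x ∈ T.sides := by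
  simp only [sides, Set.mem_insert_iff, Set.mem_singleton_iff, rev_eq_iff, G.rev_rev]
  tauto

/-- A cycle of the collapsed map extends over the deleted sides, with value 0 on `l` and the value
on `k` forced by the vertex equations. Apart from the 2-group itself every face survives with some
sides omitted, so the potential obtained for `G` can be used without correction. -/
theorem collapse_homology (z : G.Dart → ZMod 2) (hz : ∀ x, z (G.rev x) = z x)
    (hs : ∀ x, x ∉ T.sides → SmallSums T.collapseFun z x) :
    ∃ w : G.Dart → ZMod 2, (∀ x, x ∉ T.sides → w (T.collapseFun x) = w (G.rev x)) ∧
      ∀ x, x ∉ T.sides → w x + w (G.rev x) = z x := by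
  classical
  obtain ⟨n1, n2, n3, n4, n5⟩ := T.sides_ne
  have hL := T.legs_ne
  obtain ⟨la, lb, lc, ld⟩ := T.leg_notMem
  have sx : z a + z b + z c + z d = 0 := by
    have := (hs a la).four
    rw [T.collapse_a, T.collapse_b, T.collapse_c, T.collapse_d] at this
    exact this rfl T.legs_distinct.2.1.symm
  let z₀ : G.Dart → ZMod 2 := fun x =>
    if x = k ∨ x = G.rev k then z a + z b else if x = l ∨ x = G.rev l then 0 else z x
  have hz0 : ∀ x, z₀ (G.rev x) = z₀ x := by
    intro x
    simp only [z₀, rev_eq_iff, G.rev_rev, hz, or_comm]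
  have zleg : ∀ x, x ∉ T.sides → z₀ x = z x := by
    intro x hx
    simp only [sides, Set.mem_insert_iff, Set.mem_singleton_iff, not_or] at hx
    simp [z₀, hx]
  have zk : z₀ k = z a + z b := by simp [z₀]
  have zl : z₀ l = 0 := by simp [z₀, n1.symm, n4]
  have hs0 : ∀ x, vertexSum G.rot z₀ x = 0 := by
    intro x
    by_cases hx : x ∈ T.local_
    · refine T.vertexSum_local _ ?_ ?_ hx
      · rw [vertexSum_four _ T.isInteriorVertex.1.rot_four T.rot_two_ne.1, T.k_a, T.a_b, T.b_l,
          hz0, zk, zl, zleg _ la, zleg _ lb]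
        clear * -; grind
      · rw [vertexSum_four _ T.isInteriorVertex.2.rot_four T.rot_two_ne.2, T.l_c, T.c_d, T.d_k,
          hz0, zk, zl, zleg _ lc, zleg _ ld]
        clear * - sx; grind
    · refine vertexSum_of_smallSums fun y hy => ?_
      have hy' : y ∉ T.local_ :=
        notMem_of_sameVertex (L := {x | x ∈ T.local_}) (fun _ h => T.rot_local h) hx hy
      have hyS := fun h => hy' (T.sides_subset h)
      obtain ⟨f1, f2, f3, f4⟩ := deg_of_notMem (L := {x | x ∈ T.local_}) (F := T.collapseFun)
        (fun _ h => T.rot_local h) (fun _ h => T.collapse_notMem h) hy'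
      have hy1 : G.rot y ∉ T.local_ := fun h => hy' (T.local_of_rot h)
      have hy2 : G.rot (G.rot y) ∉ T.local_ := fun h => hy1 (T.local_of_rot h)
      have hy3 : G.rot (G.rot (G.rot y)) ∉ T.local_ := fun h => hy2 (T.local_of_rot h)
      have := hs y hyS
      refine ⟨?_, ?_, ?_⟩
      · have := this.two
        rwa [f2, f1, ← zleg _ hyS, ← zleg _ (fun h => hy1 (T.sides_subset h))] at this
      · have := this.three
        rwa [f3, f2, f1, ← zleg _ hyS, ← zleg _ (fun h => hy1 (T.sides_subset h)),
          ← zleg _ (fun h => hy2 (T.sides_subset h))] at this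
      · have := this.four
        rwa [f4, f3, f2, f1, ← zleg _ hyS, ← zleg _ (fun h => hy1 (T.sides_subset h)),
          ← zleg _ (fun h => hy2 (T.sides_subset h)),
          ← zleg _ (fun h => hy3 (T.sides_subset h))] at this
  obtain ⟨w, hw, hw'⟩ := G.exists_potential z₀ hz0 hs0
  refine ⟨w, fun x hx => ?_, fun x hx => by rw [hw', zleg x hx]⟩
  by_cases hb : x = b
  · subst hb
    rw [T.collapse_b, ← hw x, T.b_l, ← hw l, T.l_c]
  by_cases hd : x = d
  · subst hd
    rw [T.collapse_d, ← hw x, T.d_k, ← hw k, T.k_a]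
  rw [T.collapse_ne hb hd, hw]

theorem collapse_cutData : CutData G T.sides T.collapseFun G.base where
  rev_mem := fun _ h => T.rev_sides.2 h
  map := by
    obtain ⟨la, lb, lc, ld⟩ := T.leg_notMem
    intro x hx
    by_cases hl : x ∈ T.local_
    · rcases T.local_cases hl hx with rfl | rfl | rfl | rfl
      · rwa [T.collapse_a]
      · rwa [T.collapse_b]
      · rwa [T.collapse_c]
      · rwa [T.collapse_d]
    · rw [T.collapse_notMem hl]
      exact fun h => hl (T.local_of_rot (T.sides_subset h))
  surj := by
    obtain ⟨la, lb, lc, ld⟩ := T.leg_notMem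
    intro y hy
    by_cases hl : y ∈ T.local_
    · rcases T.local_cases hl hy with rfl | rfl | rfl | rfl
      exacts [⟨d, ld, T.collapse_d⟩, ⟨a, la, T.collapse_a⟩, ⟨b, lb, T.collapse_b⟩,
        ⟨c, lc, T.collapse_c⟩]
    · have hl' : G.rot.symm y ∉ T.local_ := fun h => hl (by simpa using T.rot_local h)
      exact ⟨G.rot.symm y, fun h => hl' (T.sides_subset h), by rw [T.collapse_notMem hl']; simp⟩
  base := fun h => T.not_outer _ (T.sides_subset h) isOuter_base
  conn := by
    obtain ⟨la, lb, lc, ld⟩ := T.leg_notMem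
    intro X hb h1 h2 x hx
    have c1 := fun h => h1 a h la; have c2 := fun h => h1 b h lb
    have c3 := fun h => h1 c h lc; have c4 := fun h => h1 d h ld
    rw [T.collapse_a] at c1; rw [T.collapse_b] at c2; rw [T.collapse_c] at c3
    rw [T.collapse_d] at c4
    have hall : ∀ u ∈ T.local_, u ∉ T.sides → u ∈ X → a ∈ X := by
      intro u hu hu' huX
      rcases T.local_cases hu hu' with rfl | rfl | rfl | rfl
      exacts [huX, c4 (c3 (c2 huX)), c4 (c3 huX), c4 huX]
    have hall' : ∀ u ∈ T.local_, u ∉ T.sides → a ∈ X → u ∈ X := by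
      intro u hu hu' huX
      rcases T.local_cases hu hu' with rfl | rfl | rfl | rfl
      exacts [huX, c1 huX, c2 (c1 huX), c3 (c2 (c1 huX))]
    -- The deleted sides are added to `X` if the leg `a`, and with it the whole collapsed vertex,
    -- belongs to `X`; the enlarged set is closed under the operations of `G`.
    have : {u | (u ∉ T.sides ∧ u ∈ X) ∨ (u ∈ T.sides ∧ a ∈ X)} = Set.univ := by
      refine G.eq_univ _ ⟨G.base, .inl ⟨fun h => T.not_outer _ (T.sides_subset h) isOuter_base,
        hb⟩⟩ ?_ ?_
      · intro u hu
        by_cases hl : u ∈ T.local_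
        · have haX : a ∈ X := by
            rcases hu with ⟨h, h'⟩ | ⟨h, h'⟩
            · exact hall u hl h h'
            · exact h'
          by_cases hS : G.rot u ∈ T.sides
          · exact .inr ⟨hS, haX⟩
          · exact .inl ⟨hS, hall' _ (T.rot_local hl) hS haX⟩
        · have hS : G.rot u ∉ T.sides := fun h => hl (T.local_of_rot (T.sides_subset h))
          rcases hu with ⟨h, h'⟩ | ⟨h, h'⟩
          · refine .inl ⟨hS, ?_⟩
            rw [← T.collapse_notMem hl]
            exact h1 u h' h
          · exact absurd (T.sides_subset h) hl
      · rintro u (⟨h, h'⟩ | ⟨h, h'⟩)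
        · exact .inl ⟨fun h'' => h (T.rev_sides.1 h''), h2 u h' h⟩
        · exact .inr ⟨T.rev_sides.2 h, h'⟩
    have := Set.eq_univ_iff_forall.1 this x
    rcases this with h | h
    · exact h.2
    · exact absurd h.1 hx
  homology := T.collapse_homology
  outer_base := isOuter_base
  outer_next := by
    intro x _ hx
    have : G.rev x ∉ T.local_ := fun h => T.not_outer _ (T.rot_local h) (by
      rw [isOuter_rot, G.rev_rev]; exact hx)
    rw [T.collapse_notMem this, isOuter_rot, G.rev_rev]; exact hx
  outer_conn := by
    intro X hb h1 x _ hx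
    refine (Equiv.Perm.SameCycle.induct hx (P := fun x => G.IsOuter x ∧ x ∈ X)
      ⟨isOuter_base, hb⟩ ?_).2
    rintro y ⟨hy, hyX⟩
    refine ⟨isOuter_next.2 hy, ?_⟩
    have : G.rev y ∉ T.local_ := fun h => T.not_outer _ (T.rot_local h) (by
      rw [isOuter_rot, G.rev_rev]; exact hy)
    rw [next_apply, ← T.collapse_notMem this]
    exact h1 y hyX (fun h => T.not_outer _ (T.sides_subset h) hy)
  outer_rot := by
    intro x _ hx
    rw [T.collapse_notMem fun h => T.not_outer _ h hx]
    exact hx.rot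
  deg_base := by
    obtain ⟨f1, f2, f3, f4⟩ := deg_of_notMem (L := {x | x ∈ T.local_}) (F := T.collapseFun)
      (fun _ h => T.rot_local h) (fun _ h => T.collapse_notMem h)
      (fun h => T.not_outer _ h isOuter_base)
    rw [f2, rot_base]
  deg_out := by
    intro x _ hx hb
    obtain ⟨f1, f2, f3, f4⟩ := deg_of_notMem (L := {x | x ∈ T.local_}) (F := T.collapseFun)
      (fun _ h => T.rot_local h) (fun _ h => T.collapse_notMem h)
      (fun h => T.not_outer _ h hx)
    rw [f3, f2]
    exact ⟨hx.rot_three hb, hx.rot_rot hb⟩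
  deg_in := by
    intro x hx d0 d1 d2 _
    by_cases hl : x ∈ T.local_
    · obtain ⟨n1, n2, n3, n4, n5, n6⟩ := T.legs_distinct
      rcases T.local_cases hl hx with rfl | rfl | rfl | rfl <;>
        simp only [T.collapse_a, T.collapse_b, T.collapse_c, T.collapse_d, true_and]
      exacts [n2.symm, n5.symm, n2, n5]
    · obtain ⟨f1, f2, f3, f4⟩ := deg_of_notMem (L := {x | x ∈ T.local_}) (F := T.collapseFun)
        (fun _ h => T.rot_local h) (fun _ h => T.collapse_notMem h) hl
      rw [f1] at d1
      rw [f2] at d2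
      rw [f4, f2]
      have := isInteriorVertex_of d0 d1 d2
      exact ⟨this.rot_four, this.rot_two_ne⟩

end BigonChart
end MinimalLoop

/-! ### Features, reducibility and the absence of new loop edges -/

namespace MinimalLoop

variable {G : MinimalLoop}

theorem isTwoGroup_iff {k : G.Dart} :
    G.IsTwoGroup k ↔ ¬ G.IsOuter k ∧ G.next (G.next k) = k ∧ ¬ G.SameVertex k (G.next k) := by
  refine ⟨fun h => ⟨h.1, h.next_next, h.2.2⟩, fun ⟨h1, h2, h3⟩ => ⟨h1, ?_, h3⟩⟩
  unfold PlaneMap.faceDegree PlaneMap.SameFace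
  rw [Equiv.Perm.ncard_sameCycle]
  refine Function.minimalPeriod_eq_prime (p := 2) h2 fun h' => h3 ?_
  rw [Function.IsFixedPt.eq h']
  exact Equiv.Perm.SameCycle.rfl

theorem IsTwoGroup.next {k : G.Dart} (h : G.IsTwoGroup k) : G.IsTwoGroup (G.next k) := by
  rw [isTwoGroup_iff] at h ⊢
  refine ⟨fun h' => h.1 (isOuter_next.1 h'), by rw [h.2.1], ?_⟩
  rw [h.2.1]
  exact fun h' => h.2.2 (Equiv.Perm.SameCycle.symm h')

theorem isTriangle_iff {p : G.Dart} :
    G.IsTriangle p ↔ ¬ G.IsOuter p ∧ G.next (G.next (G.next p)) = p ∧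
      ¬ G.SameVertex p (G.next p) ∧ ¬ G.SameVertex (G.next p) (G.next (G.next p)) ∧
      ¬ G.SameVertex p (G.next (G.next p)) := by
  refine and_congr_right fun _ => and_congr_left fun h => ?_
  unfold PlaneMap.faceDegree PlaneMap.SameFace
  rw [Equiv.Perm.ncard_sameCycle]
  refine ⟨fun h' => Function.iterate_minimalPeriod_eq h', fun h' => ?_⟩
  refine Function.minimalPeriod_eq_prime (p := 3) h' fun h'' => h.1 ?_
  rw [Function.IsFixedPt.eq h'']
  exact Equiv.Perm.SameCycle.rfl

theorem IsTriangle.next {p : G.Dart} (h : G.IsTriangle p) : G.IsTriangle (G.next p) := by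
  rw [isTriangle_iff] at h ⊢
  obtain ⟨h1, h2, h3, h4, h5⟩ := h
  rw [h2]
  exact ⟨fun h' => h1 (isOuter_next.1 h'), rfl, h4, fun h' => h5 h'.symm, fun h' => h3 h'.symm⟩

theorem sameVertex_rev_next (d : G.Dart) : G.SameVertex (G.rev d) (G.next d) := sameVertex_rot _

theorem sameFace_next (d : G.Dart) : G.SameFace d (G.next d) := by
  simp [PlaneMap.SameFace, Equiv.Perm.SameCycle.refl]

theorem _root_.PlaneMap.Loopless.next (hl : G.Loopless) (d : G.Dart) :
    ¬ G.SameVertex d (G.next d) :=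
  fun h => hl d (h.trans (sameVertex_rev_next d).symm)

theorem _root_.PlaneMap.Loopless.next_ne (hl : G.Loopless) (d : G.Dart) : G.next d ≠ d := by
  intro h
  apply hl.next d
  rw [h]; exact Equiv.Perm.SameCycle.rfl

theorem isTwoGroup_of (hl : G.Loopless) {u v : G.Dart} (h1 : G.next u = v) (h2 : G.next v = u)
    (ho : ¬ G.IsOuter u) : G.IsTwoGroup u :=
  isTwoGroup_iff.2 ⟨ho, by rw [h1, h2], hl.next u⟩

theorem isTriangle_of (hl : G.Loopless) {p : G.Dart} (h : G.next (G.next (G.next p)) = p)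
    (ho : ¬ G.IsOuter p) : G.IsTriangle p := by
  refine isTriangle_iff.2 ⟨ho, h, hl.next p, hl.next _, fun h' => hl.next (G.next (G.next p)) ?_⟩
  rw [h]; exact h'.symm

variable (G) in
/-- The features that the transformation of a minimal loop aims at. -/
def HasFeature : Prop := G.HasBoundaryTwoGroup ∨ G.HasAdjacentTwoGroups ∨ G.HasRotsTriangle

theorem IsTriangle.hasFeature {p : G.Dart} (h : G.IsTriangle p)
    (h' : G.IsTwoGroup (G.rev p) ∨ G.IsTwoGroup (G.rev (G.next p)) ∨
      G.IsTwoGroup (G.rev (G.next (G.next p)))) : G.HasFeature := by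
  refine .inr (.inr ⟨p, h, ?_⟩)
  rcases h' with h' | h' | h'
  · exact ⟨p, Equiv.Perm.SameCycle.rfl, h'⟩
  · exact ⟨_, sameFace_next p, h'⟩
  · exact ⟨_, (sameFace_next p).trans (sameFace_next _), h'⟩

/-- The minimal loop has a feature, or a triangle with a boundary edge, or it can be brought to
such a form by `ots` operations on interior triangles and by `t` operations. -/
inductive Reducible : MinimalLoop → Prop
  | feature {G : MinimalLoop} (h : G.HasFeature) : Reducible G
  | boundary {G : MinimalLoop} {p : G.Dart} (h : G.IsTriangle p) (h' : G.IsOuter (G.rev p)) :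
      Reducible G
  | flip {G : MinimalLoop} {p q r e f g h i j : G.Dart} (T : TriChart G p q r e f g h i j)
      (h : Reducible T.flip) : Reducible G
  | turn {G : MinimalLoop} {k l a b c d : G.Dart} (T : BigonChart G k l a b c d)
      (h : Reducible T.turn) : Reducible G

theorem mem_four {D : Type*} [Finite D] {σ : Equiv.Perm D} {a b c d x y : D} (h1 : σ a = b)
    (h2 : σ b = c) (h3 : σ c = d) (h4 : σ d = a) (hx : x ∈ [a, b, c, d])
    (hxy : σ.SameCycle x y) : y ∈ [a, b, c, d] := by
  refine hxy.induct (P := fun y => y ∈ [a, b, c, d]) hx ?_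
  intro z hz
  simp only [List.mem_cons, List.not_mem_nil, or_false] at hz ⊢
  rcases hz with rfl | rfl | rfl | rfl <;> simp [*]

namespace TriChart

variable {p q r e f g h i j : G.Dart} (T : TriChart G p q r e f g h i j)

theorem next_p (T : TriChart G p q r e f g h i j) : G.next p = q := T.p_q
theorem next_q (T : TriChart G p q r e f g h i j) : G.next q = r := T.q_r
theorem next_r (T : TriChart G p q r e f g h i j) : G.next r = p := T.r_p

theorem isTriangle (T : TriChart G p q r e f g h i j) (hl : G.Loopless) : G.IsTriangle p :=
  isTriangle_of hl (by rw [T.next_p, T.next_q, T.next_r]) (T.not_outer _ (by simp))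

/-- A loop edge at a new vertex would be an edge of `G` with ends `e` and `j`, or `f` and `g`, or
`h` and `i`. Together with the side of the triangle between them it would bound a 2-group, and the
triangle would be a rots-triangle. -/
theorem flip_loopless (hl : G.Loopless) (hf : ¬ G.HasFeature) : T.flip.Loopless := by
  have htri := T.isTriangle hl
  have hno : ¬ G.IsTwoGroup (G.rev p) ∧ ¬ G.IsTwoGroup (G.rev q) ∧ ¬ G.IsTwoGroup (G.rev r) := by
    have := fun h => hf (htri.hasFeature h)
    rw [T.next_p, T.next_q] at this
    tauto
  obtain ⟨le, lf, lg, lh, li, lj⟩ := T.legs_notMem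
  obtain ⟨n1, n2, n3, n4, n5, n6, n7, n8, n9, n10, n11, n12⟩ := T.sides_ne
  have hej : G.rev e ≠ j := by
    intro hej
    refine hno.2.2 (isTwoGroup_of hl (v := e) ?_ ?_ (T.not_outer _ (by simp)))
    · rw [next_rev, T.r_e]
    · rw [next_apply, hej, T.j_r]
  have hgf : G.rev g ≠ f := by
    intro hgf
    refine hno.2.1 (isTwoGroup_of hl (v := g) ?_ ?_ (T.not_outer _ (by simp)))
    · rw [next_rev, T.q_g]
    · rw [next_apply, hgf, T.f_q]
  have hih : G.rev i ≠ h := by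
    intro hih
    refine hno.1 (isTwoGroup_of hl (v := i) ?_ ?_ (T.not_outer _ (by simp)))
    · rw [next_rev, T.p_i]
    · rw [next_apply, hih, T.h_p]
  have hrr := G.rev_rev
  have hrn := G.rev_ne
  have hri : ∀ x, x ∉ T.inner → G.rev x ∉ T.inner := fun x h h' => h (T.inner_rev.1 h')
  have re := hri e le; have rf := hri f lf; have rg := hri g lg; have rh := hri h lh
  have ri := hri i li; have rj := hri j lj
  have hje : G.rev j ≠ e := fun h => hej (by rw [← h, hrr])
  have hfg : G.rev f ≠ g := fun h => hgf (by rw [← h, hrr])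
  have hhi : G.rev h ≠ i := fun h => hih (by rw [← h, hrr])
  simp only [inner, List.mem_cons, List.not_mem_nil, or_false, not_or]
    at le lf lg lh li lj re rf rg rh ri rj
  have hx : ∀ d ∈ [e, p, G.rev r, j], G.rev d ∉ [e, p, G.rev r, j] := by
    simp only [List.forall_mem_cons]
    simp only [List.mem_cons, List.not_mem_nil, or_false, not_or, hrr]
    refine ⟨⟨hrn e, re.1, re.2.2.2.2.2, hej⟩, ⟨fun h => le.2.1 h.symm, hrn p,
      fun h => n2 (G.rev.injective h), fun h => lj.2.1 h.symm⟩, ⟨fun h => le.2.2.2.2.1 h.symm,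
      fun h => n2 h.symm, n12, fun h => lj.2.2.2.2.1 h.symm⟩, ⟨hje, rj.1, rj.2.2.2.2.2, hrn j⟩,
      ?_⟩
    simp
  have hy : ∀ d ∈ [f, g, q, G.rev p], G.rev d ∉ [f, g, q, G.rev p] := by
    simp only [List.forall_mem_cons]
    simp only [List.mem_cons, List.not_mem_nil, or_false, not_or, hrr]
    refine ⟨⟨hrn f, hfg, rf.2.2.1, rf.2.1⟩, ⟨hgf, hrn g, rg.2.2.1, rg.2.1⟩,
      ⟨fun h => lf.2.2.2.1 h.symm, fun h => lg.2.2.2.1 h.symm, hrn q,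
        fun h => n1 (G.rev.injective h).symm⟩,
      ⟨fun h => lf.1 h.symm, fun h => lg.1 h.symm, n1, n4⟩, ?_⟩
    simp
  have ha : ∀ d ∈ [r, G.rev q, h, i], G.rev d ∉ [r, G.rev q, h, i] := by
    simp only [List.forall_mem_cons]
    simp only [List.mem_cons, List.not_mem_nil, or_false, not_or, hrr]
    refine ⟨⟨hrn r, fun h => n3 (G.rev.injective h).symm, fun h => lh.2.2.2.2.2 h.symm,
      fun h => li.2.2.2.2.2 h.symm⟩, ⟨n3, n8, fun h => lh.2.2.1 h.symm,
      fun h => li.2.2.1 h.symm⟩, ⟨rh.2.2.2.2.1, rh.2.2.2.1, hrn h, hhi⟩,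
      ⟨ri.2.2.2.2.1, ri.2.2.2.1, hih, hrn i⟩, ?_⟩
    simp
  intro (d : G.Dart) (hd : T.flipRot.SameCycle d (G.rev d))
  by_cases hloc : d ∈ T.local_
  · have : d ∈ [e, p, G.rev r, j] ∨ d ∈ [f, g, q, G.rev p] ∨ d ∈ [r, G.rev q, h, i] := by
      simp only [local_, List.mem_cons, List.not_mem_nil, or_false] at hloc ⊢
      rcases hloc with h | h | h | h | h | h | h | h | h | h | h | h <;> simp [h]
    rcases this with h0 | h0 | h0
    · exact hx d h0 (mem_four T.flip_e T.flip_p T.flip_rev_r T.flip_j h0 hd)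
    · exact hy d h0 (mem_four T.flip_f T.flip_g T.flip_q T.flip_rev_p h0 hd)
    · exact ha d h0 (mem_four T.flip_r T.flip_rev_q T.flip_h T.flip_i h0 hd)
  · refine hl d ((sameCycle_of_agree (τ := G.rot) (S := {x | x ∉ T.local_}) ?_ ?_ _).2 hd)
    · intro y hy
      exact hy.induct (P := fun y => y ∉ T.local_) hloc (fun u hu hu' => hu (T.local_of_flip hu'))
    · intro y hy
      exact (T.flip_notMem hy).symm

end TriChart

namespace BigonChart

variable {k l a b c d : G.Dart} (T : BigonChart G k l a b c d)

theorem next_k (T : BigonChart G k l a b c d) : G.next k = l := T.k_l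
theorem next_l (T : BigonChart G k l a b c d) : G.next l = k := T.l_k

/-- A 2-group on the far side of `k` or `l` is different from the given one and shares a vertex with
it. -/
theorem not_isTwoGroup_rev (T : BigonChart G k l a b c d) (hf : ¬ G.HasFeature) :
    ¬ G.IsTwoGroup (G.rev k) ∧ ¬ G.IsTwoGroup (G.rev l) := by
  obtain ⟨n1, n2, n3, n4, n5⟩ := T.sides_ne
  have hk := T.isTwoGroup
  have hl := hk.next
  rw [T.next_k] at hl
  have hface : ∀ y, G.SameFace k y → y = k ∨ y = l := by
    intro y hy
    refine Equiv.Perm.SameCycle.induct hy (P := fun y => y = k ∨ y = l) (.inl rfl) ?_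
    rintro z (rfl | rfl)
    · exact .inr T.next_k
    · exact .inl T.next_l
  have hkl : G.SameFace k l := by rw [← T.next_k]; exact sameFace_next k
  constructor
  · intro h
    refine hf (.inr (.inl ⟨l, G.rev k, hl, h, fun h' => ?_, ?_⟩))
    · rcases hface _ (hkl.trans h') with h' | h'
      · exact n2 h'.symm
      · exact n4 h'.symm
    · have := sameVertex_rot (G.rev k)
      rw [T.k_l] at this
      exact this.symm
  · intro h
    refine hf (.inr (.inl ⟨k, G.rev l, hk, h, fun h' => ?_, ?_⟩))
    · rcases hface _ h' with h' | h'
      · exact n3 h'.symm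
      · exact n5 h'.symm
    · have := sameVertex_rot (G.rev l)
      rw [T.l_k] at this
      exact this.symm

/-- An edge joining the legs next to the side `k`, or those next to the side `l`, would bound a
second 2-group with that side. -/
theorem legs_rev_ne (hl : G.Loopless) (hf : ¬ G.HasFeature) (T : BigonChart G k l a b c d) :
    G.rev a ≠ d ∧ G.rev c ≠ b := by
  obtain ⟨h1, h2⟩ := T.not_isTwoGroup_rev hf
  constructor
  · intro h
    refine h1 (isTwoGroup_of hl (v := a) ?_ ?_ (T.not_outer _ (by simp)))
    · rw [next_rev, T.k_a]
    · rw [next_apply, h, T.d_k]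
  · intro h
    refine h2 (isTwoGroup_of hl (v := c) ?_ ?_ (T.not_outer _ (by simp)))
    · rw [next_rev, T.l_c]
    · rw [next_apply, h, T.b_l]

/-- After the turn `d` and `a` are at one vertex and `b` and `c` at the other, so a new loop edge
would be an edge excluded by `legs_rev_ne`. -/
theorem turn_loopless (hl : G.Loopless) (hf : ¬ G.HasFeature) : T.turn.Loopless := by
  obtain ⟨h1, h2⟩ := T.legs_rev_ne hl hf
  obtain ⟨n1, n2, n3, n4, n5⟩ := T.sides_ne
  have L := T.legs_ne
  simp only [List.forall_mem_cons] at L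
  obtain ⟨la, lb, lc, ld, -⟩ := L
  have hrr := G.rev_rev
  have hrn := G.rev_ne
  have hlr : ∀ x, x ≠ k ∧ x ≠ l ∧ x ≠ G.rev k ∧ x ≠ G.rev l →
      G.rev x ≠ k ∧ G.rev x ≠ l ∧ G.rev x ≠ G.rev k ∧ G.rev x ≠ G.rev l := by
    intro x hx
    simp only [Ne, rev_eq_iff, hrr]
    tauto
  have ra := hlr a la; have rb := hlr b lb; have rc := hlr c lc; have rd := hlr d ld
  have h1' : G.rev d ≠ a := fun h => h1 (by rw [← h, hrr])
  have h2' : G.rev b ≠ c := fun h => h2 (by rw [← h, hrr])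
  have hx : ∀ u ∈ [k, d, a, G.rev l], G.rev u ∉ [k, d, a, G.rev l] := by
    simp only [List.forall_mem_cons]
    simp only [List.mem_cons, List.not_mem_nil, or_false, not_or, hrr]
    refine ⟨⟨hrn k, fun h => ld.2.2.1 h.symm, fun h => la.2.2.1 h.symm,
      fun h => n1 (G.rev.injective h)⟩, ⟨rd.1, hrn d, h1', rd.2.2.2⟩, ⟨ra.1, h1, hrn a, ra.2.2.2⟩,
      ⟨n1.symm, fun h => ld.2.1 h.symm, fun h => la.2.1 h.symm, n5⟩, ?_⟩
    simp
  have hy : ∀ u ∈ [l, b, c, G.rev k], G.rev u ∉ [l, b, c, G.rev k] := by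
    simp only [List.forall_mem_cons]
    simp only [List.mem_cons, List.not_mem_nil, or_false, not_or, hrr]
    refine ⟨⟨hrn l, fun h => lb.2.2.2 h.symm, fun h => lc.2.2.2 h.symm,
      fun h => n1 (G.rev.injective h).symm⟩, ⟨rb.2.1, hrn b, h2', rb.2.2.1⟩,
      ⟨rc.2.1, h2, hrn c, rc.2.2.1⟩,
      ⟨n1, fun h => lb.1 h.symm, fun h => lc.1 h.symm, n2⟩, ?_⟩
    simp
  intro (u : G.Dart) (hu : T.turnRot.SameCycle u (G.rev u))
  by_cases hloc : u ∈ T.local_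
  · have : u ∈ [k, d, a, G.rev l] ∨ u ∈ [l, b, c, G.rev k] := by
      simp only [local_, List.mem_cons, List.not_mem_nil, or_false] at hloc ⊢
      rcases hloc with h | h | h | h | h | h | h | h <;> simp [h]
    rcases this with h0 | h0
    · exact hx u h0 (mem_four T.turn_k T.turn_d T.turn_a T.turn_rev_l h0 hu)
    · exact hy u h0 (mem_four T.turn_l T.turn_b T.turn_c T.turn_rev_k h0 hu)
  · refine hl u ((sameCycle_of_agree (τ := G.rot) (S := {x | x ∉ T.local_}) ?_ ?_ _).2 hu)
    · intro y hy
      exact hy.induct (P := fun y => y ∉ T.local_) hloc (fun u hu hu' => hu (T.local_of_turn hu'))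
    · intro y hy
      exact (T.turn_notMem hy).symm

end BigonChart
end MinimalLoop

/-! ### The ots operation on a triangle with one boundary edge -/

namespace MinimalLoop

variable {G : MinimalLoop}

namespace CutData

variable {S : Set G.Dart} {F : G.Dart → G.Dart} {b : G.Dart} (C : CutData G S F b)

theorem mem_of_sameCycle {A : Set G.Dart} (hA : ∀ x ∈ A, F x ∈ A) {d y : {x // x ∉ S}}
    (hd : d.1 ∈ A) (h : C.rot.SameCycle d y) : y.1 ∈ A :=
  h.induct (P := fun y => y.1 ∈ A) hd (fun _ hz => hA _ hz)

/-- The set `A` encloses the vertex of `d` in the new loop: closed under `F`, it contains every dart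
at that vertex, but not `rev d`. -/
theorem loop_loopless (hl : G.Loopless) (L : Set G.Dart) (hL : ∀ d ∈ L, d ∉ S → F d ∈ L)
    (hF : ∀ d, d ∉ L → F d = G.rot d)
    (h : ∀ d ∈ L, d ∉ S → ∃ A : Set G.Dart, d ∈ A ∧ (∀ x ∈ A, F x ∈ A) ∧ G.rev d ∉ A) :
    C.loop.Loopless := by
  intro (d : {x // x ∉ S}) (hd : C.rot.SameCycle d (C.rev d))
  by_cases hdL : d.1 ∈ L
  · obtain ⟨A, h1, h2, h3⟩ := h d.1 hdL d.2
    exact h3 (C.mem_of_sameCycle h2 h1 hd)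
  · have key : ∀ y, C.rot.SameCycle d y → y.1 ∉ L := by
      intro y hy
      refine hy.induct (P := fun y => y.1 ∉ L) hdL (fun z hz hz' => hz ?_)
      exact C.rot.mem_of_closed (X := {x | x.1 ∈ L}) (fun x hx => hL _ hx x.2) hz'
    exact hl d.1 (Equiv.Perm.sameCycle_map (ι := Subtype.val) hd
      (fun z hz => hF _ (key z hz)))

theorem card_lt (hS : S.Nonempty) : Nat.card C.loop.Dart < Nat.card G.Dart := by
  obtain ⟨s, hs⟩ := hS
  exact Finite.card_subtype_lt (p := fun x => x ∉ S) (x := s) (by simpa using hs)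

end CutData

/-- A triangle with exactly one boundary edge, with the names of the darts around it as in
`OtsOneBoundary`. -/
structure SideChart (G : MinimalLoop) (p q r e f g j : G.Dart) : Prop where
  p_q : G.rot (G.rev p) = q
  q_r : G.rot (G.rev q) = r
  r_p : G.rot (G.rev r) = p
  r_e : G.rot r = e
  e_f : G.rot e = f
  f_q : G.rot f = G.rev q
  q_g : G.rot q = g
  g_p : G.rot g = G.rev p
  p_j : G.rot p = j
  j_r : G.rot j = G.rev r
  nodup : [e, p, j, f, g, G.rev p, r, q, G.rev q, G.rev r].Nodup
  outer_p : G.IsOuter (G.rev p)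
  not_outer : ∀ d ∈ [e, p, f, g, r, q, G.rev q, G.rev r], ¬ G.IsOuter d

namespace SideChart

variable {p q r e f g j : G.Dart} (T : SideChart G p q r e f g j)

/-- The darts at the three vertices of the triangle. -/
def local_ (_ : SideChart G p q r e f g j) : List G.Dart :=
  [e, p, j, f, g, G.rev p, r, q, G.rev q, G.rev r]

/-- The darts of the two sides of the triangle that are deleted. -/
def sides (_ : SideChart G p q r e f g j) : Set G.Dart := {q, G.rev q, r, G.rev r}

/-- The new clockwise successors. -/
noncomputable def cut (_ : SideChart G p q r e f g j) : G.Dart → G.Dart :=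
  redirect G.rot [(e, p), (p, j), (j, e), (f, g), (g, G.rev p), (G.rev p, f)]

theorem rot_local {d : G.Dart} (hd : d ∈ T.local_) : G.rot d ∈ T.local_ := by
  have := T.p_q; have := T.q_r; have := T.r_p; have := T.r_e; have := T.e_f; have := T.f_q
  have := T.q_g; have := T.g_p; have := T.p_j; have := T.j_r
  simp only [local_, List.mem_cons, List.not_mem_nil, or_false] at hd ⊢
  rcases hd with rfl | rfl | rfl | rfl | rfl | rfl | rfl | rfl | rfl | rfl <;> simp [*]

theorem local_of_rot {d : G.Dart} (hd : G.rot d ∈ T.local_) : d ∈ T.local_ :=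
  G.rot.mem_of_closed (X := {d | d ∈ T.local_}) (fun _ h => T.rot_local h) hd

theorem kept_nodup (T : SideChart G p q r e f g j) : [e, p, j, f, g, G.rev p].Nodup :=
  (List.nodup_append.1
    (show ([e, p, j, f, g, G.rev p] ++ [r, q, G.rev q, G.rev r]).Nodup from T.nodup)).1

theorem cut_mem {a b : G.Dart}
    (hab : (a, b) ∈ [(e, p), (p, j), (j, e), (f, g), (g, G.rev p), (G.rev p, f)]) :
    T.cut a = b := redirect_of_mem T.kept_nodup hab

theorem cut_e : T.cut e = p := T.cut_mem (by simp)
theorem cut_p : T.cut p = j := T.cut_mem (by simp)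
theorem cut_j : T.cut j = e := T.cut_mem (by simp)
theorem cut_f : T.cut f = g := T.cut_mem (by simp)
theorem cut_g : T.cut g = G.rev p := T.cut_mem (by simp)
theorem cut_rev_p : T.cut (G.rev p) = f := T.cut_mem (by simp)

theorem cut_notMem {d : G.Dart} (hd : d ∉ T.local_) : T.cut d = G.rot d := by
  refine redirect_of_notMem fun h => hd ?_
  simp only [List.map_cons, List.map_nil, List.mem_cons, List.not_mem_nil, or_false] at h
  simp only [local_, List.mem_cons]
  tauto

theorem cut_rot {d : G.Dart} (hd : d ∉ T.local_) : T.cut d = G.rot d ∧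
    T.cut (T.cut d) = G.rot (G.rot d) ∧ T.cut (T.cut (T.cut d)) = G.rot (G.rot (G.rot d)) ∧
      T.cut (T.cut (T.cut (T.cut d))) = G.rot (G.rot (G.rot (G.rot d))) :=
  deg_of_notMem (L := {x | x ∈ T.local_}) (fun _ h => T.rot_local h) (fun _ h => T.cut_notMem h) hd

theorem kept_notMem (T : SideChart G p q r e f g j) : ∀ d ∈ [e, p, j, f, g, G.rev p],
    d ∉ T.sides := by
  have := (List.nodup_append.1
    (show ([e, p, j, f, g, G.rev p] ++ [r, q, G.rev q, G.rev r]).Nodup from T.nodup)).2.2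
  intro d hd hS
  refine this d hd d ?_ rfl
  simp only [sides, Set.mem_insert_iff, Set.mem_singleton_iff] at hS
  simp only [List.mem_cons]
  tauto

theorem local_cases {x : G.Dart} (hx : x ∈ T.local_) (hS : x ∉ T.sides) :
    x = e ∨ x = p ∨ x = j ∨ x = f ∨ x = g ∨ x = G.rev p := by
  simp only [local_, sides, List.mem_cons, List.not_mem_nil, or_false, Set.mem_insert_iff,
    Set.mem_singleton_iff] at hx hS
  tauto

theorem local_of_sides {x : G.Dart} (hx : x ∈ T.sides) : x ∈ T.local_ := by
  simp only [local_, sides, List.mem_cons, List.not_mem_nil, or_false, Set.mem_insert_iff,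
    Set.mem_singleton_iff] at hx ⊢
  tauto

theorem rev_sides {x : G.Dart} : G.rev x ∈ T.sides ↔ x ∈ T.sides := by
  simp only [sides, Set.mem_insert_iff, Set.mem_singleton_iff, rev_eq_iff, G.rev_rev]
  tauto

theorem outer_j (T : SideChart G p q r e f g j) : G.IsOuter j := by
  rw [← T.p_j, isOuter_rot]; exact T.outer_p

/-- The only outer darts near the triangle are `j` and `rev p`, and neither is fixed by a double
rotation, as the base dart is. -/
theorem base_notMem : G.base ∉ T.local_ := by
  intro h
  have hb := rot_base (G := G)
  have ho := isOuter_base (G := G)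
  have no := T.not_outer
  simp only [List.forall_mem_cons] at no
  obtain ⟨o1, o2, o3, o4, o5, o6, o7, o8, -⟩ := no
  have N := T.nodup
  simp only [List.nodup_cons, List.mem_cons, List.not_mem_nil, not_or, or_false] at N
  simp only [local_, List.mem_cons, List.not_mem_nil, or_false] at h
  rcases h with h | h | h | h | h | h | h | h | h | h
  · exact o1 (h ▸ ho)
  · exact o2 (h ▸ ho)
  · rw [h, T.j_r, T.r_p] at hb
    exact N.2.1.1 hb
  · exact o3 (h ▸ ho)
  · exact o4 (h ▸ ho)
  · rw [h, T.p_q, T.q_g] at hb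
    exact N.2.2.2.2.1.1 hb
  · exact o5 (h ▸ ho)
  · exact o6 (h ▸ ho)
  · exact o7 (h ▸ ho)
  · exact o8 (h ▸ ho)

theorem outer_of_local {x : G.Dart} (hx : x ∈ T.local_) (ho : G.IsOuter x) :
    x = j ∨ x = G.rev p := by
  have no := T.not_outer
  simp only [List.forall_mem_cons] at no
  obtain ⟨o1, o2, o3, o4, o5, o6, o7, o8, -⟩ := no
  simp only [local_, List.mem_cons, List.not_mem_nil, or_false] at hx
  rcases hx with rfl | rfl | rfl | rfl | rfl | rfl | rfl | rfl | rfl | rfl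
  exacts [absurd ho o1, absurd ho o2, .inl rfl, absurd ho o3, absurd ho o4, .inr rfl,
    absurd ho o5, absurd ho o6, absurd ho o7, absurd ho o8]

theorem cut_rev_of_outer {d : G.Dart} (hd : G.IsOuter d) : T.cut (G.rev d) = G.next d := by
  rw [next_apply]
  by_cases h : G.rev d ∈ T.local_
  · have h2 := isOuter_next.2 hd
    have h1 := T.outer_of_local (T.rot_local h) h2
    rw [← T.p_j, ← T.g_p] at h1
    rcases h1 with h1 | h1 <;> rw [G.rot.injective h1]
    · rw [T.cut_p, T.p_j]
    · rw [T.cut_g, T.g_p]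
  · exact T.cut_notMem h

/-- With value 0 on `p` the values on the deleted sides are forced at `b` and `c`, and the equation
at `a` is then the sum of those at `x` and `y`. The only kept dart whose left face changes is `p`:
it moves from the triangle to the face of `f`. -/
theorem cut_homology (z : G.Dart → ZMod 2) (hz : ∀ x, z (G.rev x) = z x)
    (hs : ∀ x, x ∉ T.sides → SmallSums T.cut z x) :
    ∃ w : G.Dart → ZMod 2, (∀ x, x ∉ T.sides → w (T.cut x) = w (G.rev x)) ∧
      ∀ x, x ∉ T.sides → w x + w (G.rev x) = z x := by
  classical
  have N := T.nodup
  have K := T.kept_notMem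
  simp only [List.nodup_cons, List.mem_cons, List.not_mem_nil, not_or, or_false] at N
  obtain ⟨Ne, Np, Nj, Nf, Ng, Np', Nr, Nq, Nq', -⟩ := N
  have hrn := G.rev_ne
  have hrr := G.rev_rev
  have sx : z e + z p + z j = 0 := by
    have := (hs e (K e (by simp))).three
    rw [T.cut_e, T.cut_p, T.cut_j] at this
    exact this rfl (Ne.1 ·.symm)
  have sy : z f + z g + z p = 0 := by
    have := (hs f (K f (by simp))).three
    rw [T.cut_f, T.cut_g, T.cut_rev_p, hz] at this
    exact this rfl (Nf.1 ·.symm)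
  let z₀ : G.Dart → ZMod 2 := fun x =>
    if x = p ∨ x = G.rev p then 0 else if x = r ∨ x = G.rev r then z j else
      if x = q ∨ x = G.rev q then z g else z x
  have hz0 : ∀ x, z₀ (G.rev x) = z₀ x := by
    intro x
    simp only [z₀, rev_eq_iff, G.rev_rev, hz, or_comm]
  have zp : z₀ p = 0 := by simp [z₀]
  have zr : z₀ r = z j := by
    simp only [z₀, true_or, if_true]
    rw [if_neg]
    rintro (h | h)
    · exact Np.2.2.2.2.1 h.symm
    · exact Np'.1 h.symm
  have zq : z₀ q = z g := by
    simp only [z₀, true_or, if_true]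
    rw [if_neg, if_neg]
    · rintro (h | h)
      · exact Nr.1 h.symm
      · exact Nq.2 h
    · rintro (h | h)
      · exact Np.2.2.2.2.2.1 h.symm
      · exact Np'.2.1 h.symm
  have zk : ∀ x, x ∉ T.sides → x ≠ p → x ≠ G.rev p → z₀ x = z x := by
    intro x hx h1 h2
    simp only [sides, Set.mem_insert_iff, Set.mem_singleton_iff, not_or] at hx
    simp [z₀, h1, h2, hx]
  have ze : z₀ e = z e := zk e (K e (by simp)) Ne.1 Ne.2.2.2.2.1
  have zf : z₀ f = z f := zk f (K f (by simp)) (Np.2.1 ·.symm) Nf.2.1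
  have zg : z₀ g = z g := zk g (K g (by simp)) (Np.2.2.1 ·.symm) Ng.1
  have zj : z₀ j = z j := zk j (K j (by simp)) (Np.1 ·.symm) Nj.2.2.1
  have hs0 : ∀ x, vertexSum G.rot z₀ x = 0 := by
    have s1 : vertexSum G.rot z₀ r = 0 := by
      rw [vertexSum_four, T.r_e, T.e_f, T.f_q, hz0, zr, zq, ze, zf]
      · clear * - sx sy; grind
      · rw [T.r_e, T.e_f, T.f_q, T.q_r]
      · rw [T.r_e, T.e_f]; exact Nf.2.2.1
    have s2 : vertexSum G.rot z₀ q = 0 := by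
      rw [vertexSum_three, T.q_g, T.g_p, hz0, zp, zq, zg]
      · clear * -; grind
      · rw [T.q_g, T.g_p, T.p_q]
      · rw [T.q_g]; exact Ng.2.2.1
    have s3 : vertexSum G.rot z₀ p = 0 := by
      rw [vertexSum_three, T.p_j, T.j_r, hz0, zp, zr, zj]
      · clear * -; grind
      · rw [T.p_j, T.j_r, T.r_p]
      · rw [T.p_j]; exact fun h => Np.1 h.symm
    intro x
    by_cases hx : x ∈ T.local_
    · simp only [local_, List.mem_cons, List.not_mem_nil, or_false] at hx
      rcases hx with rfl | rfl | rfl | rfl | rfl | rfl | rfl | rfl | rfl | rfl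
      · rwa [← T.r_e, vertexSum_rot]
      · exact s3
      · rwa [← T.p_j, vertexSum_rot]
      · rwa [← T.e_f, vertexSum_rot, ← T.r_e, vertexSum_rot]
      · rwa [← T.q_g, vertexSum_rot]
      · rwa [← vertexSum_rot, T.p_q]
      · exact s1
      · exact s2
      · rwa [← vertexSum_rot, T.q_r]
      · rwa [← vertexSum_rot, T.r_p]
    · refine vertexSum_of_smallSums fun y hy => ?_
      have hy0 : y ∉ T.local_ :=
        notMem_of_sameVertex (L := {x | x ∈ T.local_}) (fun _ h => T.rot_local h) hx hy
      have hy1 : G.rot y ∉ T.local_ := fun h => hy0 (T.local_of_rot h)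
      have hy2 : G.rot (G.rot y) ∉ T.local_ := fun h => hy1 (T.local_of_rot h)
      have hy3 : G.rot (G.rot (G.rot y)) ∉ T.local_ := fun h => hy2 (T.local_of_rot h)
      obtain ⟨f1, f2, f3, f4⟩ := T.cut_rot hy0
      have zn : ∀ x, x ∉ T.local_ → z₀ x = z x := by
        intro x hx
        refine zk x (fun h => hx (T.local_of_sides h)) ?_ ?_ <;> rintro rfl <;>
          exact hx (by simp [local_])
      have := hs y (fun h => hy0 (T.local_of_sides h))
      refine ⟨?_, ?_, ?_⟩
      · have := this.two
        rwa [f2, f1, ← zn _ hy0, ← zn _ hy1] at this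
      · have := this.three
        rwa [f3, f2, f1, ← zn _ hy0, ← zn _ hy1, ← zn _ hy2] at this
      · have := this.four
        rwa [f4, f3, f2, f1, ← zn _ hy0, ← zn _ hy1, ← zn _ hy2, ← zn _ hy3] at this
  obtain ⟨w, hw, hw'⟩ := G.exists_potential z₀ hz0 hs0
  have we := hw e; have wp := hw p; have wj := hw j; have wf := hw f; have wg := hw g
  have wr := hw r; have wq := hw q
  rw [T.e_f] at we; rw [T.p_j] at wp; rw [T.j_r] at wj; rw [T.f_q] at wf; rw [T.g_p] at wg
  rw [T.r_e] at wr; rw [T.q_g] at wq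
  have ve := hw' e; have vj := hw' j
  rw [ze, ← we] at ve; rw [zj, ← wj, ← wr] at vj
  let w₀ : G.Dart → ZMod 2 := fun x => if x = p then w f else w x
  have w0p : w₀ p = w f := by simp [w₀]
  have w0 : ∀ x, x ≠ p → w₀ x = w x := fun x hx => by simp [w₀, hx]
  have w0p' : w₀ (G.rev p) = w (G.rev p) := w0 _ (hrn p)
  have w0' : ∀ x, x ≠ G.rev p → w₀ (G.rev x) = w (G.rev x) :=
    fun x hx => w0 _ (fun h => hx (rev_eq_iff.1 h))
  refine ⟨w₀, fun x hx => ?_, fun x hx => ?_⟩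
  · by_cases hl : x ∈ T.local_
    · rcases T.local_cases hl hx with rfl | rfl | rfl | rfl | rfl | rfl
      · rw [T.cut_e, w0p, w0' _ Ne.2.2.2.2.1, we]
      · rw [T.cut_p, w0 _ (Np.1 ·.symm), w0p', wp]
      · rw [T.cut_j, w0 _ Ne.1, w0' _ Nj.2.2.1, ← wj, wr]
      · rw [T.cut_f, w0 _ (Np.2.2.1 ·.symm), w0' _ Nf.2.1, ← wf, wq]
      · rw [T.cut_g, w0p', w0' _ Ng.1, wg]
      · rw [T.cut_rev_p, hrr, w0p, w0 _ (Np.2.1 ·.symm)]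
    · rw [T.cut_notMem hl, w0 _ ?_, w0' _ ?_, hw]
      · rintro rfl; exact hl (by simp [local_])
      · intro h; exact hl (T.local_of_rot (h ▸ by simp [local_]))
  · have kp : w₀ p + w₀ (G.rev p) = z p := by
      rw [w0p, w0p', ← wp]
      clear * - ve vj sx; grind
    by_cases h1 : x = p
    · subst h1; exact kp
    by_cases h2 : x = G.rev p
    · subst h2; rw [hrr, hz, add_comm]; exact kp
    rw [w0 _ h1, w0' _ h2, hw', zk x hx h1 h2]

theorem cut_kept {x : G.Dart} (hx : x ∈ [e, p, j, f, g, G.rev p]) :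
    T.cut x ∈ [e, p, j, f, g, G.rev p] := by
  have := T.cut_e; have := T.cut_p; have := T.cut_j; have := T.cut_f; have := T.cut_g
  have := T.cut_rev_p
  simp only [List.mem_cons, List.not_mem_nil, or_false] at hx ⊢
  rcases hx with rfl | rfl | rfl | rfl | rfl | rfl <;> simp [*]

theorem kept_of_local {x : G.Dart} (hx : x ∈ T.local_) (hS : x ∉ T.sides) :
    x ∈ [e, p, j, f, g, G.rev p] := by
  have := T.local_cases hx hS
  simpa using this

theorem cutData : CutData G T.sides T.cut G.base where
  rev_mem := fun _ h => T.rev_sides.2 h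
  map := by
    intro x hx
    by_cases hl : x ∈ T.local_
    · exact T.kept_notMem _ (T.cut_kept (T.kept_of_local hl hx))
    · rw [T.cut_notMem hl]
      exact fun h => hl (T.local_of_rot (T.local_of_sides h))
  surj := by
    intro y hy
    have K := T.kept_notMem
    by_cases hl : y ∈ T.local_
    · rcases T.local_cases hl hy with rfl | rfl | rfl | rfl | rfl | rfl
      exacts [⟨j, K _ (by simp), T.cut_j⟩, ⟨e, K _ (by simp), T.cut_e⟩,
        ⟨p, K _ (by simp), T.cut_p⟩, ⟨_, K (G.rev p) (by simp), T.cut_rev_p⟩,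
        ⟨f, K _ (by simp), T.cut_f⟩, ⟨g, K _ (by simp), T.cut_g⟩]
    · have hl' : G.rot.symm y ∉ T.local_ := fun h => hl (by simpa using T.rot_local h)
      exact ⟨G.rot.symm y, fun h => hl' (T.local_of_sides h), by rw [T.cut_notMem hl']; simp⟩
  base := fun h => T.base_notMem (T.local_of_sides h)
  conn := by
    intro X hb h1 h2 x hx
    have K := T.kept_notMem
    have c1 := fun h => h1 e h (K _ (by simp)); have c2 := fun h => h1 p h (K _ (by simp))
    have c3 := fun h => h1 j h (K _ (by simp)); have c4 := fun h => h1 f h (K _ (by simp))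
    have c5 := fun h => h1 g h (K _ (by simp))
    have c6 := fun h => h1 (G.rev p) h (K _ (by simp))
    rw [T.cut_e] at c1; rw [T.cut_p] at c2; rw [T.cut_j] at c3; rw [T.cut_f] at c4
    rw [T.cut_g] at c5; rw [T.cut_rev_p] at c6
    have r1 := fun h => h2 p h (K _ (by simp))
    have r2 := fun h => h2 (G.rev p) h (K _ (by simp))
    rw [G.rev_rev] at r2
    have hall : ∀ u ∈ T.local_, u ∉ T.sides → u ∈ X → p ∈ X := by
      intro u hu hu' huX
      rcases T.local_cases hu hu' with rfl | rfl | rfl | rfl | rfl | rfl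
      exacts [c1 huX, huX, c1 (c3 huX), r2 (c5 (c4 huX)), r2 (c5 huX), r2 huX]
    have hall' : ∀ u ∈ T.local_, u ∉ T.sides → p ∈ X → u ∈ X := by
      intro u hu hu' huX
      rcases T.local_cases hu hu' with rfl | rfl | rfl | rfl | rfl | rfl
      exacts [c3 (c2 huX), huX, c2 huX, c6 (r1 huX), c4 (c6 (r1 huX)), r1 huX]
    have : {u | (u ∉ T.sides ∧ u ∈ X) ∨ (u ∈ T.sides ∧ p ∈ X)} = Set.univ := by
      refine G.eq_univ _ ⟨G.base, .inl ⟨fun h => T.base_notMem (T.local_of_sides h), hb⟩⟩ ?_ ?_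
      · intro u hu
        by_cases hl : u ∈ T.local_
        · have haX : p ∈ X := by
            rcases hu with ⟨h, h'⟩ | ⟨h, h'⟩
            · exact hall u hl h h'
            · exact h'
          by_cases hS : G.rot u ∈ T.sides
          · exact .inr ⟨hS, haX⟩
          · exact .inl ⟨hS, hall' _ (T.rot_local hl) hS haX⟩
        · have hS : G.rot u ∉ T.sides := fun h => hl (T.local_of_rot (T.local_of_sides h))
          rcases hu with ⟨h, h'⟩ | ⟨h, h'⟩
          · refine .inl ⟨hS, ?_⟩
            rw [← T.cut_notMem hl]
            exact h1 u h' h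
          · exact absurd (T.local_of_sides h) hl
      · rintro u (⟨h, h'⟩ | ⟨h, h'⟩)
        · exact .inl ⟨fun h'' => h (T.rev_sides.1 h''), h2 u h' h⟩
        · exact .inr ⟨T.rev_sides.2 h, h'⟩
    have := Set.eq_univ_iff_forall.1 this x
    rcases this with h | h
    · exact h.2
    · exact absurd h.1 hx
  homology := T.cut_homology
  outer_base := isOuter_base
  outer_next := by
    intro x _ hx
    rw [T.cut_rev_of_outer hx]; exact isOuter_next.2 hx
  outer_conn := by
    intro X hb h1 x _ hx
    refine (Equiv.Perm.SameCycle.induct hx (P := fun x => G.IsOuter x ∧ x ∈ X)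
      ⟨isOuter_base, hb⟩ ?_).2
    rintro y ⟨hy, hyX⟩
    refine ⟨isOuter_next.2 hy, ?_⟩
    rw [← T.cut_rev_of_outer hy]
    refine h1 y hyX fun h => ?_
    rcases T.outer_of_local (T.local_of_sides h) hy with rfl | rfl <;>
      exact T.kept_notMem _ (by simp) h
  outer_rot := by
    intro x _ hx
    by_cases hl : x ∈ T.local_
    · rcases T.outer_of_local hl hx with rfl | rfl
      · rw [T.cut_j]; exact T.not_outer _ (by simp)
      · rw [T.cut_rev_p]; exact T.not_outer _ (by simp)
    · rw [T.cut_notMem hl]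
      exact hx.rot
  deg_base := by
    obtain ⟨f1, f2, f3, f4⟩ := T.cut_rot T.base_notMem
    rw [f2, rot_base]
  deg_out := by
    intro x _ hx hb
    by_cases hl : x ∈ T.local_
    · rcases T.outer_of_local hl hx with rfl | rfl
      · rw [T.cut_j, T.cut_e, T.cut_p]; exact ⟨rfl, T.not_outer _ (by simp)⟩
      · rw [T.cut_rev_p, T.cut_f, T.cut_g]; exact ⟨rfl, T.not_outer _ (by simp)⟩
    obtain ⟨f1, f2, f3, f4⟩ := T.cut_rot hl
    rw [f3, f2]
    exact ⟨hx.rot_three hb, hx.rot_rot hb⟩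
  deg_in := by
    intro x hx d0 d1 d2 d3
    by_cases hl : x ∈ T.local_
    · exfalso
      have oj := T.outer_j
      have op := T.outer_p
      have e1 := T.cut_e; have e2 := T.cut_p; have e3 := T.cut_j; have e4 := T.cut_f
      have e5 := T.cut_g; have e6 := T.cut_rev_p
      rcases T.local_cases hl hx with rfl | rfl | rfl | rfl | rfl | rfl
      · rw [e1, e2] at d2; exact d2 oj
      · rw [e2] at d1; exact d1 oj
      · exact d0 oj
      · rw [e4, e5] at d2; exact d2 op
      · rw [e5] at d1; exact d1 op
      · exact d0 op
    · obtain ⟨f1, f2, f3, f4⟩ := T.cut_rot hl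
      rw [f1] at d1
      rw [f2] at d2
      rw [f4, f2]
      have := isInteriorVertex_of d0 d1 d2
      exact ⟨this.rot_four, this.rot_two_ne⟩

theorem ots (T : SideChart G p q r e f g j) : G.OtsOneBoundary T.cutData.loop p := by
  have h1 : G.next p = q := T.p_q
  have h2 : G.next q = r := T.q_r
  have no := T.not_outer
  unfold OtsOneBoundary
  simp only [h1, h2, T.r_e, T.e_f, T.q_g, T.p_j]
  refine ⟨.inr T.outer_p, ?_, ?_, T.cutData.isSurgery⟩ <;>
  · rintro (h | h) <;> exact no _ (by simp) h

theorem loop_loopless (hl : G.Loopless) (hf : ¬ G.HasFeature) : T.cutData.loop.Loopless := by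
  have htri : G.IsTriangle p := by
    refine isTriangle_of hl ?_ (T.not_outer _ (by simp))
    rw [show G.next p = q from T.p_q, show G.next q = r from T.q_r, show G.next r = p from T.r_p]
  have hno : ¬ G.IsTwoGroup (G.rev p) ∧ ¬ G.IsTwoGroup (G.rev q) ∧ ¬ G.IsTwoGroup (G.rev r) := by
    have := fun h => hf (htri.hasFeature h)
    rw [show G.next p = q from T.p_q, show G.next q = r from T.q_r] at this
    tauto
  have hej : G.rev e ≠ j := by
    intro hej
    refine hno.2.2 (isTwoGroup_of hl (v := e) ?_ ?_ (T.not_outer _ (by simp)))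
    · rw [next_rev, T.r_e]
    · rw [next_apply, hej, T.j_r]
  have hgf : G.rev g ≠ f := by
    intro hgf
    refine hno.2.1 (isTwoGroup_of hl (v := g) ?_ ?_ (T.not_outer _ (by simp)))
    · rw [next_rev, T.q_g]
    · rw [next_apply, hgf, T.f_q]
  have N := T.kept_nodup
  simp only [List.nodup_cons, List.mem_cons, List.not_mem_nil, not_or, or_false] at N
  obtain ⟨Ne, Np, Nj, Nf, Ng, -⟩ := N
  have hrr := G.rev_rev
  have hrn := G.rev_ne
  have hx : ∀ d ∈ [e, p, j], G.rev d ∉ [e, p, j] := by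
    simp only [List.forall_mem_cons]
    simp only [List.mem_cons, List.not_mem_nil, or_false, not_or]
    refine ⟨⟨hrn e, fun h => Ne.2.2.2.2 (rev_eq_iff.1 h), hej⟩,
      ⟨fun h => Ne.2.2.2.2 h.symm, hrn p, fun h => Nj.2.2 h.symm⟩,
      ⟨fun h => hej (rev_eq_iff.1 h).symm, fun h => Nj.2.2 (rev_eq_iff.1 h), hrn j⟩, ?_⟩
    simp
  have hy : ∀ d ∈ [f, g, G.rev p], G.rev d ∉ [f, g, G.rev p] := by
    simp only [List.forall_mem_cons]
    simp only [List.mem_cons, List.not_mem_nil, or_false, not_or, hrr]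
    refine ⟨⟨hrn f, fun h => hgf (rev_eq_iff.1 h).symm, fun h => Np.2.1 (G.rev.injective h).symm⟩,
      ⟨hgf, hrn g, fun h => Np.2.2.1 (G.rev.injective h).symm⟩,
      ⟨Np.2.1, Np.2.2.1, (hrn p).symm⟩, ?_⟩
    simp
  refine T.cutData.loop_loopless hl {x | x ∈ T.local_} ?_ (fun d hd => T.cut_notMem hd) ?_
  · intro d hd hS
    have := T.cut_kept (T.kept_of_local hd hS)
    simp only [List.mem_cons, List.not_mem_nil, or_false] at this
    simp only [local_, List.mem_cons, Set.mem_ofPred_eq]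
    tauto
  · intro d hd hS
    have e1 := T.cut_e; have e2 := T.cut_p; have e3 := T.cut_j; have e4 := T.cut_f
    have e5 := T.cut_g; have e6 := T.cut_rev_p
    have : d ∈ [e, p, j] ∨ d ∈ [f, g, G.rev p] := by
      rcases T.local_cases hd hS with h | h | h | h | h | h <;> simp [h]
    rcases this with h | h
    · refine ⟨{x | x ∈ [e, p, j]}, h, ?_, hx d h⟩
      intro x hx
      simp only [List.mem_cons, List.not_mem_nil, or_false, Set.mem_ofPred_eq] at hx ⊢
      rcases hx with rfl | rfl | rfl <;> simp [*]
    · refine ⟨{x | x ∈ [f, g, G.rev p]}, h, ?_, hy d h⟩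
      intro x hx
      simp only [List.mem_cons, List.not_mem_nil, or_false, Set.mem_ofPred_eq] at hx ⊢
      rcases hx with rfl | rfl | rfl <;> simp [*]

end SideChart
end MinimalLoop

/-! ### The ots operation on a triangle with two boundary edges -/

namespace MinimalLoop

variable {G : MinimalLoop}

/-- A triangle with exactly two boundary edges, with the names of the darts around it as in
`OtsTwoBoundary`. -/
structure TipChart (G : MinimalLoop) (p q r h i : G.Dart) : Prop where
  p_q : G.rot (G.rev p) = q
  q_r : G.rot (G.rev q) = r
  r_p : G.rot (G.rev r) = p
  r_q : G.rot r = G.rev q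
  q_h : G.rot q = h
  h_p : G.rot h = G.rev p
  p_i : G.rot p = i
  i_r : G.rot i = G.rev r
  nodup : [h, i, p, G.rev p, q, G.rev q, r, G.rev r].Nodup
  base_eq : G.base = G.rev q
  outer_r : G.IsOuter (G.rev r)
  outer_h : G.IsOuter h
  not_outer : ∀ d ∈ [i, p, G.rev p, q, r], ¬ G.IsOuter d

namespace TipChart

variable {p q r h i : G.Dart} (T : TipChart G p q r h i)

/-- The darts at the three vertices of the triangle. -/
def local_ (_ : TipChart G p q r h i) : List G.Dart :=
  [h, i, p, G.rev p, q, G.rev q, r, G.rev r]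

/-- The darts of the sides of the triangle. -/
def sides (_ : TipChart G p q r h i) : Set G.Dart :=
  {p, G.rev p, q, G.rev q, r, G.rev r}

/-- The new clockwise successors. -/
noncomputable def cut (_ : TipChart G p q r h i) : G.Dart → G.Dart :=
  redirect G.rot [(h, i), (i, h)]

theorem rot_local {d : G.Dart} (hd : d ∈ T.local_) : G.rot d ∈ T.local_ := by
  have := T.p_q; have := T.q_r; have := T.r_p; have := T.r_q; have := T.q_h; have := T.h_p
  have := T.p_i; have := T.i_r
  simp only [local_, List.mem_cons, List.not_mem_nil, or_false] at hd ⊢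
  rcases hd with rfl | rfl | rfl | rfl | rfl | rfl | rfl | rfl <;> simp [*]

theorem local_of_rot {d : G.Dart} (hd : G.rot d ∈ T.local_) : d ∈ T.local_ :=
  G.rot.mem_of_closed (X := {d | d ∈ T.local_}) (fun _ h => T.rot_local h) hd

theorem h_ne_i (T : TipChart G p q r h i) : h ≠ i := by
  have N := T.nodup
  simp only [List.nodup_cons, List.mem_cons, not_or] at N
  exact N.1.1

theorem cut_h : T.cut h = i := redirect_of_mem (by simp [T.h_ne_i]) (by simp)
theorem cut_i : T.cut i = h := redirect_of_mem (by simp [T.h_ne_i]) (by simp)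

theorem cut_ne {d : G.Dart} (h1 : d ≠ h) (h2 : d ≠ i) : T.cut d = G.rot d :=
  redirect_of_notMem (by simp [h1, h2])

theorem cut_notMem {d : G.Dart} (hd : d ∉ T.local_) : T.cut d = G.rot d := by
  simp only [local_, List.mem_cons, not_or] at hd
  exact T.cut_ne hd.1 hd.2.1

theorem cut_rot {d : G.Dart} (hd : d ∉ T.local_) : T.cut d = G.rot d ∧
    T.cut (T.cut d) = G.rot (G.rot d) ∧ T.cut (T.cut (T.cut d)) = G.rot (G.rot (G.rot d)) ∧
      T.cut (T.cut (T.cut (T.cut d))) = G.rot (G.rot (G.rot (G.rot d))) :=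
  deg_of_notMem (L := {x | x ∈ T.local_}) (fun _ h => T.rot_local h) (fun _ h => T.cut_notMem h) hd

theorem kept_notMem (T : TipChart G p q r h i) : h ∉ T.sides ∧ i ∉ T.sides := by
  have N := T.nodup
  simp only [List.nodup_cons, List.mem_cons, List.not_mem_nil, or_false, not_or] at N
  simp only [sides, Set.mem_insert_iff, Set.mem_singleton_iff, not_or]
  exact ⟨N.1.2, N.2.1⟩

theorem local_cases {x : G.Dart} (hx : x ∈ T.local_) (hS : x ∉ T.sides) : x = h ∨ x = i := by
  simp only [local_, sides, List.mem_cons, List.not_mem_nil, or_false, Set.mem_insert_iff,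
    Set.mem_singleton_iff] at hx hS
  tauto

theorem local_of_sides {x : G.Dart} (hx : x ∈ T.sides) : x ∈ T.local_ := by
  simp only [local_, sides, List.mem_cons, List.not_mem_nil, or_false, Set.mem_insert_iff,
    Set.mem_singleton_iff] at hx ⊢
  tauto

theorem rev_sides {x : G.Dart} : G.rev x ∈ T.sides ↔ x ∈ T.sides := by
  simp only [sides, Set.mem_insert_iff, Set.mem_singleton_iff, rev_eq_iff, G.rev_rev]
  tauto

theorem outer_of_local {x : G.Dart} (hx : x ∈ T.local_) (ho : G.IsOuter x) :
    x = h ∨ x = G.rev q ∨ x = G.rev r := by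
  have no := T.not_outer
  simp only [List.forall_mem_cons] at no
  obtain ⟨o1, o2, o3, o4, o5, -⟩ := no
  simp only [local_, List.mem_cons, List.not_mem_nil, or_false] at hx
  rcases hx with rfl | rfl | rfl | rfl | rfl | rfl | rfl | rfl
  exacts [.inl rfl, absurd ho o1, absurd ho o2, absurd ho o3, absurd ho o4, .inr (.inl rfl),
    absurd ho o5, .inr (.inr rfl)]

theorem cut_rev_of_outer {d : G.Dart} (hd : G.IsOuter d) (hi : G.rev d ≠ i) :
    T.cut (G.rev d) = G.next d := by
  refine T.cut_ne (fun h' => ?_) hi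
  have h1 := isOuter_next.2 hd
  rw [next_apply, h', T.h_p] at h1
  exact T.not_outer _ (by simp) h1

/-- With value 0 on `p` the values on `q` and `r` must be those on `h` and `i`, and they agree at
the apex because they agree at the new base vertex. No kept dart changes its face, so the potential
needs no correction. -/
theorem cut_homology (z : G.Dart → ZMod 2) (hz : ∀ x, z (G.rev x) = z x)
    (hs : ∀ x, x ∉ T.sides → SmallSums T.cut z x) :
    ∃ w : G.Dart → ZMod 2, (∀ x, x ∉ T.sides → w (T.cut x) = w (G.rev x)) ∧
      ∀ x, x ∉ T.sides → w x + w (G.rev x) = z x := by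
  classical
  have N := T.nodup
  obtain ⟨Kh, Ki⟩ := T.kept_notMem
  simp only [List.nodup_cons, List.mem_cons, List.not_mem_nil, not_or, or_false] at N
  obtain ⟨Nh, Ni, Np, Np', Nq, Nq', -⟩ := N
  have s0 : z h + z i = 0 := by
    have := (hs h Kh).two
    rw [T.cut_h, T.cut_i] at this
    exact this rfl (Nh.1 ·.symm)
  let z₀ : G.Dart → ZMod 2 := fun x =>
    if x = p ∨ x = G.rev p then 0 else if x = r ∨ x = G.rev r then z i else
      if x = q ∨ x = G.rev q then z h else z x
  have hz0 : ∀ x, z₀ (G.rev x) = z₀ x := by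
    intro x
    simp only [z₀, rev_eq_iff, G.rev_rev, hz, or_comm]
  have zp : z₀ p = 0 := by simp [z₀]
  have zr : z₀ r = z i := by
    simp only [z₀, true_or, if_true]
    rw [if_neg]
    rintro (h | h)
    · exact Np.2.2.2.1 h.symm
    · exact Np'.2.2.1 h.symm
  have zq : z₀ q = z h := by
    simp only [z₀, true_or, if_true]
    rw [if_neg, if_neg]
    · rintro (h | h)
      · exact Nq.2.1 h
      · exact Nq.2.2 h
    · rintro (h | h)
      · exact Np.2.1 h.symm
      · exact Np'.1 h.symm
  have zk : ∀ x, x ∉ T.sides → z₀ x = z x := by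
    intro x hx
    simp only [sides, Set.mem_insert_iff, Set.mem_singleton_iff, not_or] at hx
    simp [z₀, hx]
  have zh : z₀ h = z h := zk h Kh
  have zi : z₀ i = z i := zk i Ki
  have hs0 : ∀ x, vertexSum G.rot z₀ x = 0 := by
    have s1 : vertexSum G.rot z₀ r = 0 := by
      rw [vertexSum_two, T.r_q, hz0, zr, zq, add_comm, s0]
      · rw [T.r_q, T.q_r]
      · rw [T.r_q]; exact Nq'.1
    have s2 : vertexSum G.rot z₀ q = 0 := by
      rw [vertexSum_three, T.q_h, T.h_p, hz0, zp, zq, zh]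
      · clear * -; grind
      · rw [T.q_h, T.h_p, T.p_q]
      · rw [T.q_h]; exact Nh.2.2.2.1
    have s3 : vertexSum G.rot z₀ p = 0 := by
      rw [vertexSum_three, T.p_i, T.i_r, hz0, zp, zr, zi]
      · clear * -; grind
      · rw [T.p_i, T.i_r, T.r_p]
      · rw [T.p_i]; exact Ni.1
    intro x
    by_cases hx : x ∈ T.local_
    · simp only [local_, List.mem_cons, List.not_mem_nil, or_false] at hx
      rcases hx with rfl | rfl | rfl | rfl | rfl | rfl | rfl | rfl
      · rwa [← T.q_h, vertexSum_rot]
      · rwa [← T.p_i, vertexSum_rot]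
      · exact s3
      · rwa [← vertexSum_rot, T.p_q]
      · exact s2
      · rwa [← vertexSum_rot, T.q_r]
      · exact s1
      · rwa [← vertexSum_rot, T.r_p]
    · refine vertexSum_of_smallSums fun y hy => ?_
      have hy0 : y ∉ T.local_ :=
        notMem_of_sameVertex (L := {x | x ∈ T.local_}) (fun _ h => T.rot_local h) hx hy
      have hy1 : G.rot y ∉ T.local_ := fun h => hy0 (T.local_of_rot h)
      have hy2 : G.rot (G.rot y) ∉ T.local_ := fun h => hy1 (T.local_of_rot h)
      have hy3 : G.rot (G.rot (G.rot y)) ∉ T.local_ := fun h => hy2 (T.local_of_rot h)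
      obtain ⟨f1, f2, f3, f4⟩ := T.cut_rot hy0
      have zn : ∀ x, x ∉ T.local_ → z₀ x = z x :=
        fun x hx => zk x (fun h => hx (T.local_of_sides h))
      have := hs y (fun h => hy0 (T.local_of_sides h))
      refine ⟨?_, ?_, ?_⟩
      · have := this.two
        rwa [f2, f1, ← zn _ hy0, ← zn _ hy1] at this
      · have := this.three
        rwa [f3, f2, f1, ← zn _ hy0, ← zn _ hy1, ← zn _ hy2] at this
      · have := this.four
        rwa [f4, f3, f2, f1, ← zn _ hy0, ← zn _ hy1, ← zn _ hy2, ← zn _ hy3] at this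
  obtain ⟨w, hw, hw'⟩ := G.exists_potential z₀ hz0 hs0
  refine ⟨w, fun x hx => ?_, fun x hx => by rw [hw', zk x hx]⟩
  by_cases h1 : x = h
  · subst h1
    rw [T.cut_h, ← hw x, T.h_p, ← hw p, T.p_i]
  by_cases h2 : x = i
  · subst h2
    rw [T.cut_i, ← hw x, T.i_r, ← hw r, T.r_q, ← hw q, T.q_h]
  rw [T.cut_ne h1 h2, hw]

theorem cutData : CutData G T.sides T.cut h where
  rev_mem := fun _ h => T.rev_sides.2 h
  map := by
    obtain ⟨Kh, Ki⟩ := T.kept_notMem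
    intro x hx
    by_cases hl : x ∈ T.local_
    · rcases T.local_cases hl hx with rfl | rfl
      · rwa [T.cut_h]
      · rwa [T.cut_i]
    · rw [T.cut_notMem hl]
      exact fun h => hl (T.local_of_rot (T.local_of_sides h))
  surj := by
    obtain ⟨Kh, Ki⟩ := T.kept_notMem
    intro y hy
    by_cases hl : y ∈ T.local_
    · rcases T.local_cases hl hy with rfl | rfl
      exacts [⟨i, Ki, T.cut_i⟩, ⟨h, Kh, T.cut_h⟩]
    · have hl' : G.rot.symm y ∉ T.local_ := fun h => hl (by simpa using T.rot_local h)
      exact ⟨G.rot.symm y, fun h => hl' (T.local_of_sides h), by rw [T.cut_notMem hl']; simp⟩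
  base := T.kept_notMem.1
  conn := by
    obtain ⟨Kh, Ki⟩ := T.kept_notMem
    intro X hb h1 h2 x hx
    have hi : i ∈ X := by rw [← T.cut_h]; exact h1 _ hb Kh
    have : {u | u ∉ T.sides → u ∈ X} = Set.univ := by
      refine G.eq_univ _ ⟨h, fun _ => hb⟩ ?_ ?_
      · intro u hu hS
        by_cases hl : u ∈ T.local_
        · rcases T.local_cases (T.rot_local hl) hS with h' | h' <;> rwa [h']
        · have := h1 u (hu fun h => hl (T.local_of_sides h)) fun h => hl (T.local_of_sides h)
          rwa [T.cut_notMem hl] at this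
      · intro u hu hS
        have hS' : u ∉ T.sides := fun h => hS (T.rev_sides.2 h)
        exact h2 u (hu hS') hS'
    exact Set.eq_univ_iff_forall.1 this x hx
  homology := T.cut_homology
  outer_base := T.outer_h
  outer_next := by
    intro x _ hx
    by_cases hi : G.rev x = i
    · rw [hi, T.cut_i]; exact T.outer_h
    · rw [T.cut_rev_of_outer hx hi]; exact isOuter_next.2 hx
  outer_conn := by
    intro X hb h1 x hxS hx
    -- The old outer walk passes `rev r`, `rev q` and then `h`. Membership in `X` is claimed for
    -- kept darts only, and the claim starts again at `h`, which is the new base.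
    refine (Equiv.Perm.SameCycle.induct hx (P := fun x => G.IsOuter x ∧ (x ∉ T.sides → x ∈ X))
      ⟨isOuter_base, fun h' => absurd (by rw [T.base_eq]; simp [sides]) h'⟩ ?_).2 hxS
    rintro y ⟨hy, hyX⟩
    refine ⟨isOuter_next.2 hy, fun hS => ?_⟩
    by_cases hyS : y ∈ T.sides
    · rcases T.outer_of_local (T.local_of_sides hyS) hy with rfl | rfl | rfl
      · exact absurd hyS T.kept_notMem.1
      · rw [next_rev, T.q_h]; exact hb
      · rw [next_rev, T.r_q] at hS
        exact absurd (by simp [sides]) hS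
    · by_cases hi : G.rev y = i
      · rw [next_apply, hi, T.i_r] at hS
        exact absurd (by simp [sides]) hS
      · rw [← T.cut_rev_of_outer hy hi]
        exact h1 y (hyX hyS) hyS
  outer_rot := by
    intro x hxS hx
    by_cases hl : x ∈ T.local_
    · rcases T.local_cases hl hxS with rfl | rfl
      · rw [T.cut_h]; exact T.not_outer _ (by simp)
      · exact absurd hx (T.not_outer _ (by simp))
    · rw [T.cut_notMem hl]
      exact hx.rot
  deg_base := by rw [T.cut_h, T.cut_i]
  deg_out := by
    intro x hxS hx hb
    by_cases hl : x ∈ T.local_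
    · rcases T.local_cases hl hxS with rfl | rfl
      · exact absurd rfl hb
      · exact absurd hx (T.not_outer _ (by simp))
    obtain ⟨f1, f2, f3, f4⟩ := T.cut_rot hl
    rw [f3, f2]
    have hb' : x ≠ G.base := by
      rintro rfl
      exact hxS (by rw [T.base_eq]; simp [sides])
    exact ⟨hx.rot_three hb', hx.rot_rot hb'⟩
  deg_in := by
    intro x hx d0 d1 d2 d3
    by_cases hl : x ∈ T.local_
    · exfalso
      rcases T.local_cases hl hx with rfl | rfl
      · exact d0 T.outer_h
      · rw [T.cut_i] at d1; exact d1 T.outer_h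
    · obtain ⟨f1, f2, f3, f4⟩ := T.cut_rot hl
      rw [f1] at d1
      rw [f2] at d2
      rw [f4, f2]
      have := isInteriorVertex_of d0 d1 d2
      exact ⟨this.rot_four, this.rot_two_ne⟩

theorem ots (T : TipChart G p q r h i) : G.OtsTwoBoundary T.cutData.loop p := by
  have h1 : G.next p = q := T.p_q
  have h2 : G.next q = r := T.q_r
  have no := T.not_outer
  unfold OtsTwoBoundary
  simp only [h1, h2, T.q_h, T.p_i]
  refine ⟨?_, .inr ?_, .inr T.outer_r, T.cutData.isSurgery⟩
  · rintro (h | h) <;> exact no _ (by simp) h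
  · rw [← T.base_eq]; exact isOuter_base

theorem isTriangle (T : TipChart G p q r h i) (hl : G.Loopless) : G.IsTriangle p := by
  refine isTriangle_of hl ?_ (T.not_outer _ (by simp))
  rw [show G.next p = q from T.p_q, show G.next q = r from T.q_r, show G.next r = p from T.r_p]

theorem loop_loopless (hl : G.Loopless) (hf : ¬ G.HasFeature) : T.cutData.loop.Loopless := by
  have hih : G.rev i ≠ h := by
    intro hih
    refine hf ((T.isTriangle hl).hasFeature (.inl ?_))
    refine isTwoGroup_of hl (v := i) ?_ ?_ (T.not_outer _ (by simp))
    · rw [next_rev, T.p_i]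
    · rw [next_apply, hih, T.h_p]
  refine T.cutData.loop_loopless hl {x | x ∈ T.local_} ?_ (fun d hd => T.cut_notMem hd) ?_
  · intro d hd hS
    rcases T.local_cases hd hS with rfl | rfl
    · rw [T.cut_h]; simp [local_]
    · rw [T.cut_i]; simp [local_]
  · intro d hd hS
    refine ⟨{h, i}, T.local_cases hd hS, ?_, ?_⟩
    · rintro x (rfl | rfl)
      · rw [T.cut_h]; simp
      · rw [T.cut_i]; simp
    · rcases T.local_cases hd hS with rfl | rfl
      · rintro (h' | h')
        · exact G.rev_ne _ h'
        · exact hih (rev_eq_iff.1 h').symm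
      · rintro (h' | h')
        · exact hih h'
        · exact G.rev_ne _ h'

end TipChart

/-! ### Charts of triangles at the boundary -/

theorem IsTriangle.next_three {p : G.Dart} (h : G.IsTriangle p) :
    G.next (G.next (G.next p)) = p := (isTriangle_iff.1 h).2.1

/-- At the common vertex of two boundary edges of a triangle lies the base vertex. -/
theorem base_of_two_outer {q r : G.Dart} (hq : G.rot (G.rev q) = r) (h1 : G.IsOuter (G.rev q))
    (h2 : G.IsOuter (G.rev r)) : G.rot r = G.rev q ∧ G.base = G.rev q := by
  have h3 : G.rot r = G.rev q := by
    refine (h1.eq_of_sameVertex (isOuter_rot.2 h2) ?_).symm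
    rw [← hq]
    exact (sameVertex_rot _).trans (sameVertex_rot _)
  refine ⟨h3, ?_⟩
  by_contra hb
  apply h1.rot_two_ne (Ne.symm hb)
  rw [hq, h3]

theorem nodup_append_of_sameVertex {u v : G.Dart} {l m : List G.Dart} (hl : l.Nodup)
    (hm : m.Nodup) (h1 : ∀ x ∈ l, G.SameVertex u x) (h2 : ∀ x ∈ m, G.SameVertex v x)
    (huv : ¬ G.SameVertex u v) : (l ++ m).Nodup := by
  rw [List.nodup_append]
  refine ⟨hl, hm, ?_⟩
  rintro x hx y hy rfl
  exact huv ((h1 x hx).trans (h2 x hy).symm)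

theorem exists_tipChart {p : G.Dart} (ht : G.IsTriangle p)
    (hq : G.IsOuter (G.rev (G.next p))) (hr : G.IsOuter (G.rev (G.next (G.next p)))) :
    TipChart G p (G.next p) (G.next (G.next p)) (G.rot (G.next p)) (G.rot p) := by
  obtain ⟨ho, h3, v1, v2, v3⟩ := isTriangle_iff.1 ht
  set q := G.next p with hq0
  set r := G.next q with hr0
  have pq : G.rot (G.rev p) = q := rfl
  have qr : G.rot (G.rev q) = r := rfl
  have rp : G.rot (G.rev r) = p := h3
  obtain ⟨rq, hb⟩ := base_of_two_outer qr hq hr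
  have oq : ¬ G.IsOuter q := fun h => ho (isOuter_next.1 h)
  have or' : ¬ G.IsOuter r := fun h => oq (isOuter_next.1 h)
  -- With three boundary edges two different vertices of the triangle would both be the base vertex.
  have op' : ¬ G.IsOuter (G.rev p) := by
    intro h
    obtain ⟨-, hb'⟩ := base_of_two_outer rp hr h
    rw [hb] at hb'
    have := G.rev.injective hb'
    exact v2 (this ▸ Equiv.Perm.SameCycle.rfl)
  have oh : G.IsOuter (G.rot q) := isOuter_rot.2 hq
  have sq : G.SameVertex r (G.rev q) := by have := sameVertex_rot (G.rev q); rw [qr] at this; exact this.symm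
  have sr : G.SameVertex p (G.rev r) := by have := sameVertex_rot (G.rev r); rw [rp] at this; exact this.symm
  have sp : G.SameVertex q (G.rev p) := by have := sameVertex_rot (G.rev p); rw [pq] at this; exact this.symm
  have hhb : G.rot q ≠ G.base := by
    intro h
    rw [hb] at h
    exact v2 ((sameVertex_rot q).trans (h ▸ sq.symm))
  have hrb : G.rev r ≠ G.base := by
    intro h
    rw [hb] at h
    exact v3 (sr.trans (h ▸ sq.symm))
  have hp : G.rot (G.rot q) = G.rev p := by
    apply G.rot.injective
    have := oh.rot_three hhb
    rw [pq]; exact G.rot.injective this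
  have ir : G.rot (G.rot p) = G.rev r := by
    have := hr.rot_three hrb
    rwa [rp] at this
  have oi : ¬ G.IsOuter (G.rot p) := fun h => op' (isOuter_rot.1 h)
  refine ⟨pq, qr, rp, rq, rfl, hp, rfl, ir, ?_, hb, hr, oh, ?_⟩
  · have n1 : [r, G.rev q].Nodup := by
      simp only [List.nodup_cons, List.mem_cons, List.not_mem_nil, or_false, not_false_eq_true,
        List.nodup_nil, and_true]
      intro h; exact or' (h ▸ hq)
    have n2 : [p, G.rot p, G.rev r].Nodup := by
      have a1 : p ≠ G.rot p := by
        intro h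
        rw [← h, ← h] at ir
        exact ho (ir ▸ hr)
      simp only [List.nodup_cons, List.mem_cons, List.not_mem_nil, or_false, not_false_eq_true,
        List.nodup_nil, and_true, not_or]
      exact ⟨⟨a1, fun h => ho (h ▸ hr)⟩, fun h => oi (h ▸ hr)⟩
    have n3 : [q, G.rot q, G.rev p].Nodup := by
      simp only [List.nodup_cons, List.mem_cons, List.not_mem_nil, or_false, not_false_eq_true,
        List.nodup_nil, and_true, not_or]
      refine ⟨⟨fun h => oq (h ▸ oh), fun h => ?_⟩, fun h => op' (h ▸ oh)⟩
      have h1 : G.rot (G.rot q) = q := by rw [hp, ← h]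
      have h2 : G.rot q = q := by
        have := congrArg G.rot h
        rw [pq] at this; exact this
      exact oq (h2 ▸ oh)
    have m1 : ∀ x ∈ [r, G.rev q], G.SameVertex r x := by
      intro x hx
      simp only [List.mem_cons, List.not_mem_nil, or_false] at hx
      rcases hx with rfl | rfl
      exacts [Equiv.Perm.SameCycle.rfl, sq]
    have m2 : ∀ x ∈ [p, G.rot p, G.rev r], G.SameVertex p x := by
      intro x hx
      simp only [List.mem_cons, List.not_mem_nil, or_false] at hx
      rcases hx with rfl | rfl | rfl
      exacts [Equiv.Perm.SameCycle.rfl, sameVertex_rot _, sr]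
    have m3 : ∀ x ∈ [q, G.rot q, G.rev p], G.SameVertex q x := by
      intro x hx
      simp only [List.mem_cons, List.not_mem_nil, or_false] at hx
      rcases hx with rfl | rfl | rfl
      exacts [Equiv.Perm.SameCycle.rfl, sameVertex_rot _, sp]
    have k1 := nodup_append_of_sameVertex n3 n1 m3 m1 v2
    have k2 : ([p, G.rot p, G.rev r] ++ ([q, G.rot q, G.rev p] ++ [r, G.rev q])).Nodup := by
      rw [List.nodup_append]
      refine ⟨n2, k1, ?_⟩
      rintro x hx y hy rfl
      rw [List.mem_append] at hy
      rcases hy with hy | hy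
      · exact v1 ((m2 x hx).trans (m3 x hy).symm)
      · exact v3 ((m2 x hx).trans (m1 x hy).symm)
    refine (List.Perm.nodup_iff ?_).1 k2
    have := List.Perm.map (![p, G.rot p, G.rev r, q, G.rot q, G.rev p, r, G.rev q] : Fin 8 → G.Dart)
      (show List.Perm [0, 1, 2, 3, 4, 5, 6, 7] [4, 1, 0, 5, 3, 7, 6, 2] by decide)
    exact this
  · simp only [List.forall_mem_cons]
    exact ⟨oi, ho, op', oq, or', by simp⟩

theorem exists_sideChart {p : G.Dart} (ht : G.IsTriangle p) (hp : G.IsOuter (G.rev p))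
    (hq : ¬ G.IsOuter (G.rev (G.next p))) (hr : ¬ G.IsOuter (G.rev (G.next (G.next p)))) :
    SideChart G p (G.next p) (G.next (G.next p)) (G.rot (G.next (G.next p)))
      (G.rot (G.rot (G.next (G.next p)))) (G.rot (G.next p)) (G.rot p) := by
  obtain ⟨ho, h3, v1, v2, v3⟩ := isTriangle_iff.1 ht
  set q := G.next p with hq0
  set r := G.next q with hr0
  have pq : G.rot (G.rev p) = q := rfl
  have qr : G.rot (G.rev q) = r := rfl
  have rp : G.rot (G.rev r) = p := h3
  have oq : ¬ G.IsOuter q := fun h => ho (isOuter_next.1 h)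
  have or' : ¬ G.IsOuter r := fun h => oq (isOuter_next.1 h)
  have oj : G.IsOuter (G.rot p) := isOuter_rot.2 hp
  have oe : ¬ G.IsOuter (G.rot r) := fun h => hr (isOuter_rot.1 h)
  have og : ¬ G.IsOuter (G.rot q) := fun h => hq (isOuter_rot.1 h)
  have sq : G.SameVertex r (G.rev q) := by have := sameVertex_rot (G.rev q); rw [qr] at this; exact this.symm
  have sr : G.SameVertex p (G.rev r) := by have := sameVertex_rot (G.rev r); rw [rp] at this; exact this.symm
  have sp : G.SameVertex q (G.rev p) := by have := sameVertex_rot (G.rev p); rw [pq] at this; exact this.symm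
  -- Neither end of the boundary side is the base vertex: there the neighbouring side of the
  -- triangle would be a boundary edge too, against `hq` or `hr`.
  have hpb : G.rev p ≠ G.base := by
    intro h
    have hb := rot_base (G := G)
    rw [← h, pq] at hb
    exact og (hb ▸ hp)
  have hjb : G.rot p ≠ G.base := by
    intro h
    have hb := rot_base (G := G)
    rw [← h] at hb
    have := G.rot.injective hb
    apply hr
    rw [← rp] at this
    have h' := G.rot.injective this
    rw [rp] at h'
    rw [← h']; exact oj
  have gp : G.rot (G.rot q) = G.rev p := by
    have := hp.rot_three hpb
    rwa [pq] at this
  have jr : G.rot (G.rot p) = G.rev r := by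
    apply G.rot.injective
    have := oj.rot_three hjb
    rw [rp]; exact G.rot.injective this
  have ir : G.IsInteriorVertex r := by
    rw [← qr, isInteriorVertex_rot]
    refine isInteriorVertex_of hq ?_ ?_
    · rwa [qr]
    · rwa [qr]
  have fq : G.rot (G.rot (G.rot r)) = G.rev q := by
    apply G.rot.injective; rw [ir.rot_four, qr]
  have of' : ¬ G.IsOuter (G.rot (G.rot r)) :=
    ir _ ((sameVertex_rot _).trans (sameVertex_rot _))
  refine ⟨pq, qr, rp, rfl, rfl, fq, rfl, gp, rfl, jr, ?_, hp, ?_⟩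
  · have n1 := nodup_four rfl rfl fq qr ir.rot_two_ne
    have n2 : [p, G.rot p, G.rev r].Nodup := by
      simp only [List.nodup_cons, List.mem_cons, List.not_mem_nil, or_false, not_false_eq_true,
        List.nodup_nil, and_true, not_or]
      refine ⟨⟨fun h => ho (h ▸ oj), fun h => ?_⟩, fun h => hr (h ▸ oj)⟩
      have h1 : G.rot p = p := by
        have := congrArg G.rot h
        rw [rp] at this; exact this
      exact ho (h1 ▸ oj)
    have n3 : [q, G.rot q, G.rev p].Nodup := by
      have a1 : q ≠ G.rot q := by
        intro h
        rw [← h, ← h] at gp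
        exact oq (gp ▸ hp)
      simp only [List.nodup_cons, List.mem_cons, List.not_mem_nil, or_false, not_false_eq_true,
        List.nodup_nil, and_true, not_or]
      exact ⟨⟨a1, fun h => oq (h ▸ hp)⟩, fun h => og (h ▸ hp)⟩
    have m1 : ∀ x ∈ [r, G.rot r, G.rot (G.rot r), G.rev q], G.SameVertex r x := by
      intro x hx
      simp only [List.mem_cons, List.not_mem_nil, or_false] at hx
      rcases hx with rfl | rfl | rfl | rfl
      exacts [Equiv.Perm.SameCycle.rfl, sameVertex_rot _,
        (sameVertex_rot _).trans (sameVertex_rot _), sq]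
    have m2 : ∀ x ∈ [p, G.rot p, G.rev r], G.SameVertex p x := by
      intro x hx
      simp only [List.mem_cons, List.not_mem_nil, or_false] at hx
      rcases hx with rfl | rfl | rfl
      exacts [Equiv.Perm.SameCycle.rfl, sameVertex_rot _, sr]
    have m3 : ∀ x ∈ [q, G.rot q, G.rev p], G.SameVertex q x := by
      intro x hx
      simp only [List.mem_cons, List.not_mem_nil, or_false] at hx
      rcases hx with rfl | rfl | rfl
      exacts [Equiv.Perm.SameCycle.rfl, sameVertex_rot _, sp]
    have k1 := nodup_append_of_sameVertex n3 n1 m3 m1 v2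
    have k2 : ([p, G.rot p, G.rev r] ++
        ([q, G.rot q, G.rev p] ++ [r, G.rot r, G.rot (G.rot r), G.rev q])).Nodup := by
      rw [List.nodup_append]
      refine ⟨n2, k1, ?_⟩
      rintro x hx y hy rfl
      rw [List.mem_append] at hy
      rcases hy with hy | hy
      · exact v1 ((m2 x hx).trans (m3 x hy).symm)
      · exact v3 ((m2 x hx).trans (m1 x hy).symm)
    refine (List.Perm.nodup_iff ?_).1 k2
    have := List.Perm.map (![p, G.rot p, G.rev r, q, G.rot q, G.rev p, r, G.rot r,
      G.rot (G.rot r), G.rev q] : Fin 10 → G.Dart)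
      (show List.Perm [0, 1, 2, 3, 4, 5, 6, 7, 8, 9] [7, 0, 1, 8, 4, 5, 6, 3, 9, 2] by decide)
    exact this
  · simp only [List.forall_mem_cons]
    exact ⟨oe, ho, of', og, or', oq, hq, hr, by simp⟩

/-- A triangle with a boundary edge allows an operation that makes the minimal loop smaller. -/
theorem exists_ots_of_boundary (hl : G.Loopless) (hf : ¬ G.HasFeature) {p : G.Dart}
    (ht : G.IsTriangle p) (hp : G.IsOuter (G.rev p)) :
    ∃ G' : MinimalLoop, G.Ots G' ∧ G'.Loopless ∧ Nat.card G'.Dart < Nat.card G.Dart := by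
  have hots : ∀ {u : G.Dart}, G.IsTriangle u → G.IsOtsTriangle u := fun {u} hu =>
    ⟨hu, fun e he he' => hf (.inr (.inr ⟨u, hu, e, he, he'⟩))⟩
  have tip : ∀ u : G.Dart, G.IsTriangle u → G.IsOuter (G.rev (G.next u)) →
      G.IsOuter (G.rev (G.next (G.next u))) →
      ∃ G' : MinimalLoop, G.Ots G' ∧ G'.Loopless ∧ Nat.card G'.Dart < Nat.card G.Dart := by
    intro u hu h1 h2
    have T := exists_tipChart hu h1 h2
    exact ⟨T.cutData.loop, ⟨u, hots hu, .inr (.inr T.ots)⟩, T.loop_loopless hl hf,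
      T.cutData.card_lt ⟨u, by simp [TipChart.sides]⟩⟩
  by_cases hq : G.IsOuter (G.rev (G.next p))
  · refine tip (G.next (G.next p)) ht.next.next ?_ ?_
    · rwa [ht.next_three]
    · rwa [ht.next_three]
  by_cases hr : G.IsOuter (G.rev (G.next (G.next p)))
  · refine tip (G.next p) ht.next hr ?_
    rwa [ht.next_three]
  have T := exists_sideChart ht hp hq hr
  exact ⟨T.cutData.loop, ⟨p, hots ht, .inr (.inl T.ots)⟩, T.loop_loopless hl hf,
    T.cutData.card_lt ⟨G.next p, by simp [SideChart.sides]⟩⟩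

end MinimalLoop

/-! ### The parity argument and the induction along reductions -/

namespace MinimalLoop

/-- The legs of a 2-group at opposite positions do not belong to the same edge. -/
theorem BigonChart.rev_ne_opposite {G : MinimalLoop} {k l a b c d : G.Dart}
    (T : BigonChart G k l a b c d) : G.rev a ≠ c := by
  classical
  intro hac
  have := Fintype.ofFinite G.Dart
  have hca : G.rev c = a := by rw [← hac, G.rev_rev]
  have N := T.nodup
  simp only [List.nodup_cons, List.mem_cons, List.not_mem_nil, not_or, or_false] at N
  obtain ⟨Nk, Nd, Na, Nl, Nb, Nc, Nk', -⟩ := N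
  -- The supposed edge carrying `a` and `c` joins the two vertices of the 2-group and forms a closed
  -- curve with the edge of `k`.
  let z : G.Dart → ZMod 2 := fun x => if x = a ∨ x = c ∨ x = k ∨ x = G.rev k then 1 else 0
  have hz : ∀ x, z (G.rev x) = z x := by
    intro x
    simp only [z, rev_eq_iff, G.rev_rev, hac, hca]
    congr 1
    exact propext (by tauto)
  have za : z a = 1 := by simp [z]
  have zc : z c = 1 := by simp [z]
  have zk : z k = 1 := by simp [z]
  have zk' : z (G.rev k) = 1 := by simp [z]
  have z0 : ∀ x, x ≠ a → x ≠ c → x ≠ k → x ≠ G.rev k → z x = 0 := by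
    intro x h1 h2 h3 h4; simp [z, h1, h2, h3, h4]
  have zl : z l = 0 := z0 l (Na.1 ·.symm) Nl.2.1 (Nk.2.2.1 ·.symm) Nl.2.2.1
  have zl' : z (G.rev l) = 0 := by rw [hz, zl]
  have zb : z b = 0 := z0 b (Na.2.1 ·.symm) Nb.1 (Nk.2.2.2.1 ·.symm) Nb.2.1
  have zd : z d = 0 := z0 d Nd.1 Nd.2.2.2.1 (Nk.1 ·.symm) Nd.2.2.2.2.1
  have zn : ∀ x, x ∉ T.local_ → z x = 0 := by
    intro x hx
    simp only [local_, List.mem_cons, List.not_mem_nil, or_false, not_or] at hx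
    exact z0 x hx.2.2.1 hx.2.2.2.2.2.1 hx.1 hx.2.2.2.2.2.2.1
  have hnl : ∀ {x y}, x ∉ T.local_ → G.SameVertex x y → y ∉ T.local_ := fun {x y} hx hxy =>
    notMem_of_sameVertex (L := {x | x ∈ T.local_}) (fun _ h => T.rot_local h) hx hxy
  have hs : ∀ x, vertexSum G.rot z x = 0 := by
    intro x
    by_cases hx : x ∈ T.local_
    · refine T.vertexSum_local z ?_ ?_ hx
      · rw [vertexSum_four _ T.isInteriorVertex.1.rot_four T.rot_two_ne.1, T.k_a, T.a_b, T.b_l,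
          za, zk, zb, zl']
        decide
      · rw [vertexSum_four _ T.isInteriorVertex.2.rot_four T.rot_two_ne.2, T.l_c, T.c_d, T.d_k,
          zc, zl, zd, zk']
        decide
    · have : vertexSum G.rot z x = vertexSum G.rot (fun _ => 0) x :=
        vertexSum_congr _ fun y hy => zn y (hnl hx hy)
      rw [this]; simp [vertexSum]
  obtain ⟨w₁, hw₁, hw₁'⟩ := G.exists_potential z hz hs
  -- Adding a constant makes `w` vanish on the outer face; then `w = 1` means inside the curve.
  obtain ⟨w, hw, hw', hwb⟩ : ∃ w : G.Dart → ZMod 2, (∀ d, w (G.rot d) = w (G.rev d)) ∧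
      (∀ d, w d + w (G.rev d) = z d) ∧ w G.base = 0 := by
    refine ⟨fun x => w₁ x + w₁ G.base, fun x => by simp only [hw₁], fun x => ?_, ?_⟩
    · rw [← hw₁' x]; clear * -; grind
    · clear * -; grind
  have wo : ∀ x, G.IsOuter x → w x = 0 := by
    intro x hx
    refine Equiv.Perm.SameCycle.induct hx (P := fun x => w x = 0) hwb ?_
    intro y hy
    rw [next_apply, hw, G.rev_rev, hy]
  have wr : ∀ x, z x = 0 → w (G.rev x) = w x := by
    intro x hx
    have := hw' x
    rw [hx] at this; clear * - this; grind
  have winv : ∀ x y, x ∉ T.local_ → G.SameVertex x y → w y = w x := by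
    intro x y hx hxy
    refine (Equiv.Perm.SameCycle.induct hxy (P := fun y => y ∉ T.local_ ∧ w y = w x)
      ⟨hx, rfl⟩ ?_).2
    rintro u ⟨hu, huw⟩
    exact ⟨fun h => hu (T.local_of_rot h), by rw [hw, wr u (zn u hu), huw]⟩
  have hint : ∀ x, x ∉ T.local_ → w x = 1 → G.IsInteriorVertex x := by
    intro x hx h1 y hy hyo
    rw [← winv x y hx hy, wo y hyo] at h1
    exact zero_ne_one h1
  let A : Finset G.Dart := Finset.univ.filter fun x =>
    ¬ (x = a ∨ x = c ∨ x = k ∨ x = G.rev k ∨ x = l ∨ x = G.rev l) ∧ w x = 1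
  let B : Finset G.Dart := Finset.univ.filter fun x => x ∉ T.local_ ∧ w x = 1
  -- Reversal pairs the inside edge ends, the edges of the curve and of `l` being left out.
  have sA : ∑ x ∈ A, (1 : ZMod 2) = 0 := by
    refine Finset.sum_involution (fun x _ => G.rev x) (fun _ _ => by decide)
      (fun x _ _ => G.rev_ne x) (fun x hx => ?_) (fun x _ => G.rev_rev x)
    simp only [A, Finset.mem_filter, Finset.mem_univ, true_and, rev_eq_iff, G.rev_rev, hac, hca]
      at hx ⊢
    simp only [not_or] at hx
    obtain ⟨⟨h1, h2, h3, h4, h5, h6⟩, h7⟩ := hx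
    refine ⟨?_, ?_⟩
    · rintro (h | h | h | h | h | h)
      exacts [h2 h, h1 h, h4 h, h3 h, h6 h, h5 h]
    · rw [wr x (z0 x h1 h2 h3 h4), h7]
  -- Every vertex inside and off the curve has degree 4, so passing to the opposite dart pairs the
  -- inside edge ends at these vertices.
  have sB : ∑ x ∈ B, (1 : ZMod 2) = 0 := by
    refine Finset.sum_involution (fun x _ => G.rot (G.rot x)) (fun _ _ => by decide)
      (fun x hx _ => ?_) (fun x hx => ?_) (fun x hx => ?_) <;>
      simp only [B, Finset.mem_filter, Finset.mem_univ, true_and] at hx ⊢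
    · exact (hint x hx.1 hx.2).rot_two_ne
    · have : G.SameVertex x (G.rot (G.rot x)) := (sameVertex_rot _).trans (sameVertex_rot _)
      exact ⟨hnl hx.1 this, by rw [winv x _ hx.1 this, hx.2]⟩
    · exact (hint x hx.1 hx.2).rot_four
  have wk := hw k; have wa := hw a; have wl := hw l; have wc := hw c
  rw [T.k_a] at wk; rw [T.a_b, hac] at wa; rw [T.l_c] at wl; rw [T.c_d, hca] at wc
  have vk := hw' k; rw [zk, ← wk] at vk
  have va := hw' a; rw [za, hac] at va
  have wb1 : w b + w d = 1 := by rw [wa, wc, add_comm]; exact va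
  have six : ∀ x, ¬ (x = a ∨ x = c ∨ x = k ∨ x = G.rev k ∨ x = l ∨ x = G.rev l) ↔
      x = b ∨ x = d ∨ x ∉ T.local_ := by
    intro x
    simp only [local_, List.mem_cons, List.not_mem_nil, or_false]
    constructor
    · clear * -
      tauto
    · rintro (rfl | rfl | h)
      · rintro (h | h | h | h | h | h)
        exacts [Na.2.1 h.symm, Nb.1 h, Nk.2.2.2.1 h.symm, Nb.2.1 h, Nl.1 h.symm, Nb.2.2 h]
      · rintro (h | h | h | h | h | h)
        exacts [Nd.1 h, Nd.2.2.2.1 h, Nk.1 h.symm, Nd.2.2.2.2.1 h, Nd.2.1 h, Nd.2.2.2.2.2 h]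
      · clear * - h
        tauto
  -- By `wb1` exactly one of `b` and `d` points inside, so the two sets of even size would differ by
  -- a single dart.
  have AB : ∀ u v : G.Dart, (u = b ∧ v = d ∨ u = d ∧ v = b) → w u = 1 → w v = 0 →
      A = insert u B := by
    intro u v huv hu hv
    ext x
    simp only [A, B, Finset.mem_insert, Finset.mem_filter, Finset.mem_univ, true_and, six]
    have hxv : w x = 1 → x ≠ v := by rintro h rfl; rw [hv] at h; exact zero_ne_one h
    have hxu : x = u → w x = 1 := by rintro rfl; exact hu
    clear * - huv hxv hxu
    rcases huv with ⟨rfl, rfl⟩ | ⟨rfl, rfl⟩ <;> tauto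
  have notB : ∀ u, u = b ∨ u = d → u ∉ B := by
    intro u hu h
    simp only [B, Finset.mem_filter, Finset.mem_univ, true_and, local_, List.mem_cons] at h
    clear * - h hu
    tauto
  have contra : ∀ u v : G.Dart, (u = b ∧ v = d ∨ u = d ∧ v = b) → w u = 1 → w v = 0 → False := by
    intro u v huv hu hv
    rw [AB u v huv hu hv, Finset.sum_insert (notB u (huv.imp And.left And.left)), sB] at sA
    exact absurd sA (by decide)
  have two : ∀ t : ZMod 2, t = 0 ∨ t = 1 := by decide
  rcases two (w b) with h | h <;> rw [h] at wb1
  · exact contra d b (.inr ⟨rfl, rfl⟩) (by simpa using wb1) h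
  · exact contra b d (.inl ⟨rfl, rfl⟩) h (by clear * - wb1; grind)

/-- Two legs on a common edge form a loop edge of `G` if they are at the same vertex, and a second
2-group if they are next to the same side. The opposite pairs are excluded by parity, the pair `b`,
`d` after a turn, which shifts the legs by one place. -/
theorem BigonChart.collapse_loopless {G : MinimalLoop} {k l a b c d : G.Dart}
    (T : BigonChart G k l a b c d) (hl : G.Loopless) (hf : ¬ G.HasFeature) :
    T.collapse_cutData.loop.Loopless := by
  obtain ⟨h1, h2⟩ := T.legs_rev_ne hl hf
  have h3 := T.rev_ne_opposite
  have h4 : G.rev d ≠ b := T.turn_chart.rev_ne_opposite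
  have h5 : G.rev a ≠ b := by
    intro h
    refine hl a ?_
    rw [h, ← T.a_b]; exact sameVertex_rot a
  have h6 : G.rev c ≠ d := by
    intro h
    refine hl c ?_
    rw [h, ← T.c_d]; exact sameVertex_rot c
  have hrn := G.rev_ne
  have hx : ∀ x ∈ [a, b, c, d], G.rev x ∉ [a, b, c, d] := by
    simp only [List.forall_mem_cons]
    simp only [List.mem_cons, List.not_mem_nil, or_false, not_or]
    refine ⟨⟨hrn a, h5, h3, h1⟩, ⟨fun h => h5 (rev_eq_iff.1 h).symm, hrn b,
      fun h => h2 (rev_eq_iff.1 h).symm, fun h => h4 (rev_eq_iff.1 h).symm⟩,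
      ⟨fun h => h3 (rev_eq_iff.1 h).symm, h2, hrn c, h6⟩,
      ⟨fun h => h1 (rev_eq_iff.1 h).symm, h4, fun h => h6 (rev_eq_iff.1 h).symm, hrn d⟩, ?_⟩
    simp
  have key : ∀ x ∈ [a, b, c, d], T.collapseFun x ∈ [a, b, c, d] := by
    have := T.collapse_a; have := T.collapse_b; have := T.collapse_c; have := T.collapse_d
    intro x hx
    simp only [List.mem_cons, List.not_mem_nil, or_false] at hx ⊢
    rcases hx with rfl | rfl | rfl | rfl <;> simp [*]
  have hkept : ∀ x ∈ T.local_, x ∉ T.sides → x ∈ [a, b, c, d] := by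
    intro x hx hS
    have := T.local_cases hx hS
    simpa using this
  refine T.collapse_cutData.loop_loopless hl {x | x ∈ T.local_} ?_
    (fun x hx => T.collapse_notMem hx) ?_
  · intro x hx hS
    have := key x (hkept x hx hS)
    simp only [List.mem_cons, List.not_mem_nil, or_false] at this
    simp only [local_, List.mem_cons, Set.mem_ofPred_eq]
    tauto
  · intro x hxl hS
    exact ⟨{x | x ∈ [a, b, c, d]}, hkept x hxl hS, key, hx x (hkept x hxl hS)⟩

/-- From `G` one of the desired features can be reached. -/
def Reaches (G : MinimalLoop) : Prop :=
  ∃ G' : MinimalLoop,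
    Relation.ReflTransGen (fun H H' : MinimalLoop => H.Ots H' ∨ H.Turn H') G G' ∧ G'.HasFeature

theorem Reaches.step {G H : MinimalLoop} (h : G.Ots H ∨ G.Turn H) (hH : H.Reaches) :
    G.Reaches := by
  obtain ⟨G', h1, h2⟩ := hH
  exact ⟨G', Relation.ReflTransGen.head h h1, h2⟩

/-- Interior operations keep the type of darts, so `ih` remains valid along the reduction until a
triangle at the boundary lowers their number. A feature met on the way ends the process; in its
absence every triangle is an ots-triangle and the operations create no loop edges. -/
theorem Reducible.reaches {G : MinimalLoop} (hG : Reducible G) (hl : G.Loopless)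
    (ih : ∀ G' : MinimalLoop, Nat.card G'.Dart < Nat.card G.Dart → G'.Loopless → G'.Reaches) :
    G.Reaches := by
  induction hG with
  | @feature G h => exact ⟨G, .refl, h⟩
  | @boundary G p h h' =>
    by_cases hf : G.HasFeature
    · exact ⟨G, .refl, hf⟩
    obtain ⟨G', h1, h2, h3⟩ := exists_ots_of_boundary hl hf h h'
    exact (ih G' h3 h2).step (.inl h1)
  | @flip G p q r e f g h i j T _ hT =>
    by_cases hf : G.HasFeature
    · exact ⟨G, .refl, hf⟩
    refine (hT (T.flip_loopless hl hf) ih).step (.inl ?_)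
    obtain ⟨h1, h2, h3⟩ := T.not_isBoundaryEdge
    exact ⟨p, ⟨T.isTriangle hl, fun e he he' => hf (.inr (.inr ⟨p, T.isTriangle hl, e, he, he'⟩))⟩,
      .inl (T.ots_flip h1 h2 h3)⟩
  | @turn G k l a b c d T _ hT =>
    by_cases hf : G.HasFeature
    · exact ⟨G, .refl, hf⟩
    exact (hT (T.turn_loopless hl hf) ih).step (.inr T.turn_turn)

end MinimalLoop

/-! ### Doubling a vertex to a 2-group -/

namespace MinimalLoop

/-- `G` arises from `H` by doubling a vertex of degree 4, whose darts are `A, B, C, D`, to a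
2-group with sides `k` and `l`. -/
structure Doubling (H G : MinimalLoop) (ι : H.Dart → G.Dart) (k l : G.Dart)
    (A B C D : H.Dart) : Prop where
  chart : BigonChart G k l (ι A) (ι B) (ι C) (ι D)
  inj : Function.Injective ι
  range : ∀ x, x ∈ [k, l, G.rev k, G.rev l] ∨ ∃ u, ι u = x
  notMem : ∀ u, ι u ∉ [k, l, G.rev k, G.rev l]
  rev : ∀ u, ι (H.rev u) = G.rev (ι u)
  base : ι H.base = G.base
  rot_A : H.rot A = B
  rot_B : H.rot B = C
  rot_C : H.rot C = D
  rot_D : H.rot D = A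
  rot : ∀ u, u ∉ [A, B, C, D] → ι (H.rot u) = G.rot (ι u)

theorem BigonChart.swap {G : MinimalLoop} {k l a b c d : G.Dart} (T : BigonChart G k l a b c d) :
    BigonChart G l k c d a b where
  k_l := T.l_k
  l_k := T.k_l
  k_a := T.l_c
  a_b := T.c_d
  b_l := T.d_k
  l_c := T.k_a
  c_d := T.a_b
  d_k := T.b_l
  nodup := by
    refine (List.Perm.nodup_iff ?_).1 T.nodup
    have := List.Perm.map (![k, d, a, l, b, c, G.rev k, G.rev l] : Fin 8 → G.Dart)
      (show List.Perm [0, 1, 2, 3, 4, 5, 6, 7] [3, 4, 5, 0, 1, 2, 7, 6] by decide)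
    exact this
  not_outer := by
    intro x hx
    refine T.not_outer x ?_
    simp only [List.mem_cons] at hx ⊢
    tauto

theorem BigonChart.collapse_doubling {G : MinimalLoop} {k l a b c d : G.Dart}
    (T : BigonChart G k l a b c d) : ∃ A B C D : T.collapse_cutData.loop.Dart,
      Doubling T.collapse_cutData.loop G Subtype.val k l A B C D := by
  obtain ⟨la, lb, lc, ld⟩ := T.leg_notMem
  refine ⟨⟨a, la⟩, ⟨b, lb⟩, ⟨c, lc⟩, ⟨d, ld⟩, T, Subtype.val_injective, ?_, ?_, fun _ => rfl, rfl,
    Subtype.ext T.collapse_a, Subtype.ext T.collapse_b, Subtype.ext T.collapse_c,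
    Subtype.ext T.collapse_d, ?_⟩
  · intro x
    by_cases hx : x ∈ T.sides
    · left
      simp only [sides, Set.mem_insert_iff, Set.mem_singleton_iff] at hx
      simp only [List.mem_cons]
      tauto
    · exact .inr ⟨⟨x, hx⟩, rfl⟩
  · intro u hu
    apply u.2
    simp only [List.mem_cons, List.not_mem_nil, or_false] at hu
    simp only [sides, Set.mem_insert_iff, Set.mem_singleton_iff]
    tauto
  · intro u hu
    refine T.collapse_ne (fun h => hu ?_) (fun h => hu ?_)
    · have : u = ⟨b, lb⟩ := Subtype.ext h
      rw [this]
      exact .tail _ (.head _)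
    · have : u = ⟨d, ld⟩ := Subtype.ext h
      rw [this]
      exact .tail _ (.tail _ (.tail _ (.head _)))

namespace Doubling

variable {H G : MinimalLoop} {ι : H.Dart → G.Dart} {k l : G.Dart} {A B C D : H.Dart}

theorem swap (E : Doubling H G ι k l A B C D) : Doubling H G ι l k C D A B where
  chart := E.chart.swap
  inj := E.inj
  range := by
    intro x
    refine (E.range x).imp_left fun h => ?_
    simp only [List.mem_cons] at h ⊢
    tauto
  notMem := by
    intro u hu
    apply E.notMem u
    simp only [List.mem_cons] at hu ⊢
    tauto
  rev := E.rev
  base := E.base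
  rot_A := E.rot_C
  rot_B := E.rot_D
  rot_C := E.rot_A
  rot_D := E.rot_B
  rot := by
    intro u hu
    refine E.rot u fun h => hu ?_
    simp only [List.mem_cons] at h ⊢
    tauto

/-- A turn of the 2-group is invisible after collapsing: `H` and `ι` stay, and only the marking of
the four darts is shifted by one place. -/
theorem turn (E : Doubling H G ι k l A B C D) : Doubling H E.chart.turn ι k l D A B C where
  chart := E.chart.turn_chart
  inj := E.inj
  range := E.range
  notMem := E.notMem
  rev := E.rev
  base := E.base
  rot_A := E.rot_D
  rot_B := E.rot_A
  rot_C := E.rot_B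
  rot_D := E.rot_C
  rot := by
    intro u hu
    have hu' : u ∉ [A, B, C, D] := fun h => hu <| by simp only [List.mem_cons] at h ⊢; tauto
    rw [E.rot u hu']
    refine (E.chart.turn_notMem fun h => ?_).symm
    have h1 := E.notMem u
    simp only [List.mem_cons, List.not_mem_nil, or_false, not_or] at hu' h1
    simp only [BigonChart.local_, List.mem_cons, List.not_mem_nil, or_false, E.inj.eq_iff] at h
    tauto

theorem notMem_local (E : Doubling H G ι k l A B C D) {u : H.Dart} (hu : u ∉ [A, B, C, D]) :
    ι u ∉ E.chart.local_ := by
  intro h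
  have h1 := E.notMem u
  simp only [List.mem_cons, List.not_mem_nil, or_false, not_or] at hu h1
  simp only [BigonChart.local_, List.mem_cons, List.not_mem_nil, or_false, E.inj.eq_iff] at h
  tauto

theorem rot_mark (E : Doubling H G ι k l A B C D) {u : H.Dart} (hu : u ∈ [A, B, C, D]) :
    H.rot u ∈ [A, B, C, D] := by
  have := E.rot_A; have := E.rot_B; have := E.rot_C; have := E.rot_D
  simp only [List.mem_cons, List.not_mem_nil, or_false] at hu ⊢
  rcases hu with rfl | rfl | rfl | rfl <;> simp [*]

theorem mark_of_rot (E : Doubling H G ι k l A B C D) {u : H.Dart} (hu : H.rot u ∈ [A, B, C, D]) :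
    u ∈ [A, B, C, D] :=
  H.rot.mem_of_closed (X := {x | x ∈ [A, B, C, D]}) (fun _ h => E.rot_mark h) hu

theorem mark_congr (E : Doubling H G ι k l A B C D) {u v : H.Dart} (huv : H.SameVertex u v) :
    u ∈ [A, B, C, D] ↔ v ∈ [A, B, C, D] :=
  ⟨fun h => mem_four E.rot_A E.rot_B E.rot_C E.rot_D h huv,
    fun h => mem_four E.rot_A E.rot_B E.rot_C E.rot_D h huv.symm⟩

theorem mark_sameVertex (E : Doubling H G ι k l A B C D) {u : H.Dart} (hu : u ∈ [A, B, C, D]) :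
    H.SameVertex A u := by
  have hB := sameVertex_rot A; rw [E.rot_A] at hB
  have hC := sameVertex_rot B; rw [E.rot_B] at hC
  have hD := sameVertex_rot C; rw [E.rot_C] at hD
  simp only [List.mem_cons, List.not_mem_nil, or_false] at hu
  rcases hu with rfl | rfl | rfl | rfl
  exacts [Equiv.Perm.SameCycle.rfl, hB, hB.trans hC, (hB.trans hC).trans hD]

theorem mark_sameVertex' (E : Doubling H G ι k l A B C D) {u v : H.Dart}
    (hu : u ∈ [A, B, C, D]) (hv : v ∈ [A, B, C, D]) : H.SameVertex u v :=
  (E.mark_sameVertex hu).symm.trans (E.mark_sameVertex hv)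

/-- The 2-group is inserted into the rotation after `B` and after `D` only; these are the two split
angles. -/
theorem rot_of_ne (E : Doubling H G ι k l A B C D) {u : H.Dart} (hB : u ≠ B) (hD : u ≠ D) :
    ι (H.rot u) = G.rot (ι u) := by
  by_cases hA : u = A
  · rw [hA, E.rot_A, E.chart.a_b]
  by_cases hC : u = C
  · rw [hC, E.rot_C, E.chart.c_d]
  exact E.rot u (by simp [hA, hB, hC, hD])

theorem next_of_ne (E : Doubling H G ι k l A B C D) {u : H.Dart} (hB : H.rev u ≠ B)
    (hD : H.rev u ≠ D) : ι (H.next u) = G.next (ι u) := by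
  rw [next_apply, E.rot_of_ne hB hD, E.rev, next_apply]

theorem next_of_outer (E : Doubling H G ι k l A B C D) {u : H.Dart} (h : G.IsOuter (ι u)) :
    ι (H.next u) = G.next (ι u) := by
  refine E.next_of_ne ?_ ?_
  · intro h'
    refine E.chart.not_outer (G.rot (ι B)) (by rw [E.chart.b_l]; simp) ?_
    rw [isOuter_rot, ← h', E.rev, G.rev_rev]; exact h
  · intro h'
    refine E.chart.not_outer (G.rot (ι D)) (by rw [E.chart.d_k]; simp) ?_
    rw [isOuter_rot, ← h', E.rev, G.rev_rev]; exact h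

theorem isOuter_iff (E : Doubling H G ι k l A B C D) {u : H.Dart} :
    G.IsOuter (ι u) ↔ H.IsOuter u := by
  constructor
  · intro h
    have : ∃ v, ι v = ι u ∧ H.IsOuter v := by
      refine (Equiv.Perm.SameCycle.induct h (P := fun x => G.IsOuter x ∧ ∃ v, ι v = x ∧ H.IsOuter v)
        ⟨isOuter_base, H.base, E.base, isOuter_base⟩ ?_).2
      rintro _ ⟨hx, v, rfl, hv⟩
      exact ⟨isOuter_next.2 hx, H.next v, E.next_of_outer hx, isOuter_next.2 hv⟩
    obtain ⟨v, hv, hv'⟩ := this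
    rwa [← E.inj hv]
  · intro h
    refine Equiv.Perm.SameCycle.induct h (P := fun u => G.IsOuter (ι u)) ?_ ?_
    · rw [E.base]; exact isOuter_base
    · intro v hv
      rw [E.next_of_outer hv]; exact isOuter_next.2 hv

theorem mark_interior (E : Doubling H G ι k l A B C D) {u : H.Dart} (hu : u ∈ [A, B, C, D]) :
    H.IsInteriorVertex u := by
  rw [← isInteriorVertex_congr (E.mark_sameVertex hu)]
  refine isInteriorVertex_of ?_ ?_ ?_
  · rw [← E.isOuter_iff]; exact E.chart.not_outer _ (by simp)
  · rw [← E.isOuter_iff, E.rot_A]; exact E.chart.not_outer _ (by simp)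
  · rw [← E.isOuter_iff, E.rot_A, E.rot_B]; exact E.chart.not_outer _ (by simp)

/-- Both vertices of the 2-group collapse to the doubled vertex. This is why the converse,
`sameVertex_map`, needs a vertex other than that one. -/
theorem sameVertex_of (E : Doubling H G ι k l A B C D) {u v : H.Dart}
    (h : G.SameVertex (ι u) (ι v)) : H.SameVertex u v := by
  have : (ι v ∈ E.chart.local_ ∧ H.SameVertex u A) ∨
      (ι v ∉ E.chart.local_ ∧ ∃ t, ι t = ι v ∧ H.SameVertex u t) := by
    refine Equiv.Perm.SameCycle.induct h (P := fun x => (x ∈ E.chart.local_ ∧ H.SameVertex u A) ∨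
      (x ∉ E.chart.local_ ∧ ∃ t, ι t = x ∧ H.SameVertex u t)) ?_ ?_
    · by_cases hu : u ∈ [A, B, C, D]
      · refine .inl ⟨?_, (E.mark_sameVertex hu).symm⟩
        simp only [List.mem_cons, List.not_mem_nil, or_false] at hu
        rcases hu with rfl | rfl | rfl | rfl <;> simp [BigonChart.local_]
      · exact .inr ⟨E.notMem_local hu, u, rfl, Equiv.Perm.SameCycle.rfl⟩
    · rintro x (⟨hx, hu⟩ | ⟨hx, t, rfl, ht⟩)
      · exact .inl ⟨E.chart.rot_local hx, hu⟩
      · refine .inr ⟨fun h => hx (E.chart.local_of_rot h), H.rot t, ?_, ht.trans (sameVertex_rot _)⟩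
        refine E.rot t fun h => hx ?_
        simp only [List.mem_cons, List.not_mem_nil, or_false] at h
        rcases h with rfl | rfl | rfl | rfl <;> simp [BigonChart.local_]
  rcases this with ⟨h1, h2⟩ | ⟨h1, t, h2, h3⟩
  · refine h2.trans (E.mark_sameVertex ?_)
    by_contra hv
    exact E.notMem_local hv h1
  · rwa [← E.inj h2]

theorem sameVertex_map (E : Doubling H G ι k l A B C D) {u v : H.Dart} (hu : u ∉ [A, B, C, D])
    (h : H.SameVertex u v) : G.SameVertex (ι u) (ι v) :=
  Equiv.Perm.sameCycle_map h fun z hz => E.rot z fun hz' => hu ((E.mark_congr hz).2 hz')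

/-- A 2-group away from the doubled vertex is a 2-group after the doubling. -/
theorem isTwoGroup_map (E : Doubling H G ι k l A B C D) {u : H.Dart} (hu : H.IsTwoGroup u)
    (h1 : H.rev u ∉ [A, B, C, D]) (h2 : H.rev (H.next u) ∉ [A, B, C, D]) :
    G.IsTwoGroup (ι u) ∧ ι (H.next u) = G.next (ι u) := by
  simp only [List.mem_cons, List.not_mem_nil, or_false, not_or] at h1 h2
  have e1 := E.next_of_ne h1.2.1 h1.2.2.2
  have e2 := E.next_of_ne h2.2.1 h2.2.2.2
  obtain ⟨g1, g2, g3⟩ := isTwoGroup_iff.1 hu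
  refine ⟨isTwoGroup_iff.2 ⟨fun h => g1 (E.isOuter_iff.1 h), by rw [← e1, ← e2, g2], ?_⟩, e1⟩
  rw [← e1]
  exact fun h => g3 (E.sameVertex_of h)

/-- A 2-group at the doubled vertex gives rise to a feature. -/
theorem hasFeature_of_mark (E : Doubling H G ι k l A B C D) {u : H.Dart} (hu : H.IsTwoGroup u)
    (hm : H.rev u ∈ [A, B, C, D]) : G.HasFeature := by
  obtain ⟨g1, g2, g3⟩ := isTwoGroup_iff.1 hu
  set v := H.next u with hv
  have hrv : H.rot (H.rev u) = v := rfl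
  have hvm : H.rev v ∉ [A, B, C, D] := by
    intro h
    apply g3
    have h1 := E.mark_sameVertex' hm h
    have h2 := sameVertex_rev_next v
    rw [g2] at h2
    exact (h2.symm.trans h1.symm).trans (sameVertex_rev_next u)
  have hum : u ∉ [A, B, C, D] := by
    have h2 := sameVertex_rev_next v
    rw [g2] at h2
    rwa [← E.mark_congr h2]
  have e2 : G.next (ι v) = ι u := by
    rw [← g2]
    simp only [List.mem_cons, List.not_mem_nil, or_false, not_or] at hvm
    exact (E.next_of_ne hvm.2.1 hvm.2.2.2).symm
  have ou : ¬ G.IsOuter (ι u) := fun h => g1 (E.isOuter_iff.1 h)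
  -- If the angle is not split, the face remains a 2-group and shares a vertex with the inserted
  -- one.
  have adj : ∀ {k l : G.Dart} {A B C D : H.Dart}, Doubling H G ι k l A B C D → H.rev u = A →
      G.HasFeature := by
    intro k l A B C D E hA
    have e1 : G.next (ι u) = ι v := by
      rw [next_apply, ← E.rev, hA, E.chart.a_b, ← hrv, hA, E.rot_A]
    have hvB : v = B := by rw [← hrv, hA, E.rot_A]
    have hb : G.IsTwoGroup (ι u) :=
      isTwoGroup_iff.2 ⟨ou, by rw [e1, e2], by rw [e1]; exact fun h => g3 (E.sameVertex_of h)⟩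
    have hb' := hb.next
    rw [e1] at hb'
    refine .inr (.inl ⟨k, ι v, E.chart.isTwoGroup, hb', fun h => ?_, ?_⟩)
    · have hface : ∀ y, G.SameFace k y → y = k ∨ y = l := by
        intro y hy
        refine Equiv.Perm.SameCycle.induct hy (P := fun y => y = k ∨ y = l) (.inl rfl) ?_
        rintro z (rfl | rfl)
        · exact .inr E.chart.next_k
        · exact .inl E.chart.next_l
      have := E.notMem v
      simp only [List.mem_cons] at this
      rcases hface _ h with h | h <;> tauto
    · have h1 := sameVertex_rot k
      have h2 := sameVertex_rot (ι A)
      rw [E.chart.k_a] at h1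
      rw [E.chart.a_b, ← hvB] at h2
      exact h1.trans h2
  -- If the angle is split, the face acquires the third side `rev l`, on whose other side the
  -- inserted 2-group lies.
  have rots : ∀ {k l : G.Dart} {A B C D : H.Dart}, Doubling H G ι k l A B C D →
      u ∉ [A, B, C, D] → H.rev u = B → G.HasFeature := by
    intro k l A B C D E hum hB
    have hvC : v = C := by rw [← hrv, hB, E.rot_B]
    have e1 : G.next (ι u) = G.rev l := by
      rw [next_apply, ← E.rev, hB, E.chart.b_l]
    have e3 : G.next (G.rev l) = ι v := by
      rw [next_rev, E.chart.l_c, hvC]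
    have hl : G.IsTwoGroup l := by
      have := E.chart.isTwoGroup.next
      rwa [E.chart.next_k] at this
    have sB : G.SameVertex (ι B) (G.rev l) := by
      rw [← E.chart.b_l]; exact sameVertex_rot _
    have sC : G.SameVertex l (ι C) := by
      rw [← E.chart.l_c]; exact sameVertex_rot _
    have ht : G.IsTriangle (ι u) := by
      refine isTriangle_iff.2 ⟨ou, by rw [e1, e3, e2], ?_, ?_, ?_⟩
      · rw [e1]
        intro h
        have := E.sameVertex_of (h.trans sB.symm)
        exact hum ((E.mark_congr this).2 (by simp))
      · rw [e1, e3, hvC]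
        intro h
        have h0 : G.SameVertex (G.rev l) k := by
          have := sameVertex_rot (G.rev l); rwa [E.chart.l_k] at this
        exact E.chart.not_sameVertex ((h0.symm.trans h).trans sC.symm)
      · rw [e1, e3]
        exact fun h => g3 (E.sameVertex_of h)
    refine ht.hasFeature (.inr (.inl ?_))
    rwa [e1, G.rev_rev]
  have hum' : u ∉ [C, D, A, B] := fun h => hum <| by simp only [List.mem_cons] at h ⊢; tauto
  simp only [List.mem_cons, List.not_mem_nil, or_false] at hm
  rcases hm with hm | hm | hm | hm
  exacts [adj E hm, rots E hum hm, adj E.swap hm, rots E.swap hum' hm]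

theorem hasFeature_of_mark_or (E : Doubling H G ι k l A B C D) {u : H.Dart} (hu : H.IsTwoGroup u)
    (hm : H.rev u ∈ [A, B, C, D] ∨ H.rev (H.next u) ∈ [A, B, C, D]) : G.HasFeature :=
  hm.elim (E.hasFeature_of_mark hu) (E.hasFeature_of_mark hu.next)

/-- A triangle survives the doubling of a vertex if the 2-group is in the right position. -/
theorem isTriangle_map (E : Doubling H G ι k l A B C D) {p : H.Dart} (hp : H.IsTriangle p)
    (h : ∀ u, H.SameFace p u → H.rev u ≠ B ∧ H.rev u ≠ D) :
    G.IsTriangle (ι p) ∧ ∀ u, H.SameFace p u → ι (H.next u) = G.next (ι u) := by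
  have e : ∀ u, H.SameFace p u → ι (H.next u) = G.next (ι u) :=
    fun u hu => E.next_of_ne (h u hu).1 (h u hu).2
  have e1 := e p Equiv.Perm.SameCycle.rfl
  have e2 := e _ (sameFace_next p)
  have e3 := e _ ((sameFace_next p).trans (sameFace_next _))
  refine ⟨?_, e⟩
  obtain ⟨g1, g2, g3, g4, g5⟩ := isTriangle_iff.1 hp
  rw [isTriangle_iff, ← e1, ← e2, ← e3, g2]
  exact ⟨fun h => g1 (E.isOuter_iff.1 h), rfl, fun h => g3 (E.sameVertex_of h),
    fun h => g4 (E.sameVertex_of h), fun h => g5 (E.sameVertex_of h)⟩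

theorem _root_.MinimalLoop.IsTriangle.sameFace {p u : H.Dart} (hp : H.IsTriangle p)
    (hu : H.SameFace p u) : u = p ∨ u = H.next p ∨ u = H.next (H.next p) := by
  refine Equiv.Perm.SameCycle.induct hu
    (P := fun u => u = p ∨ u = H.next p ∨ u = H.next (H.next p)) (.inl rfl) ?_
  rintro z (rfl | rfl | rfl)
  · exact .inr (.inl rfl)
  · exact .inr (.inr rfl)
  · exact .inl hp.next_three

theorem _root_.MinimalLoop.IsTriangle.of_sameFace {p u : H.Dart} (hp : H.IsTriangle p)
    (hu : H.SameFace p u) : H.IsTriangle u := by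
  rcases hp.sameFace hu with rfl | rfl | rfl
  exacts [hp, hp.next, hp.next.next]

/-- Two sides of a triangle that end at the same vertex coincide. -/
theorem _root_.MinimalLoop.IsTriangle.eq_of_sameVertex {p u v : H.Dart} (hp : H.IsTriangle p)
    (hu : H.SameFace p u) (hv : H.SameFace p v) (huv : H.SameVertex (H.rev u) (H.rev v)) :
    u = v := by
  have h1 : H.SameVertex (H.next u) (H.next v) :=
    ((sameVertex_rev_next u).symm.trans huv).trans (sameVertex_rev_next v)
  obtain ⟨g1, g2, g3, g4, g5⟩ := isTriangle_iff.1 hp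
  rcases hp.sameFace hu with rfl | rfl | rfl <;> rcases hp.sameFace hv with rfl | rfl | rfl <;>
    first
    | rfl
    | (rw [g2] at h1; first | exact absurd h1 g3 | exact absurd h1.symm g3 | exact absurd h1 g5 |
        exact absurd h1.symm g5)
    | exact absurd h1 g4
    | exact absurd h1.symm g4

/-- By turning the 2-group if necessary one may assume that a given triangle survives the
doubling. -/
theorem reducible_of_triangle (E : Doubling H G ι k l A B C D) {p : H.Dart}
    (hp : H.IsTriangle p)
    (hyp : ∀ (G' : MinimalLoop) (ι : H.Dart → G'.Dart) (k l : G'.Dart) (A' B' C' D' : H.Dart),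
      Doubling H G' ι k l A' B' C' D' → (∀ u ∈ [A, B, C, D], u ∈ [A', B', C', D']) →
      (∀ u, H.SameFace p u → H.rev u ≠ B' ∧ H.rev u ≠ D') → Reducible G') : Reducible G := by
  by_cases h : ∀ u, H.SameFace p u → H.rev u ≠ B ∧ H.rev u ≠ D
  · exact hyp G ι k l A B C D E (fun _ => id) h
  push Not at h
  obtain ⟨u, hu, hu'⟩ := h
  have hBD : H.rev u = B ∨ H.rev u = D := by
    by_cases hB : H.rev u = B
    · exact .inl hB
    · exact .inr (hu' hB)
  have hmu : H.rev u ∈ [A, B, C, D] := by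
    rcases hBD with h | h <;> simp [h]
  refine .turn E.chart (hyp _ ι k l D A B C E.turn (fun v hv => ?_) fun v hv => ?_)
  · simp only [List.mem_cons] at hv ⊢
    tauto
  -- A triangle passes the doubled vertex only once. If it uses a split angle now, it does not use
  -- any of the angles that are split after the turn.
  have key : ∀ X, X = A ∨ X = C → H.rev v ≠ X := by
    intro X hX hvX
    have hmv : H.rev v ∈ [A, B, C, D] := by
      rcases hX with h | h <;> simp [hvX, h]
    have := hp.eq_of_sameVertex hu hv (E.mark_sameVertex' hmu hmv)
    subst this
    have N := E.chart.nodup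
    simp only [List.nodup_cons, List.mem_cons, List.not_mem_nil, not_or, or_false,
      E.inj.eq_iff] at N
    obtain ⟨Nk, Nd, Na, Nl, Nb, Nc, Nk', -⟩ := N
    rcases hX with rfl | rfl <;> rcases hBD with h | h <;> rw [hvX] at h
    exacts [Na.2.1 h, Nd.1 h.symm, Nb.1 h.symm, Nd.2.2.2.1 h.symm]
  exact ⟨key A (.inl rfl), key C (.inr rfl)⟩

/-- A 2-group of `H` that avoids the doubled vertex persists in `G`, and one that meets it yields a
feature by `hasFeature_of_mark`. A rots-triangle persists after at most one turn. -/
theorem reducible_of_hasFeature (E : Doubling H G ι k l A B C D) (hH : H.HasFeature) :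
    Reducible G := by
  rcases hH with ⟨u, hu, hb⟩ | ⟨u, v, hu, hv, hf, huv⟩ | ⟨p, hp, e, he, hg⟩
  · have ho : H.IsOuter (H.rev u) := hb.resolve_left hu.1
    have h1 : H.rev u ∉ [A, B, C, D] := fun h => not_isOuter_of_interior (E.mark_interior h) ho
    have h2 : H.rev (H.next u) ∉ [A, B, C, D] := by
      intro h
      have s := sameVertex_rev_next (H.next u)
      rw [hu.next_next] at s
      have hi := (isInteriorVertex_congr s).1 (E.mark_interior h)
      refine hi _ (sameVertex_rot u) (isOuter_rot.2 ho)
    have := E.isTwoGroup_map hu h1 h2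
    exact .feature (.inl ⟨ι u, this.1, .inr (by rw [← E.rev, E.isOuter_iff]; exact ho)⟩)
  · by_cases hmu : H.rev u ∈ [A, B, C, D] ∨ H.rev (H.next u) ∈ [A, B, C, D]
    · exact .feature (E.hasFeature_of_mark_or hu hmu)
    by_cases hmv : H.rev v ∈ [A, B, C, D] ∨ H.rev (H.next v) ∈ [A, B, C, D]
    · exact .feature (E.hasFeature_of_mark_or hv hmv)
    rw [not_or] at hmu hmv
    have hu' := E.isTwoGroup_map hu hmu.1 hmu.2
    have hv' := E.isTwoGroup_map hv hmv.1 hmv.2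
    refine .feature (.inr (.inl ⟨ι u, ι v, hu'.1, hv'.1, fun h => hf ?_, E.sameVertex_map ?_ huv⟩))
    · have : ι v = ι u ∨ ι v = G.next (ι u) := by
        refine Equiv.Perm.SameCycle.induct h (P := fun y => y = ι u ∨ y = G.next (ι u))
          (.inl rfl) ?_
        rintro z (rfl | rfl)
        · exact .inr rfl
        · exact .inl hu'.1.next_next
      rw [← hu'.2] at this
      rcases this with h | h
      · rw [E.inj h]; exact Equiv.Perm.SameCycle.rfl
      · rw [E.inj h]; exact sameFace_next u
    · have s := sameVertex_rev_next (H.next u)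
      rw [hu.next_next] at s
      rw [← E.mark_congr s]; exact hmu.2
  · have he' := hp.of_sameFace he
    by_cases hm : H.rev (H.rev e) ∈ [A, B, C, D] ∨ H.rev (H.next (H.rev e)) ∈ [A, B, C, D]
    · exact .feature (E.hasFeature_of_mark_or hg hm)
    rw [not_or] at hm
    refine E.reducible_of_triangle he' fun G' ι k l A' B' C' D' E' _ hgood => ?_
    obtain ⟨ht, -⟩ := E'.isTriangle_map he' hgood
    by_cases hm' : H.rev (H.rev e) ∈ [A', B', C', D'] ∨ H.rev (H.next (H.rev e)) ∈ [A', B', C', D']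
    · exact .feature (E'.hasFeature_of_mark_or hg hm')
    rw [not_or] at hm'
    refine .feature (ht.hasFeature (.inl ?_))
    rw [← E'.rev]
    exact (E'.isTwoGroup_map hg hm'.1 hm'.2).1

theorem reducible_of_boundary (E : Doubling H G ι k l A B C D) {p : H.Dart}
    (hp : H.IsTriangle p) (ho : H.IsOuter (H.rev p)) : Reducible G := by
  refine E.reducible_of_triangle hp fun G' ι k l A B C D E _ hgood => ?_
  refine .boundary (E.isTriangle_map hp hgood).1 ?_
  rwa [← E.rev, E.isOuter_iff]

/-- Precomposition with an isomorphism. -/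
theorem comp {H' : MinimalLoop} (E : Doubling H G ι k l A B C D) (ρ : H'.Dart ≃ H.Dart)
    (hrot : ∀ u, ρ (H'.rot u) = H.rot (ρ u)) (hrev : ∀ u, ρ (H'.rev u) = H.rev (ρ u))
    (hbase : ρ H'.base = H.base) : Doubling H' G (fun u => ι (ρ u)) k l (ρ.symm A) (ρ.symm B)
      (ρ.symm C) (ρ.symm D) where
  chart := by
    simp only [Equiv.apply_symm_apply]
    exact E.chart
  inj := E.inj.comp ρ.injective
  range := fun x => (E.range x).imp_right fun ⟨u, hu⟩ => ⟨ρ.symm u, by simpa using hu⟩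
  notMem := fun u => E.notMem _
  rev := fun u => by rw [hrev, E.rev]
  base := by rw [hbase, E.base]
  rot_A := by apply ρ.injective; simp [hrot, E.rot_A]
  rot_B := by apply ρ.injective; simp [hrot, E.rot_B]
  rot_C := by apply ρ.injective; simp [hrot, E.rot_C]
  rot_D := by apply ρ.injective; simp [hrot, E.rot_D]
  rot := by
    intro u hu
    rw [hrot, E.rot]
    intro h
    simp only [List.mem_cons, List.not_mem_nil, or_false] at h hu
    simp only [Equiv.eq_symm_apply] at hu
    exact hu h

end Doubling
end MinimalLoop

/-! ### Lifting operations to the doubled loop -/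

namespace MinimalLoop

variable {G H : MinimalLoop}

theorem BigonChart.flip_chart {k l a b c d p q r e f g h i j : G.Dart}
    (K : BigonChart G k l a b c d) (T : TriChart G p q r e f g h i j)
    (hd : ∀ x ∈ K.local_, x ∉ T.local_) : BigonChart T.flip k l a b c d where
  k_l := (T.flip_notMem (hd (G.rev k) (by simp [local_]))).trans K.k_l
  l_k := (T.flip_notMem (hd (G.rev l) (by simp [local_]))).trans K.l_k
  k_a := (T.flip_notMem (hd _ (by simp [local_]))).trans K.k_a
  a_b := (T.flip_notMem (hd _ (by simp [local_]))).trans K.a_b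
  b_l := (T.flip_notMem (hd _ (by simp [local_]))).trans K.b_l
  l_c := (T.flip_notMem (hd _ (by simp [local_]))).trans K.l_c
  c_d := (T.flip_notMem (hd _ (by simp [local_]))).trans K.c_d
  d_k := (T.flip_notMem (hd _ (by simp [local_]))).trans K.d_k
  nodup := K.nodup
  not_outer := fun x hx h => K.not_outer x hx (T.flip_isOuter.1 h)

theorem BigonChart.turn_chart_of_disjoint {k l a b c d k' l' a' b' c' d' : G.Dart}
    (K : BigonChart G k l a b c d) (T : BigonChart G k' l' a' b' c' d')
    (hd : ∀ x ∈ K.local_, x ∉ T.local_) : BigonChart T.turn k l a b c d where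
  k_l := (T.turn_notMem (hd (G.rev k) (by simp [local_]))).trans K.k_l
  l_k := (T.turn_notMem (hd (G.rev l) (by simp [local_]))).trans K.l_k
  k_a := (T.turn_notMem (hd _ (by simp [local_]))).trans K.k_a
  a_b := (T.turn_notMem (hd _ (by simp [local_]))).trans K.a_b
  b_l := (T.turn_notMem (hd _ (by simp [local_]))).trans K.b_l
  l_c := (T.turn_notMem (hd _ (by simp [local_]))).trans K.l_c
  c_d := (T.turn_notMem (hd _ (by simp [local_]))).trans K.c_d
  d_k := (T.turn_notMem (hd _ (by simp [local_]))).trans K.d_k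
  nodup := K.nodup
  not_outer := fun x hx h => K.not_outer x hx (T.turn_isOuter.1 h)

namespace Doubling

variable {ι : H.Dart → G.Dart} {k l : G.Dart} {A B C D : H.Dart}

theorem notMem_map (E : Doubling H G ι k l A B C D) {L : List H.Dart}
    (hL : ∀ x ∈ L, x ∉ [A, B, C, D]) : ∀ x ∈ E.chart.local_, x ∉ L.map ι := by
  intro x hx hx'
  obtain ⟨u, hu, rfl⟩ := List.mem_map.1 hx'
  exact E.notMem_local (hL u hu) hx

theorem mem_map (E : Doubling H G ι k l A B C D) {L : List H.Dart} {u : H.Dart} :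
    ι u ∈ L.map ι ↔ u ∈ L := by
  rw [List.mem_map]
  exact ⟨fun ⟨v, hv, h⟩ => E.inj h ▸ hv, fun h => ⟨u, h, rfl⟩⟩

section Turn

variable {k' l' a' b' c' d' : H.Dart}

theorem bigonChart_map (E : Doubling H G ι k l A B C D) (K : BigonChart H k' l' a' b' c' d')
    (hK : ∀ x ∈ K.local_, x ∉ [A, B, C, D]) :
    BigonChart G (ι k') (ι l') (ι a') (ι b') (ι c') (ι d') := by
  have hr : ∀ x ∈ K.local_, G.rot (ι x) = ι (H.rot x) := fun x hx => (E.rot x (hK x hx)).symm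
  simp only [BigonChart.local_, List.forall_mem_cons] at hr
  obtain ⟨h1, h2, h3, h4, h5, h6, h7, h8, -⟩ := hr
  have hn := (List.nodup_map_iff E.inj).2 K.nodup
  simp only [List.map_cons, List.map_nil, E.rev] at hn
  refine ⟨?_, ?_, ?_, ?_, ?_, ?_, ?_, ?_, hn, ?_⟩
  · rw [← E.rev, h7, K.k_l]
  · rw [← E.rev, h8, K.l_k]
  · rw [h1, K.k_a]
  · rw [h3, K.a_b]
  · rw [h5, K.b_l, E.rev]
  · rw [h4, K.l_c]
  · rw [h6, K.c_d]
  · rw [h2, K.d_k, E.rev]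
  · intro x hx
    have : x ∈ [k', d', a', l', b', c', H.rev k', H.rev l'].map ι := by
      simpa only [List.map_cons, List.map_nil, E.rev] using hx
    obtain ⟨u, hu, rfl⟩ := List.mem_map.1 this
    exact fun h => K.not_outer u hu (E.isOuter_iff.1 h)

/-- The operation changes other vertices than the doubling does, so the two commute; the same holds
for `flip_map`. -/
theorem turn_map (E : Doubling H G ι k l A B C D) (K : BigonChart H k' l' a' b' c' d')
    (hK : ∀ x ∈ K.local_, x ∉ [A, B, C, D]) :
    Doubling K.turn (E.bigonChart_map K hK).turn ι k l A B C D := by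
  set K' := E.bigonChart_map K hK with hK'
  have hloc : K'.local_ = K.local_.map ι := by
    simp only [BigonChart.local_, List.map_cons, List.map_nil, E.rev]
  have hd : ∀ x ∈ E.chart.local_, x ∉ K'.local_ := by rw [hloc]; exact E.notMem_map hK
  have hm : ∀ x ∈ [A, B, C, D], x ∉ K.local_ := fun x hx hx' => hK x hx' hx
  refine ⟨E.chart.turn_chart_of_disjoint K' hd, E.inj, E.range, E.notMem, E.rev, E.base,
    (K.turn_notMem (hm A (by simp))).trans E.rot_A, (K.turn_notMem (hm B (by simp))).trans E.rot_B,
    (K.turn_notMem (hm C (by simp))).trans E.rot_C, (K.turn_notMem (hm D (by simp))).trans E.rot_D,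
    ?_⟩
  intro (u : H.Dart) (hu : u ∉ [A, B, C, D])
  show ι (K.turnRot u) = K'.turnRot (ι u)
  by_cases hul : u ∈ K.local_
  · simp only [BigonChart.local_, List.mem_cons, List.not_mem_nil, or_false] at hul
    rcases hul with rfl | rfl | rfl | rfl | rfl | rfl | rfl | rfl
    · rw [K.turn_k, K'.turn_k]
    · rw [K.turn_d, K'.turn_d]
    · rw [K.turn_a, K'.turn_a, E.rev]
    · rw [K.turn_l, K'.turn_l]
    · rw [K.turn_b, K'.turn_b]
    · rw [K.turn_c, K'.turn_c, E.rev]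
    · rw [K.turn_rev_k, E.rev, K'.turn_rev_k]
    · rw [K.turn_rev_l, E.rev, K'.turn_rev_l]
  · rw [K.turn_notMem hul, K'.turn_notMem, E.rot u hu]
    rw [hloc, E.mem_map]; exact hul

end Turn

section Flip

variable {p q r e f g h i j : H.Dart}

theorem triChart_map (E : Doubling H G ι k l A B C D) (T : TriChart H p q r e f g h i j)
    (hT : ∀ x ∈ T.local_, x ∉ [A, B, C, D]) :
    TriChart G (ι p) (ι q) (ι r) (ι e) (ι f) (ι g) (ι h) (ι i) (ι j) := by
  have hr : ∀ x ∈ T.local_, G.rot (ι x) = ι (H.rot x) := fun x hx => (E.rot x (hT x hx)).symm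
  simp only [TriChart.local_, List.forall_mem_cons] at hr
  obtain ⟨h1, h2, h3, h4, h5, h6, h7, h8, h9, h10, h11, h12, -⟩ := hr
  have hn := (List.nodup_map_iff E.inj).2 T.nodup
  simp only [List.map_cons, List.map_nil, E.rev] at hn
  refine ⟨?_, ?_, ?_, ?_, ?_, ?_, ?_, ?_, ?_, ?_, ?_, ?_, hn, ?_⟩
  · rw [← E.rev, h8, T.p_q]
  · rw [← E.rev, h10, T.q_r]
  · rw [← E.rev, h3, T.r_p]
  · rw [h9, T.r_e]
  · rw [h1, T.e_f]
  · rw [h5, T.f_q, E.rev]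
  · rw [h7, T.q_g]
  · rw [h6, T.g_h]
  · rw [h11, T.h_p, E.rev]
  · rw [h2, T.p_i]
  · rw [h12, T.i_j]
  · rw [h4, T.j_r, E.rev]
  · intro x hx
    have : x ∈ [e, p, H.rev r, j, f, g, q, H.rev p, r, H.rev q, h, i].map ι := by
      simpa only [List.map_cons, List.map_nil, E.rev] using hx
    obtain ⟨u, hu, rfl⟩ := List.mem_map.1 this
    exact fun h => T.not_outer u hu (E.isOuter_iff.1 h)

theorem flip_map (E : Doubling H G ι k l A B C D) (T : TriChart H p q r e f g h i j)
    (hT : ∀ x ∈ T.local_, x ∉ [A, B, C, D]) :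
    Doubling T.flip (E.triChart_map T hT).flip ι k l A B C D := by
  set T' := E.triChart_map T hT with hT'
  have hloc : T'.local_ = T.local_.map ι := by
    simp only [TriChart.local_, List.map_cons, List.map_nil, E.rev]
  have hd : ∀ x ∈ E.chart.local_, x ∉ T'.local_ := by rw [hloc]; exact E.notMem_map hT
  have hm : ∀ x ∈ [A, B, C, D], x ∉ T.local_ := fun x hx hx' => hT x hx' hx
  refine ⟨E.chart.flip_chart T' hd, E.inj, E.range, E.notMem, E.rev, E.base,
    (T.flip_notMem (hm A (by simp))).trans E.rot_A, (T.flip_notMem (hm B (by simp))).trans E.rot_B,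
    (T.flip_notMem (hm C (by simp))).trans E.rot_C, (T.flip_notMem (hm D (by simp))).trans E.rot_D,
    ?_⟩
  intro (u : H.Dart) (hu : u ∉ [A, B, C, D])
  show ι (T.flipRot u) = T'.flipRot (ι u)
  by_cases hul : u ∈ T.local_
  · simp only [TriChart.local_, List.mem_cons, List.not_mem_nil, or_false] at hul
    rcases hul with rfl | rfl | rfl | rfl | rfl | rfl | rfl | rfl | rfl | rfl | rfl | rfl
    · rw [T.flip_e, T'.flip_e]
    · rw [T.flip_p, T'.flip_p, E.rev]
    · rw [T.flip_rev_r, E.rev, T'.flip_rev_r]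
    · rw [T.flip_j, T'.flip_j]
    · rw [T.flip_f, T'.flip_f]
    · rw [T.flip_g, T'.flip_g]
    · rw [T.flip_q, T'.flip_q, E.rev]
    · rw [T.flip_rev_p, E.rev, T'.flip_rev_p]
    · rw [T.flip_r, T'.flip_r, E.rev]
    · rw [T.flip_rev_q, E.rev, T'.flip_rev_q]
    · rw [T.flip_h, T'.flip_h]
    · rw [T.flip_i, T'.flip_i]
  · rw [T.flip_notMem hul, T'.flip_notMem, E.rot u hu]
    rw [hloc, E.mem_map]; exact hul

end Flip

/-! ### Moving a strand across a doubled vertex -/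

section Apex

variable {p q r e f g h i j : H.Dart}

/-- The first of the two operations that move a strand across both vertices of the 2-group. -/
theorem apex_first (E : Doubling H G ι k l (H.rev q) r e f) (T : TriChart H p q r e f g h i j) :
    TriChart G (ι p) (ι q) (ι r) (G.rev l) k (ι g) (ι h) (ι i) (ι j) := by
  have N := T.nodup
  simp only [List.nodup_cons, List.mem_cons, List.not_mem_nil, not_or, or_false] at N
  obtain ⟨Ne, Np, Nr', Nj, Nf, Ng, Nq, Np', Nr, Nq', Nh, -⟩ := N
  have hr : ∀ x, x ≠ H.rev q → x ≠ r → x ≠ e → x ≠ f → G.rot (ι x) = ι (H.rot x) :=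
    fun x h1 h2 h3 h4 => (E.rot x (by simp [h1, h2, h3, h4])).symm
  have n1 := E.chart.sides_ne.2.2.1
  have hk : ∀ u, k ≠ ι u := fun u hu => E.notMem u (by simp [← hu])
  have hl' : ∀ u, G.rev l ≠ ι u := fun u hu => E.notMem u (by simp [← hu])
  refine ⟨?_, ?_, ?_, ?_, ?_, ?_, ?_, ?_, ?_, ?_, ?_, ?_, ?_, ?_⟩
  · rw [← E.rev, hr _ Np'.2.1 Np'.1 (Ne.2.2.2.2.2.2.1 ·.symm) (Nf.2.2.1 ·.symm), T.p_q]
  · rw [← E.rev, E.chart.a_b]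
  · rw [← E.rev, hr _ Nr'.2.2.2.2.2.2.1 Nr'.2.2.2.2.2.1 (Ne.2.1 ·.symm) Nr'.2.1, T.r_p]
  · exact E.chart.b_l
  · exact E.chart.l_k
  · rw [E.chart.k_a, E.rev]
  · rw [hr _ Nq.2.2.1 Nq.2.1 (Ne.2.2.2.2.2.1 ·.symm) (Nf.2.1 ·.symm), T.q_g]
  · rw [hr _ Ng.2.2.2.1 Ng.2.2.1 (Ne.2.2.2.2.1 ·.symm) (Nf.1 ·.symm), T.g_h]
  · rw [hr _ (Nq'.1 ·.symm) (Nr.2.1 ·.symm) (Ne.2.2.2.2.2.2.2.2.2.1 ·.symm)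
      (Nf.2.2.2.2.2.1 ·.symm), T.h_p, E.rev]
  · rw [hr _ Np.2.2.2.2.2.2.2.1 Np.2.2.2.2.2.2.1 (Ne.1 ·.symm) Np.2.2.1, T.p_i]
  · rw [hr _ (Nq'.2 ·.symm) (Nr.2.2 ·.symm) (Ne.2.2.2.2.2.2.2.2.2.2 ·.symm)
      (Nf.2.2.2.2.2.2 ·.symm), T.i_j]
  · rw [hr _ Nj.2.2.2.2.2.1 Nj.2.2.2.2.1 (Ne.2.2.1 ·.symm) Nj.1, T.j_r, E.rev]
  · have hsub : [p, H.rev r, j, g, q, H.rev p, r, H.rev q, h, i].Nodup := by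
      refine T.nodup.sublist ?_
      exact .cons _ (.cons_cons _ (.cons_cons _ (.cons_cons _ (.cons _ (List.Sublist.refl _)))))
    have h1 := (List.nodup_map_iff E.inj).2 hsub
    have h2 : (G.rev l :: k :: [p, H.rev r, j, g, q, H.rev p, r, H.rev q, h, i].map ι).Nodup := by
      refine List.nodup_cons.2 ⟨?_, List.nodup_cons.2 ⟨?_, h1⟩⟩
      · rw [List.mem_cons, not_or]
        refine ⟨n1.symm, fun h => ?_⟩
        obtain ⟨u, -, hu⟩ := List.mem_map.1 h
        exact hl' u hu.symm
      · intro h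
        obtain ⟨u, -, hu⟩ := List.mem_map.1 h
        exact hk u hu.symm
    simp only [List.map_cons, List.map_nil, E.rev] at h2
    refine (List.Perm.nodup_iff ?_).1 h2
    have := List.Perm.map (![G.rev l, k, ι p, G.rev (ι r), ι j, ι g, ι q, G.rev (ι p), ι r,
      G.rev (ι q), ι h, ι i] : Fin 12 → G.Dart)
      (show List.Perm [0, 1, 2, 3, 4, 5, 6, 7, 8, 9, 10, 11] [0, 2, 3, 4, 1, 5, 6, 7, 8, 9, 10, 11]
        by decide)
    exact this
  · have key : ∀ u ∈ [e, p, H.rev r, j, f, g, q, H.rev p, r, H.rev q, h, i], ¬ G.IsOuter (ι u) :=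
      fun u hu hu' => T.not_outer u hu (E.isOuter_iff.1 hu')
    have ok : ¬ G.IsOuter k := E.chart.not_outer _ (by simp)
    have ol : ¬ G.IsOuter (G.rev l) := E.chart.not_outer _ (by simp)
    simp only [List.forall_mem_cons, E.rev] at key ⊢
    tauto

/-- The first operation moves the strand of `p` across one vertex into the 2-group. There it crosses
both sides, and the 2-group becomes a triangle with sides `p`, `k`, `l`, whose apex is the other
vertex. -/
theorem apex_second (E : Doubling H G ι k l (H.rev q) r e f) (T : TriChart H p q r e f g h i j) :
    TriChart (E.apex_first T).flip (ι p) k l (ι e) (ι f) (ι g) (ι q) (G.rev (ι r)) (ι j) := by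
  set T₁ := E.apex_first T with hT₁
  have N := T.nodup
  simp only [List.nodup_cons, List.mem_cons, List.not_mem_nil, not_or, or_false] at N
  obtain ⟨Ne, Np, Nr', Nj, Nf, Ng, Nq, Np', Nr, Nq', Nh, -⟩ := N
  obtain ⟨n1, n2, n3, n4, n5⟩ := E.chart.sides_ne
  have hk : ∀ u, k ≠ ι u := fun u hu => E.notMem u (by simp [← hu])
  have hl : ∀ u, l ≠ ι u := fun u hu => E.notMem u (by simp [← hu])
  have hk' : ∀ u, G.rev k ≠ ι u := fun u hu => E.notMem u (by simp [← hu])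
  have hl' : ∀ u, G.rev l ≠ ι u := fun u hu => E.notMem u (by simp [← hu])
  have ml : l ∉ T₁.local_ := by
    simp only [TriChart.local_, ← E.rev, List.mem_cons, List.not_mem_nil, or_false, not_or]
    exact ⟨n5, hl _, hl _, hl _, n1.symm, hl _, hl _, hl _, hl _, hl _, hl _, hl _⟩
  have mk' : G.rev k ∉ T₁.local_ := by
    simp only [TriChart.local_, ← E.rev, List.mem_cons, List.not_mem_nil, or_false, not_or]
    exact ⟨fun h => n1 (G.rev.injective h), hk' _, hk' _, hk' _, n2.symm, hk' _, hk' _, hk' _,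
      hk' _, hk' _, hk' _, hk' _⟩
  have me : ι e ∉ T₁.local_ := by
    simp only [TriChart.local_, ← E.rev, List.mem_cons, List.not_mem_nil, or_false, not_or,
      E.inj.eq_iff]
    exact ⟨(hl' _).symm, Ne.1, Ne.2.1, Ne.2.2.1, (hk _).symm, Ne.2.2.2.2⟩
  have mf : ι f ∉ T₁.local_ := by
    simp only [TriChart.local_, ← E.rev, List.mem_cons, List.not_mem_nil, or_false, not_or,
      E.inj.eq_iff]
    exact ⟨(hl' _).symm, (Np.2.2.1 ·.symm), (Nr'.2.1 ·.symm), (Nj.1 ·.symm), (hk _).symm, Nf⟩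
  refine ⟨T₁.flip_rev_p, (T₁.flip_notMem mk').trans E.chart.k_l, T₁.flip_e,
    (T₁.flip_notMem ml).trans E.chart.l_c, (T₁.flip_notMem me).trans E.chart.c_d,
    (T₁.flip_notMem mf).trans E.chart.d_k, T₁.flip_f, T₁.flip_g, T₁.flip_q, T₁.flip_p,
    T₁.flip_rev_r, T₁.flip_j, ?_, ?_⟩
  · show [ι e, ι p, G.rev l, ι j, ι f, ι g, k, G.rev (ι p), l, G.rev k, ι q, G.rev (ι r)].Nodup
    have hsub : [e, p, H.rev r, j, f, g, q, H.rev p].Nodup := by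
      refine T.nodup.sublist ?_
      have : [e, p, H.rev r, j, f, g, q, H.rev p] ++ [r, H.rev q, h, i] =
        [e, p, H.rev r, j, f, g, q, H.rev p, r, H.rev q, h, i] := rfl
      rw [← this]
      exact List.sublist_append_left _ _
    have h1 := (List.nodup_map_iff E.inj).2 hsub
    have h2 : ([k, l, G.rev k, G.rev l] ++
        [e, p, H.rev r, j, f, g, q, H.rev p].map ι).Nodup := by
      refine List.nodup_append.2 ⟨?_, h1, ?_⟩
      · simp only [List.nodup_cons, List.mem_cons, List.not_mem_nil, not_or, or_false,
          not_false_eq_true, List.nodup_nil, and_true]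
        exact ⟨⟨n1, n2, n3⟩, ⟨n4, n5⟩, fun h => n1 (G.rev.injective h)⟩
      · rintro x hx y hy rfl
        obtain ⟨u, -, rfl⟩ := List.mem_map.1 hy
        exact E.notMem u hx
    simp only [List.map_cons, List.map_nil, E.rev] at h2
    refine (List.Perm.nodup_iff ?_).1 h2
    have := List.Perm.map (![k, l, G.rev k, G.rev l, ι e, ι p, G.rev (ι r), ι j, ι f, ι g, ι q,
      G.rev (ι p)] : Fin 12 → G.Dart)
      (show List.Perm [0, 1, 2, 3, 4, 5, 6, 7, 8, 9, 10, 11] [4, 5, 3, 7, 8, 9, 0, 11, 1, 2, 10, 6]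
        by decide)
    exact this
  · show ∀ x ∈ [ι e, ι p, G.rev l, ι j, ι f, ι g, k, G.rev (ι p), l, G.rev k, ι q, G.rev (ι r)],
      ¬ T₁.flip.IsOuter x
    have key : ∀ u ∈ [e, p, H.rev r, j, f, g, q, H.rev p, r, H.rev q, h, i], ¬ G.IsOuter (ι u) :=
      fun u hu hu' => T.not_outer u hu (E.isOuter_iff.1 hu')
    have key2 := E.chart.not_outer
    simp only [List.forall_mem_cons, E.rev] at key key2 ⊢
    simp only [T₁.flip_isOuter]
    tauto

open Classical in
/-- The identification of darts after both operations. -/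
noncomputable def apexMap (ι : H.Dart → G.Dart) (k l : G.Dart) (q r : H.Dart) (u : H.Dart) :
    G.Dart :=
  if u = r then l else if u = H.rev r then G.rev l else if u = q then k else
    if u = H.rev q then G.rev k else ι u

/-- After both operations the edges of `q` and `r` bound a 2-group, while `k` and `l` are the sides
at `y` and `x` of the moved triangle. Thus the pairs have exchanged their roles, and this is what
`apexMap` records. -/
theorem apex_doubling (E : Doubling H G ι k l (H.rev q) r e f)
    (T : TriChart H p q r e f g h i j) :
    Doubling T.flip (E.apex_second T).flip (apexMap ι k l q r) (G.rev (ι q)) (G.rev (ι r))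
      h i r (H.rev q) := by
  classical
  set T₁ := E.apex_first T with hT₁
  set T₂ := E.apex_second T with hT₂
  have N := T.nodup
  simp only [List.nodup_cons, List.mem_cons, List.not_mem_nil, not_or, or_false] at N
  obtain ⟨Ne, Np, Nr', Nj, Nf, Ng, Nq, Np', Nr, Nq', Nh, -⟩ := N
  obtain ⟨n1, n2, n3, n4, n5⟩ := E.chart.sides_ne
  obtain ⟨m1, m2, m3, m4, m5, m6, m7, m8, m9, m10, m11, m12⟩ := T.sides_ne
  have hk : ∀ u, k ≠ ι u := fun u hu => E.notMem u (by simp [← hu])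
  have hl : ∀ u, l ≠ ι u := fun u hu => E.notMem u (by simp [← hu])
  have hk' : ∀ u, G.rev k ≠ ι u := fun u hu => E.notMem u (by simp [← hu])
  have hl' : ∀ u, G.rev l ≠ ι u := fun u hu => E.notMem u (by simp [← hu])
  have ar : apexMap ι k l q r r = l := by simp [apexMap]
  have ar' : apexMap ι k l q r (H.rev r) = G.rev l := by simp [apexMap, m12.symm]
  have aq : apexMap ι k l q r q = k := by simp [apexMap, m3, m9]
  have aq' : apexMap ι k l q r (H.rev q) = G.rev k := by
    simp [apexMap, m8.symm, m11.symm, m3]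
  have ax : ∀ u, u ≠ r → u ≠ H.rev r → u ≠ q → u ≠ H.rev q → apexMap ι k l q r u = ι u := by
    intro u h1 h2 h3 h4; simp [apexMap, h1, h2, h3, h4]
  have ah := ax h (Nr.2.1 ·.symm) (Nr'.2.2.2.2.2.2.2.1 ·.symm) (Nq.2.2.2.1 ·.symm) (Nq'.1 ·.symm)
  have ai := ax i (Nr.2.2 ·.symm) (Nr'.2.2.2.2.2.2.2.2 ·.symm) (Nq.2.2.2.2 ·.symm)
    (Nq'.2 ·.symm)
  have ae := ax e Ne.2.2.2.2.2.2.2.1 Ne.2.1 Ne.2.2.2.2.2.1 Ne.2.2.2.2.2.2.2.2.1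
  have af := ax f Nf.2.2.2.1 (Nr'.2.1 ·.symm) Nf.2.1 Nf.2.2.2.2.1
  have ag := ax g Ng.2.2.1 (Nr'.2.2.1 ·.symm) Ng.1 Ng.2.2.2.1
  have aj := ax j Nj.2.2.2.2.1 (Nr'.1 ·.symm) Nj.2.2.1 Nj.2.2.2.2.2.1
  have ap := ax p m2 m6 m1 m5
  have ap' := ax (H.rev p) Np'.1 (Nr'.2.2.2.2.1 ·.symm) (Nq.1 ·.symm) Np'.2.1
  have acases : ∀ u, apexMap ι k l q r u = ι u ∨ u = r ∨ u = H.rev r ∨ u = q ∨ u = H.rev q := by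
    intro u
    by_cases h1 : u = r
    · exact .inr (.inl h1)
    by_cases h2 : u = H.rev r
    · exact .inr (.inr (.inl h2))
    by_cases h3 : u = q
    · exact .inr (.inr (.inr (.inl h3)))
    by_cases h4 : u = H.rev q
    · exact .inr (.inr (.inr (.inr h4)))
    exact .inl (ax u h1 h2 h3 h4)
  have nl2 : ∀ u, u ∉ [e, p, j, f, g, H.rev p, q, H.rev r] → ι u ∉ T₂.local_ := by
    intro u hu hu'
    have : ι u ∈ [ι e, ι p, G.rev l, ι j, ι f, ι g, k, G.rev (ι p), l, G.rev k, ι q,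
      G.rev (ι r)] := hu'
    simp only [← E.rev, List.mem_cons, List.not_mem_nil, or_false, E.inj.eq_iff] at this hu
    have a1 := hk u; have a2 := hl u; have a3 := hk' u; have a4 := hl' u
    rcases this with h | h | h | h | h | h | h | h | h | h | h | h
    exacts [hu (.inl h), hu (.inr (.inl h)), a4 h.symm, hu (.inr (.inr (.inl h))),
      hu (.inr (.inr (.inr (.inl h)))), hu (.inr (.inr (.inr (.inr (.inl h))))), a1 h.symm,
      hu (.inr (.inr (.inr (.inr (.inr (.inl h)))))), a2 h.symm, a3 h.symm,
      hu (.inr (.inr (.inr (.inr (.inr (.inr (.inl h))))))),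
      hu (.inr (.inr (.inr (.inr (.inr (.inr (.inr h))))))) ]
  have nr : ι r ∉ T₂.local_ := by
    refine nl2 r ?_
    simp only [List.mem_cons, List.not_mem_nil, or_false, not_or]
    exact ⟨(Ne.2.2.2.2.2.2.2.1 ·.symm), m2.symm, (Nj.2.2.2.2.1 ·.symm), (Nf.2.2.2.1 ·.symm),
      (Ng.2.2.1 ·.symm), m10, m3.symm, m12⟩
  have nq' : ι (H.rev q) ∉ T₂.local_ := by
    refine nl2 _ ?_
    simp only [List.mem_cons, List.not_mem_nil, or_false, not_or]
    exact ⟨(Ne.2.2.2.2.2.2.2.2.1 ·.symm), m5.symm, (Nj.2.2.2.2.2.1 ·.symm),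
      (Nf.2.2.2.2.1 ·.symm), (Ng.2.2.2.1 ·.symm), (Np'.2.1 ·.symm), m8.symm,
      (Nr'.2.2.2.2.2.2.1 ·.symm)⟩
  have nh : ι h ∉ T₂.local_ := by
    refine nl2 _ ?_
    simp only [List.mem_cons, List.not_mem_nil, or_false, not_or]
    exact ⟨(Ne.2.2.2.2.2.2.2.2.2.1 ·.symm), (Np.2.2.2.2.2.2.2.2.1 ·.symm),
      (Nj.2.2.2.2.2.2.1 ·.symm), (Nf.2.2.2.2.2.1 ·.symm), (Ng.2.2.2.2.1 ·.symm),
      (Np'.2.2.1 ·.symm), (Nq.2.2.2.1 ·.symm), (Nr'.2.2.2.2.2.2.2.1 ·.symm)⟩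
  have ni : ι i ∉ T₂.local_ := by
    refine nl2 _ ?_
    simp only [List.mem_cons, List.not_mem_nil, or_false, not_or]
    exact ⟨(Ne.2.2.2.2.2.2.2.2.2.2 ·.symm), (Np.2.2.2.2.2.2.2.2.2 ·.symm),
      (Nj.2.2.2.2.2.2.2 ·.symm), (Nf.2.2.2.2.2.2 ·.symm), (Ng.2.2.2.2.2 ·.symm),
      (Np'.2.2.2 ·.symm), (Nq.2.2.2.2 ·.symm), (Nr'.2.2.2.2.2.2.2.2 ·.symm)⟩
  have rr : G.rev (G.rev (ι r)) = ι r := G.rev_rev _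
  have qq : G.rev (G.rev (ι q)) = ι q := G.rev_rev _
  obtain ⟨R, hR⟩ : ∃ R : G.Dart → G.Dart, R = T₂.flipRot := ⟨_, rfl⟩
  have cr : R (ι r) = G.rev (ι q) := (congrFun hR _).trans ((T₂.flip_notMem nr).trans T₁.flip_r)
  have cq' : R (ι (H.rev q)) = ι h := (congrFun hR _).trans ((T₂.flip_notMem nq').trans
    ((congrArg T₁.flipRot (E.rev q)).trans T₁.flip_rev_q))
  have ch : R (ι h) = ι i := (congrFun hR _).trans ((T₂.flip_notMem nh).trans T₁.flip_h)
  have ci : R (ι i) = ι r := (congrFun hR _).trans ((T₂.flip_notMem ni).trans T₁.flip_i)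
  have cq : R (ι q) = G.rev (ι r) := (congrFun hR _).trans T₂.flip_h
  have cr' : R (G.rev (ι r)) = l := (congrFun hR _).trans T₂.flip_i
  have cl : R l = G.rev k := (congrFun hR _).trans T₂.flip_r
  have ck' : R (G.rev k) = ι q := (congrFun hR _).trans T₂.flip_rev_q
  have ce : R (ι e) = ι p := (congrFun hR _).trans T₂.flip_e
  have cp : R (ι p) = G.rev l := (congrFun hR _).trans T₂.flip_p
  have cl' : R (G.rev l) = ι j := (congrFun hR _).trans T₂.flip_rev_r
  have cj : R (ι j) = ι e := (congrFun hR _).trans T₂.flip_j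
  have cf : R (ι f) = ι g := (congrFun hR _).trans T₂.flip_f
  have cg : R (ι g) = k := (congrFun hR _).trans T₂.flip_g
  have ck : R k = ι (H.rev p) := (congrFun hR _).trans (T₂.flip_q.trans (E.rev p).symm)
  have cp' : R (ι (H.rev p)) = ι f :=
    (congrFun hR _).trans ((congrArg T₂.flipRot (E.rev p)).trans T₂.flip_rev_p)
  have cu : ∀ u, u ∉ T.local_ → R (ι u) = ι (H.rot u) := by
    intro u hul
    simp only [TriChart.local_, List.mem_cons, List.not_mem_nil, or_false, not_or] at hul
    obtain ⟨u1, u2, u3, u4, u5, u6, u7, u8, u9, u10, u11, u12⟩ := hul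
    have n1 : ι u ∉ T₁.local_ := by
      simp only [TriChart.local_, ← E.rev, List.mem_cons, List.not_mem_nil, or_false, not_or,
        E.inj.eq_iff]
      exact ⟨(hl' u).symm, u2, u3, u4, (hk u).symm, u6, u7, u8, u9, u10, u11, u12⟩
    have n2 : ι u ∉ T₂.local_ := nl2 u (by simp [u1, u2, u3, u4, u5, u6, u7, u8])
    rw [E.rot u (by simp [u1, u5, u9, u10])]
    exact (congrFun hR _).trans ((T₂.flip_notMem n2).trans (T₁.flip_notMem n1))
  have chart : ∀ a b c d : G.Dart, a = ι h → b = ι i → c = l → d = G.rev k →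
      BigonChart T₂.flip (G.rev (ι q)) (G.rev (ι r)) a b c d := by
    rintro a b c d rfl rfl rfl rfl
    have hn : [G.rev (ι q), G.rev k, ι h, G.rev (ι r), ι i, c, G.rev (G.rev (ι q)),
        G.rev (G.rev (ι r))].Nodup := by
      rw [rr, qq, ← E.rev, ← E.rev]
      simp only [List.nodup_cons, List.mem_cons, List.not_mem_nil, not_or, or_false,
        not_false_eq_true, List.nodup_nil, and_true, E.inj.eq_iff]
      exact ⟨⟨(hk' _).symm, Nq'.1, (Nr'.2.2.2.2.2.2.1 ·.symm), Nq'.2, (hl _).symm, m8.symm,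
          m11.symm⟩, ⟨hk' _, hk' _, hk' _, n4.symm, hk' _, hk' _⟩,
        ⟨(Nr'.2.2.2.2.2.2.2.1 ·.symm), Nh, (hl _).symm, (Nq.2.2.2.1 ·.symm), (Nr.2.1 ·.symm)⟩,
        ⟨Nr'.2.2.2.2.2.2.2.2, (hl _).symm, m9.symm, m12.symm⟩,
        ⟨(hl _).symm, (Nq.2.2.2.2 ·.symm), (Nr.2.2 ·.symm)⟩, ⟨hl _, hl _⟩, m3⟩
    have ho : ∀ x ∈ [G.rev (ι q), G.rev k, ι h, G.rev (ι r), ι i, c, G.rev (G.rev (ι q)),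
        G.rev (G.rev (ι r))], ¬ G.IsOuter x := by
      rw [rr, qq]
      have key : ∀ u ∈ [e, p, H.rev r, j, f, g, q, H.rev p, r, H.rev q, h, i], ¬ G.IsOuter (ι u) :=
        fun u hu hu' => T.not_outer u hu (E.isOuter_iff.1 hu')
      have key2 := E.chart.not_outer
      simp only [List.forall_mem_cons, E.rev] at key key2 ⊢
      clear * - key key2
      tauto
    have RR : ∀ x y, R x = y → T₂.flipRot x = y := fun x y h => (congrFun hR x).symm.trans h
    exact ⟨RR _ _ ((congrArg R qq).trans cq), RR _ _ ((congrArg R rr).trans cr), RR _ _ ((E.rev q) ▸ cq'), RR _ _ ch,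
      RR _ _ (ci.trans rr.symm), RR _ _ cr', RR _ _ cl, RR _ _ (ck'.trans qq.symm), hn,
      fun x hx hx' => ho x hx (T₁.flip_isOuter.1 (T₂.flip_isOuter.1 hx'))⟩
  have inj : ∀ u v, apexMap ι k l q r u = apexMap ι k l q r v → u = v := by
    have key2 : ∀ u v, apexMap ι k l q r u = ι u → v = r ∨ v = H.rev r ∨ v = q ∨ v = H.rev q →
        apexMap ι k l q r u ≠ apexMap ι k l q r v := by
      intro u v hu hv
      rw [hu]
      rcases hv with hv | hv | hv | hv <;> rw [hv]
      · rw [ar]; exact (hl u).symm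
      · rw [ar']; exact (hl' u).symm
      · rw [aq]; exact (hk u).symm
      · rw [aq']; exact (hk' u).symm
    intro u v huv
    rcases acases u with hu | hu
    · rcases acases v with hv | hv
      · rw [hu, hv] at huv; exact E.inj huv
      · exact absurd huv (key2 u v hu hv)
    · rcases acases v with hv | hv
      · exact absurd huv.symm (key2 v u hv hu)
      · have i1 : G.rev l ≠ G.rev k := fun h => n1 (G.rev.injective h).symm
        rcases hu with hu | hu | hu | hu <;> rcases hv with hv | hv | hv | hv <;>
          rw [hu, hv] <;> rw [hu, hv] at huv <;> simp only [ar, ar', aq, aq'] at huv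
        exacts [absurd huv n5, absurd huv n1.symm, absurd huv n4, absurd huv.symm n5,
          absurd huv.symm n3, absurd huv i1, absurd huv n1, absurd huv n3, absurd huv n2,
          absurd huv.symm n4, absurd huv.symm i1, absurd huv.symm n2]
  have range : ∀ x, x ∈ [G.rev (ι q), G.rev (ι r), G.rev (G.rev (ι q)), G.rev (G.rev (ι r))] ∨
      ∃ u, apexMap ι k l q r u = x := by
    intro x
    rw [rr, qq, ← E.rev, ← E.rev]
    rcases E.range x with hx | ⟨u, rfl⟩
    · right
      simp only [List.mem_cons, List.not_mem_nil, or_false] at hx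
      rcases hx with rfl | rfl | rfl | rfl
      exacts [⟨q, aq⟩, ⟨r, ar⟩, ⟨_, aq'⟩, ⟨_, ar'⟩]
    · rcases acases u with hu | hu
      · exact .inr ⟨u, hu⟩
      · left
        rcases hu with hu | hu | hu | hu <;> rw [hu] <;> simp
  have notMem : ∀ u, apexMap ι k l q r u ∉
      [G.rev (ι q), G.rev (ι r), G.rev (G.rev (ι q)), G.rev (G.rev (ι r))] := by
    intro u
    rw [rr, qq, ← E.rev, ← E.rev]
    simp only [List.mem_cons, List.not_mem_nil, or_false, not_or]
    by_cases h1 : u = r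
    · rw [h1, ar]; exact ⟨hl _, hl _, hl _, hl _⟩
    by_cases h2 : u = H.rev r
    · rw [h2, ar']; exact ⟨hl' _, hl' _, hl' _, hl' _⟩
    by_cases h3 : u = q
    · rw [h3, aq]; exact ⟨hk _, hk _, hk _, hk _⟩
    by_cases h4 : u = H.rev q
    · rw [h4, aq']; exact ⟨hk' _, hk' _, hk' _, hk' _⟩
    rw [ax u h1 h2 h3 h4]
    simp only [E.inj.eq_iff]
    exact ⟨h4, h2, h3, h1⟩
  have rev : ∀ u, apexMap ι k l q r (H.rev u) = G.rev (apexMap ι k l q r u) := by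
    intro u
    by_cases h0 : u = r ∨ u = H.rev r ∨ u = q ∨ u = H.rev q
    · rcases h0 with rfl | rfl | rfl | rfl
      · rw [ar, ar']
      · rw [H.rev_rev, ar, ar', G.rev_rev]
      · rw [aq, aq']
      · rw [H.rev_rev, aq, aq', G.rev_rev]
    · simp only [not_or] at h0
      rw [ax u h0.1 h0.2.1 h0.2.2.1 h0.2.2.2, ax, E.rev]
      · exact fun h => h0.2.1 (rev_eq_iff.1 h)
      · exact fun h => h0.1 (H.rev.injective h)
      · exact fun h => h0.2.2.2 (rev_eq_iff.1 h)
      · exact fun h => h0.2.2.1 (H.rev.injective h)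
  have base : apexMap ι k l q r H.base = G.base := by
    rw [ax, E.base]
    · rintro h; exact T.not_outer r (by simp) (h ▸ isOuter_base)
    · rintro h; exact T.not_outer (H.rev r) (by simp) (h ▸ isOuter_base)
    · rintro h; exact T.not_outer q (by simp) (h ▸ isOuter_base)
    · rintro h; exact T.not_outer (H.rev q) (by simp) (h ▸ isOuter_base)
  have rot : ∀ u, u ∉ [h, i, r, H.rev q] →
      apexMap ι k l q r (T.flipRot u) = R (apexMap ι k l q r u) := by
    intro u hu
    by_cases hul : u ∈ T.local_
    · simp only [TriChart.local_, List.mem_cons, List.not_mem_nil, or_false] at hul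
      rcases hul with rfl | rfl | rfl | rfl | rfl | rfl | rfl | rfl | rfl | rfl | rfl | rfl
      · rw [T.flip_e, ap, ae, ce]
      · rw [T.flip_p, ar', ap, cp]
      · rw [T.flip_rev_r, ar', aj, cl']
      · rw [T.flip_j, ae, aj, cj]
      · rw [T.flip_f, ag, af, cf]
      · rw [T.flip_g, aq, ag, cg]
      · rw [T.flip_q, ap', aq, ck]
      · rw [T.flip_rev_p, af, ap', cp']
      · simp at hu
      · simp at hu
      · simp at hu
      · simp at hu
    · have hul' := fun h => hul (T.local_of_rot h)
      rw [T.flip_notMem hul]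
      have hul0 := hul
      simp only [TriChart.local_, List.mem_cons, List.not_mem_nil, or_false, not_or] at hul hul'
      obtain ⟨u1, u2, u3, u4, u5, u6, u7, u8, u9, u10, u11, u12⟩ := hul
      have hrot : H.rot u ≠ r ∧ H.rot u ≠ H.rev r ∧ H.rot u ≠ q ∧ H.rot u ≠ H.rev q := by
        refine ⟨fun h => hul' ?_, fun h => hul' ?_, fun h => hul' ?_, fun h => hul' ?_⟩ <;>
          simp [h]
      rw [ax u u9 u3 u7 u10, ax _ hrot.1 hrot.2.1 hrot.2.2.1 hrot.2.2.2, cu u hul0]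
  exact ⟨chart _ _ _ _ ah ai ar aq', fun u v => inj u v, range, notMem, rev, base, T.flip_h,
    T.flip_i, T.flip_r, T.flip_rev_q, fun u hu => (rot u hu).trans (congrFun hR _)⟩

end Apex

end Doubling
end MinimalLoop

/-! ### Independence of the apex and lifting of whole reductions -/

namespace MinimalLoop

variable {G H : MinimalLoop}

namespace TriChart

variable {p q r e f g h i j : G.Dart}

/-- The same triangle with another vertex as its apex. -/
theorem rotate (T : TriChart G p q r e f g h i j) : TriChart G r p q g h i j e f where
  p_q := T.r_p
  q_r := T.p_q
  r_p := T.q_r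
  r_e := T.q_g
  e_f := T.g_h
  f_q := T.h_p
  q_g := T.p_i
  g_h := T.i_j
  h_p := T.j_r
  p_i := T.r_e
  i_j := T.e_f
  j_r := T.f_q
  nodup := by
    refine (List.Perm.nodup_iff ?_).1 T.nodup
    have := List.Perm.map (![e, p, G.rev r, j, f, g, q, G.rev p, r, G.rev q, h, i] :
        Fin 12 → G.Dart)
      (show List.Perm [0, 1, 2, 3, 4, 5, 6, 7, 8, 9, 10, 11] [5, 8, 9, 4, 10, 11, 1, 2, 6, 7, 3, 0]
        by decide)
    exact this
  not_outer := by
    intro x hx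
    refine T.not_outer x ?_
    simp only [List.mem_cons] at hx ⊢
    tauto

theorem isTriangle_self (T : TriChart G p q r e f g h i j) : G.IsTriangle p := by
  have N := T.nodup
  simp only [List.nodup_cons, List.mem_cons, List.not_mem_nil, not_or, or_false] at N
  obtain ⟨Ne, Np, Nr', Nj, Nf, Ng, Nq, Np', Nr, Nq', Nh, -⟩ := N
  obtain ⟨m1, m2, m3, m4, m5, m6, m7, m8, m9, m10, m11, m12⟩ := T.sides_ne
  rw [isTriangle_iff, T.next_p, T.next_q, T.next_r]
  refine ⟨T.not_outer p (by simp), rfl, fun hs => ?_, fun hs => ?_, fun hs => ?_⟩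
  · have := mem_four T.p_i T.i_j T.j_r T.r_p (x := p) (by simp) hs
    simp only [List.mem_cons, List.not_mem_nil, or_false] at this
    rcases this with h | h | h | h
    exacts [m1 h.symm, Nq.2.2.2.2 h, Nj.2.2.1 h.symm, m9 h]
  · have := mem_four T.q_g T.g_h T.h_p T.p_q (x := q) (by simp) hs
    simp only [List.mem_cons, List.not_mem_nil, or_false] at this
    rcases this with h | h | h | h
    exacts [m3 h.symm, Ng.2.2.1 h.symm, Nr.2.1 h, m10 h]
  · have := mem_four T.p_i T.i_j T.j_r T.r_p (x := p) (by simp) hs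
    simp only [List.mem_cons, List.not_mem_nil, or_false] at this
    rcases this with h | h | h | h
    exacts [m2 h.symm, Nr.2.2 h, Nj.2.2.2.2.1 h.symm, m12 h]

open Classical in
/-- The cyclic permutation of the three sides, which identifies the results of moving the strands
across the different vertices of a triangle. -/
noncomputable def rotateEquiv (_ : TriChart G p q r e f g h i j) : Equiv.Perm G.Dart :=
  (Equiv.swap p r * Equiv.swap p q) *
    (Equiv.swap (G.rev p) (G.rev r) * Equiv.swap (G.rev p) (G.rev q))

variable (T : TriChart G p q r e f g h i j)

theorem rotateEquiv_sides : T.rotateEquiv p = q ∧ T.rotateEquiv q = r ∧ T.rotateEquiv r = p ∧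
    T.rotateEquiv (G.rev p) = G.rev q ∧ T.rotateEquiv (G.rev q) = G.rev r ∧
    T.rotateEquiv (G.rev r) = G.rev p := by
  classical
  obtain ⟨m1, m2, m3, m4, m5, m6, m7, m8, m9, m10, m11, m12⟩ := T.sides_ne
  have i1 : G.rev p ≠ G.rev q := fun h => m1 (G.rev.injective h)
  have i2 : G.rev p ≠ G.rev r := fun h => m2 (G.rev.injective h)
  have i3 : G.rev q ≠ G.rev r := fun h => m3 (G.rev.injective h)
  simp only [rotateEquiv, Equiv.Perm.mul_apply]
  refine ⟨?_, ?_, ?_, ?_, ?_, ?_⟩ <;>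
    simp [Equiv.swap_apply_def, m3, m4, m5, m6, m7, m8, m9, m10, m11, m12, m1.symm,
      m2.symm, m3.symm, m4.symm, m5.symm, m6.symm, m7.symm, m8.symm, m9.symm, m10.symm, m11.symm,
      m12.symm, i3, i1.symm, i2.symm, i3.symm]

theorem rotateEquiv_of_ne {u : G.Dart} (h1 : u ≠ p) (h2 : u ≠ q) (h3 : u ≠ r) (h4 : u ≠ G.rev p)
    (h5 : u ≠ G.rev q) (h6 : u ≠ G.rev r) : T.rotateEquiv u = u := by
  classical
  simp only [rotateEquiv, Equiv.Perm.mul_apply]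
  simp [Equiv.swap_apply_of_ne_of_ne, h1, h2, h3, h4, h5, h6]

theorem rotateEquiv_rev (u : G.Dart) : T.rotateEquiv (G.rev u) = G.rev (T.rotateEquiv u) := by
  obtain ⟨s1, s2, s3, s4, s5, s6⟩ := T.rotateEquiv_sides
  by_cases h1 : u = p
  · rw [h1, s1, s4]
  by_cases h2 : u = q
  · rw [h2, s2, s5]
  by_cases h3 : u = r
  · rw [h3, s3, s6]
  by_cases h4 : u = G.rev p
  · rw [h4, s4, G.rev_rev, G.rev_rev, s1]
  by_cases h5 : u = G.rev q
  · rw [h5, s5, G.rev_rev, G.rev_rev, s2]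
  by_cases h6 : u = G.rev r
  · rw [h6, s6, G.rev_rev, G.rev_rev, s3]
  rw [T.rotateEquiv_of_ne h1 h2 h3 h4 h5 h6, T.rotateEquiv_of_ne]
  exacts [fun h => h4 (rev_eq_iff.1 h), fun h => h5 (rev_eq_iff.1 h), fun h => h6 (rev_eq_iff.1 h),
    fun h => h1 (G.rev.injective h), fun h => h2 (G.rev.injective h),
    fun h => h3 (G.rev.injective h)]

theorem local_of_rotate {u : G.Dart} (h : u ∈ T.rotate.local_) : u ∈ T.local_ := by
  simp only [TriChart.local_, List.mem_cons, List.not_mem_nil, or_false] at h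
  rcases h with rfl | rfl | rfl | rfl | rfl | rfl | rfl | rfl | rfl | rfl | rfl | rfl <;>
    simp [TriChart.local_]

/-- Moving any of the three strands across the opposite vertex reverses the same triangle; the
results differ by the cyclic relabelling `p` to `q` to `r` to `p` of the sides, with all legs fixed.
-/
theorem rotateEquiv_rot (u : G.Dart) :
    T.rotateEquiv (T.flipRot u) = T.rotate.flipRot (T.rotateEquiv u) := by
  obtain ⟨s1, s2, s3, s4, s5, s6⟩ := T.rotateEquiv_sides
  have N := T.nodup
  simp only [List.nodup_cons, List.mem_cons, List.not_mem_nil, not_or, or_false] at N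
  obtain ⟨Ne, Np, Nr', Nj, Nf, Ng, Nq, Np', Nr, Nq', Nh, -⟩ := N
  have fix := @T.rotateEquiv_of_ne
  have fe := fix Ne.1 Ne.2.2.2.2.2.1 Ne.2.2.2.2.2.2.2.1 Ne.2.2.2.2.2.2.1 Ne.2.2.2.2.2.2.2.2.1
    Ne.2.1
  have fj := fix (Np.2.1 ·.symm) Nj.2.2.1 Nj.2.2.2.2.1 Nj.2.2.2.1 Nj.2.2.2.2.2.1 (Nr'.1 ·.symm)
  have ff := fix (Np.2.2.1 ·.symm) Nf.2.1 Nf.2.2.2.1 Nf.2.2.1 Nf.2.2.2.2.1 (Nr'.2.1 ·.symm)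
  have fg := fix (Np.2.2.2.1 ·.symm) Ng.1 Ng.2.2.1 Ng.2.1 Ng.2.2.2.1 (Nr'.2.2.1 ·.symm)
  have fh := fix (Np.2.2.2.2.2.2.2.2.1 ·.symm) (Nq.2.2.2.1 ·.symm) (Nr.2.1 ·.symm)
    (Np'.2.2.1 ·.symm) (Nq'.1 ·.symm) (Nr'.2.2.2.2.2.2.2.1 ·.symm)
  have fi := fix (Np.2.2.2.2.2.2.2.2.2 ·.symm) (Nq.2.2.2.2 ·.symm) (Nr.2.2 ·.symm)
    (Np'.2.2.2 ·.symm) (Nq'.2 ·.symm) (Nr'.2.2.2.2.2.2.2.2 ·.symm)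
  by_cases hul : u ∈ T.local_
  · simp only [TriChart.local_, List.mem_cons, List.not_mem_nil, or_false] at hul
    rcases hul with rfl | rfl | rfl | rfl | rfl | rfl | rfl | rfl | rfl | rfl | rfl | rfl
    · rw [T.flip_e, s1, fe, T.rotate.flip_i]
    · rw [T.flip_p, s6, s1, T.rotate.flip_r]
    · rw [T.flip_rev_r, s6, fj, T.rotate.flip_rev_q]
    · rw [T.flip_j, fe, fj, T.rotate.flip_h]
    · rw [T.flip_f, ff, fg, T.rotate.flip_j]
    · rw [T.flip_g, fg, s2, T.rotate.flip_e]
    · rw [T.flip_q, s4, s2, T.rotate.flip_p]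
    · rw [T.flip_rev_p, s4, ff, T.rotate.flip_rev_r]
    · rw [T.flip_r, s5, s3, T.rotate.flip_q]
    · rw [T.flip_rev_q, s5, fh, T.rotate.flip_rev_p]
    · rw [T.flip_h, fh, fi, T.rotate.flip_f]
    · rw [T.flip_i, fi, s3, T.rotate.flip_g]
  · have hul' : G.rot u ∉ T.local_ := fun h => hul (T.local_of_rot h)
    rw [T.flip_notMem hul]
    have hur : u ∉ T.rotate.local_ := fun h => hul (T.local_of_rotate h)
    simp only [TriChart.local_, List.mem_cons, List.not_mem_nil, or_false, not_or] at hul hul'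
    obtain ⟨u1, u2, u3, u4, u5, u6, u7, u8, u9, u10, u11, u12⟩ := hul
    obtain ⟨v1, v2, v3, v4, v5, v6, v7, v8, v9, v10, v11, v12⟩ := hul'
    rw [fix u2 u7 u9 u8 u10 u3, fix v2 v7 v9 v8 v10 v3, T.rotate.flip_notMem hur]

theorem rotateEquiv_base : T.rotateEquiv G.base = G.base := by
  have key : ∀ u ∈ T.local_, G.base ≠ u := fun u hu h => T.not_outer u hu (h ▸ isOuter_base)
  apply T.rotateEquiv_of_ne <;> exact key _ (by simp [local_])

end TriChart

namespace Doubling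

variable {ι : H.Dart → G.Dart} {k l : G.Dart} {A B C D : H.Dart} {p q r e f g h i j : H.Dart}

/-- Once the triangle survives the doubling, `rev q` and `r` are legs at the same vertex of the
2-group, so `rev q` is `A` or `C`. Up to exchanging the two sides of the 2-group the situation is
that of `apex_first`. -/
theorem reducible_of_flip_apex (E : Doubling H G ι k l A B C D) (T : TriChart H p q r e f g h i j)
    (hr : r ∈ [A, B, C, D])
    (ih : ∀ (G : MinimalLoop) (ι : H.Dart → G.Dart) (k l : G.Dart) (A B C D : H.Dart),
      Doubling T.flip G ι k l A B C D → Reducible G) : Reducible G := by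
  refine E.reducible_of_triangle T.isTriangle_self fun G' ι k l A B C D E hm hgood => ?_
  have main : ∀ {k l : G'.Dart} {A B C D : H.Dart}, Doubling H G' ι k l A B C D → A = H.rev q →
      Reducible G' := by
    intro k l A B C D E hA
    have hB : B = r := by rw [← E.rot_A, hA, T.q_r]
    have hC : C = e := by rw [← E.rot_B, hB, T.r_e]
    have hD : D = f := by rw [← E.rot_C, hC, T.e_f]
    rw [hA, hB, hC, hD] at E
    exact .flip (E.apex_first T) (.flip (E.apex_second T) (ih _ _ _ _ _ _ _ _ (E.apex_doubling T)))
  have hq : H.rev q ∈ [A, B, C, D] := E.mark_of_rot (by rw [T.q_r]; exact hm _ hr)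
  have hg := hgood q (by have := sameFace_next p; rwa [T.next_p] at this)
  simp only [List.mem_cons, List.not_mem_nil, or_false] at hq
  rcases hq with h | h | h | h
  exacts [main E h.symm, absurd h hg.1, main E.swap h.symm, absurd h hg.2]

theorem comp_rotate (T : TriChart H p q r e f g h i j)
    {ι : H.Dart → G.Dart} {A B C D : H.Dart} (E : Doubling T.rotate.flip G ι k l A B C D) :
    ∃ (ι' : H.Dart → G.Dart) (A' B' C' D' : H.Dart), Doubling T.flip G ι' k l A' B' C' D' :=
  ⟨_, _, _, _, _, E.comp (H' := T.flip) T.rotateEquiv T.rotateEquiv_rot T.rotateEquiv_rev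
    T.rotateEquiv_base⟩

/-- If a vertex of the triangle is the doubled one, it is made the apex by a rotation of the
triangle. This does not matter for the hypothesis on the result, by `comp_rotate`. Otherwise the
operation is disjoint from the doubling. -/
theorem reducible_of_flip (E : Doubling H G ι k l A B C D) (T : TriChart H p q r e f g h i j)
    (ih : ∀ (G : MinimalLoop) (ι : H.Dart → G.Dart) (k l : G.Dart) (A B C D : H.Dart),
      Doubling T.flip G ι k l A B C D → Reducible G) : Reducible G := by
  have ih1 : ∀ (G : MinimalLoop) (ι : H.Dart → G.Dart) (k l : G.Dart) (A B C D : H.Dart),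
      Doubling T.rotate.flip G ι k l A B C D → Reducible G := by
    intro G ι k l A B C D E
    obtain ⟨ι', A', B', C', D', E'⟩ := comp_rotate T E
    exact ih _ _ _ _ _ _ _ _ E'
  have ih2 : ∀ (G : MinimalLoop) (ι : H.Dart → G.Dart) (k l : G.Dart) (A B C D : H.Dart),
      Doubling T.rotate.rotate.flip G ι k l A B C D → Reducible G := by
    intro G ι k l A B C D E
    obtain ⟨ι', A', B', C', D', E'⟩ := comp_rotate T.rotate E
    exact ih1 _ _ _ _ _ _ _ _ E'
  by_cases hr : r ∈ [A, B, C, D]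
  · exact E.reducible_of_flip_apex T hr ih
  by_cases hq : q ∈ [A, B, C, D]
  · exact E.reducible_of_flip_apex T.rotate hq ih1
  by_cases hp : p ∈ [A, B, C, D]
  · exact E.reducible_of_flip_apex T.rotate.rotate hp ih2
  have hT : ∀ x ∈ T.local_, x ∉ [A, B, C, D] := by
    have step : ∀ {u v : H.Dart}, H.rot u = v → u ∉ [A, B, C, D] → v ∉ [A, B, C, D] :=
      fun h hu hv => hu (E.mark_of_rot (h ▸ hv))
    have he := step T.r_e hr
    have hf := step T.e_f he
    have hg := step T.q_g hq
    have hh := step T.g_h hg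
    have hi := step T.p_i hp
    have hj := step T.i_j hi
    have h1 := step T.f_q hf
    have h2 := step T.h_p hh
    have h3 := step T.j_r hj
    simp only [TriChart.local_, List.forall_mem_cons]
    exact ⟨he, hp, h3, hj, hf, hg, hq, h2, hr, h1, hh, hi, by simp⟩
  exact .flip (E.triChart_map T hT) (ih _ _ _ _ _ _ _ _ (E.flip_map T hT))

theorem reducible_of_turn {k' l' a' b' c' d' : H.Dart} (E : Doubling H G ι k l A B C D)
    (K : BigonChart H k' l' a' b' c' d')
    (ih : ∀ (G : MinimalLoop) (ι : H.Dart → G.Dart) (k l : G.Dart) (A B C D : H.Dart),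
      Doubling K.turn G ι k l A B C D → Reducible G) : Reducible G := by
  by_cases hm : H.rev k' ∈ [A, B, C, D] ∨ H.rev (H.next k') ∈ [A, B, C, D]
  · exact .feature (E.hasFeature_of_mark_or K.isTwoGroup hm)
  rw [not_or, K.next_k] at hm
  have hK : ∀ x ∈ K.local_, x ∉ [A, B, C, D] := by
    have step : ∀ {u v : H.Dart}, H.rot u = v → u ∉ [A, B, C, D] → v ∉ [A, B, C, D] :=
      fun h hu hv => hu (E.mark_of_rot (h ▸ hv))
    have h1 := step K.k_l hm.1
    have h2 := step K.l_k hm.2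
    have h3 := step K.k_a h2
    have h4 := step K.a_b h3
    have h5 := step K.l_c h1
    have h6 := step K.c_d h5
    simp only [BigonChart.local_, List.forall_mem_cons]
    exact ⟨h2, h6, h3, h1, h4, h5, hm.1, hm.2, by simp⟩
  exact .turn (E.bigonChart_map K hK) (ih _ _ _ _ _ _ _ _ (E.turn_map K hK))

end Doubling

/-- If the result of collapsing a 2-group to a vertex is reducible, so is the original. -/
theorem Reducible.of_doubling (hH : Reducible H) : ∀ (G : MinimalLoop) (ι : H.Dart → G.Dart)
    (k l : G.Dart) (A B C D : H.Dart), Doubling H G ι k l A B C D → Reducible G := by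
  induction hH with
  | feature h => exact fun G ι k l A B C D E => E.reducible_of_hasFeature h
  | boundary h h' => exact fun G ι k l A B C D E => E.reducible_of_boundary h h'
  | flip T _ ih => exact fun G ι k l A B C D E => E.reducible_of_flip T ih
  | turn T _ ih => exact fun G ι k l A B C D E => E.reducible_of_turn T ih

end MinimalLoop

/-! ### Convex regions -/

namespace MinimalLoop

variable {G : MinimalLoop}

/-- A convex region: a union of inner faces, given by the set of darts that have it on their left,
which has no reflex angles and whose complement is connected. -/
structure Region (G : MinimalLoop) (R : Set G.Dart) : Prop where
  -- A dart stands for the angle at its initial vertex in the face on its left. As `rot d` and `rev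
  -- d` have the same left face, this says that `R` is a union of faces.
  rot_iff : ∀ d, G.rot d ∈ R ↔ G.rev d ∈ R
  not_outer : ∀ d ∈ R, ¬ G.IsOuter d
  -- A single excluded inner angle between two angles of the region would leave a reflex angle or
  -- two opposite angles in the region.
  convex : ∀ d ∈ R, G.rot d ∉ R → ¬ G.IsOuter (G.rot d) → G.rot (G.rot d) ∉ R
  -- From the base one may turn around vertices and run along every edge that does not have the
  -- region on both sides.
  coconn : ∀ X : Set G.Dart, G.base ∈ X → (∀ d ∈ X, G.rot d ∈ X) →
    (∀ d ∈ X, ¬ (d ∈ R ∧ G.rot d ∈ R) → G.rev d ∈ X) → ∀ d, d ∉ R → d ∈ X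

/-- All faces at the initial vertex of `d` belong to the region. -/
def Deep (R : Set G.Dart) (d : G.Dart) : Prop := ∀ e, G.SameVertex d e → e ∈ R

/-- The darts at which the region has a corner. -/
def corners (R : Set G.Dart) : Set G.Dart := {d | d ∈ R ∧ G.rot d ∉ R ∧ G.rot.symm d ∉ R}

namespace Region

variable {R : Set G.Dart}

theorem next_iff (hR : G.Region R) (d : G.Dart) : G.next d ∈ R ↔ d ∈ R := by
  rw [next_apply, hR.rot_iff, G.rev_rev]

theorem deep_congr {d e : G.Dart} (h : G.SameVertex d e) : Deep R d ↔ Deep R e :=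
  ⟨fun hd x hx => hd x (h.trans hx), fun hd x hx => hd x (h.symm.trans hx)⟩

theorem interior_of_deep (hR : G.Region R) {d : G.Dart} (h : Deep R d) : G.IsInteriorVertex d :=
  fun e he => hR.not_outer e (h e he)

/-- The vertex has degree 4, and convexity does not allow its fourth angle to be the only excluded
one. -/
theorem deep_of_three (hR : G.Region R) {d : G.Dart} (h0 : d ∈ R) (h1 : G.rot d ∈ R)
    (h2 : G.rot (G.rot d) ∈ R) : Deep R d := by
  have hi := isInteriorVertex_of (hR.not_outer _ h0) (hR.not_outer _ h1) (hR.not_outer _ h2)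
  have h4 := hi.rot_four
  have h3 : G.rot (G.rot (G.rot d)) ∈ R := by
    by_contra h
    refine hR.convex _ h2 h ?_ (by rwa [h4])
    rw [← isInteriorVertex_rot, ← isInteriorVertex_rot, ← isInteriorVertex_rot] at hi
    exact not_isOuter_of_interior hi
  intro e he
  have := mem_four rfl rfl rfl h4 (x := d) (by simp) he
  simp only [List.mem_cons, List.not_mem_nil, or_false] at this
  rcases this with rfl | rfl | rfl | rfl <;> assumption

/-- On the boundary of a region, at most one edge enters its interior. -/
theorem eq_of_not_deep (hR : G.Region R) {d e : G.Dart} (hd : ¬ Deep R d) (h0 : d ∈ R)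
    (h1 : G.rot d ∈ R) (h2 : e ∈ R) (h3 : G.rot e ∈ R) (hde : G.SameVertex d e) : d = e := by
  by_cases hi : G.IsInteriorVertex d
  · have := mem_four rfl rfl rfl hi.rot_four (x := d) (by simp) hde
    simp only [List.mem_cons, List.not_mem_nil, or_false] at this
    rcases this with rfl | rfl | rfl | rfl
    · rfl
    · exact absurd (hR.deep_of_three h0 h1 h3) hd
    · exact absurd (hR.deep_of_three h0 h1 h2) hd
    · rw [hi.rot_four] at h3
      refine absurd ((deep_congr hde).2 (hR.deep_of_three h2 ?_ ?_)) hd <;> rw [hi.rot_four] <;>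
        assumption
  · have key : ∀ o, G.IsOuter o → ∀ x, G.SameVertex o x → x ∈ R → G.rot x ∈ R → x = G.rot o := by
      intro o ho x hx hx0 hx1
      have ho' : o ∉ R := fun h => hR.not_outer _ h ho
      have h3 : G.rot (G.rot o) = o ∨ G.rot (G.rot (G.rot o)) = o := by
        by_cases hb : o = G.base
        · left; rw [hb]; exact rot_base
        · exact .inr (ho.rot_three hb)
      have : x = o ∨ x = G.rot o ∨ x = G.rot (G.rot o) := by
        refine Equiv.Perm.SameCycle.induct hx
          (P := fun x => x = o ∨ x = G.rot o ∨ x = G.rot (G.rot o)) (.inl rfl) ?_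
        rintro _ (rfl | rfl | rfl)
        · exact .inr (.inl rfl)
        · exact .inr (.inr rfl)
        · rcases h3 with h3 | h3
          · right; left; rw [h3]
          · exact .inl h3
      rcases this with rfl | rfl | rfl
      · exact absurd hx0 ho'
      · rfl
      · rcases h3 with h3 | h3
        · rw [h3] at hx0; exact absurd hx0 ho'
        · rw [h3] at hx1; exact absurd hx1 ho'
    unfold IsInteriorVertex at hi
    push Not at hi
    obtain ⟨o, hdo, ho⟩ := hi
    rw [key o ho d hdo.symm h0 h1, key o ho e (hdo.symm.trans hde) h2 h3]

open Classical in
/-- Two vertices outside the interior of a region are joined by a chain outside the interior. -/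
theorem exists_chain (hR : G.Region R) {a b : G.Dart} (ha : ¬ Deep R a) (hb : ¬ Deep R b) :
    ∃ q : G.Dart → ZMod 2, (∀ x, q (G.rev x) = q x) ∧ (∀ x, x ∈ R → G.rot x ∈ R → q x = 0) ∧
      ∀ x, vertexSum G.rot q x =
        (if G.SameVertex x a then 1 else 0) + if G.SameVertex x b then 1 else 0 := by
  have key : ∀ y, ¬ Deep R y → ∃ q : G.Dart → ZMod 2, (∀ x, q (G.rev x) = q x) ∧
      (∀ x, x ∈ R → G.rot x ∈ R → q x = 0) ∧ ∀ x, vertexSum G.rot q x =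
        (if G.SameVertex x G.base then 1 else 0) + if G.SameVertex x y then 1 else 0 := by
    have cong : ∀ {y y' : G.Dart}, G.SameVertex y y' → ∀ x,
        (if G.SameVertex x y then 1 else 0 : ZMod 2) = if G.SameVertex x y' then 1 else 0 := by
      intro y y' h x
      have : G.SameVertex x y ↔ G.SameVertex x y' := ⟨fun h' => h'.trans h, fun h' => h'.trans h.symm⟩
      simp only [this]
    intro y hy
    unfold Deep at hy
    push Not at hy
    obtain ⟨y', hyy, hy'⟩ := hy
    -- The set consists of the darts whose vertex can be joined to the base vertex by such a chain.
    have main := hR.coconn {y | ∃ q : G.Dart → ZMod 2, (∀ x, q (G.rev x) = q x) ∧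
      (∀ x, x ∈ R → G.rot x ∈ R → q x = 0) ∧ ∀ x, vertexSum G.rot q x =
        (if G.SameVertex x G.base then 1 else 0) + if G.SameVertex x y then 1 else 0} ?_ ?_ ?_ y' hy'
    · obtain ⟨q, h1, h2, h3⟩ := main
      exact ⟨q, h1, h2, fun x => by rw [h3, cong hyy]⟩
    · exact ⟨fun _ => 0, fun _ => rfl, fun _ _ _ => rfl, fun x => by
        rw [vertexSum_zero, CharTwo.add_self_eq_zero]⟩
    · rintro d ⟨q, h1, h2, h3⟩
      exact ⟨q, h1, h2, fun x => by rw [h3, cong (sameVertex_rot d)]⟩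
    rintro d ⟨q, h1, h2, h3⟩ hd
    refine ⟨fun x => q x + ((if x = d then 1 else 0) + if x = G.rev d then 1 else 0), fun x => ?_,
      fun x hx hx' => ?_, fun x => ?_⟩
    · have e1 : G.rev x = d ↔ x = G.rev d := rev_eq_iff
      have e2 : G.rev x = G.rev d ↔ x = d := G.rev.injective.eq_iff
      simp only [h1, e1, e2, add_comm]
    · have n1 : x ≠ d := by rintro rfl; exact hd ⟨hx, hx'⟩
      have n2 : x ≠ G.rev d := by
        rintro rfl
        exact hd ⟨by rwa [hR.rot_iff, G.rev_rev] at hx', (hR.rot_iff d).2 hx⟩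
      simp only [h2 x hx hx', if_neg n1, if_neg n2, add_zero]
    · rw [vertexSum_add, vertexSum_add, vertexSum_single, vertexSum_single, h3]
      change _ + _ + ((if G.SameVertex x d then 1 else 0) + if G.SameVertex x (G.rev d) then 1 else 0) = _
      have : ∀ a b c : ZMod 2, a + b + (b + c) = a + c := by decide
      exact this _ _ _
  obtain ⟨q, h1, h2, h3⟩ := key a ha
  obtain ⟨q', h1', h2', h3'⟩ := key b hb
  refine ⟨fun x => q x + q' x, fun x => by simp only [h1, h1'],
    fun x hx hx' => by simp only [h2 x hx hx', h2' x hx hx', add_zero], fun x => ?_⟩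
  · rw [vertexSum_add, h3, h3']
    have : ∀ a b c : ZMod 2, a + b + (a + c) = b + c := by decide
    exact this _ _ _

/-- The part of a region on which a potential takes the value `c`. -/
def piece (R : Set G.Dart) (w : G.Dart → ZMod 2) (c : ZMod 2) : Set G.Dart := {d | d ∈ R ∧ w d = c}

/-- Inside `R` the two colours of `w` are separated by the edges of `z`. At a vertex where three
consecutive angles lie in `R`, `hconv` forbids an excluded middle angle between two edges of `z`.
`hreach` says that the edges of `z` in `R` can be reached from outside the piece, which makes its
complement connected. -/
theorem region_piece (hR : G.Region R) {w z : G.Dart → ZMod 2} {c : ZMod 2}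
    (hw : ∀ d, w (G.rot d) = w (G.rev d))
    (hwz : ∀ d ∈ R, G.rot d ∈ R → w d + w (G.rot d) = z d)
    (hconv : ∀ d ∈ R, G.rot d ∈ R → G.rot (G.rot d) ∈ R → z d ≠ 0 → z (G.rot d) ≠ 0 → w d ≠ c)
    (hreach : ∀ X : Set G.Dart, G.base ∈ X → (∀ d ∈ X, G.rot d ∈ X) →
      (∀ d ∈ X, ¬ (d ∈ piece R w c ∧ G.rot d ∈ piece R w c) → G.rev d ∈ X) →
      (∀ d, d ∉ R → d ∈ X) → ∀ d ∈ R, G.rot d ∈ R → z d ≠ 0 → d ∈ X) :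
    G.Region (piece R w c) where
  rot_iff d := by
    change G.rot d ∈ R ∧ w (G.rot d) = c ↔ G.rev d ∈ R ∧ w (G.rev d) = c
    rw [hw, hR.rot_iff]
  not_outer d hd := hR.not_outer d hd.1
  convex d hd hd1 ho hd2 := by
    by_cases h1 : G.rot d ∈ R
    · have h1' : w (G.rot d) ≠ c := fun h => hd1 ⟨h1, h⟩
      refine hconv d hd.1 h1 hd2.1 ?_ ?_ hd.2
      · rw [← hwz d hd.1 h1, Ne, CharTwo.add_eq_zero, hd.2]; exact h1'.symm
      · rw [← hwz _ h1 hd2.1, Ne, CharTwo.add_eq_zero, hd2.2]; exact h1'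
    · exact hR.convex d hd.1 h1 ho hd2.1
  coconn X hb hrot hrev := by
    have hX : ∀ d, d ∉ R → d ∈ X :=
      hR.coconn X hb hrot fun d hd hd' => hrev d hd fun h => hd' ⟨h.1.1, h.2.1⟩
    have hZ := hreach X hb hrot hrev hX
    have hrot' : ∀ d, d ∉ X → G.rot d ∉ X := fun d hd h => hd (G.rot.mem_of_closed hrot h)
    by_contra! hcon
    obtain ⟨y, hy, hyX⟩ := hcon
    have hyR : ∀ d, d ∉ X → d ∈ R := fun d hd => by by_contra h; exact hd (hX d h)
    have hyw : w y ≠ c := fun h => hy ⟨hyR y hyX, h⟩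
    have step : ∀ d, d ∉ X → w (G.rot d) = w d := by
      intro d hd
      have := hwz d (hyR d hd) (hyR _ (hrot' d hd))
      by_cases h : z d = 0
      · rw [h, CharTwo.add_eq_zero] at this; exact this.symm
      · exact absurd (hZ d (hyR d hd) (hyR _ (hrot' d hd)) h) hd
    -- Among the unreached darts no edge of `z` occurs, so their colour cannot change. Those of the
    -- wrong colour form a set closed under everything, which would contain the base.
    have := G.eq_univ {d | d ∉ X ∧ w d ≠ c} ⟨y, hyX, hyw⟩
      (fun d hd => ⟨hrot' d hd.1, by rw [step d hd.1]; exact hd.2⟩)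
      (fun d hd => ⟨fun h => ?_, by rw [← hw, step d hd.1]; exact hd.2⟩)
    · have hb' : G.base ∈ ({d | d ∉ X ∧ w d ≠ c} : Set G.Dart) := by rw [this]; trivial
      exact hb'.1 hb
    · refine hd.1 ?_
      have := hrev _ h ?_
      · rwa [G.rev_rev] at this
      · rintro ⟨h1, h2⟩
        have h3 : w (G.rot (G.rev d)) = c := h2.2
        rw [hw, G.rev_rev] at h3
        exact hd.2 h3

end Region
end MinimalLoop

/-! ### Straight paths and the loops they enclose -/

namespace MinimalLoop

variable {G : MinimalLoop}

open Classical in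
/-- The sum (mod 2) of the edges of a walk. -/
noncomputable def chain (d : ℕ → G.Dart) (n : ℕ) (y : G.Dart) : ZMod 2 :=
  ∑ k ∈ Finset.range n, ((if y = d k then 1 else 0) + if y = G.rev (d k) then 1 else 0)

open Classical in
theorem chain_rev (d : ℕ → G.Dart) (n : ℕ) (y : G.Dart) :
    chain d n (G.rev y) = chain d n y := by
  have e1 : ∀ k, G.rev y = d k ↔ y = G.rev (d k) := fun _ => rev_eq_iff
  have e2 : ∀ k, G.rev y = G.rev (d k) ↔ y = d k := fun _ => G.rev.injective.eq_iff
  unfold chain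
  refine Finset.sum_congr rfl fun k _ => ?_
  rw [add_comm]
  exact congrArg₂ (· + ·) (if_congr (e2 k) rfl rfl) (if_congr (e1 k) rfl rfl)

open Classical in
-- Each intermediate vertex is the end of one edge and the beginning of the next, and these
-- contributions cancel mod 2.
theorem vertexSum_chain {d : ℕ → G.Dart} {n : ℕ}
    (h : ∀ k < n, G.SameVertex (G.rev (d k)) (d (k + 1))) (x : G.Dart) :
    vertexSum G.rot (chain d n) x =
      (if G.SameVertex x (d 0) then 1 else 0) + if G.SameVertex x (d n) then 1 else 0 := by
  induction n with
  | zero =>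
    have : chain d 0 = fun _ => 0 := by ext y; simp [chain]
    rw [this, vertexSum_zero, CharTwo.add_self_eq_zero]
  | succ n ih =>
    have e : chain d (n + 1) = fun y => chain d n y +
        ((if y = d n then 1 else 0) + if y = G.rev (d n) then 1 else 0) := by
      ext y; exact Finset.sum_range_succ _ _
    have c : G.SameVertex x (G.rev (d n)) ↔ G.SameVertex x (d (n + 1)) :=
      ⟨fun h' => h'.trans (h n (by omega)), fun h' => h'.trans (h n (by omega)).symm⟩
    rw [e, vertexSum_add, vertexSum_add, vertexSum_single, vertexSum_single,
      ih fun k hk => h k (by omega)]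
    change _ + _ + ((if G.SameVertex x (d n) then 1 else 0) +
      if G.SameVertex x (G.rev (d n)) then 1 else 0) = _
    simp only [c]
    have : ∀ a b c : ZMod 2, a + b + (b + c) = a + c := by decide
    exact this _ _ _

theorem exists_of_chain {d : ℕ → G.Dart} {n : ℕ} {y : G.Dart} (h : chain d n y ≠ 0) :
    ∃ k < n, y = d k ∨ y = G.rev (d k) := by
  by_contra! hc
  refine h (Finset.sum_eq_zero fun k hk => ?_)
  have := hc k (Finset.mem_range.1 hk)
  rw [if_neg this.1, if_neg this.2, add_zero]

/-- A walk through the interior of a region that goes straight on at every vertex and has no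
self-intersection, except possibly that it ends where it began. -/
structure Path (R : Set G.Dart) (d : ℕ → G.Dart) (n : ℕ) : Prop where
  pos : 0 < n
  succ : ∀ k, d (k + 1) = G.rot (G.rot (G.rev (d k)))
  mem : ∀ k < n, d k ∈ R
  rot_mem : ∀ k < n, G.rot (d k) ∈ R
  deep : ∀ k, 0 < k → k < n → Deep R (d k)
  simple : ∀ k l, k < l → l ≤ n → G.SameVertex (d k) (d l) → k = 0 ∧ l = n
  noUturn : ∀ k < n, ∀ l < n, d k ≠ G.rev (d l)

theorem sameVertex_straight (x : G.Dart) : G.SameVertex (G.rev x) (G.rot (G.rot (G.rev x))) :=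
  (sameVertex_rot _).trans (sameVertex_rot _)

namespace Path

variable {R : Set G.Dart} {d : ℕ → G.Dart} {n : ℕ}

theorem sameVertex_succ (P : Path R d n) (k : ℕ) : G.SameVertex (G.rev (d k)) (d (k + 1)) := by
  rw [P.succ]; exact sameVertex_straight _

theorem injective (P : Path R d n) {k l : ℕ} (hk : k < n) (hl : l < n) (h : d k = d l) :
    k = l := by
  rcases lt_trichotomy k l with hkl | hkl | hkl
  · have := (P.simple k l hkl hl.le (by rw [h]; exact .rfl)).2
    omega
  · exact hkl
  · have := (P.simple l k hkl hk.le (by rw [h]; exact .rfl)).2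
    omega

theorem chain_apply (P : Path R d n) {k : ℕ} (hk : k < n) : chain d n (d k) = 1 := by
  unfold chain
  rw [Finset.sum_eq_single k]
  · rw [if_pos rfl, if_neg (G.rev_ne _).symm, add_zero]
  · intro l hl hlk
    have hl := Finset.mem_range.1 hl
    rw [if_neg fun h => hlk (P.injective hk hl h).symm, if_neg (P.noUturn k hk l hl), add_zero]
  · intro h
    exact absurd (Finset.mem_range.2 hk) h

theorem chain_rev_apply (P : Path R d n) {k : ℕ} (hk : k < n) : chain d n (G.rev (d k)) = 1 := by
  rw [chain_rev, P.chain_apply hk]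

/-- Consecutive edges of a path at a vertex are the first and the last edge of a closed path. -/
theorem adjacent (hR : G.Region R) (P : Path R d n) {y : G.Dart} (h : chain d n y ≠ 0)
    (h' : chain d n (G.rot y) ≠ 0) (hy : G.rot y ≠ y) : G.SameVertex (d 0) (d n) ∧
      (y = d 0 ∧ G.rot y = G.rev (d (n - 1)) ∨ y = G.rev (d (n - 1)) ∧ G.rot y = d 0) := by
  have hs := sameVertex_rot y
  -- The straight continuation lies opposite at a vertex of degree 4 and is not a neighbour in the
  -- rotation.
  have opp : ∀ k, k + 1 < n → G.rot (d (k + 1)) ≠ G.rev (d k) ∧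
      G.rot (G.rev (d k)) ≠ d (k + 1) := by
    intro k hk
    have hi := hR.interior_of_deep (P.deep (k + 1) (by omega) hk)
    constructor
    · intro h
      have h2 := P.succ k
      rw [← h] at h2
      have h3 := congrArg G.rot h2
      rw [hi.rot_four] at h3
      exact hi.rot_ne h3
    · intro h
      have h2 := P.succ k
      rw [h] at h2
      exact hi.rot_ne h2.symm
  -- An arriving and a leaving edge at one vertex are consecutive edges of the path or close it up,
  -- since vertices do not repeat otherwise.
  have mixed : ∀ k < n, ∀ l < n, G.SameVertex (d k) (G.rev (d l)) →
      k = l + 1 ∨ k = 0 ∧ l = n - 1 ∧ G.SameVertex (d 0) (d n) := by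
    intro k hk l hl hkl
    have hkl := hkl.trans (P.sameVertex_succ l)
    rcases lt_trichotomy k (l + 1) with h | h | h
    · have := P.simple k (l + 1) h (by omega) hkl
      obtain ⟨rfl, h2⟩ := this
      rw [h2] at hkl
      exact .inr ⟨rfl, by omega, hkl⟩
    · exact .inl h
    · have := P.simple (l + 1) k h hk.le hkl.symm
      omega
  obtain ⟨k, hk, hyk⟩ := exists_of_chain h
  obtain ⟨l, hl, hyl⟩ := exists_of_chain h'
  rcases hyk with hyk | hyk <;> rcases hyl with hyl | hyl <;> rw [hyl, hyk] at hs
  · exfalso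
    have : k = l := by
      rcases lt_trichotomy k l with hkl | hkl | hkl
      · have := (P.simple k l hkl hl.le hs).2; omega
      · exact hkl
      · have := (P.simple l k hkl hk.le hs.symm).2; omega
    rw [hyl, hyk, this] at hy; exact hy rfl
  · rcases mixed k hk l hl hs with h | ⟨rfl, rfl, h⟩
    · exfalso
      subst h
      exact (opp l hk).1 (by rw [← hyk, hyl])
    · exact ⟨h, .inl ⟨hyk, hyl⟩⟩
  · rcases mixed l hl k hk hs.symm with h | ⟨rfl, rfl, h⟩
    · exfalso
      subst h
      exact (opp k hl).2 (by rw [← hyk, hyl])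
    · exact ⟨h, .inr ⟨hyk, hyl⟩⟩
  · exfalso
    have hs := ((P.sameVertex_succ k).symm.trans hs).trans (P.sameVertex_succ l)
    have : k = l := by
      rcases lt_trichotomy k l with hkl | hkl | hkl
      · have := P.simple (k + 1) (l + 1) (by omega) (by omega) hs; omega
      · exact hkl
      · have := P.simple (l + 1) (k + 1) (by omega) (by omega) hs.symm; omega
    rw [hyl, hyk, this] at hy; exact hy rfl

end Path

namespace Region

variable {R : Set G.Dart}

/-- The part of the walk from `d a` to `d (a + n)` is a simple closed curve, straight everywhere
except at the crossing, where the only corner can be. Since `0 < a`, a tail reaches the crossing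
from the boundary of `R`. It stays outside the curve, so the inside has one angle there and not
three. The bound `a + n < m` keeps the curve in the interior of `R`. -/
theorem loop_region (hR : G.Region R) {d : ℕ → G.Dart} {a n m : ℕ}
    (h0 : ¬ Deep R (d 0)) (hd0 : d 0 ∈ R) (hdeep : ∀ k, 0 < k → k < m → Deep R (d k)) (ha : 0 < a)
    (hm : a + n < m) (hs : ∀ k, d (k + 1) = G.rot (G.rot (G.rev (d k))))
    (hV : G.SameVertex (d a) (d (a + n)))
    (hmin : ∀ k l, k < l → l < a + n → ¬ G.SameVertex (d k) (d l))
    (P : Path R (fun k => d (a + k)) n) :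
    ∃ S, G.Region S ∧ S ⊂ R ∧ S.Nonempty ∧ (corners S).ncard ≤ 1 := by
  classical
  have hn := P.pos
  set z := chain (fun k => d (a + k)) n with hz
  have zrev : ∀ x, z (G.rev x) = z x := chain_rev _ _
  have sv : ∀ k, G.SameVertex (G.rev (d k)) (d (k + 1)) := fun k => by
    rw [hs]; exact sameVertex_straight _
  obtain ⟨w₀, hw₀, hwz₀⟩ := G.exists_potential z zrev fun x => by
    rw [vertexSum_chain fun k _ => P.sameVertex_succ k]
    have : G.SameVertex x (d (a + 0)) ↔ G.SameVertex x (d (a + n)) :=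
      ⟨fun h => h.trans hV, fun h => h.trans hV.symm⟩
    simp only [this]
    exact CharTwo.add_self_eq_zero _
  -- After adding a constant, `w = 1` describes the inside of the curve.
  obtain ⟨w, hw, hwz, hwb⟩ : ∃ w : G.Dart → ZMod 2, (∀ x, w (G.rot x) = w (G.rev x)) ∧
      (∀ x, w x + w (G.rev x) = z x) ∧ w G.base = 0 := by
    refine ⟨fun x => w₀ x + w₀ G.base, fun x => by simp only [hw₀], fun x => ?_,
      CharTwo.add_self_eq_zero _⟩
    rw [← hwz₀]
    have : ∀ a b c : ZMod 2, a + c + (b + c) = a + b := by decide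
    exact this _ _ _
  have wrot : ∀ x, z x = 0 → w (G.rot x) = w x := by
    intro x hx
    have := hwz x
    rw [hx, CharTwo.add_eq_zero] at this
    rw [hw, this]
  have wrot' : ∀ x, w x + w (G.rot x) = z x := fun x => by rw [hw, hwz]
  have around : ∀ x, (∀ y, G.SameVertex x y → z y = 0) → w x = 0 →
      ∀ y, G.SameVertex x y → w y = 0 := by
    intro x hx hx0 y hy
    refine (Equiv.Perm.SameCycle.induct hy (P := fun y => G.SameVertex x y ∧ w y = 0)
      ⟨.rfl, hx0⟩ ?_).2
    rintro u ⟨hu, hu0⟩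
    exact ⟨hu.trans (sameVertex_rot u), by rw [wrot u (hx u hu), hu0]⟩
  have zmem : ∀ x, z x ≠ 0 → ∃ k, a ≤ k ∧ k ≤ a + n ∧ G.SameVertex x (d k) := by
    intro x hx
    obtain ⟨k, hk, h | h⟩ := exists_of_chain hx
    · exact ⟨a + k, by omega, by omega, by rw [h]; exact .rfl⟩
    · exact ⟨a + k + 1, by omega, by omega, by rw [h]; exact sv _⟩
  have zdeep : ∀ x, ¬ Deep R x → z x = 0 := by
    intro x hx
    by_contra h
    obtain ⟨k, h1, h2, h3⟩ := zmem x h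
    exact hx ((deep_congr h3).2 (hdeep k (by omega) (by omega)))
  -- The vertices that are not interior to `R` are connected with the base without meeting the
  -- curve.
  have wdeep : ∀ x, ¬ Deep R x → w x = 0 := by
    have ndeep : ∀ {x y : G.Dart}, ¬ Deep R x → G.SameVertex x y → ¬ Deep R y :=
      fun hx hxy h => hx ((deep_congr hxy).2 h)
    intro x hx
    have hx' := hx
    unfold Deep at hx'
    push Not at hx'
    obtain ⟨e, hxe, he⟩ := hx'
    refine hR.coconn {x | ∀ y, G.SameVertex x y → w y = 0} ?_ ?_ ?_ e he x hxe.symm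
    · refine around _ (fun y hy => zdeep y (ndeep (fun h => ?_) hy)) hwb
      exact hR.not_outer _ (h _ .rfl) isOuter_base
    · exact fun y hy u hu => hy u ((sameVertex_rot y).trans hu)
    · intro y hy hyR
      have hnd : ¬ Deep R (G.rev y) := by
        intro h
        refine hyR ⟨?_, (hR.rot_iff y).2 (h _ .rfl)⟩
        have := h _ (sameVertex_rot _)
        rwa [hR.rot_iff, G.rev_rev] at this
      refine around _ (fun u hu => zdeep u (ndeep hnd hu)) ?_
      have h1 := zdeep _ hnd
      have h2 := hwz y
      rw [← zrev, h1, hy y .rfl, zero_add] at h2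
      exact h2
  -- The crossing is the first repetition of a vertex, so the tail does not touch the curve before
  -- it.
  have tail : ∀ k < a, ∀ y, G.SameVertex (d k) y → z y = 0 := by
    intro k hk y hy
    by_contra h
    obtain ⟨l, h1, h2, h3⟩ := zmem y h
    rcases h2.lt_or_eq with h2 | h2
    · exact hmin k l (by omega) h2 (hy.trans h3)
    · rw [h2] at h3
      exact hmin k a hk (by omega) ((hy.trans h3).trans hV.symm)
  have wtail : ∀ k < a, ∀ y, G.SameVertex (d k) y → w y = 0 := by
    intro k
    induction k with
    | zero => exact fun h => around _ (tail 0 h) (wdeep _ h0)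
    | succ k ih =>
      intro hk
      have h1 := hwz (d k)
      rw [tail k (by omega) _ .rfl, ih (by omega) _ .rfl, zero_add] at h1
      intro y hy
      refine around (G.rev (d k)) (fun u hu => tail (k + 1) hk u ((sv k).symm.trans hu)) h1 y
        ((sv k).trans hy)
  obtain ⟨a, rfl⟩ := Nat.exists_eq_succ_of_ne_zero ha.ne'
  -- From here on `a` is one less: the curve starts at `d (a + 1)`, and `e` is the last edge of the
  -- tail, seen from the crossing. The faces on both sides of `e` are outside the curve.
  set e := G.rev (d a) with he
  have za : z e = 0 := by rw [he, zrev]; exact tail a (by omega) _ .rfl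
  have we : w e = 0 := by
    have h1 := hwz (d a)
    rwa [tail a (by omega) _ .rfl, wtail a (by omega) _ .rfl, zero_add] at h1
  have we1 : w (G.rot e) = 0 := by rw [wrot e za, we]
  have hd : d (a + 1) = G.rot (G.rot e) := hs a
  have hdd : Deep R (d (a + 1)) := hdeep _ (by omega) (by omega)
  have hi := hR.interior_of_deep hdd
  have hie : G.IsInteriorVertex e := (isInteriorVertex_congr (sv a)).2 hi
  have nerot : ∀ {x}, Deep R x → G.rot x ≠ x := fun h => (hR.interior_of_deep h).rot_ne
  have adj : ∀ y, Deep R y → z y ≠ 0 → z (G.rot y) ≠ 0 →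
      (y = d (a + 1) ∧ G.rot y = G.rev (d (a + 1 + (n - 1)))) ∨
      (y = G.rev (d (a + 1 + (n - 1))) ∧ G.rot y = d (a + 1)) :=
    fun y hy h h' => (P.adjacent hR h h' (nerot hy)).2
  have zd : z (d (a + 1)) = 1 := P.chain_apply hn
  refine ⟨piece R w 1, hR.region_piece hw (fun x _ _ => wrot' x) ?_ ?_, ⟨fun x hx => hx.1, ?_⟩,
    ?_, ?_⟩
  -- Edges of the curve are neighbours at the crossing only. An excluded middle angle there would
  -- force one of the angles beside the tail to have colour 1.
  · intro y h1 h2 h3 h4 h5 h6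
    rcases adj y (hR.deep_of_three h1 h2 h3) h4 h5 with ⟨h7, h8⟩ | ⟨h7, h8⟩
    · have z1 : z (G.rot e) ≠ 0 := by
        intro h
        have := wrot _ h
        rw [← hd, ← h7, h6, we1] at this
        exact one_ne_zero this
      have hde : Deep R (G.rot e) :=
        (deep_congr ((sameVertex_rot e).symm.trans (sv a))).2 hdd
      rcases adj (G.rot e) hde z1 (by rw [← hd, zd]; exact one_ne_zero) with ⟨g1, g2⟩ | ⟨g1, g2⟩
      · rw [hd] at g1; exact nerot hde g1.symm
      · rw [← h8, h7, hd] at g1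
        exact (isInteriorVertex_rot.2 hie).rot_two_ne g1.symm
    · rw [hd] at h8
      rw [G.rot.injective h8, we1] at h6
      exact zero_ne_one h6
  · intro X hXb hXrot hXrev hX x hx hx' hxz
    have hXv : ∀ {u v}, u ∈ X → G.SameVertex u v → v ∈ X :=
      fun hu huv => huv.induct (P := fun v => v ∈ X) hu hXrot
    have hd : ∀ k ≤ a + 1 + n, d k ∈ X := by
      intro k
      induction k with
      | zero =>
        intro _
        unfold Deep at h0
        push Not at h0
        obtain ⟨u, hu, hu'⟩ := h0
        exact hXv (hX u hu') hu.symm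
      | succ k ih =>
        intro hk
        refine hXv (hXrev (d k) (ih (by omega)) ?_) (sv k)
        rintro ⟨⟨h1, h2⟩, h3, h4⟩
        by_cases hka : k < a + 1
        · rw [wtail k hka _ .rfl] at h2; exact zero_ne_one h2
        · have h5 := P.chain_apply (k := k - (a + 1)) (by omega)
          simp only [show a + 1 + (k - (a + 1)) = k by omega] at h5
          have h6 := wrot' (d k)
          rw [h2, h4, CharTwo.add_self_eq_zero, hz, h5] at h6
          exact zero_ne_one h6
    obtain ⟨k, -, h2, h3⟩ := zmem x hxz
    exact hXv (hd k h2) h3.symm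
  · intro h
    have := (h hd0).2
    rw [wtail 0 (by omega) _ .rfl] at this
    exact zero_ne_one this
  · have h1 := wrot' (d (a + 1))
    rw [zd] at h1
    have : w (d (a + 1)) = 1 ∨ w (G.rot (d (a + 1))) = 1 := by
      revert h1
      generalize w (d (a + 1)) = u; generalize w (G.rot (d (a + 1))) = v
      revert u v; decide
    rcases this with h | h
    exacts [⟨_, hdd _ .rfl, h⟩, ⟨_, hdd _ (sameVertex_rot _), h⟩]
  · rw [Set.ncard_le_one_iff_subsingleton]
    -- Both edges at a corner of the piece belong to the curve and are neighbours, so the corner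
    -- lies at the crossing.
    have key : ∀ x ∈ corners (piece R w 1),
        (x = G.rev (d (a + 1 + (n - 1))) ∧ x = G.rot (d (a + 1))) ∨
        (x = d (a + 1) ∧ x = G.rot (G.rev (d (a + 1 + (n - 1))))) := by
      rintro x ⟨hx1, hx2, hx3⟩
      have hxd : Deep R x := by
        by_contra h
        have := wdeep x h
        rw [hx1.2] at this
        exact one_ne_zero this
      have s1 := sameVertex_rot (G.rot.symm x)
      rw [Equiv.apply_symm_apply] at s1
      have w1 : w (G.rot x) ≠ 1 := fun h => hx2 ⟨hxd _ (sameVertex_rot x), h⟩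
      have w2 : w (G.rot.symm x) ≠ 1 := fun h => hx3 ⟨hxd _ s1.symm, h⟩
      have z1 : z x ≠ 0 := by
        rw [← wrot', Ne, CharTwo.add_eq_zero, hx1.2]; exact w1.symm
      have z2 : z (G.rot.symm x) ≠ 0 := by
        rw [← wrot', Ne, CharTwo.add_eq_zero, Equiv.apply_symm_apply, hx1.2]; exact w2
      rcases adj (G.rot.symm x) ((deep_congr s1).2 hxd) z2
        (by rwa [Equiv.apply_symm_apply]) with ⟨h1, h2⟩ | ⟨h1, h2⟩ <;>
        rw [Equiv.apply_symm_apply] at h2 <;> rw [Equiv.symm_apply_eq] at h1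
      exacts [.inl ⟨h2, h1⟩, .inr ⟨h2, h1⟩]
    intro x hx y hy
    rcases key x hx with ⟨h1, h2⟩ | ⟨h1, h2⟩ <;> rcases key y hy with ⟨h3, h4⟩ | ⟨h3, h4⟩
    · rw [h1, h3]
    · rw [← h1, h2, ← h3, h3] at h4; exact absurd h4.symm hi.rot_two_ne
    · rw [← h3, h4, ← h1, h1] at h2; exact absurd h2.symm hi.rot_two_ne
    · rw [h1, h3]

end Region
end MinimalLoop

/-! ### Cutting a region in two -/

namespace MinimalLoop

variable {G : MinimalLoop}

namespace Region

variable {R : Set G.Dart}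

/-- The straight walk from a boundary vertex into a region either crosses the region or
encloses a smaller region with at most one corner. -/
theorem arc_or_loop (hR : G.Region R) {α : G.Dart} (h0 : α ∈ R) (h1 : G.rot α ∈ R)
    (hα : ¬ Deep R α) :
    (∃ S, G.Region S ∧ S ⊂ R ∧ S.Nonempty ∧ (corners S).ncard ≤ 1) ∨
    ∃ d n, Path R d n ∧ d 0 = α ∧ ¬ Deep R (d n) ∧ ¬ G.SameVertex (d 0) (d n) := by
  classical
  set σ : Equiv.Perm G.Dart := G.rot * G.rot * G.rev with hσ
  set d : ℕ → G.Dart := fun k => (σ ^ k) α with hd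
  have hs : ∀ k, d (k + 1) = G.rot (G.rot (G.rev (d k))) := fun k => by
    simp only [hd, pow_succ', Equiv.Perm.mul_apply, hσ]
  have sv : ∀ k, G.SameVertex (G.rev (d k)) (d (k + 1)) := fun k => by
    rw [hs]; exact sameVertex_straight _
  -- The walk is an orbit of a permutation and returns to `α`, so it leaves the interior of the
  -- region after finitely many steps.
  have hex : ∃ m, 0 < m ∧ ¬ Deep R (d m) :=
    ⟨orderOf σ, orderOf_pos σ, by
      change ¬ Deep R ((σ ^ orderOf σ) α)
      rwa [pow_orderOf_eq_one]⟩
  set m := Nat.find hex with hm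
  obtain ⟨m0, hmd⟩ := Nat.find_spec hex
  rw [← hm] at m0 hmd
  have hdeep : ∀ k, 0 < k → k < m → Deep R (d k) := fun k hk hkm => by
    by_contra h
    exact Nat.find_min hex hkm ⟨hk, h⟩
  have hmem : ∀ k < m, d k ∈ R ∧ G.rot (d k) ∈ R := by
    intro k hk
    rcases Nat.eq_zero_or_pos k with rfl | hk0
    · exact ⟨h0, h1⟩
    · exact ⟨hdeep k hk0 hk _ .rfl, hdeep k hk0 hk _ (sameVertex_rot _)⟩
  -- If an edge were traversed backwards later, the same would hold one step further in from both
  -- ends, down to an edge reversed at once or a dart equal to its reverse.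
  have turn : ∀ n c, c + n < m → d (c + n) ≠ G.rev (d c) := by
    intro n
    induction n using Nat.twoStepInduction with
    | zero => intro c _ h; exact G.rev_ne _ h.symm
    | one =>
      intro c hc h
      have hi := hR.interior_of_deep (hdeep (c + 1) (by omega) hc)
      rw [← isInteriorVertex_congr (sv c)] at hi
      rw [hs] at h
      exact hi.rot_two_ne h
    | more n ih _ =>
      intro c hc h
      have hi := hR.interior_of_deep (hdeep (c + 1) (by omega) (by omega))
      rw [← isInteriorVertex_congr (sv c)] at hi
      have h4 := hi.rot_four
      rw [← hs] at h4
      rw [← h4, show c + (n + 2) = (c + 1 + n) + 1 by omega, hs (c + 1 + n)] at h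
      have := G.rot.injective (G.rot.injective h)
      exact ih (c + 1) (by omega) (rev_eq_iff.1 this)
  have turn' : ∀ k < m, ∀ l < m, d k ≠ G.rev (d l) := by
    intro k hk l hl h
    rcases le_total l k with hkl | hkl
    · obtain ⟨n, rfl⟩ := Nat.exists_eq_add_of_le hkl
      exact turn n l hk h
    · obtain ⟨n, rfl⟩ := Nat.exists_eq_add_of_le hkl
      exact turn n k hl (by rw [h, G.rev_rev])
  by_cases hmeet : ∃ b, b ≤ m ∧ ∃ a < b, G.SameVertex (d a) (d b)
  · left
    set b := Nat.find hmeet with hb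
    obtain ⟨hbm, a, hab, hV⟩ := Nat.find_spec hmeet
    rw [← hb] at hbm hab hV
    have hmin : ∀ k l, k < l → l < b → ¬ G.SameVertex (d k) (d l) := fun k l hkl hlb h =>
      Nat.find_min hmeet hlb ⟨by omega, k, hkl, h⟩
    -- The walk does not return to its start: until it leaves, its vertices are interior to the
    -- region, and if it left at the start it would arrive along its first edge, the only one that
    -- enters the region there.
    have ha : 0 < a := by
      by_contra ha
      obtain rfl : a = 0 := by omega
      rcases hbm.lt_or_eq with hbm | hbm
      · exact hα ((deep_congr hV).2 (hdeep b hab hbm))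
      · have e1 := hmem (m - 1) (by omega)
        have e2 := sv (m - 1)
        rw [show m - 1 + 1 = b by omega] at e2
        refine turn' 0 (by omega) (m - 1) (by omega) (hR.eq_of_not_deep hα h0 h1 ?_ ?_
          (hV.trans e2.symm))
        · exact (hR.rot_iff _).1 e1.2
        · exact (hR.next_iff _).2 e1.1
    have hbm : b < m := by
      rcases hbm.lt_or_eq with hbm | hbm
      · exact hbm
      · rw [hbm] at hV
        exact absurd ((deep_congr hV).1 (hdeep a ha (by omega))) hmd
    clear_value b
    clear hb
    obtain ⟨n, rfl⟩ : ∃ n, b = a + n := Nat.exists_eq_add_of_le hab.le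
    have hn : 0 < n := by omega
    refine hR.loop_region (d := d) (a := a) (n := n) (m := m) hα h0 hdeep ha hbm hs hV hmin ?_
    refine ⟨hn, fun k => hs _, fun k hk => (hmem _ (by omega)).1, fun k hk => (hmem _ (by omega)).2,
      fun k h0 hk => hdeep _ (by omega) (by omega), fun k l hkl hl h => ?_,
      fun k hk l hl => turn' _ (by omega) _ (by omega)⟩
    rcases hl.lt_or_eq with hl | rfl
    · exact absurd h (hmin _ _ (by omega) (by omega))
    · refine ⟨?_, rfl⟩
      by_contra hk
      exact hmin a (a + k) (by omega) (by omega) (hV.trans h.symm)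
  · right
    push Not at hmeet
    exact ⟨d, m, ⟨m0, hs, fun k hk => (hmem k hk).1, fun k hk => (hmem k hk).2, hdeep,
      fun k l hkl hl h => absurd h (hmeet l hl k hkl), turn'⟩, rfl, hmd, hmeet m le_rfl 0 m0⟩

end Region

/-- A path that cuts a region in two, with a potential that distinguishes the two parts. -/
structure Cut (R : Set G.Dart) (d : ℕ → G.Dart) (n : ℕ) (w : G.Dart → ZMod 2) : Prop where
  path : Path R d n
  start : ¬ Deep R (d 0)
  ne : ¬ G.SameVertex (d 0) (d n)
  rot : ∀ x, w (G.rot x) = w (G.rev x)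
  sum : ∀ x ∈ R, G.rot x ∈ R → w x + w (G.rot x) = chain d n x

namespace Region

variable {R : Set G.Dart}

/-- A chain that avoids the interior of the region closes the path to a cycle. Inside the region the
potential of this cycle changes exactly across the path. -/
theorem exists_cut (hR : G.Region R) {d : ℕ → G.Dart} {n : ℕ} (P : Path R d n)
    (h0 : ¬ Deep R (d 0)) (hn : ¬ Deep R (d n)) (hne : ¬ G.SameVertex (d 0) (d n)) :
    ∃ w, Cut R d n w := by
  obtain ⟨q, h1, h2, h3⟩ := hR.exists_chain h0 hn
  obtain ⟨w, hw, hwz⟩ := G.exists_potential (fun x => chain d n x + q x)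
    (fun x => by simp only [h1, chain_rev]) (fun x => by
      rw [vertexSum_add, h3, vertexSum_chain fun k _ => P.sameVertex_succ k]
      exact CharTwo.add_self_eq_zero _)
  exact ⟨w, P, h0, hne, hw, fun x hx hx' => by rw [hw, hwz, h2 x hx hx', add_zero]⟩

end Region

namespace Cut

variable {R : Set G.Dart} {d : ℕ → G.Dart} {n : ℕ} {w : G.Dart → ZMod 2}

theorem next (C : Cut R d n w) (x : G.Dart) : w (G.next x) = w x := by
  rw [next_apply, C.rot, G.rev_rev]

/-- The exceptional case of `Path.adjacent` is a closed path, and the ends of a cut are different.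
-/
theorem not_adjacent (C : Cut R d n w) (hR : G.Region R) {x : G.Dart} (h : chain d n x ≠ 0)
    (hx : G.rot x ≠ x) : chain d n (G.rot x) = 0 := by
  by_contra h'
  exact C.ne (C.path.adjacent hR h h' hx).1

theorem rot_ne (C : Cut R d n w) {k : ℕ} (hk : k < n) : w (G.rot (d k)) ≠ w (d k) := by
  intro h
  have := C.sum _ (C.path.mem k hk) (C.path.rot_mem k hk)
  rw [h, CharTwo.add_self_eq_zero, C.path.chain_apply hk] at this
  exact zero_ne_one this

theorem chain_ne (C : Cut R d n w) {x : G.Dart} (h : x ∈ R) (h' : G.rot x ∈ R)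
    (hw : w (G.rot x) ≠ w x) : chain d n x ≠ 0 := by
  rw [← C.sum x h h', Ne, CharTwo.add_eq_zero]
  exact hw.symm

/-- Between two consecutive edges of the path the only edge on the left is that of `next (d k)`. It
is a neighbour of the path, hence not on it, and the colour on the left does not change. -/
theorem color (C : Cut R d n w) (hR : G.Region R) {k : ℕ} (hk : k < n) : w (d k) = w (d 0) := by
  induction k with
  | zero => rfl
  | succ k ih =>
    rw [← ih (by omega), ← C.next (d k), C.path.succ]
    have hdeep := (Region.deep_congr (C.path.sameVertex_succ k)).2 (C.path.deep _ (by omega) hk)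
    by_contra h
    refine C.chain_ne (x := G.next (d k)) (hdeep _ (sameVertex_rot _))
      (hdeep _ (sameVertex_straight _)) h ?_
    refine C.not_adjacent hR (x := G.rev (d k)) ?_ (hR.interior_of_deep hdeep).rot_ne
    rw [C.path.chain_rev_apply (by omega)]
    exact one_ne_zero

theorem end_eq (C : Cut R d n w) {x : G.Dart} (hx : ¬ Deep R x) (h : chain d n x ≠ 0) :
    x = d 0 ∨ x = G.rev (d (n - 1)) := by
  obtain ⟨k, hk, rfl | rfl⟩ := exists_of_chain h
  · rcases Nat.eq_zero_or_pos k with rfl | hk0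
    · exact .inl rfl
    · exact absurd (C.path.deep k hk0 hk) hx
  · right
    by_cases hk' : k + 1 < n
    · exact absurd ((Region.deep_congr (C.path.sameVertex_succ k)).2
        (C.path.deep _ (by omega) hk')) hx
    · rw [show k = n - 1 by omega]

/-- The two sides of an edge of the path have different colours, so no such edge is interior to a
piece and the path can be walked from its starting point. -/
theorem mem_of_closed (C : Cut R d n w) {c : ZMod 2} {X : Set G.Dart} (hrot : ∀ x ∈ X, G.rot x ∈ X)
    (hrev : ∀ x ∈ X, ¬ (x ∈ Region.piece R w c ∧ G.rot x ∈ Region.piece R w c) → G.rev x ∈ X)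
    (hX : ∀ x, x ∉ R → x ∈ X) {x : G.Dart} (h : chain d n x ≠ 0) : x ∈ X := by
  have hXv : ∀ {u v}, u ∈ X → G.SameVertex u v → v ∈ X :=
    fun hu huv => huv.induct (P := fun v => v ∈ X) hu hrot
  have hd : ∀ k ≤ n, d k ∈ X := by
    intro k
    induction k with
    | zero =>
      intro _
      have h0 := C.start
      unfold Deep at h0
      push Not at h0
      obtain ⟨u, hu, hu'⟩ := h0
      exact hXv (hX u hu') hu.symm
    | succ k ih =>
      intro hk
      refine hXv (hrev (d k) (ih (by omega)) ?_) (C.path.sameVertex_succ k)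
      rintro ⟨⟨h1, h2⟩, h3, h4⟩
      exact C.rot_ne (k := k) (by omega) (h4.trans h2.symm)
  obtain ⟨k, hk, rfl | rfl⟩ := exists_of_chain h
  · exact hd k hk.le
  · exact hXv (hd (k + 1) hk) (C.path.sameVertex_succ k).symm

theorem region (C : Cut R d n w) (hR : G.Region R) (c : ZMod 2) :
    G.Region (Region.piece R w c) := by
  refine hR.region_piece C.rot C.sum (fun x h1 h2 h3 h4 h5 _ => h5 (C.not_adjacent hR h4
    (hR.interior_of_deep (hR.deep_of_three h1 h2 h3)).rot_ne)) ?_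
  exact fun X _ hrot hrev hX x _ _ hz => C.mem_of_closed hrot hrev hX hz

open Classical in
/-- The corner of the part of color `c` at an end of the path. -/
noncomputable def endCorner (w : G.Dart → ZMod 2) (c : ZMod 2) (x : G.Dart) : G.Dart :=
  if w x = c then x else G.rot x

/-- The edges bounding a corner of a piece lie on the boundary of the region or on the path. If both
are on the boundary, it is an old corner. Both cannot lie on the path, as neighbours do not. If just
one does, the vertex is on the boundary of the region and hence an end of the path. -/
theorem corner (C : Cut R d n w) (hR : G.Region R) {c : ZMod 2} {x : G.Dart}
    (hx : x ∈ corners (Region.piece R w c)) : (x ∈ corners R ∧ w x = c) ∨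
      x = endCorner w c (d 0) ∨ x = endCorner w c (G.rev (d (n - 1))) := by
  obtain ⟨⟨hxR, hxc⟩, h1, h2⟩ := hx
  set y := G.rot.symm x with hy
  have hyx : G.rot y = x := Equiv.apply_symm_apply _ _
  have key : ∀ u, ¬ Deep R u → chain d n u ≠ 0 → ∀ v, (w u = c → v = u) → (w u ≠ c → v = G.rot u) →
      v = endCorner w c (d 0) ∨ v = endCorner w c (G.rev (d (n - 1))) := by
    intro u hu hu' v hv hv'
    have : v = endCorner w c u := by
      unfold endCorner
      by_cases h : w u = c
      · rw [if_pos h, hv h]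
      · rw [if_neg h, hv' h]
    rcases C.end_eq hu hu' with h | h
    · exact .inl (by rw [this, h])
    · exact .inr (by rw [this, h])
  by_cases r1 : G.rot x ∈ R
  · have w1 : w (G.rot x) ≠ w x := fun h => h1 ⟨r1, h.trans hxc⟩
    have z1 := C.chain_ne hxR r1 w1
    have r2 : y ∉ R := by
      intro r2
      have w2 : w y ≠ c := fun h => h2 ⟨r2, h⟩
      have z2 := C.chain_ne r2 (by rwa [hyx]) (by rw [hyx, hxc]; exact w2.symm)
      refine absurd (C.not_adjacent hR z2 ?_) (by rwa [hyx])
      intro h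
      rw [hyx] at h
      exact w2 (by rw [← h, hxc])
    refine .inr (key x (fun h => r2 (h y ?_)) z1 x (fun _ => rfl) fun h => absurd hxc h)
    have := sameVertex_rot y
    rw [hyx] at this
    exact this.symm
  by_cases r2 : y ∈ R
  · have w2 : w y ≠ c := fun h => h2 ⟨r2, h⟩
    have z2 := C.chain_ne r2 (by rwa [hyx]) (by rw [hyx, hxc]; exact w2.symm)
    refine .inr (key y (fun h => r1 (h _ ?_)) z2 x (fun h => absurd h w2) fun _ => hyx.symm)
    rw [← hyx]
    exact (sameVertex_rot y).trans (sameVertex_rot _)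
  · exact .inl ⟨⟨hxR, r1, r2⟩, hxc⟩

theorem nonempty (C : Cut R d n w) (c : ZMod 2) : (Region.piece R w c).Nonempty := by
  have h := C.rot_ne C.path.pos
  have : w (d 0) = c ∨ w (G.rot (d 0)) = c := by
    revert h
    generalize w (d 0) = u; generalize w (G.rot (d 0)) = v
    revert u v c; decide
  rcases this with h | h
  exacts [⟨_, C.path.mem 0 C.path.pos, h⟩, ⟨_, C.path.rot_mem 0 C.path.pos, h⟩]

theorem ssubset (C : Cut R d n w) (c : ZMod 2) : Region.piece R w c ⊂ R := by
  refine ⟨fun x hx => hx.1, fun h => ?_⟩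
  obtain ⟨x, hx⟩ := C.nonempty (c + 1)
  have h2 := (h hx.1).2
  rw [hx.2] at h2
  simp at h2

/-- If there are no smaller regions with at most two corners, then there is a corner of the region
on either side of a cut. -/
theorem exists_corner (C : Cut R d n w) (hR : G.Region R)
    (hmin : ∀ S, G.Region S → S.Nonempty → S ⊂ R → 3 ≤ (corners S).ncard) (c : ZMod 2) :
    ∃ x ∈ corners R, w x = c := by
  by_contra! h
  have h3 := hmin _ (C.region hR c) (C.nonempty c) (C.ssubset c)
  -- A part without old corners has at most the two corners at the ends of the path, one fewer than
  -- minimality demands.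
  have hsub : corners (Region.piece R w c) ⊆
      {endCorner w c (d 0), endCorner w c (G.rev (d (n - 1)))} := by
    intro x hx
    rcases C.corner hR hx with h' | h'
    · exact absurd h'.2 (h x h'.1)
    · exact h'
  have := Set.ncard_le_ncard hsub (Set.toFinite _)
  have := Set.ncard_insert_le (endCorner w c (d 0)) {endCorner w c (G.rev (d (n - 1)))}
  rw [Set.ncard_singleton] at this
  omega

end Cut
end MinimalLoop

theorem ZMod.eq_of_ne_of_ne {a b c : ZMod 2} (h : a ≠ c) (h' : b ≠ c) : a = b := by
  revert a b c; decide

theorem exists_ne_succ {α : Type*} (f : ℕ → α) {a b : ℕ} (hab : a ≤ b) (h : f a ≠ f b) :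
    ∃ j, a ≤ j ∧ j < b ∧ f j ≠ f (j + 1) := by
  by_contra! hc
  refine h ?_
  have : ∀ n, a + n ≤ b → f a = f (a + n) := by
    intro n
    induction n with
    | zero => intro _; rfl
    | succ n ih => intro hn; rw [ih (by omega), hc (a + n) (by omega) (by omega)]; rfl
  have := this (b - a) (by omega)
  rwa [show a + (b - a) = b by omega] at this

/-! ### Wedges and a triangle at the boundary of a minimal region -/

namespace MinimalLoop

variable {G : MinimalLoop}

/-- The region is minimal among those with at most two corners. -/
def MinRegion (R : Set G.Dart) : Prop :=
  ∀ S, G.Region S → S.Nonempty → S ⊂ R → 3 ≤ (corners S).ncard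

namespace Region

variable {R S : Set G.Dart}

/-- A self-crossing of the strand would enclose a smaller region with at most one corner, so
minimality makes it a cut. -/
theorem exists_cut_at (hS : G.Region S) (hmin : MinRegion S) {α : G.Dart} (h0 : α ∈ S)
    (h1 : G.rot α ∈ S) (hα : ¬ Deep S α) : ∃ d n w, Cut S d n w ∧ d 0 = α := by
  rcases hS.arc_or_loop h0 h1 hα with ⟨T, h1, h2, h3, h4⟩ | ⟨d, n, P, h1, h2, h3⟩
  · have := hmin T h1 h3 h2
    omega
  · obtain ⟨w, hw⟩ := hS.exists_cut P (h1 ▸ hα) h2 h3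
    exact ⟨d, n, w, hw, h1⟩

/-- A region without cuts contains a face all of whose vertices are corners of the region. -/
theorem exists_face_corners (hS : G.Region S) (hne : S.Nonempty)
    (h : ∀ x ∈ S, G.rot x ∈ S → Deep S x) :
    ∃ t, t ∈ corners S ∧ ∀ y ∈ corners S, G.SameFace t y → G.next y ∈ corners S := by
  have key : ∀ x ∈ S, G.rot.symm x ∉ S → x ∈ corners S := by
    intro x hx hx'
    refine ⟨hx, fun h' => hx' (h x hx h' _ ?_), hx'⟩
    have := sameVertex_rot (G.rot.symm x)
    rw [Equiv.apply_symm_apply] at this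
    exact this.symm
  have step : ∀ y ∈ corners S, G.next y ∈ corners S := by
    intro y hy
    refine key _ ((hS.next_iff y).2 hy.1) ?_
    rw [next_apply, Equiv.symm_apply_apply, ← hS.rot_iff]
    exact hy.2.1
  have : ∃ x ∈ S, G.rot.symm x ∉ S := by
    by_contra! hc
    have hrot : ∀ x ∈ S, G.rot x ∈ S := by
      intro x hx
      have : ∀ x ∈ S, G.rot.symm x ∈ S := hc
      refine Equiv.Perm.mem_of_closed G.rot.symm this ?_
      rwa [Equiv.symm_apply_apply]
    have := G.eq_univ S hne hrot fun x hx => (hS.rot_iff x).1 (hrot x hx)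
    have hb : G.base ∈ S := by rw [this]; trivial
    exact hS.not_outer _ hb isOuter_base
  obtain ⟨t, ht, ht'⟩ := this
  exact ⟨t, key t ht ht', fun y hy _ => step y hy⟩

end Region

/-- A region with at most three corners, two of which are joined by a single edge, such that one of
the other two sides is known. -/
structure Wedge (R S : Set G.Dart) (π γ : G.Dart) (r : ℕ → G.Dart) (m : ℕ) : Prop where
  region : G.Region S
  sub : S ⊆ R
  mem : π ∈ S
  corner : ∀ x ∈ corners S, x = π ∨ x = G.next π ∨ x = γ
  r_mem : ∀ i ≤ m, r i ∈ S
  r_boundary : ∀ i ≤ m, G.rot (r i) ∉ S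
  -- The known side is straight: at each of its inner vertices exactly one edge enters the region,
  -- and it is skipped.
  r_succ : ∀ i < m, r (i + 1) = G.rot (G.next (r i))
  r_inj : ∀ i ≤ m, ∀ j ≤ m, r i = r j → i = j
  -- Every edge of the third side therefore lies on the boundary of `R`.
  side : ∀ y ∈ S, G.rot y ∉ S → G.rot y ∈ R → y = π ∨ ∃ i ≤ m, y = r i
  -- The known side ends where `π` begins, or it begins where `π` ends; `γ` is the corner at its far
  -- end.
  shape : G.next (r m) = π ∧ γ = r 0 ∨ G.next π = r 0 ∧ γ = G.next (r m)

namespace Cut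

variable {S : Set G.Dart} {d : ℕ → G.Dart} {n : ℕ} {w : G.Dart → ZMod 2}

theorem rev_last_ne (C : Cut S d n w) (hS : G.Region S) : w (G.rev (d (n - 1))) ≠ w (d 0) := by
  have hn := C.path.pos
  rw [← C.rot, ← C.color hS (k := n - 1) (by omega)]
  exact C.rot_ne (by omega)

theorem rev_ne (C : Cut S d n w) (hS : G.Region S) {k : ℕ} (hk : k < n) :
    w (G.rev (d k)) ≠ w (d 0) := by
  rw [← C.rot, ← C.color hS hk]
  exact C.rot_ne hk

theorem endCorner_of_eq {c : ZMod 2} {x : G.Dart} (h : w x = c) : endCorner w c x = x := if_pos h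

theorem endCorner_of_ne {c : ZMod 2} {x : G.Dart} (h : w x ≠ c) : endCorner w c x = G.rot x :=
  if_neg h

end Cut

namespace Wedge

variable {R S : Set G.Dart} {π γ : G.Dart} {r : ℕ → G.Dart} {m : ℕ}

theorem minRegion (W : Wedge R S π γ r m) (hmin : MinRegion R) : MinRegion S :=
  fun T h1 h2 h3 => hmin T h1 h2 (h3.trans_subset W.sub)

theorem not_deep (W : Wedge R S π γ r m) {i : ℕ} (hi : i ≤ m) : ¬ Deep S (G.next (r i)) := by
  intro h
  refine W.r_boundary i hi ((W.region.rot_iff _).2 (h _ (sameVertex_rev_next _).symm))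

/-- A cut does not meet the interior of the known side if both ends of this side are in the same
part. -/
theorem color (W : Wedge R S π γ r m) {d : ℕ → G.Dart} {n : ℕ} {w : G.Dart → ZMod 2}
    (C : Cut S d n w) {a b : ℕ} (hb : b ≤ m)
    (hd : ∀ i, a ≤ i → i < b → G.next (r i) ≠ d 0) (hw : w (r a) = w (r b)) {i : ℕ} (hai : a ≤ i)
    (hib : i ≤ b) : w (r i) = w (r b) := by
  have switch : ∀ j, a ≤ j → j < b → w (r j) ≠ w (r (j + 1)) →
      G.next (r j) = G.rev (d (n - 1)) := by
    intro j h1 h2 h3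
    refine (C.end_eq (W.not_deep (by omega)) (C.chain_ne ?_ ?_ ?_)).resolve_left (hd j h1 h2)
    · exact (W.region.next_iff _).2 (W.r_mem j (by omega))
    · rw [← W.r_succ j (by omega)]; exact W.r_mem _ (by omega)
    · rw [← W.r_succ j (by omega), C.next]; exact h3.symm
  by_contra h
  -- Colours that agree at both ends of the stretch but differ between require two changes. Each
  -- change takes place at an end of the cut, and only the far end is available.
  obtain ⟨j, h1, h2, h3⟩ := exists_ne_succ (fun i => w (r i)) hai (fun h' => h (h'.symm.trans hw))
  obtain ⟨k, h4, h5, h6⟩ := exists_ne_succ (fun i => w (r i)) hib h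
  have e1 := switch j h1 (by omega) h3
  have e2 := switch k (by omega) h5 h6
  have := W.r_inj j (by omega) k (by omega) (G.next.injective (e1.trans e2.symm))
  omega

/-- Cut `S` at the inner vertex of the known side closest to `γ`. The corners at the ends of `π`
belong to one face and thus to one part; as each part contains a corner, `γ` lies in the other. That
part is a wedge again: its single edge is the last piece of the old known side, its known side is
the cut, and its third side is still on the boundary of `R`. -/
theorem exists_smaller (W : Wedge R S π γ r m) (hmin : MinRegion R) (hm : 0 < m) :
    ∃ S' π' γ' r' m', Wedge R S' π' γ' r' m' ∧ S' ⊂ S := by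
  have hS := W.region
  have hminS := W.minRegion hmin
  rcases W.shape with ⟨hπ, hγ⟩ | ⟨hπ, hγ⟩
  · obtain ⟨d, n, w, C, hd⟩ := hS.exists_cut_at hminS (α := G.next (r 0))
      ((hS.next_iff _).2 (W.r_mem 0 (by omega)))
      (by rw [← W.r_succ 0 hm]; exact W.r_mem 1 hm) (W.not_deep (by omega))
    have hn := C.path.pos
    have w0 : w (d 0) = w (r 0) := by rw [hd, C.next]
    -- Otherwise all corners of `S` would lie in the same part of the cut.
    have hwπ : w π ≠ w (r 0) := by
      intro h
      obtain ⟨x, hx, hx'⟩ := C.exists_corner hS hminS (w (r 0) + 1)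
      have : w x = w (r 0) := by
        rcases W.corner x hx with rfl | rfl | rfl
        · exact h
        · rw [C.next, h]
        · rw [hγ]
      rw [this] at hx'
      simp at hx'
    have hw1 : w (r 1) ≠ w (r 0) := by
      rw [W.r_succ 0 hm, ← hd, ← w0]; exact C.rot_ne hn
    have hwm : w (r m) ≠ w (r 0) := by rw [← C.next, hπ]; exact hwπ
    have hr : ∀ i, 1 ≤ i → i ≤ m → w (r i) ≠ w (r 0) := by
      intro i h1 h2
      rw [W.color C le_rfl (fun j h3 h4 h5 => ?_) (ZMod.eq_of_ne_of_ne hw1 hwm) h1 h2]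
      · exact hwm
      · rw [hd] at h5
        have := W.r_inj j (by omega) 0 (by omega) (G.next.injective h5)
        omega
    refine ⟨Region.piece S w (w (r 0)), r 0, G.next (d (n - 1)), d, n - 1, ⟨C.region hS _,
      (C.ssubset _).1.trans W.sub, ⟨W.r_mem 0 (by omega), rfl⟩, ?_, ?_, ?_, ?_, ?_, ?_,
      .inr ⟨hd.symm, rfl⟩⟩, C.ssubset _⟩
    · intro x hx
      rcases C.corner hS hx with ⟨h1, h2⟩ | h1 | h1
      · rcases W.corner x h1 with rfl | rfl | rfl
        · exact absurd h2 hwπ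
        · rw [C.next] at h2; exact absurd h2 hwπ
        · exact .inl hγ
      · rw [Cut.endCorner_of_eq w0, hd] at h1
        exact .inr (.inl h1)
      · rw [Cut.endCorner_of_ne (by rw [← w0]; exact C.rev_last_ne hS)] at h1
        exact .inr (.inr h1)
    · intro i hi
      exact ⟨C.path.mem i (by omega), by rw [C.color hS (by omega), w0]⟩
    · intro i hi h
      exact C.rot_ne (k := i) (by omega) (by rw [h.2, C.color hS (by omega), w0])
    · intro i _
      rw [C.path.succ, next_apply]
    · exact fun i hi j hj h => C.path.injective (by omega) (by omega) h
    · intro y hy hy1 hy2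
      by_cases hyS : G.rot y ∈ S
      · obtain ⟨k, hk, rfl | rfl⟩ := exists_of_chain (C.chain_ne hy.1 hyS fun h =>
          hy1 ⟨hyS, h.trans hy.2⟩)
        · exact .inr ⟨k, by omega, rfl⟩
        · exact absurd (hy.2.trans w0.symm) (C.rev_ne hS hk)
      · rcases W.side y hy.1 hyS hy2 with rfl | ⟨i, hi, rfl⟩
        · exact absurd hy.2 hwπ
        · rcases Nat.eq_zero_or_pos i with rfl | hi0
          · exact .inl rfl
          · exact absurd hy.2 (hr i hi0 hi)
  · have hs := W.r_succ (m - 1) (by omega)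
    rw [show m - 1 + 1 = m by omega] at hs
    obtain ⟨d, n, w, C, hd⟩ := hS.exists_cut_at hminS (α := G.next (r (m - 1)))
      ((hS.next_iff _).2 (W.r_mem _ (by omega)))
      (by rw [← hs]; exact W.r_mem m le_rfl) (W.not_deep (by omega))
    have hn := C.path.pos
    have w0 : w (d 0) ≠ w (r m) := by
      rw [hs, ← hd]; exact (C.rot_ne hn).symm
    have wd : ∀ k < n, w (G.rev (d k)) = w (r m) := fun k hk =>
      ZMod.eq_of_ne_of_ne (C.rev_ne hS hk) w0.symm
    have hwπ : w π ≠ w (r m) := by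
      intro h
      obtain ⟨x, hx, hx'⟩ := C.exists_corner hS hminS (w (r m) + 1)
      have : w x = w (r m) := by
        rcases W.corner x hx with rfl | rfl | rfl
        · exact h
        · rw [C.next, h]
        · rw [hγ, C.next]
      rw [this] at hx'
      simp at hx'
    have hw0 : w (r 0) ≠ w (r m) := by rw [← hπ, C.next]; exact hwπ
    have hw1 : w (r (m - 1)) ≠ w (r m) := by rw [← C.next, ← hd]; exact w0
    have hr : ∀ i < m, w (r i) ≠ w (r m) := by
      intro i h2
      rw [W.color C (a := 0) (b := m - 1) (by omega) (fun j h3 h4 h5 => ?_)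
        (ZMod.eq_of_ne_of_ne hw0 hw1) (by omega) (by omega)]
      · exact hw1
      · rw [hd] at h5
        have := W.r_inj j (by omega) (m - 1) (by omega) (G.next.injective h5)
        omega
    have hrot : G.rot (d 0) = r m := by rw [hd, hs]
    -- The new wedge lies on the right of the cut, so its known side is the cut traversed backwards;
    -- the shape of the wedge alternates.
    refine ⟨Region.piece S w (w (r m)), r m, G.rev (d (n - 1)), fun i => G.rev (d (n - 1 - i)),
      n - 1, ⟨C.region hS _, (C.ssubset _).1.trans W.sub, ⟨W.r_mem m le_rfl, rfl⟩, ?_, ?_, ?_, ?_,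
      ?_, ?_, .inl ⟨?_, rfl⟩⟩, C.ssubset _⟩
    · intro x hx
      rcases C.corner hS hx with ⟨h1, h2⟩ | h1 | h1
      · rcases W.corner x h1 with rfl | rfl | rfl
        · exact absurd h2 hwπ
        · rw [C.next] at h2; exact absurd h2 hwπ
        · exact .inr (.inl hγ)
      · rw [Cut.endCorner_of_ne w0, hrot] at h1
        exact .inl h1
      · rw [Cut.endCorner_of_eq (wd _ (by omega))] at h1
        exact .inr (.inr h1)
    · intro i hi
      exact ⟨(hS.rot_iff _).1 (C.path.rot_mem _ (by omega)), wd _ (by omega)⟩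
    · intro i hi h
      have := h.2
      rw [← next_apply, C.next, C.color hS (by omega)] at this
      exact w0 this
    · intro i hi
      obtain ⟨k, hk, hk1⟩ : ∃ k, n - 1 - (i + 1) = k ∧ n - 1 - i = k + 1 := ⟨_, rfl, by omega⟩
      simp only [hk, hk1]
      have hint := hS.interior_of_deep (C.path.deep (k + 1) (by omega) (by omega))
      rw [← isInteriorVertex_congr (C.path.sameVertex_succ k)] at hint
      rw [next_rev, C.path.succ, hint.rot_four]
    · intro i hi j hj h
      have := C.path.injective (by omega) (by omega) (G.rev.injective h)
      omega
    · intro y hy hy1 hy2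
      by_cases hyS : G.rot y ∈ S
      · obtain ⟨k, hk, rfl | rfl⟩ := exists_of_chain (C.chain_ne hy.1 hyS fun h =>
          hy1 ⟨hyS, h.trans hy.2⟩)
        · have := hy.2
          rw [C.color hS hk] at this
          exact absurd this w0
        · exact .inr ⟨n - 1 - k, by omega, by rw [show n - 1 - (n - 1 - k) = k by omega]⟩
      · rcases W.side y hy.1 hyS hy2 with rfl | ⟨i, hi, rfl⟩
        · exact absurd hy.2 hwπ
        · rcases hi.lt_or_eq with hi | rfl
          · exact absurd hy.2 (hr i hi)
          · exact .inl rfl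
    · simp only [Nat.sub_self]
      rw [next_rev, hrot]

/-- Descend to a wedge whose known side is a single edge. All its corners then belong to one face,
so no cut can separate them and there is no cut at all. Without cuts some face has corners of the
region at all its angles; having no fewer than three sides and at most three corners available, it
is a triangle. Its side other than `π` and `r 0` is on the boundary of `R`. -/
theorem exists_triangle (hl : G.Loopless) (h2 : ∀ x, ¬ G.IsTwoGroup x) (hmin : MinRegion R)
    (W : Wedge R S π γ r m) : ∃ t, G.IsTriangle t ∧ t ∈ R ∧ G.rot t ∉ R := by
  have := G.finite
  induction hN : S.ncard using Nat.strong_induction_on generalizing S π γ r m with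
  | _ N ih =>
  rcases Nat.eq_zero_or_pos m with rfl | hm
  swap
  · obtain ⟨S', π', γ', r', m', W', hlt⟩ := W.exists_smaller hmin hm
    exact ih _ (hN ▸ Set.ncard_lt_ncard hlt (Set.toFinite _)) W' rfl
  have hS := W.region
  have hne : ∀ x, G.next x ≠ x := fun x => hl.next_ne x
  have hne2 : ∀ x ∈ S, G.next (G.next x) ≠ x := fun x hx h =>
    h2 x (isTwoGroup_of hl rfl h (hS.not_outer x hx))
  have hface : ∀ w : G.Dart → ZMod 2, (∀ x, w (G.next x) = w x) → ∀ x ∈ corners S, w x = w π := by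
    intro w hw x hx
    have h0 : w (r 0) = w π := by
      rcases W.shape with ⟨h, -⟩ | ⟨h, -⟩
      · rw [← h, hw]
      · rw [← h, hw]
    rcases W.corner x hx with rfl | rfl | rfl
    · rfl
    · exact hw _
    · rcases W.shape with ⟨-, h⟩ | ⟨-, h⟩
      · rw [h, h0]
      · rw [h, hw, h0]
  obtain ⟨t, ht, hface'⟩ := hS.exists_face_corners ⟨π, W.mem⟩ fun x hx hx' => by
    by_contra hd
    obtain ⟨d, n, w, C, -⟩ := hS.exists_cut_at (W.minRegion hmin) hx hx' hd
    obtain ⟨x, hx, hx'⟩ := C.exists_corner hS (W.minRegion hmin) (w π + 1)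
    rw [hface w C.next x hx] at hx'
    simp at hx'
  have t1 := hface' t ht .rfl
  have t2 := hface' _ t1 (sameFace_next t)
  have t3 := hface' _ t2 ((sameFace_next t).trans (sameFace_next _))
  have hne4 := hne2 _ t1.1
  -- three of the four corners coincide
  have h3 : G.next (G.next (G.next t)) = t := by
    have i1 := hne t; have i2 := hne (G.next t); have i3 := hne (G.next (G.next t))
    have i4 := hne2 t ht.1
    have a0 := W.corner _ ht; have a1 := W.corner _ t1; have a2 := W.corner _ t2
    have a3 := W.corner _ t3
    clear * - i1 i2 i3 i4 hne4 a0 a1 a2 a3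
    grind
  have hπ : π = t ∨ π = G.next t ∨ π = G.next (G.next t) := by
    have i1 := hne t; have i2 := hne (G.next t)
    have i4 := hne2 t ht.1
    have a0 := W.corner _ ht; have a1 := W.corner _ t1; have a2 := W.corner _ t2
    clear * - i1 i2 i4 a0 a1 a2
    grind
  have htri : G.IsTriangle t := isTriangle_of hl h3 (hS.not_outer t ht.1)
  have hπf : G.SameFace t π := by
    rcases hπ with h | h | h <;> rw [h]
    exacts [.rfl, sameFace_next _, (sameFace_next _).trans (sameFace_next _)]
  have hcor : ∀ y, G.SameFace t y → y ∈ corners S := by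
    intro y hy
    rcases htri.sameFace hy with rfl | rfl | rfl
    exacts [ht, t1, t2]
  have hπt := htri.of_sameFace hπf
  have fin : ∀ u, G.SameFace t u → u ≠ π → u ≠ r 0 →
      ∃ t, G.IsTriangle t ∧ t ∈ R ∧ G.rot t ∉ R := by
    intro u hu h1 h2
    have huc := hcor u hu
    refine ⟨u, htri.of_sameFace hu, W.sub huc.1, fun h => ?_⟩
    rcases W.side u huc.1 huc.2.1 h with h | ⟨i, hi, h⟩
    · exact h1 h
    · rw [Nat.le_zero.1 hi] at h; exact h2 h
  rcases W.shape with ⟨h, -⟩ | ⟨h, -⟩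
  · refine fin (G.next π) (hπf.trans (sameFace_next _)) (hne π) fun h' => ?_
    rw [← h'] at h
    exact hne2 π W.mem h
  · refine fin (G.next (G.next π)) ((hπf.trans (sameFace_next _)).trans (sameFace_next _))
      (hne2 π W.mem) fun h' => ?_
    rw [← h] at h'
    exact hne _ h'

end Wedge

/-- A minimal region with at most two corners contains a triangle that has an edge on the boundary
of the region. -/
theorem Region.exists_triangle {R : Set G.Dart} (hl : G.Loopless) (h2 : ∀ x, ¬ G.IsTwoGroup x)
    (hR : G.Region R) (hne : R.Nonempty) (hc : (corners R).ncard ≤ 2) (hmin : MinRegion R) :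
    ∃ t, G.IsTriangle t ∧ t ∈ R ∧ G.rot t ∉ R := by
  have := G.finite
  have n1 : ∀ x, G.next x ≠ x := fun x => hl.next_ne x
  have n2 : ∀ x ∈ R, G.next (G.next x) ≠ x := fun x hx h =>
    h2 x (isTwoGroup_of hl rfl h (hR.not_outer x hx))
  -- Without cuts there would be a face consisting of corners, and it would have at least three of
  -- them.
  by_cases harc : ∀ x ∈ R, G.rot x ∈ R → Deep R x
  · exfalso
    obtain ⟨t, ht, hface⟩ := hR.exists_face_corners hne harc
    have t1 := hface t ht .rfl
    have t2 := hface _ t1 (sameFace_next t)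
    have hsub : ({t, G.next t, G.next (G.next t)} : Set G.Dart) ⊆ corners R := by
      rintro x (rfl | rfl | rfl) <;> assumption
    have := Set.ncard_le_ncard hsub (Set.toFinite _)
    rw [Set.ncard_eq_three.2 ⟨t, G.next t, G.next (G.next t), (n1 t).symm, (n2 t ht.1).symm,
      (n1 _).symm, rfl⟩] at this
    omega
  push Not at harc
  obtain ⟨x₀, hx₀, hx₀', hdeep⟩ := harc
  obtain ⟨d₀, n₀, w₀, C₀, -⟩ := hR.exists_cut_at hmin hx₀ hx₀' hdeep
  obtain ⟨c, hcR, -⟩ := C₀.exists_corner hR hmin 0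
  have two : ∀ u v, u ∈ corners R → v ∈ corners R → u ≠ v → ∀ x ∈ corners R, x = u ∨ x = v := by
    intro u v hu hv huv x hx
    by_contra! h
    have hsub : ({x, u, v} : Set G.Dart) ⊆ corners R := by
      rintro y (rfl | rfl | rfl) <;> assumption
    have := Set.ncard_le_ncard hsub (Set.toFinite _)
    rw [Set.ncard_eq_three.2 ⟨x, u, v, h.1, h.2, huv, rfl⟩] at this
    omega
  have hrevc : G.rev c ∉ R := by rw [← hR.rot_iff]; exact hcR.2.1
  have hcn : G.next c ∈ R := (hR.next_iff c).2 hcR.1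
  have hcs : G.rot.symm (G.next c) = G.rev c := by rw [next_apply, Equiv.symm_apply_apply]
  -- If `next c` were a corner as well, the two corners would lie on one face and the cut `C₀` could
  -- not separate them.
  by_cases hrc : G.rot (G.next c) ∈ R
  swap
  · exfalso
    have hcc : G.next c ∈ corners R := ⟨hcn, hrc, by rwa [hcs]⟩
    obtain ⟨x, hx, hx'⟩ := C₀.exists_corner hR hmin (w₀ c + 1)
    have : w₀ x = w₀ c := by
      rcases two c _ hcR hcc (n1 c).symm x hx with rfl | rfl
      · rfl
      · exact C₀.next c
    rw [this] at hx'
    simp at hx'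
  obtain ⟨d, n, w, C, hd⟩ := hR.exists_cut_at hmin hcn hrc fun h =>
    hrevc (h _ (sameVertex_rev_next c).symm)
  have hn := C.path.pos
  have w0 : w (d 0) = w c := by rw [hd, C.next]
  obtain ⟨c', hc', hcc'⟩ := C.exists_corner hR hmin (w c + 1)
  have hne' : w c' ≠ w c := by rw [hcc']; simp
  have hcc : c ≠ c' := by rintro rfl; exact hne' rfl
  -- The cut at the end of the boundary edge of `c` separates the two corners. The part containing
  -- `c` is a wedge whose known side is this cut.
  refine Wedge.exists_triangle (S := Region.piece R w (w c)) (π := c) (γ := G.next (d (n - 1)))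
    (r := d) (m := n - 1) hl h2 hmin ⟨C.region hR _, (C.ssubset _).1, ⟨hcR.1, rfl⟩, ?_, ?_, ?_,
      ?_, ?_, ?_, .inr ⟨hd.symm, rfl⟩⟩
  · intro x hx
    rcases C.corner hR hx with ⟨h1, h2⟩ | h1 | h1
    · rcases two c c' hcR hc' hcc x h1 with rfl | rfl
      · exact .inl rfl
      · exact absurd h2 hne'
    · rw [Cut.endCorner_of_eq w0, hd] at h1
      exact .inr (.inl h1)
    · rw [Cut.endCorner_of_ne (by rw [← w0]; exact C.rev_last_ne hR)] at h1
      exact .inr (.inr h1)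
  · intro i hi
    exact ⟨C.path.mem i (by omega), by rw [C.color hR (by omega), w0]⟩
  · intro i hi h
    exact C.rot_ne (k := i) (by omega) (by rw [h.2, C.color hR (by omega), w0])
  · intro i _
    rw [C.path.succ, next_apply]
  · exact fun i hi j hj h => C.path.injective (by omega) (by omega) h
  · intro y hy hy1 hy2
    obtain ⟨k, hk, rfl | rfl⟩ := exists_of_chain (C.chain_ne hy.1 hy2 fun h =>
      hy1 ⟨hy2, h.trans hy.2⟩)
    · exact .inr ⟨k, by omega, rfl⟩
    · exact absurd (hy.2.trans w0.symm) (C.rev_ne hR hk)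

end MinimalLoop

/-! ### Pushing the boundary of a region across a triangle -/

namespace MinimalLoop

variable {G : MinimalLoop}

namespace TriChart

variable {p q r e f g h i j : G.Dart} {R : Set G.Dart}

/-- The region that remains when a strand is moved across a triangle at the boundary of a region,
so that the triangle leaves the region. -/
def shrink (_ : TriChart G p q r e f g h i j) (R : Set G.Dart) : Set G.Dart :=
  {x | (x ∈ R ∧ x ∉ [p, q, r, G.rev p, G.rev q, G.rev r]) ∨ (x = p ∧ f ∈ R)}

variable (T : TriChart G p q r e f g h i j)

theorem shrink_of_notMem {x : G.Dart} (hx : x ∉ [p, q, r, G.rev p, G.rev q, G.rev r]) :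
    x ∈ T.shrink R ↔ x ∈ R :=
  ⟨fun h => h.elim (·.1) fun h => absurd (h.1 ▸ List.mem_cons_self) hx, fun h => .inl ⟨h, hx⟩⟩

theorem shrink_p : p ∈ T.shrink R ↔ f ∈ R :=
  ⟨fun h => h.elim (fun h => absurd List.mem_cons_self h.2) (·.2), fun h => .inr ⟨rfl, h⟩⟩

theorem sides_local {x : G.Dart} (hx : x ∈ [p, q, r, G.rev p, G.rev q, G.rev r]) :
    x ∈ T.local_ := by
  simp only [List.mem_cons, List.not_mem_nil, or_false] at hx
  rcases hx with rfl | rfl | rfl | rfl | rfl | rfl <;> simp [local_]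

theorem rev_side {x : G.Dart} (hx : G.rev x ∈ [p, q, r, G.rev p, G.rev q, G.rev r]) :
    x ∈ [p, q, r, G.rev p, G.rev q, G.rev r] := by
  simp only [List.mem_cons, List.not_mem_nil, or_false, rev_eq_iff, G.rev_rev] at hx ⊢
  rcases hx with rfl | rfl | rfl | rfl | rfl | rfl <;> simp

theorem legs_not_side (T : TriChart G p q r e f g h i j) :
    ∀ x ∈ [e, f, g, h, i, j], x ∉ [p, q, r, G.rev p, G.rev q, G.rev r] := by
  have N := T.nodup
  simp only [List.nodup_cons, List.mem_cons, List.not_mem_nil, not_or, or_false] at N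
  obtain ⟨Ne, Np, Nr', Nj, Nf, Ng, Nq, Np', Nr, Nq', Nh, -⟩ := N
  simp only [List.forall_mem_cons]
  simp only [List.mem_cons, List.not_mem_nil, or_false, not_or]
  exact ⟨⟨Ne.1, Ne.2.2.2.2.2.1, Ne.2.2.2.2.2.2.2.1, Ne.2.2.2.2.2.2.1, Ne.2.2.2.2.2.2.2.2.1, Ne.2.1⟩,
    ⟨(Np.2.2.1 ·.symm), Nf.2.1, Nf.2.2.2.1, Nf.2.2.1, Nf.2.2.2.2.1, (Nr'.2.1 ·.symm)⟩,
    ⟨(Np.2.2.2.1 ·.symm), Ng.1, Ng.2.2.1, Ng.2.1, Ng.2.2.2.1, (Nr'.2.2.1 ·.symm)⟩,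
    ⟨(Np.2.2.2.2.2.2.2.2.1 ·.symm), (Nq.2.2.2.1 ·.symm), (Nr.2.1 ·.symm), (Np'.2.2.1 ·.symm),
      (Nq'.1 ·.symm), (Nr'.2.2.2.2.2.2.2.1 ·.symm)⟩,
    ⟨(Np.2.2.2.2.2.2.2.2.2 ·.symm), (Nq.2.2.2.2 ·.symm), (Nr.2.2 ·.symm), (Np'.2.2.2 ·.symm),
      (Nq'.2 ·.symm), (Nr'.2.2.2.2.2.2.2.2 ·.symm)⟩,
    ⟨(Np.2.1 ·.symm), Nj.2.2.1, Nj.2.2.2.2.1, Nj.2.2.2.1, Nj.2.2.2.2.2.1, (Nr'.1 ·.symm)⟩,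
    fun x hx => absurd hx id⟩

/-- The faces around a triangle at the boundary of a region that belong to the region. -/
structure AtBoundary (T : TriChart G p q r e f g h i j) (R : Set G.Dart) : Prop where
  mem_p : p ∈ R
  mem_q : q ∈ R
  mem_r : r ∈ R
  rev_p : G.rev p ∉ R
  not_i : i ∉ R
  not_j : j ∉ R
  not_h : h ∉ R
  e_iff : e ∈ R ↔ G.rev r ∈ R
  g_iff : g ∈ R ↔ G.rev q ∈ R
  f_iff : f ∈ R ↔ e ∈ R ∧ g ∈ R
  p' : p ∈ T.shrink R ↔ f ∈ R
  q' : q ∉ T.shrink R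
  r' : r ∉ T.shrink R
  rev_p' : G.rev p ∉ T.shrink R
  rev_q' : G.rev q ∉ T.shrink R
  rev_r' : G.rev r ∉ T.shrink R
  leg : ∀ x ∈ [e, f, g, h, i, j], (x ∈ T.shrink R ↔ x ∈ R) ∧
    (G.rev x ∈ T.shrink R ↔ G.rot x ∈ R)
  away : ∀ x, x ∉ T.local_ → (x ∈ T.shrink R ↔ x ∈ R) ∧ (G.rev x ∈ T.shrink R ↔ G.rot x ∈ R)

/-- Convexity at the ends of the boundary side `p` excludes the angles `j` and `h`, while at the
apex it gives `f_iff`. After the operation the reversed sides bound the triangle, which has left the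
region, and `q` and `r` lie on the excluded faces of `h` and `j`. Only `p` can still belong to the
region, as a dart of the face of `f`. -/
theorem atBoundary (hR : G.Region R) (hp : p ∈ R) (hpb : G.rot p ∉ R) : T.AtBoundary R := by
  have hq : q ∈ R := by rw [← T.p_q, ← next_apply]; exact (hR.next_iff p).2 hp
  have hr : r ∈ R := by rw [← T.q_r, ← next_apply]; exact (hR.next_iff q).2 hq
  have hi : i ∉ R := by rwa [← T.p_i]
  have hp' : G.rev p ∉ R := by rwa [← hR.rot_iff]
  have hno := T.not_outer
  have cv := hR.convex
  have hj : j ∉ R := by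
    have := cv p hp hpb (by rw [T.p_i]; exact hno i (by simp))
    rwa [T.p_i, T.i_j] at this
  have hh : h ∉ R := fun h' => by
    have := cv h h' (by rwa [T.h_p]) (by rw [T.h_p]; exact hno _ (by simp))
    rw [T.h_p, T.p_q] at this
    exact this hq
  have he : e ∈ R ↔ G.rev r ∈ R := by rw [← hR.rot_iff, T.r_e]
  have hg : g ∈ R ↔ G.rev q ∈ R := by rw [← hR.rot_iff, T.q_g]
  have hf : f ∈ R ↔ e ∈ R ∧ g ∈ R := by
    constructor
    · intro hf
      constructor
      · by_contra h'
        have := cv r hr (by rwa [T.r_e]) (by rw [T.r_e]; exact hno _ (by simp))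
        rw [T.r_e, T.e_f] at this
        exact this hf
      · rw [hg]
        by_contra h'
        have := cv f hf (by rwa [T.f_q]) (by rw [T.f_q]; exact hno _ (by simp))
        rw [T.f_q, T.q_r] at this
        exact this hr
    · rintro ⟨h1, h2⟩
      have := hR.deep_of_three (d := G.rev q) (hg.1 h2) (by rwa [T.q_r])
        (by rwa [T.q_r, T.r_e])
      refine this f ?_
      have s1 := sameVertex_rot (G.rev q); rw [T.q_r] at s1
      have s2 := sameVertex_rot r; rw [T.r_e] at s2
      have s3 := sameVertex_rot e; rw [T.e_f] at s3
      exact (s1.trans s2).trans s3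
  have out : ∀ x ∈ [p, q, r, G.rev p, G.rev q, G.rev r], x ≠ p → x ∉ T.shrink R := by
    intro x hx hxp h'
    exact h'.elim (fun h' => h'.2 hx) fun h' => hxp h'.1
  obtain ⟨m1, m2, m3, m4, m5, m6, m7, m8, m9, m10, m11, m12⟩ := T.sides_ne
  have gen : ∀ x, x ∉ [p, q, r, G.rev p, G.rev q, G.rev r] → (x ∈ T.shrink R ↔ x ∈ R) ∧
      (G.rev x ∈ T.shrink R ↔ G.rot x ∈ R) := fun x hx =>
    ⟨T.shrink_of_notMem hx, (T.shrink_of_notMem fun h' => hx (rev_side h')).trans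
      (hR.rot_iff x).symm⟩
  exact ⟨hp, hq, hr, hp', hi, hj, hh, he, hg, hf, T.shrink_p, out q (by simp) m1.symm,
    out r (by simp) m2.symm, out _ (by simp) m4.symm, out _ (by simp) m5.symm,
    out _ (by simp) m6.symm, fun x hx => gen x (T.legs_not_side x hx),
    fun x hx => gen x fun h' => hx (T.sides_local h')⟩

variable {T}

theorem AtBoundary.local_iff (B : T.AtBoundary R) : (e ∈ T.shrink R ↔ e ∈ R) ∧
    (f ∈ T.shrink R ↔ f ∈ R) ∧ (g ∈ T.shrink R ↔ g ∈ R) ∧ h ∉ T.shrink R ∧ i ∉ T.shrink R ∧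
    j ∉ T.shrink R :=
  ⟨(B.leg e (by simp)).1, (B.leg f (by simp)).1, (B.leg g (by simp)).1,
    fun h' => B.not_h ((B.leg h (by simp)).1.1 h'), fun h' => B.not_i ((B.leg i (by simp)).1.1 h'),
    fun h' => B.not_j ((B.leg j (by simp)).1.1 h')⟩

theorem AtBoundary.rot_iff (B : T.AtBoundary R) (x : G.Dart) :
    T.flipRot x ∈ T.shrink R ↔ G.rev x ∈ T.shrink R := by
  obtain ⟨ke, kf, kg, kh, ki, kj⟩ := B.local_iff
  have kr := B.rev_r'; have kq := B.rev_q'; have kp := B.rev_p'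
  have kr0 := B.r'; have kq0 := B.q'; have kp0 := B.p'
  have hf := B.f_iff; have he := B.e_iff; have hg := B.g_iff
  by_cases hx : x ∈ T.local_
  · simp only [TriChart.local_, List.mem_cons, List.not_mem_nil, or_false] at hx
    rcases hx with rfl | rfl | rfl | rfl | rfl | rfl | rfl | rfl | rfl | rfl | rfl | rfl
    · rw [T.flip_e, (B.leg x (by simp)).2, T.e_f, kp0]
    · rw [T.flip_p]; simp only [kr, kp]
    · rw [T.flip_rev_r, G.rev_rev]; simp only [kj, kr0]
    · rw [T.flip_j, (B.leg x (by simp)).2, T.j_r, ke, he]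
    · rw [T.flip_f, (B.leg x (by simp)).2, T.f_q, kg, hg]
    · rw [T.flip_g, (B.leg x (by simp)).2, T.g_h]; simp only [kq0, B.not_h]
    · rw [T.flip_q]; simp only [kp, kq]
    · rw [T.flip_rev_p, G.rev_rev, kf, kp0]
    · rw [T.flip_r]; simp only [kq, kr]
    · rw [T.flip_rev_q, G.rev_rev]; simp only [kh, kq0]
    · rw [T.flip_h, (B.leg x (by simp)).2, T.h_p]; simp only [ki, B.rev_p]
    · rw [T.flip_i, (B.leg x (by simp)).2, T.i_j]; simp only [kr0, B.not_j]
  · rw [T.flip_notMem hx, (B.away x hx).2]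
    exact (B.away _ fun h' => hx (T.local_of_rot h')).1

theorem AtBoundary.subset (B : T.AtBoundary R) : T.shrink R ⊆ R := by
  rintro x (hx | ⟨rfl, -⟩)
  exacts [hx.1, B.mem_p]

theorem AtBoundary.mem_local (B : T.AtBoundary R) {x : G.Dart} (hx : x ∈ T.shrink R)
    (hl : x ∈ T.local_) : x = e ∨ x = p ∨ x = f ∨ x = g := by
  obtain ⟨ke, kf, kg, kh, ki, kj⟩ := B.local_iff
  simp only [TriChart.local_, List.mem_cons, List.not_mem_nil, or_false] at hl
  rcases hl with rfl | rfl | rfl | rfl | rfl | rfl | rfl | rfl | rfl | rfl | rfl | rfl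
  exacts [.inl rfl, .inr (.inl rfl), absurd hx B.rev_r', absurd hx kj, .inr (.inr (.inl rfl)),
    .inr (.inr (.inr rfl)), absurd hx B.q', absurd hx B.rev_p', absurd hx B.r', absurd hx B.rev_q',
    absurd hx kh, absurd hx ki]

theorem AtBoundary.convex (B : T.AtBoundary R) (hR : G.Region R) {x : G.Dart}
    (hx : x ∈ T.shrink R) (hx' : T.flipRot x ∉ T.shrink R) (ho : ¬ G.IsOuter (T.flipRot x)) :
    T.flipRot (T.flipRot x) ∉ T.shrink R := by
  obtain ⟨ke, kf, kg, kh, ki, kj⟩ := B.local_iff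
  by_cases hl : x ∈ T.local_
  · rcases B.mem_local hx hl with rfl | rfl | rfl | rfl
    · rw [T.flip_e, T.flip_p]; exact B.rev_r'
    · rw [T.flip_p, T.flip_rev_r]; exact kj
    · rw [T.flip_f, kg] at hx'
      exact absurd (B.f_iff.1 (kf.1 hx)).2 hx'
    · rw [T.flip_g, T.flip_q]; exact B.rev_p'
  · have hl1 : G.rot x ∉ T.local_ := fun h' => hl (T.local_of_rot h')
    have hl2 : G.rot (G.rot x) ∉ T.local_ := fun h' => hl1 (T.local_of_rot h')
    rw [T.flip_notMem hl] at hx' ho ⊢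
    rw [T.flip_notMem hl1, (B.away _ hl2).1]
    rw [(B.away _ hl1).1] at hx'
    rw [(B.away _ hl).1] at hx
    exact hR.convex x hx hx' ho

theorem AtBoundary.coconn (B : T.AtBoundary R) (hR : G.Region R) {X : Set G.Dart}
    (hb : G.base ∈ X) (hrot : ∀ x ∈ X, T.flipRot x ∈ X)
    (hrev : ∀ x ∈ X, ¬ (x ∈ T.shrink R ∧ T.flipRot x ∈ T.shrink R) → G.rev x ∈ X) {x : G.Dart}
    (hx : x ∉ T.shrink R) : x ∈ X := by
  obtain ⟨ke, kf, kg, kh, ki, kj⟩ := B.local_iff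
  have side : ∀ u, u ∈ [p, q, r, G.rev p, G.rev q, G.rev r] →
      ¬ (u ∈ T.shrink R ∧ T.flipRot u ∈ T.shrink R) := by
    rintro u hu ⟨h1, h2⟩
    rw [B.rot_iff] at h2
    simp only [List.mem_cons, List.not_mem_nil, or_false] at hu
    rcases hu with rfl | rfl | rfl | rfl | rfl | rfl
    exacts [B.rev_p' h2, B.q' h1, B.r' h1, B.rev_p' h1, B.rev_q' h1, B.rev_r' h1]
  have hs : ∀ u, u ∈ [p, q, r, G.rev p, G.rev q, G.rev r] → u ∈ X → G.rev u ∈ X :=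
    fun u hu hX => hrev u hX (side u hu)
  have hrot' : ∀ u, T.flipRot u ∈ X → u ∈ X := fun u hu => T.flipRot.mem_of_closed hrot hu
  have up : ∀ {u v}, T.flipRot u = v → (u ∈ X ↔ v ∈ X) := fun {u v} huv =>
    ⟨fun h' => huv ▸ hrot u h', fun h' => hrot' u (huv ▸ h')⟩
  -- No side of the moved triangle is interior to the new region, so its three vertices are reached
  -- together, and `j` is reached from outside.
  have loc : ∀ u ∈ T.local_, (u ∈ X ↔ r ∈ X) := by
    have a1 := up T.flip_e; have a2 := up T.flip_p; have a3 := up T.flip_rev_r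
    have b1 := up T.flip_f; have b2 := up T.flip_g; have b3 := up T.flip_q
    have c1 := up T.flip_r; have c2 := up T.flip_rev_q; have c3 := up T.flip_h
    have s1 : r ∈ X ↔ G.rev r ∈ X := ⟨hs r (by simp), fun h' => by
      have := hs (G.rev r) (by simp) h'
      rwa [G.rev_rev] at this⟩
    have s2 : q ∈ X ↔ G.rev q ∈ X := ⟨hs q (by simp), fun h' => by
      have := hs (G.rev q) (by simp) h'
      rwa [G.rev_rev] at this⟩
    simp only [TriChart.local_, List.forall_mem_cons, List.not_mem_nil, false_imp_iff,
      implies_true, and_true]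
    have hp := a2.trans s1.symm
    have hq := s2.trans c1.symm
    have hh := c2.symm.trans c1.symm
    exact ⟨a1.trans hp, hp, s1.symm, a3.symm.trans s1.symm, b1.trans (b2.trans hq), b2.trans hq, hq,
      b3.symm.trans hq, trivial, c1.symm, hh, c3.symm.trans hh⟩
  have key : ∀ u, u ∉ R → u ∈ X := by
    refine hR.coconn X hb ?_ ?_
    · intro u hu
      by_cases hl : u ∈ T.local_
      · exact (loc _ (T.rot_local hl)).2 ((loc u hl).1 hu)
      · rw [← T.flip_notMem hl]; exact hrot u hu
    · intro u hu hnot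
      by_cases hus : u ∈ [p, q, r, G.rev p, G.rev q, G.rev r]
      · exact hs u hus hu
      · refine hrev u hu fun h' => hnot ⟨(T.shrink_of_notMem hus).1 h'.1, ?_⟩
        rw [B.rot_iff, T.shrink_of_notMem fun h' => hus (rev_side h')] at h'
        exact (hR.rot_iff u).2 h'.2
  by_cases hl : x ∈ T.local_
  · have hj : j ∈ X := key j B.not_j
    exact (loc x hl).2 ((loc j (by simp [local_])).1 hj)
  · exact key x (mt (B.away x hl).1.2 hx)

theorem AtBoundary.region (B : T.AtBoundary R) (hR : G.Region R) :
    T.flip.Region (T.shrink R) where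
  rot_iff := B.rot_iff
  not_outer _ hx h' := hR.not_outer _ (B.subset hx) (T.flip_isOuter.1 h')
  convex _ hx hx' ho := B.convex hR hx hx' fun h' => ho (T.flip_isOuter.2 h')
  coconn _ hb hrot hrev _ hx := B.coconn hR hb hrot hrev hx

theorem AtBoundary.ssubset (B : T.AtBoundary R) : T.shrink R ⊂ R :=
  ⟨B.subset, fun h' => B.q' (h' B.mem_q)⟩

/-- If neither `e` nor `g` remains, then `p`, `q` and `r` were all corners of the region, one too
many. -/
theorem AtBoundary.nonempty (B : T.AtBoundary R) (hc : (corners R).ncard ≤ 2) :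
    (T.shrink R).Nonempty := by
  obtain ⟨ke, kf, kg, kh, ki, kj⟩ := B.local_iff
  by_cases he : e ∈ R
  · exact ⟨e, ke.2 he⟩
  by_cases hg : g ∈ R
  · exact ⟨g, kg.2 hg⟩
  exfalso
  obtain ⟨m1, m2, m3, -⟩ := T.sides_ne
  have hsub : ({p, q, r} : Set G.Dart) ⊆ corners R := by
    rintro x (rfl | rfl | rfl)
    · refine ⟨B.mem_p, by rw [T.p_i]; exact B.not_i, ?_⟩
      rw [(Equiv.symm_apply_eq _).2 T.r_p.symm, ← B.e_iff]; exact he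
    · refine ⟨B.mem_q, by rwa [T.q_g], ?_⟩
      rw [(Equiv.symm_apply_eq _).2 T.p_q.symm]; exact B.rev_p
    · refine ⟨B.mem_r, by rwa [T.r_e], ?_⟩
      rw [(Equiv.symm_apply_eq _).2 T.q_r.symm, ← B.g_iff]; exact hg
  have := G.finite
  have := Set.ncard_le_ncard hsub (Set.toFinite _)
  rw [Set.ncard_eq_three.2 ⟨p, q, r, m1, m2, m3, rfl⟩] at this
  omega

/-- Corners travel with the crossings of strands: a corner at `e` comes from one at `q`, and a
corner at `g` from one at `p`. No corner arises at the other local darts, and those elsewhere are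
unchanged. -/
theorem AtBoundary.corners_le (B : T.AtBoundary R) :
    (corners (G := T.flip) (T.shrink R)).ncard ≤ (corners R).ncard := by
  classical
  have := G.finite
  obtain ⟨ke, kf, kg, kh, ki, kj⟩ := B.local_iff
  have key : ∀ x : G.Dart, x ∈ corners (G := T.flip) (T.shrink R) →
      (x = e ∧ q ∈ corners R) ∨ (x = g ∧ p ∈ corners R) ∨ (x ∉ T.local_ ∧ x ∈ corners R) := by
    rintro x ⟨hx, (hx1 : T.flipRot x ∉ T.shrink R), hx2⟩
    have hx2 : ∀ u, T.flipRot u = x → u ∉ T.shrink R := by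
      intro u hu h'
      refine hx2 ?_
      have : (T.flipRot).symm x = u := (Equiv.symm_apply_eq _).2 hu.symm
      exact Set.mem_of_eq_of_mem this h'
    by_cases hl : x ∈ T.local_
    · rcases B.mem_local hx hl with h' | h' | h' | h' <;> rw [h'] at hx hx1 hx2
      · refine .inl ⟨h', B.mem_q, ?_, ?_⟩
        · rw [T.q_g]
          intro hg
          rw [T.flip_e] at hx1
          exact hx1 (B.p'.2 (B.f_iff.2 ⟨ke.1 hx, hg⟩))
        · rw [(Equiv.symm_apply_eq _).2 T.p_q.symm]; exact B.rev_p
      · exact absurd (ke.2 (B.f_iff.1 (B.p'.1 hx)).1) (hx2 e T.flip_e)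
      · rw [T.flip_f] at hx1
        exact absurd (kg.2 (B.f_iff.1 (kf.1 hx)).2) hx1
      · refine .inr (.inl ⟨h', B.mem_p, by rw [T.p_i]; exact B.not_i, ?_⟩)
        rw [(Equiv.symm_apply_eq _).2 T.r_p.symm, ← B.e_iff]
        intro he
        exact hx2 f T.flip_f (kf.2 (B.f_iff.2 ⟨he, kg.1 hx⟩))
    · refine .inr (.inr ⟨hl, (B.away x hl).1.1 hx, ?_, fun h' => ?_⟩)
      · rw [T.flip_notMem hl] at hx1
        exact mt (B.away _ fun h' => hl (T.local_of_rot h')).1.2 hx1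
      · set u := G.rot.symm x with hu
        have hux : G.rot u = x := Equiv.apply_symm_apply _ _
        have hul : u ∉ T.local_ := fun h'' => hl (hux ▸ T.rot_local h'')
        exact hx2 u (by rw [T.flip_notMem hul, hux]) ((B.away u hul).1.2 h')
  have N := T.nodup
  simp only [List.nodup_cons, List.mem_cons, List.not_mem_nil, not_or, or_false] at N
  have hge : g ≠ e := fun h' => N.1.2.2.2.2.1 h'.symm
  have el : e ∈ T.local_ := by simp [local_]
  have gl : g ∈ T.local_ := by simp [local_]
  have pl : p ∈ T.local_ := by simp [local_]
  have ql : q ∈ T.local_ := by simp [local_]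
  obtain ⟨m1, -⟩ := T.sides_ne
  refine Set.ncard_le_ncard_of_injOn (fun x : G.Dart => if x = e then q else if x = g then p else x)
    ?_ ?_ (Set.toFinite _)
  · intro (x : G.Dart) hx
    rcases key x hx with ⟨hxe, h'⟩ | ⟨hxg, h'⟩ | ⟨hl, h'⟩
    · simpa [hxe] using h'
    · simpa [hxg, hge] using h'
    · have h1 : x ≠ e := fun hh => hl (by rw [hh]; exact el)
      have h2 : x ≠ g := fun hh => hl (by rw [hh]; exact gl)
      simpa [h1, h2] using h'
  · intro (x : G.Dart) hx (y : G.Dart) hy hxy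
    have hc : ∀ z : G.Dart, z ∈ corners (G := T.flip) (T.shrink R) → z = e ∨ z = g ∨ z ∉ T.local_ :=
      fun z hz => (key z hz).imp (·.1) (Or.imp (·.1) (·.1))
    have a := hc x hx; have b := hc y hy
    have hxy : (if x = e then q else if x = g then p else x) =
      (if y = e then q else if y = g then p else y) := hxy
    have : ∀ x y : G.Dart, (x = e ∨ x = g ∨ x ∉ T.local_) → (y = e ∨ y = g ∨ y ∉ T.local_) →
        (if x = e then q else if x = g then p else x) =
        (if y = e then q else if y = g then p else y) → x = y := by
      intro x y a b hxy
      clear * - a b hxy hge el gl pl ql m1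
      grind
    exact this x y a b hxy

end TriChart
end MinimalLoop

/-! ### The inductions -/

namespace MinimalLoop

variable {G : MinimalLoop}

/-- No inner angle is excluded, so convexity is vacuous; the complement is connected along the
boundary cycle. -/
theorem region_inner (G : MinimalLoop) : G.Region {d | ¬ G.IsOuter d} where
  rot_iff _ := not_congr isOuter_rot
  not_outer _ hd := hd
  convex _ _ h h' := absurd h' h
  coconn X hb hrot hrev d hd := by
    have := G.finite
    have hd : G.SameFace G.base d := not_not.1 hd
    have key : G.IsOuter d ∧ d ∈ X := by
      refine Equiv.Perm.SameCycle.induct (P := fun x => G.IsOuter x ∧ x ∈ X) hd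
        ⟨isOuter_base, hb⟩ ?_
      rintro x ⟨h1, h2⟩
      exact ⟨isOuter_next.2 h1, hrot _ (hrev x h2 fun h => h.1 h1)⟩
    exact key.2

/-- The two outer angles beside a corner must coincide, so the vertex has degree 2 and is the base
vertex. -/
theorem ncard_corners_inner (G : MinimalLoop) : (corners {d | ¬ G.IsOuter d}).ncard ≤ 2 := by
  have := G.finite
  refine (Set.ncard_le_ncard (t := {G.rot G.base}) ?_ (Set.toFinite _)).trans (by simp)
  rintro d ⟨-, h1, h2⟩
  have h1 : G.IsOuter (G.rot d) := not_not.1 h1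
  have h2 : G.IsOuter (G.rot.symm d) := not_not.1 h2
  set u := G.rot.symm d with hu
  have hd : G.rot u = d := Equiv.apply_symm_apply _ _
  rw [← hd] at h1
  have hu2 : G.rot (G.rot u) = u :=
    h1.eq_of_sameVertex h2 ((sameVertex_rot u).trans (sameVertex_rot _)).symm
  have hb : u = G.base := by
    by_contra hb
    exact h2.rot_two_ne hb hu2
  rw [Set.mem_singleton_iff, ← hd, hb]

/-- If neither edge of an inner angle is on the boundary cycle, three consecutive darts at the
vertex are not outer, and that is enough. -/
theorem isInteriorVertex_of_edges {u v : G.Dart} (hv : G.next v = u) (hu : ¬ G.IsOuter u)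
    (h1 : ¬ G.IsOuter (G.rev u)) (h2 : ¬ G.IsOuter (G.rev v)) : G.IsInteriorVertex u := by
  rw [next_apply] at hv
  have : G.IsInteriorVertex (G.rev v) :=
    isInteriorVertex_of h2 (by rwa [hv]) (by rwa [hv, isOuter_rot])
  rwa [← isInteriorVertex_rot, hv] at this

/-- Every nonempty region with few corners contains a minimal one. -/
theorem Region.exists_minRegion {R : Set G.Dart} (hR : G.Region R) (hne : R.Nonempty)
    (hc : (corners R).ncard ≤ 2) :
    ∃ S, G.Region S ∧ S.Nonempty ∧ (corners S).ncard ≤ 2 ∧ MinRegion S ∧ S ⊆ R := by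
  have := G.finite
  induction hn : R.ncard using Nat.strong_induction_on generalizing R with
  | _ n ih =>
  by_cases hmin : MinRegion R
  · exact ⟨R, hR, hne, hc, hmin, subset_rfl⟩
  simp only [MinRegion, not_forall, not_le] at hmin
  obtain ⟨S, h1, h2, h3, h4⟩ := hmin
  obtain ⟨U, k1, k2, k3, k4, k5⟩ := ih _ (hn ▸ Set.ncard_lt_ncard h3 (Set.toFinite _)) h1 h2
    (by omega) rfl
  exact ⟨U, k1, k2, k3, k4, k5.trans h3.1⟩

/-- A minimal loop with a region with few corners is reducible, if the minimal loops of the same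
size that have a 2-group are. -/
theorem Region.reducible {N : ℕ} (h2 : ∀ G : MinimalLoop, Nat.card G.Dart = N → G.Loopless →
    (∃ x, G.IsTwoGroup x) → Reducible G) (n : ℕ) : ∀ (G : MinimalLoop) (R : Set G.Dart),
    Nat.card G.Dart = N → G.Loopless → G.Region R → R.Nonempty → (corners R).ncard ≤ 2 →
    R.ncard = n → Reducible G := by
  induction n using Nat.strong_induction_on with
  | _ n ih =>
  intro G R hN hl hR hne hc hn
  have := G.finite
  by_cases hf : G.HasFeature
  · exact .feature hf
  by_cases hx : ∃ x, G.IsTwoGroup x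
  -- This case may arise after operations that have created a 2-group; they keep the number of
  -- darts, so `h2` still applies.
  · exact h2 G hN hl hx
  obtain ⟨S, hS, hSne, hSc, hmin, hSR⟩ := hR.exists_minRegion hne hc
  obtain ⟨t, ht, htS, htb⟩ := hS.exists_triangle hl (not_exists.1 hx) hSne hSc hmin
  by_cases b1 : G.IsOuter (G.rev t)
  · exact .boundary ht b1
  by_cases b2 : G.IsOuter (G.rev (G.next t))
  · exact .boundary ht.next b2
  by_cases b3 : G.IsOuter (G.rev (G.next (G.next t)))
  · exact .boundary ht.next.next b3
  obtain ⟨-, h3, v1, v2, v3⟩ := isTriangle_iff.1 ht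
  have T := triChart_of (p := t) rfl rfl h3 (isInteriorVertex_of_edges h3 ht.1 b1 b3)
    (isInteriorVertex_of_edges rfl ht.next.1 b2 b1)
    (isInteriorVertex_of_edges rfl ht.next.next.1 b3 b2) v1 v2 v3
  have B := T.atBoundary hS htS htb
  -- The operation preserves `N` and looplessness, and the shrunk region is properly contained in
  -- the minimal region `S`, which lies in `R`.
  refine .flip T (ih _ ?_ T.flip (T.shrink S) hN (T.flip_loopless hl hf) (B.region hS)
    (B.nonempty hSc) (B.corners_le.trans hSc) rfl)
  exact hn ▸ (Set.ncard_lt_ncard B.ssubset (Set.toFinite _)).trans_le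
    (Set.ncard_le_ncard hSR (Set.toFinite _))

/-- The outer induction on the number of darts handles loops with a 2-group, by collapsing it. The
inner induction of `Region.reducible`, started with the union of all inner faces, handles the
others. -/
theorem reducible_of_loopless (hl : G.Loopless) : Reducible G := by
  induction hN : Nat.card G.Dart using Nat.strong_induction_on generalizing G with
  | _ N ih =>
  refine Region.reducible (N := N) ?_ _ G _ hN hl G.region_inner
    ⟨G.rev G.base, isOuter_base.rev⟩ G.ncard_corners_inner rfl
  rintro H hH hHl ⟨k, hk⟩
  by_cases hf : H.HasFeature
  · exact .feature hf
  have b1 : ¬ H.IsOuter (H.rev k) := fun h => hf (.inl ⟨k, hk, .inr h⟩)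
  have b2 : ¬ H.IsOuter (H.rev (H.next k)) := fun h => hf (.inl ⟨_, hk.next, .inr h⟩)
  have T := bigonChart_of hk rfl (isInteriorVertex_of_edges hk.next_next hk.1 b1 b2)
    (isInteriorVertex_of_edges rfl hk.next.1 b2 b1)
  obtain ⟨A, B, C, D, E⟩ := T.collapse_doubling
  have hlt := T.collapse_cutData.card_lt ⟨k, by simp [BigonChart.sides]⟩
  exact .of_doubling (ih _ (hH ▸ hlt) (T.collapse_loopless hHl hf) rfl) _ _ _ _ _ _ _ _ E

theorem reaches_of_loopless (hl : G.Loopless) : G.Reaches := by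
  induction hN : Nat.card G.Dart using Nat.strong_induction_on generalizing G with
  | _ N ih => exact (reducible_of_loopless hl).reaches hl fun G' h hl' => ih _ (hN ▸ h) hl' rfl

end MinimalLoop

theorem mainTheorem5 (G : MinimalLoop) (hG : G.Nontrivial) (hloop : G.Loopless) :
    ∃ G' : MinimalLoop,
      Relation.ReflTransGen (fun H H' : MinimalLoop => H.Ots H' ∨ H.Turn H') G G' ∧
        (G'.HasBoundaryTwoGroup ∨ G'.HasAdjacentTwoGroups ∨ G'.HasRotsTriangle) :=
  MinimalLoop.reaches_of_loopless hloop
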